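/- A supernatural number is a formal product $\mathfrak p=\prod_{\ell}\ell^{\mathfrak p(\ell)}$ over all primes $\ell$ with exponents $\mathfrak p(\ell)\in\{0,1,2,\dots,\infty\}$; $\mathfrak p$ and $\mathfrak q$ are relatively prime if $\mathfrak p(\ell)=0$ or $\mathfrak q(\ell)=0$ for every prime $\ell$. Let $M_{\mathfrak p}$ be the UHF algebra of type $\mathfrak p$, that is, the $C^*$-inductive limit of the matrix algebras $M_n(\mathbb C)$ with $n$ dividing $\mathfrak p$, with unital connecting maps, and let $$Z_{\mathfrak p,\mathfrak q}=\{f\in C([0,1],M_{\mathfrak p}\otimes M_{\mathfrak q}) : f(0)\in M_{\mathfrak p}\otimes 1,\ f(1)\in 1\otimes M_{\mathfrak q}\},$$ with the endpoint evaluations $\mathrm{ev}_0\colon Z_{\mathfrak p,\mathfrak q}\to M_{\mathfrak p}$ and $\mathrm{ev}_1\colon Z_{\mathfrak p,\mathfrak q}\to M_{\mathfrak q}$. For a $C^*$-algebra $A$ write $K_*(A)=K_0(A)\oplus K_1(A)$. Here $\otimes$ of groups is over $\mathbb Z$, and $\otimes$ of $C^*$-algebras is the $C^*$-tensor product, which is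 unique in all the cases below because one factor is nuclear. **Proposition.** Let $\mathfrak p,\mathfrak q$ be relatively prime supernatural numbers. (1) For every abelian group $G$ the homomorphism $$\beta\colon G\to (G\otimes K_0(M_{\mathfrak p}))\oplus (G\otimes K_0(M_{\mathfrak q})),\qquad \beta(g)=(g\otimes[1],\,g\otimes[1]),$$ is injective. (2) $K_1(M_{\mathfrak p})=K_1(M_{\mathfrak q})=0$, and for every separable (not necessarily unital) $C^*$-algebra $A$ the following holds. (a) The map $(\mathrm{id}\otimes 1)_*\colon K_*(A)\to K_*(A\otimes Z_{\mathfrak p,\mathfrak q})$ induced by $a\mapsto a\otimes 1$ is an isomorphism. (b) There is exactly one group homomorphism (the Künneth map) $$\alpha\colon K_*(A)\otimes\bigl(K_*(M_{\mathfrak p})\oplus K_*(M_{\mathfrak q})\bigr)\to K_*\bigl((A\otimes M_{\mathfrak p})\oplus (A\otimes M_{\mathfrak q})\bigr)$$ such that for all $x\in K_*(A)$ and every projection $e$ in a matrix algebra $M_k(M_{\mathfrak p})$ or $M_k(M_{\mathfrak q})$, $\alpha(x\otimes[e])$ is the image of $x$ under the map induced by $a\mapsto a\otimes e$, a $*$-homomorphism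 from $A$ to $M_k(A\otimes M_{\mathfrak p})$ or $M_k(A\otimes M_{\mathfrak q})$, respectively, followed by the inclusion of the respective summand; and $\alpha$ is an isomorphism. (c) The composition $$K_*(A)\xrightarrow{(\mathrm{id}\otimes 1)_*}K_*(A\otimes Z_{\mathfrak p,\mathfrak q})\xrightarrow{\alpha^{-1}\circ(\mathrm{ev}_0\oplus \mathrm{ev}_1)_*}K_*(A)\otimes\bigl(K_*(M_{\mathfrak p})\oplus K_*(M_{\mathfrak q})\bigr)$$ is injective, where $\mathrm{ev}_0\oplus\mathrm{ev}_1$ denotes the map $A\otimes Z_{\mathfrak p,\mathfrak q}\to (A\otimes M_{\mathfrak p})\oplus(A\otimes M_{\mathfrak q})$ given by $\mathrm{id}_A\otimes\mathrm{ev}_0$ and $\mathrm{id}_A\otimes\mathrm{ev}_1$. -/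

import Mathlib

open scoped TensorProduct ZeroAtInfty Matrix

/-! ### Projections in matrix algebras and the group `K₀` -/

noncomputable section

namespace KTheory

section Projections

variable {R S T : Type*} [NonUnitalRing R] [StarRing R] [NonUnitalRing S] [StarRing S]
  [NonUnitalRing T] [StarRing T]

/-- Murray-von Neumann equivalence of two square matrices, possibly of different sizes:
`p = v* v` and `q = v v*` for a rectangular matrix `v`. -/
def MvN {ι κ : Type*} [Fintype ι] [Fintype κ] (p : Matrix ι ι R) (q : Matrix κ κ R) : Prop :=
  ∃ v : Matrix κ ι R, vᴴ * v = p ∧ v * vᴴ = q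

theorem MvN.symm {ι κ : Type*} [Fintype ι] [Fintype κ] {p : Matrix ι ι R} {q : Matrix κ κ R}
    (h : MvN p q) : MvN q p := by
  obtain ⟨v, h1, h2⟩ := h
  exact ⟨vᴴ, by simpa using h2, by simpa using h1⟩

theorem MvN.trans {ι κ μ : Type*} [Fintype ι] [Fintype κ] [Fintype μ] {p : Matrix ι ι R}
    {q : Matrix κ κ R} {r : Matrix μ μ R} (hp : IsStarProjection p) (hr : IsStarProjection r)
    (h : MvN p q) (h' : MvN q r) : MvN p r := by
  obtain ⟨v, h1, h2⟩ := h
  obtain ⟨w, h3, h4⟩ := h'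
  refine ⟨w * v, ?_, ?_⟩
  · calc (w * v)ᴴ * (w * v) = vᴴ * (wᴴ * w) * v := by
          simp only [Matrix.conjTranspose_mul, Matrix.mul_assoc]
      _ = (vᴴ * v) * (vᴴ * v) := by rw [h3, ← h2]; simp only [Matrix.mul_assoc]
      _ = p := by rw [h1]; exact hp.isIdempotentElem
  · calc (w * v) * (w * v)ᴴ = w * (v * vᴴ) * wᴴ := by
          simp only [Matrix.conjTranspose_mul, Matrix.mul_assoc]
      _ = (w * wᴴ) * (w * wᴴ) := by rw [h2, ← h3]; simp only [Matrix.mul_assoc]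
      _ = r := by rw [h4]; exact hr.isIdempotentElem

theorem isStarProjection_submatrix {ι κ : Type*} [Fintype ι] [Fintype κ] {p : Matrix ι ι R}
    (hp : IsStarProjection p) (e : κ ≃ ι) : IsStarProjection (p.submatrix e e) := by
  constructor
  · have := hp.isIdempotentElem
    unfold IsIdempotentElem at *
    rw [Matrix.submatrix_mul_equiv, this]
  · have := hp.isSelfAdjoint
    rw [isSelfAdjoint_iff, Matrix.star_eq_conjTranspose] at *
    rw [Matrix.conjTranspose_submatrix, this]

theorem MvN.submatrix {ι κ : Type*} [Fintype ι] [Fintype κ] {p : Matrix ι ι R}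
    (hp : IsStarProjection p) (e : κ ≃ ι) : MvN p (p.submatrix e e) := by
  have h1 : p * p = p := hp.isIdempotentElem
  have h2 : pᴴ = p := hp.isSelfAdjoint
  refine ⟨p.submatrix e id, ?_, ?_⟩
  · rw [Matrix.conjTranspose_submatrix, Matrix.submatrix_mul_equiv, h2, h1, Matrix.submatrix_id_id]
  · rw [Matrix.conjTranspose_submatrix, h2]
    have := Matrix.submatrix_mul_equiv p p e (Equiv.refl ι) e
    rw [h1] at this
    exact this

theorem isStarProjection_fromBlocks {ι κ : Type*} [Fintype ι] [Fintype κ] {p : Matrix ι ι R}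
    {q : Matrix κ κ R} (hp : IsStarProjection p) (hq : IsStarProjection q) :
    IsStarProjection (Matrix.fromBlocks p 0 0 q) := by
  have h1 : p * p = p := hp.isIdempotentElem
  have h2 : pᴴ = p := hp.isSelfAdjoint
  have h3 : q * q = q := hq.isIdempotentElem
  have h4 : qᴴ = q := hq.isSelfAdjoint
  constructor
  · simp [IsIdempotentElem, Matrix.fromBlocks_multiply, h1, h3]
  · simp [isSelfAdjoint_iff, Matrix.star_eq_conjTranspose, Matrix.fromBlocks_conjTranspose, h2, h4]

theorem MvN.fromBlocks {ι κ ι' κ' : Type*} [Fintype ι] [Fintype κ] [Fintype ι'] [Fintype κ']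
    {p : Matrix ι ι R} {q : Matrix κ κ R} {p' : Matrix ι' ι' R} {q' : Matrix κ' κ' R}
    (hp : MvN p p') (hq : MvN q q') :
    MvN (Matrix.fromBlocks p 0 0 q) (Matrix.fromBlocks p' 0 0 q') := by
  obtain ⟨v, h1, h2⟩ := hp
  obtain ⟨w, h3, h4⟩ := hq
  refine ⟨Matrix.fromBlocks v 0 0 w, ?_, ?_⟩ <;>
    simp [Matrix.fromBlocks_multiply, Matrix.fromBlocks_conjTranspose, h1, h2, h3, h4]

variable (R) in
/-- A projection in some matrix algebra `M_n(R)`, `n = 0, 1, 2, …`. -/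
structure Proj where
  size : ℕ
  mat : Matrix (Fin size) (Fin size) R
  isProj : IsStarProjection mat

theorem Proj.mvN_refl (p : Proj R) : MvN p.mat p.mat := by
  simpa using MvN.submatrix p.isProj (Equiv.refl _)

instance Proj.setoid : Setoid (Proj R) where
  r p q := MvN p.mat q.mat
  iseqv := ⟨Proj.mvN_refl, fun h => h.symm, fun {p _ r} h h' => h.trans p.isProj r.isProj h'⟩

/-- A projection over an arbitrary finite index set `ι ≃ Fin n`, as a projection in `M_n(R)`. -/
def Proj.ofEquiv {ι : Type*} [Fintype ι] {n : ℕ} (e : Fin n ≃ ι) (p : Matrix ι ι R)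
    (hp : IsStarProjection p) : Proj R :=
  ⟨n, p.submatrix e e, isStarProjection_submatrix hp e⟩

theorem Proj.mvN_ofEquiv {ι : Type*} [Fintype ι] {n : ℕ} (e : Fin n ≃ ι) (p : Matrix ι ι R)
    (hp : IsStarProjection p) : MvN p (Proj.ofEquiv e p hp).mat := MvN.submatrix hp e

/-- The orthogonal direct sum `p ⊕ q = diag(p, q)`. -/
def Proj.dsum (p q : Proj R) : Proj R :=
  Proj.ofEquiv finSumFinEquiv.symm (Matrix.fromBlocks p.mat 0 0 q.mat)
    (isStarProjection_fromBlocks p.isProj q.isProj)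

theorem Proj.mvN_dsum (p q : Proj R) :
    MvN (Matrix.fromBlocks p.mat 0 0 q.mat) (p.dsum q).mat := Proj.mvN_ofEquiv _ _ _

theorem Proj.dsum_rel {p q p' q' : Proj R} (hp : MvN p.mat p'.mat) (hq : MvN q.mat q'.mat) :
    MvN (p.dsum q).mat (p'.dsum q').mat :=
  ((p.mvN_dsum q).symm.trans (p.dsum q).isProj
    (isStarProjection_fromBlocks p'.isProj q'.isProj) (hp.fromBlocks hq)).trans
    (p.dsum q).isProj (p'.dsum q').isProj (p'.mvN_dsum q')

variable (R) in
/-- The semigroup of Murray-von Neumann equivalence classes of projections in matrix algebras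
over `R`. -/
def V : Type _ := Quotient (Proj.setoid (R := R))

/-- The class of a projection. -/
def V.mk (p : Proj R) : V R := Quotient.mk _ p

theorem V.sound {p q : Proj R} (h : MvN p.mat q.mat) : V.mk p = V.mk q := Quotient.sound h

theorem V.ind {C : V R → Prop} (h : ∀ p, C (V.mk p)) (x : V R) : C x := Quotient.ind h x

instance V.instAdd : Add (V R) :=
  ⟨Quotient.map₂ Proj.dsum fun _ _ h _ _ h' => Proj.dsum_rel h h'⟩

instance V.instZero : Zero (V R) := ⟨V.mk ⟨0, 0, .zero _⟩⟩

theorem V.mk_add_mk (p q : Proj R) : V.mk p + V.mk q = V.mk (p.dsum q) := rfl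

instance V.instAddCommMonoid : AddCommMonoid (V R) where
  add_assoc x y z := by
    induction x using V.ind with | _ p
    induction y using V.ind with | _ q
    induction z using V.ind with | _ r
    refine V.sound (p := (p.dsum q).dsum r) (q := p.dsum (q.dsum r)) ?_
    have hpq := isStarProjection_fromBlocks p.isProj q.isProj
    have hqr := isStarProjection_fromBlocks q.isProj r.isProj
    have hl := isStarProjection_fromBlocks hpq r.isProj
    have hr := isStarProjection_fromBlocks p.isProj hqr
    have h1 : MvN ((p.dsum q).dsum r).mat
        (Matrix.fromBlocks (Matrix.fromBlocks p.mat 0 0 q.mat) 0 0 r.mat) :=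
      ((p.dsum q).mvN_dsum r).symm.trans ((p.dsum q).dsum r).isProj hl
        ((p.mvN_dsum q).symm.fromBlocks r.mvN_refl)
    have h2 : MvN (Matrix.fromBlocks (Matrix.fromBlocks p.mat 0 0 q.mat) 0 0 r.mat)
        (Matrix.fromBlocks p.mat 0 0 (Matrix.fromBlocks q.mat 0 0 r.mat)) := by
      convert MvN.submatrix hl (Equiv.sumAssoc _ _ _).symm using 1
      ext (i | i | i) (j | j | j) <;> rfl
    have h3 : MvN (Matrix.fromBlocks p.mat 0 0 (Matrix.fromBlocks q.mat 0 0 r.mat))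
        (p.dsum (q.dsum r)).mat :=
      (p.mvN_refl.fromBlocks (q.mvN_dsum r)).trans hr (p.dsum (q.dsum r)).isProj
        (p.mvN_dsum (q.dsum r))
    exact h1.trans ((p.dsum q).dsum r).isProj (p.dsum (q.dsum r)).isProj
      (h2.trans hl (p.dsum (q.dsum r)).isProj h3)
  add_comm x y := by
    induction x using V.ind with | _ p
    induction y using V.ind with | _ q
    refine V.sound (p := p.dsum q) (q := q.dsum p) ?_
    have hpq := isStarProjection_fromBlocks p.isProj q.isProj
    have h2 : MvN (Matrix.fromBlocks p.mat 0 0 q.mat) (Matrix.fromBlocks q.mat 0 0 p.mat) := by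
      convert MvN.submatrix hpq (Equiv.sumComm _ _) using 1
      ext (i | i) (j | j) <;> rfl
    exact (p.mvN_dsum q).symm.trans (p.dsum q).isProj (q.dsum p).isProj
      (h2.trans hpq (q.dsum p).isProj (q.mvN_dsum p))
  zero_add x := by
    induction x using V.ind with | _ p
    refine V.sound (p := Proj.dsum ⟨0, 0, .zero _⟩ p) (q := p) (MvN.symm ?_)
    refine MvN.trans p.isProj (Proj.isProj _) ?_ (Proj.mvN_dsum _ _)
    convert MvN.submatrix p.isProj (Equiv.emptySum (Fin 0) _) using 1
    ext (i | i) (j | j)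
    exacts [i.elim0, i.elim0, j.elim0, rfl]
  add_zero x := by
    induction x using V.ind with | _ p
    refine V.sound (p := p.dsum ⟨0, 0, .zero _⟩) (q := p) (MvN.symm ?_)
    refine MvN.trans p.isProj (Proj.isProj _) ?_ (Proj.mvN_dsum _ _)
    convert MvN.submatrix p.isProj (Equiv.sumEmpty _ (Fin 0)) using 1
    ext (i | i) (j | j)
    exacts [rfl, j.elim0, i.elim0, i.elim0]
  nsmul := nsmulRec

variable [Module ℂ R] [Module ℂ S] [Module ℂ T]

/-- The image of a matrix over `R` under a homomorphism `φ : R → M_k(S)`: the block matrix with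
blocks `φ (p i j)`. -/
def blockMap {k : ℕ} {ι κ : Type*} (φ : R →⋆ₙₐ[ℂ] Matrix (Fin k) (Fin k) S) (p : Matrix ι κ R) :
    Matrix (ι × Fin k) (κ × Fin k) S :=
  Matrix.of fun i j => φ (p i.1 j.1) i.2 j.2

theorem blockMap_mul {k : ℕ} {ι κ μ : Type*} [Fintype κ]
    (φ : R →⋆ₙₐ[ℂ] Matrix (Fin k) (Fin k) S) (p : Matrix ι κ R) (q : Matrix κ μ R) :
    blockMap φ (p * q) = blockMap φ p * blockMap φ q := by
  ext ⟨i, s⟩ ⟨j, t⟩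
  simp [blockMap, Matrix.mul_apply, Fintype.sum_prod_type, Matrix.sum_apply]

theorem blockMap_conjTranspose {k : ℕ} {ι κ : Type*}
    (φ : R →⋆ₙₐ[ℂ] Matrix (Fin k) (Fin k) S) (p : Matrix ι κ R) :
    blockMap φ pᴴ = (blockMap φ p)ᴴ := by
  ext ⟨i, s⟩ ⟨j, t⟩
  simp [blockMap, map_star, Matrix.star_apply]

theorem MvN.blockMap {k : ℕ} {ι κ : Type*} [Fintype ι] [Fintype κ] {p : Matrix ι ι R}
    {q : Matrix κ κ R} (h : MvN p q) (φ : R →⋆ₙₐ[ℂ] Matrix (Fin k) (Fin k) S) :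
    MvN (blockMap φ p) (blockMap φ q) := by
  obtain ⟨v, h1, h2⟩ := h
  refine ⟨KTheory.blockMap φ v, ?_, ?_⟩
  · rw [← blockMap_conjTranspose, ← blockMap_mul, h1]
  · rw [← blockMap_conjTranspose, ← blockMap_mul, h2]

theorem isStarProjection_blockMap {k : ℕ} {ι : Type*} [Fintype ι] {p : Matrix ι ι R}
    (hp : IsStarProjection p) (φ : R →⋆ₙₐ[ℂ] Matrix (Fin k) (Fin k) S) :
    IsStarProjection (blockMap φ p) := by
  have h1 : p * p = p := hp.isIdempotentElem
  have h2 : pᴴ = p := hp.isSelfAdjoint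
  constructor
  · rw [IsIdempotentElem, ← blockMap_mul, h1]
  · rw [isSelfAdjoint_iff, Matrix.star_eq_conjTranspose, ← blockMap_conjTranspose, h2]

theorem isStarProjection_map {ι : Type*} [Fintype ι] {p : Matrix ι ι R}
    (hp : IsStarProjection p) (φ : R →⋆ₙₐ[ℂ] S) : IsStarProjection (p.map φ) := by
  have h1 : p * p = p := hp.isIdempotentElem
  have h2 : pᴴ = p := hp.isSelfAdjoint
  constructor
  · rw [IsIdempotentElem, ← Matrix.map_mul, h1]
  · rw [isSelfAdjoint_iff, Matrix.star_eq_conjTranspose,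
      ← Matrix.conjTranspose_map _ (fun x => map_star φ x), h2]

/-- The map on classes of projections induced by a `*`-homomorphism `R → S`, applied entrywise. -/
def V.map (φ : R →⋆ₙₐ[ℂ] S) : V R →+ V S where
  toFun := Quotient.map (fun p => ⟨p.size, p.mat.map φ, isStarProjection_map p.isProj φ⟩) <| by
    rintro p q ⟨v, h1, h2⟩
    refine ⟨v.map φ, ?_, ?_⟩
    · rw [← Matrix.conjTranspose_map _ (fun x => map_star φ x), ← Matrix.map_mul, h1]
    · rw [← Matrix.conjTranspose_map _ (fun x => map_star φ x), ← Matrix.map_mul, h2]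
  map_zero' := by
    refine V.sound ?_
    convert Proj.mvN_refl (R := S) ⟨0, 0, .zero _⟩
    ext i
    exact i.elim0
  map_add' x y := by
    induction x using V.ind with | _ p
    induction y using V.ind with | _ q
    refine congrArg V.mk (?_ : Proj.mk _ _ _ = Proj.mk _ _ _)
    simp only [Proj.dsum, Proj.ofEquiv, Proj.mk.injEq, heq_eq_eq, true_and]
    ext i j
    obtain ⟨i, rfl⟩ := finSumFinEquiv.surjective i
    obtain ⟨j, rfl⟩ := finSumFinEquiv.surjective j
    rcases i with i | i <;> rcases j with j | j <;> simp

/-- The projection `(φ (p i j))_{i j}` in `M_{nk}(S)`, for a projection `p` in `M_n(R)`. -/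
def Proj.mapMat {k : ℕ} (φ : R →⋆ₙₐ[ℂ] Matrix (Fin k) (Fin k) S) (p : Proj R) : Proj S :=
  Proj.ofEquiv finProdFinEquiv.symm (blockMap φ p.mat) (isStarProjection_blockMap p.isProj φ)

/-- The map on classes of projections induced by a `*`-homomorphism `R → M_k(S)`, through the
identification `M_n(M_k(S)) = M_{nk}(S)`. -/
def V.mapMat {k : ℕ} (φ : R →⋆ₙₐ[ℂ] Matrix (Fin k) (Fin k) S) : V R →+ V S where
  toFun := Quotient.map (Proj.mapMat φ) fun p q h =>
    ((Proj.mvN_ofEquiv _ _ _).symm.trans (Proj.isProj _) (isStarProjection_blockMap q.isProj φ)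
      (h.blockMap φ)).trans (Proj.isProj _) (Proj.isProj _) (Proj.mvN_ofEquiv _ _ _)
  map_zero' := by
    refine V.sound ⟨0, ?_, ?_⟩
    · ext i
      exact (finProdFinEquiv.symm i).1.elim0
    · ext i
      exact i.elim0
  map_add' x y := by
    induction x using V.ind with | _ p
    induction y using V.ind with | _ q
    refine V.sound (p := (p.dsum q).mapMat φ) (q := (p.mapMat φ).dsum (q.mapMat φ)) ?_
    have hp := isStarProjection_blockMap p.isProj φ
    have hq := isStarProjection_blockMap q.isProj φ
    have hs := isStarProjection_fromBlocks p.isProj q.isProj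
    have hs' := isStarProjection_blockMap hs φ
    have h1 : MvN ((p.dsum q).mapMat φ).mat
        (blockMap φ (Matrix.fromBlocks p.mat 0 0 q.mat)) :=
      (Proj.mvN_ofEquiv _ _ _).symm.trans (Proj.isProj _) hs' ((p.mvN_dsum q).symm.blockMap φ)
    have h2 : MvN (blockMap φ (Matrix.fromBlocks p.mat 0 0 q.mat))
        (Matrix.fromBlocks (blockMap φ p.mat) 0 0 (blockMap φ q.mat)) := by
      convert MvN.submatrix hs' (Equiv.sumProdDistrib _ _ _).symm using 1
      ext (i | i) (j | j) <;> simp [blockMap]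
    have h3 : MvN (Matrix.fromBlocks (blockMap φ p.mat) 0 0 (blockMap φ q.mat))
        ((p.mapMat φ).dsum (q.mapMat φ)).mat :=
      ((Proj.mvN_ofEquiv _ _ _).fromBlocks (Proj.mvN_ofEquiv _ _ _)).trans
        (isStarProjection_fromBlocks hp hq) (Proj.isProj _) (Proj.mvN_dsum _ _)
    exact h1.trans (Proj.isProj _) (Proj.isProj _) (h2.trans hs' (Proj.isProj _) h3)

variable (R) in
/-- The Grothendieck group of the semigroup `V R`; for a unital C⋆-algebra `R` this is the usual
`K₀`-group of `R`. -/
abbrev K00 : Type _ := Algebra.GrothendieckAddGroup (V R)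

/-- The class `[p]` of a projection in `K00`. -/
def K00.of (p : Proj R) : K00 R := Algebra.GrothendieckAddGroup.of (V.mk p)

/-- Functoriality of `K00`. -/
def K00.map (φ : R →⋆ₙₐ[ℂ] S) : K00 R →+ K00 S :=
  Algebra.GrothendieckAddGroup.lift (Algebra.GrothendieckAddGroup.of.comp (V.map φ))

/-- Functoriality of `K00` for `*`-homomorphisms `R → M_k(S)`. -/
def K00.mapMat {k : ℕ} (φ : R →⋆ₙₐ[ℂ] Matrix (Fin k) (Fin k) S) : K00 R →+ K00 S :=
  Algebra.GrothendieckAddGroup.lift (Algebra.GrothendieckAddGroup.of.comp (V.mapMat φ))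

theorem K00.hom_ext {R : Type*} [NonUnitalRing R] [StarRing R] {G : Type*} [AddCommGroup G]
    {f g : K00 R →+ G} (h : ∀ p, f (K00.of p) = g (K00.of p)) : f = g :=
  Algebra.GrothendieckAddGroup.lift.symm.injective <| by
    ext x
    induction x using V.ind with | _ p
    exact h p

theorem K00.map_of (φ : R →⋆ₙₐ[ℂ] S) (p : Proj R) :
    K00.map φ (K00.of p) = K00.of ⟨p.size, p.mat.map φ, isStarProjection_map p.isProj φ⟩ :=
  DFunLike.congr_fun (Algebra.GrothendieckAddGroup.lift.symm_apply_apply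
    (Algebra.GrothendieckAddGroup.of.comp (V.map φ))) (V.mk p)

theorem K00.mapMat_of {k : ℕ} (φ : R →⋆ₙₐ[ℂ] Matrix (Fin k) (Fin k) S) (p : Proj R) :
    K00.mapMat φ (K00.of p) = K00.of (p.mapMat φ) :=
  DFunLike.congr_fun (Algebra.GrothendieckAddGroup.lift.symm_apply_apply
    (Algebra.GrothendieckAddGroup.of.comp (V.mapMat φ))) (V.mk p)

theorem K00.map_map (ψ : S →⋆ₙₐ[ℂ] T) (φ : R →⋆ₙₐ[ℂ] S) (χ : R →⋆ₙₐ[ℂ] T)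
    (h : ∀ x, ψ (φ x) = χ x) (x : K00 R) : K00.map ψ (K00.map φ x) = K00.map χ x := by
  refine DFunLike.congr_fun (f := (K00.map ψ).comp (K00.map φ)) (K00.hom_ext fun p => ?_) x
  rw [AddMonoidHom.comp_apply, K00.map_of, K00.map_of, K00.map_of]
  congr 2
  ext i j
  exact h _

/-- If `ψ (φ x) i j = χ (ω x) i j`, then the induced maps agree: `ψ_* φ_* = χ_* ω_*`. -/
theorem K00.map_mapMat {R' : Type*} [NonUnitalRing R'] [StarRing R'] [Module ℂ R'] {k : ℕ}
    (ψ : S →⋆ₙₐ[ℂ] T) (φ : R →⋆ₙₐ[ℂ] Matrix (Fin k) (Fin k) S)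
    (χ : R' →⋆ₙₐ[ℂ] Matrix (Fin k) (Fin k) T) (ω : R →⋆ₙₐ[ℂ] R')
    (h : ∀ x i j, ψ (φ x i j) = χ (ω x) i j) (x : K00 R) :
    K00.map ψ (K00.mapMat φ x) = K00.mapMat χ (K00.map ω x) := by
  refine DFunLike.congr_fun (f := (K00.map ψ).comp (K00.mapMat φ))
    (g := (K00.mapMat χ).comp (K00.map ω)) (K00.hom_ext fun p => ?_) x
  rw [AddMonoidHom.comp_apply, AddMonoidHom.comp_apply, K00.mapMat_of, K00.map_of, K00.map_of,
    K00.mapMat_of]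
  refine congrArg (Algebra.GrothendieckAddGroup.of ∘ V.mk) ?_
  simp only [Proj.mapMat, Proj.ofEquiv, Proj.mk.injEq, heq_eq_eq, true_and]
  ext i j
  exact h _ _ _

end Projections

section NonUnital

variable {A B : Type*} [NonUnitalCStarAlgebra A] [NonUnitalCStarAlgebra B]

/-- The character `λ + a ↦ λ` of the unitization `A⁺ = ℂ ⊕ A`. -/
def scalarPart (A : Type*) [NonUnitalCStarAlgebra A] : Unitization ℂ A →⋆ₙₐ[ℂ] ℂ where
  toFun x := x.fst
  map_smul' _ _ := rfl
  map_zero' := rfl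
  map_add' _ _ := rfl
  map_mul' _ _ := rfl
  map_star' _ := rfl

theorem scalarPart_apply (x : Unitization ℂ A) : scalarPart A x = x.fst := rfl

/-- `K₀(A)`, the kernel of the map `K₀(A⁺) → K₀(ℂ)` induced by `λ + a ↦ λ`. -/
abbrev K0 (A : Type*) [NonUnitalCStarAlgebra A] : Type _ := (K00.map (scalarPart A)).ker

/-- The map `K₀(A) → K₀(B)` induced by a `*`-homomorphism `A → B`. -/
def K0.map (φ : A →⋆ₙₐ[ℂ] B) : K0 A →+ K0 B :=
  ((K00.map (Unitization.starMap φ : Unitization ℂ A →⋆ₙₐ[ℂ] Unitization ℂ B)).comp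
    (K00.map (scalarPart A)).ker.subtype).codRestrict _ fun x => by
      rw [AddMonoidHom.mem_ker, AddMonoidHom.comp_apply, K00.map_map _ _ (scalarPart A)]
      · exact x.2
      · intro a
        simp [scalarPart_apply]
        rfl

/-- A homomorphism `A → M_k(B)`, regarded as a homomorphism into `M_k(B⁺)`. -/
def inrMat {k : ℕ} (φ : A →⋆ₙₐ[ℂ] Matrix (Fin k) (Fin k) B) :
    A →⋆ₙₐ[ℂ] Matrix (Fin k) (Fin k) (Unitization ℂ B) where
  toFun a := (φ a).map (Unitization.inrNonUnitalStarAlgHom ℂ B)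
  map_smul' c a := by ext1 i j; simp
  map_zero' := by ext1 i j; simp
  map_add' a b := by ext1 i j; simp
  map_mul' a b := by rw [map_mul, Matrix.map_mul]
  map_star' a := by ext1 i j; simp [Matrix.star_apply, map_star]

/-- The unital extension `λ + a ↦ λ 1 + φ a` of `φ : A → M_k(B)` to the unitizations. -/
def unitizeMat {k : ℕ} (φ : A →⋆ₙₐ[ℂ] Matrix (Fin k) (Fin k) B) :
    Unitization ℂ A →⋆ₙₐ[ℂ] Matrix (Fin k) (Fin k) (Unitization ℂ B) :=
  (Unitization.starLift (inrMat φ) :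
    Unitization ℂ A →⋆ₐ[ℂ] Matrix (Fin k) (Fin k) (Unitization ℂ B))

theorem unitizeMat_apply {k : ℕ} (φ : A →⋆ₙₐ[ℂ] Matrix (Fin k) (Fin k) B) (x : Unitization ℂ A)
    (i j : Fin k) : unitizeMat φ x i j =
      (if i = j then algebraMap ℂ (Unitization ℂ B) x.fst else 0) + (φ x.snd i j : B) := by
  have h : unitizeMat φ x = Unitization.starLift (inrMat φ) x := rfl
  rw [h]
  simp
  rfl

/-- The inclusion of the scalar matrices `ℂ 1 ⊆ M_k(ℂ)`. -/
def scalarMat (k : ℕ) : ℂ →⋆ₙₐ[ℂ] Matrix (Fin k) (Fin k) ℂ where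
  toFun c := c • 1
  map_smul' c a := by simp [mul_smul]
  map_zero' := by simp
  map_add' a b := by simp [add_smul]
  map_mul' a b := by simp [smul_smul, mul_comm]
  map_star' a := by simp

/-- The map `K₀(A) → K₀(B)` induced by a `*`-homomorphism `A → M_k(B)`, through the
identification `M_n(M_k(B⁺)) = M_{nk}(B⁺)`. -/
def K0.mapMat {k : ℕ} (φ : A →⋆ₙₐ[ℂ] Matrix (Fin k) (Fin k) B) : K0 A →+ K0 B :=
  ((K00.mapMat (unitizeMat φ)).comp (K00.map (scalarPart A)).ker.subtype).codRestrict _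
    fun x => by
      rw [AddMonoidHom.mem_ker, AddMonoidHom.comp_apply,
        K00.map_mapMat _ _ (scalarMat k) (scalarPart A)]
      · rw [show K00.map (scalarPart A) ((K00.map (scalarPart A)).ker.subtype x) = 0 from x.2,
          map_zero]
      · intro a i j
        rw [scalarPart_apply, unitizeMat_apply, scalarPart_apply]
        by_cases hij : i = j
        · simp [scalarMat, hij]
          rfl
        · simp [scalarMat, hij]

/-- The class `[q]` in `K₀(A)` of a projection `q` in `M_k(A)`. -/
def K0.ofProj {k : ℕ} (q : Matrix (Fin k) (Fin k) A) (hq : IsStarProjection q) : K0 A :=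
  ⟨K00.of ⟨k, q.map (Unitization.inrNonUnitalStarAlgHom ℂ A), isStarProjection_map hq _⟩, by
    rw [AddMonoidHom.mem_ker, K00.map_of, ← map_zero Algebra.GrothendieckAddGroup.of]
    refine congrArg Algebra.GrothendieckAddGroup.of (V.sound (q := ⟨0, 0, .zero _⟩) ⟨0, ?_, ?_⟩)
    · ext i j
      simp [scalarPart_apply]
    · ext i
      exact i.elim0⟩

/-- The class `[1]` in `K₀(A)` of the unit of a unital C⋆-algebra `A`. -/
def K0.unitClass (A : Type*) [CStarAlgebra A] : K0 A :=
  K0.ofProj (k := 1) (1 : Matrix (Fin 1) (Fin 1) A) (.one _)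

end NonUnital

end KTheory

end

/-! ### C⋆-seminorms and the C⋆-algebras that they define -/

noncomputable section

/-- A C⋆-seminorm on a complex `*`-algebra. -/
structure CStarSeminorm (R : Type*) [NonUnitalRing R] [StarRing R] [Module ℂ R] extends
    Seminorm ℂ R where
  mul_le' : ∀ x y, toFun (x * y) ≤ toFun x * toFun y
  star_mul_self' : ∀ x, toFun (star x * x) = toFun x * toFun x

namespace CStarSeminorm

variable {R : Type*} [NonUnitalRing R] [StarRing R] [Module ℂ R]

instance : CoeFun (CStarSeminorm R) fun _ => R → ℝ := ⟨fun N => N.toFun⟩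

variable (N : CStarSeminorm R)

theorem nonneg (x : R) : 0 ≤ N x := apply_nonneg N.toSeminorm x

theorem le_star (x : R) : N x ≤ N (star x) := by
  have h := N.star_mul_self' x ▸ N.mul_le' (star x) x
  rcases (N.nonneg x).eq_or_lt with h0 | h0
  · exact h0 ▸ N.nonneg _
  · exact le_of_mul_le_mul_right h h0

theorem star_eq (x : R) : N (star x) = N x :=
  le_antisymm (by simpa using N.le_star (star x)) (N.le_star x)

/-- The algebra `R`, equipped with the seminorm `N`. -/
@[nolint unusedArguments]
def Carrier (_ : CStarSeminorm R) : Type _ := R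

instance : NonUnitalRing N.Carrier := inferInstanceAs (NonUnitalRing R)
instance : StarRing N.Carrier := inferInstanceAs (StarRing R)
instance : Module ℂ N.Carrier := inferInstanceAs (Module ℂ R)
instance [IsScalarTower ℂ R R] : IsScalarTower ℂ N.Carrier N.Carrier :=
  inferInstanceAs (IsScalarTower ℂ R R)
instance [SMulCommClass ℂ R R] : SMulCommClass ℂ N.Carrier N.Carrier :=
  inferInstanceAs (SMulCommClass ℂ R R)
instance [StarModule ℂ R] : StarModule ℂ N.Carrier := inferInstanceAs (StarModule ℂ R)

instance : NonUnitalSeminormedRing N.Carrier where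
  __ : NonUnitalRing N.Carrier := inferInstance
  __ : PseudoMetricSpace N.Carrier :=
    (AddGroupSeminorm.toSeminormedAddCommGroup (E := R) N.toAddGroupSeminorm).toPseudoMetricSpace
  norm := N.toFun
  dist_eq := (AddGroupSeminorm.toSeminormedAddCommGroup (E := R) N.toAddGroupSeminorm).dist_eq
  norm_mul_le := N.mul_le'

instance : NormedSpace ℂ N.Carrier where
  norm_smul_le c x := (N.smul' c x).le

theorem norm_def (x : N.Carrier) : ‖x‖ = N x := rfl

instance : NormedStarGroup N.Carrier where
  norm_star_le x := (N.star_eq x).le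

/-- The C⋆-algebra obtained from `(R, N)` by separation and completion. -/
def Compl (N : CStarSeminorm R) : Type _ := UniformSpace.Completion N.Carrier

namespace Compl

instance : NormedAddCommGroup N.Compl :=
  inferInstanceAs (NormedAddCommGroup (UniformSpace.Completion N.Carrier))
instance : NormedSpace ℂ N.Compl :=
  inferInstanceAs (NormedSpace ℂ (UniformSpace.Completion N.Carrier))
instance : CompleteSpace N.Compl :=
  inferInstanceAs (CompleteSpace (UniformSpace.Completion N.Carrier))

/-- The canonical map `R → Compl`. -/
def ofCarrier : N.Carrier →L[ℂ] N.Compl :=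
  UniformSpace.Completion.toComplL (𝕜 := ℂ) (E := N.Carrier)

theorem norm_of (x : N.Carrier) : ‖ofCarrier N x‖ = ‖x‖ := UniformSpace.Completion.norm_coe x

theorem denseRange : DenseRange (ofCarrier N) := UniformSpace.Completion.denseRange_coe

theorem isUniformInducing : IsUniformInducing (ofCarrier N) :=
  UniformSpace.Completion.isUniformInducing_coe _

variable {N} in
theorem induction {P : N.Compl → Prop} (hc : IsClosed {x | P x}) (h : ∀ x, P (ofCarrier N x))
    (x : N.Compl) : P x := (denseRange N).induction_on x hc h

instance : Star N.Compl := ⟨UniformSpace.Completion.map (star : N.Carrier → N.Carrier)⟩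

@[fun_prop]
theorem continuous_star_apply {X : Type*} [TopologicalSpace X] {f : X → N.Compl}
    (hf : Continuous f) : Continuous fun x => star (f x) :=
  UniformSpace.Completion.continuous_map.comp hf

theorem of_star (x : N.Carrier) : ofCarrier N (star x) = star (ofCarrier N x) :=
  (UniformSpace.Completion.map_coe (f := (star : N.Carrier → N.Carrier))
    star_isometry.uniformContinuous x).symm

variable [IsScalarTower ℂ R R] [SMulCommClass ℂ R R]

/-- Multiplication by an element of `R`, extended by continuity. -/
def mulAux : N.Carrier →L[ℂ] N.Compl →L[ℂ] N.Compl :=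
  LinearMap.mkContinuous
    { toFun x := ((ofCarrier N).comp (ContinuousLinearMap.mul ℂ N.Carrier x)).extend (ofCarrier N)
      map_add' x y := by
        refine ContinuousLinearMap.extend_unique _ (denseRange N) (isUniformInducing N) _ ?_
        ext z
        simp [ContinuousLinearMap.extend_eq _ (denseRange N) (isUniformInducing N)]
      map_smul' c x := by
        refine ContinuousLinearMap.extend_unique _ (denseRange N) (isUniformInducing N) _ ?_
        ext z
        simp [ContinuousLinearMap.extend_eq _ (denseRange N) (isUniformInducing N)] } 1 <| by
    intro x
    refine ContinuousLinearMap.opNorm_le_bound _ (by positivity) fun z => ?_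
    induction z using induction with
    | hc =>
      exact isClosed_le (ContinuousLinearMap.continuous _).norm
        (continuous_const.mul continuous_norm)
    | h z =>
      simp only [LinearMap.coe_mk, AddHom.coe_mk,
        ContinuousLinearMap.extend_eq _ (denseRange N) (isUniformInducing N)]
      simpa [norm_of] using norm_mul_le x z

/-- Multiplication on the completion. -/
def mulL : N.Compl →L[ℂ] N.Compl →L[ℂ] N.Compl := (mulAux N).extend (ofCarrier N)

theorem mulL_of (x y : N.Carrier) :
    mulL N (ofCarrier N x) (ofCarrier N y) = ofCarrier N (x * y) := by
  rw [mulL, ContinuousLinearMap.extend_eq _ (denseRange N) (isUniformInducing N)]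
  exact ContinuousLinearMap.extend_eq _ (denseRange N) (isUniformInducing N) _

instance : Mul N.Compl := ⟨fun x y => mulL N x y⟩

theorem mul_def (x y : N.Compl) : x * y = mulL N x y := rfl

theorem of_mul (x y : N.Carrier) : ofCarrier N (x * y) = ofCarrier N x * ofCarrier N y :=
  (mulL_of N x y).symm

theorem continuous_mul' : Continuous fun p : N.Compl × N.Compl => mulL N p.1 p.2 :=
  (mulL N).continuous₂

@[fun_prop]
theorem continuous_mulL_apply {X : Type*} [TopologicalSpace X] {f g : X → N.Compl}
    (hf : Continuous f) (hg : Continuous g) : Continuous fun x => f x * g x :=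
  (continuous_mul' N).comp (hf.prodMk hg)

instance : NonUnitalNormedRing N.Compl where
  __ : NormedAddCommGroup N.Compl := inferInstance
  left_distrib x y z := map_add (mulL N x) y z
  right_distrib x y z := by simp [mul_def]
  zero_mul x := by simp [mul_def]
  mul_zero x := map_zero (mulL N x)
  mul_assoc x y z := by
    have c := continuous_id (X := N.Compl)
    have k (w : N.Compl) : Continuous fun _ : N.Compl => w := continuous_const
    have m {f g : N.Compl → N.Compl} (hf : Continuous f) (hg : Continuous g) :
      Continuous fun x => f x * g x := continuous_mulL_apply N hf hg
    induction x using induction with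
    | hc => exact isClosed_eq (m (m c (k y)) (k z)) (m c (k (y * z)))
    | h x =>
    induction y using induction with
    | hc => exact isClosed_eq (m (m (k _) c) (k z)) (m (k _) (m c (k z)))
    | h y =>
    induction z using induction with
    | hc => exact isClosed_eq (m (k _) c) (m (k _) (m (k _) c))
    | h z => simp only [← of_mul, mul_assoc]
  norm_mul_le x y := by
    induction x using induction with
    | hc =>
      exact isClosed_le (continuous_mulL_apply N continuous_id continuous_const).norm
        (continuous_norm.mul continuous_const)
    | h x =>
    induction y using induction with
    | hc =>
      exact isClosed_le (continuous_mulL_apply N continuous_const continuous_id).norm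
        (continuous_const.mul continuous_norm)
    | h y =>
      rw [← of_mul, norm_of, norm_of, norm_of]
      exact norm_mul_le x y

instance : StarRing N.Compl where
  star_involutive x := by
    induction x using induction with
    | hc => exact isClosed_eq (by fun_prop) (by fun_prop)
    | h x => rw [← of_star, ← of_star, star_star]
  star_mul x y := by
    induction x using induction with
    | hc => exact isClosed_eq (by fun_prop) (by fun_prop)
    | h x =>
    induction y using induction with
    | hc => exact isClosed_eq (by fun_prop) (by fun_prop)
    | h y => simp only [← of_mul, ← of_star, star_mul]
  star_add x y := by
    induction x using induction with
    | hc => exact isClosed_eq (by fun_prop) (by fun_prop)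
    | h x =>
    induction y using induction with
    | hc => exact isClosed_eq (by fun_prop) (by fun_prop)
    | h y => simp only [← map_add, ← of_star, star_add]

instance : CStarRing N.Compl where
  norm_mul_self_le x := by
    induction x using induction with
    | hc =>
      exact isClosed_le (continuous_norm.mul continuous_norm) (continuous_norm.comp
        (continuous_mulL_apply N (continuous_star_apply N continuous_id) continuous_id))
    | h x =>
      rw [← of_star, ← of_mul, norm_of, norm_of]
      exact (N.star_mul_self' x).ge

instance : IsScalarTower ℂ N.Compl N.Compl where
  smul_assoc c x y := by
    change mulL N (c • x) y = c • mulL N x y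
    simp

instance : SMulCommClass ℂ N.Compl N.Compl where
  smul_comm c x y := (map_smul (mulL N x) c y).symm

instance [StarModule ℂ R] : StarModule ℂ N.Compl where
  star_smul c x := by
    induction x using induction with
    | hc =>
      exact isClosed_eq (continuous_star_apply N (continuous_const_smul c))
        ((continuous_star_apply N continuous_id).const_smul (star c))
    | h x => rw [← map_smul, ← of_star, star_smul, map_smul, of_star]

instance [StarModule ℂ R] : NonUnitalCStarAlgebra N.Compl where
  __ : CompleteSpace N.Compl := inferInstance

end Compl
end CStarSeminorm
end

/-! ### The tensor product of C⋆-algebras -/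

noncomputable section

namespace CStarTensor

variable {A B C D : Type*} [NonUnitalCStarAlgebra A] [NonUnitalCStarAlgebra B]
  [NonUnitalCStarAlgebra C] [NonUnitalCStarAlgebra D]

/-- The property `N (a ⊗ b) ≤ ‖a‖ ‖b‖` of C⋆-seminorms on the algebraic tensor product. (It holds
for all C⋆-seminorms; it is made explicit here since it shows that their supremum is finite.) -/
def IsSubcross (N : CStarSeminorm (A ⊗[ℂ] B)) : Prop := ∀ a b, N (a ⊗ₜ[ℂ] b) ≤ ‖a‖ * ‖b‖

theorem exists_bound (x : A ⊗[ℂ] B) :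
    ∃ c, ∀ N : CStarSeminorm (A ⊗[ℂ] B), IsSubcross N → N x ≤ c := by
  induction x with
  | zero => exact ⟨0, fun N _ => (map_zero N.toSeminorm).le⟩
  | tmul a b => exact ⟨‖a‖ * ‖b‖, fun N h => h a b⟩
  | add x y hx hy =>
    obtain ⟨c, hc⟩ := hx
    obtain ⟨d, hd⟩ := hy
    exact ⟨c + d, fun N h => (map_add_le_add N.toSeminorm x y).trans (add_le_add (hc N h) (hd N h))⟩

variable (A B) in
/-- The index set of the supremum which defines the norm of the tensor product. -/
abbrev Index : Type _ := {N : CStarSeminorm (A ⊗[ℂ] B) // IsSubcross N}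

instance : Nonempty (Index A B) :=
  ⟨⟨{ (0 : Seminorm ℂ (A ⊗[ℂ] B)) with
      mul_le' := fun _ _ => (zero_mul (0 : ℝ)).ge
      star_mul_self' := fun _ => (zero_mul (0 : ℝ)).symm },
    fun _ _ => mul_nonneg (norm_nonneg _) (norm_nonneg _)⟩⟩

/-- The value of the largest C⋆-seminorm. -/
def maxFun (x : A ⊗[ℂ] B) : ℝ := ⨆ N : Index A B, N.1 x

theorem le_maxFun (N : Index A B) (x : A ⊗[ℂ] B) : N.1 x ≤ maxFun x := by
  obtain ⟨c, hc⟩ := exists_bound x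
  exact le_ciSup (f := fun N : Index A B => N.1 x) ⟨c, by rintro _ ⟨N, rfl⟩; exact hc N.1 N.2⟩ N

theorem maxFun_nonneg (x : A ⊗[ℂ] B) : 0 ≤ maxFun x :=
  Real.iSup_nonneg fun N => N.1.nonneg x

variable (A B) in
/-- The largest C⋆-seminorm on the algebraic tensor product `A ⊙ B`. If `A` or `B` is nuclear,
then this is the only C⋆-norm on `A ⊙ B`. -/
def maxSeminorm : CStarSeminorm (A ⊗[ℂ] B) where
  toFun := maxFun
  map_zero' := by simp [maxFun, show ∀ N : Index A B, N.1 0 = 0 from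
    fun N => map_zero N.1.toSeminorm]
  add_le' x y := ciSup_le fun N => (map_add_le_add N.1.toSeminorm x y).trans
    (add_le_add (le_maxFun N x) (le_maxFun N y))
  neg' x := by simp [maxFun, show ∀ N : Index A B, N.1 (-x) = N.1 x from
    fun N => map_neg_eq_map N.1.toSeminorm x]
  smul' c x := by
    rw [maxFun, maxFun, Real.mul_iSup_of_nonneg (norm_nonneg c)]
    exact iSup_congr fun N => N.1.smul' c x
  mul_le' x y := ciSup_le fun N => (N.1.mul_le' x y).trans
    (mul_le_mul (le_maxFun N x) (le_maxFun N y) (N.1.nonneg y) (maxFun_nonneg x))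
  star_mul_self' x := by
    apply le_antisymm
    · refine ciSup_le fun N => ?_
      rw [N.1.star_mul_self']
      exact mul_self_le_mul_self (N.1.nonneg x) (le_maxFun N x)
    · have h : maxFun x ≤ √(maxFun (star x * x)) := by
        refine ciSup_le fun N => Real.le_sqrt_of_sq_le ?_
        rw [sq, ← N.1.star_mul_self']
        exact le_maxFun N _
      calc maxFun x * maxFun x ≤ √(maxFun (star x * x)) * √(maxFun (star x * x)) :=
            mul_self_le_mul_self (maxFun_nonneg x) h
        _ = maxFun (star x * x) := Real.mul_self_sqrt (maxFun_nonneg _)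

end CStarTensor

/-- The C⋆-algebraic tensor product `A ⊗ B`: the completion of the algebraic tensor product in
its largest C⋆-norm. In what follows one of the factors is always nuclear, so that there is only
one C⋆-norm on the algebraic tensor product and hence only one C⋆-tensor product. -/
def CStarTensor (A B : Type*) [NonUnitalCStarAlgebra A] [NonUnitalCStarAlgebra B] : Type _ :=
  (CStarTensor.maxSeminorm A B).Compl

instance (A B : Type*) [NonUnitalCStarAlgebra A] [NonUnitalCStarAlgebra B] :
    NonUnitalCStarAlgebra (CStarTensor A B) :=
  inferInstanceAs (NonUnitalCStarAlgebra (CStarTensor.maxSeminorm A B).Compl)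

namespace CStarTensor

variable {A B C D : Type*} [NonUnitalCStarAlgebra A] [NonUnitalCStarAlgebra B]
  [NonUnitalCStarAlgebra C] [NonUnitalCStarAlgebra D]

variable (A B) in
/-- The canonical map from the algebraic tensor product to `A ⊗ B`. -/
def ofAlg : A ⊗[ℂ] B →⋆ₙₐ[ℂ] CStarTensor A B where
  toFun x := CStarSeminorm.Compl.ofCarrier (maxSeminorm A B) x
  map_smul' c x := map_smul (CStarSeminorm.Compl.ofCarrier (maxSeminorm A B)) c x
  map_zero' := map_zero (CStarSeminorm.Compl.ofCarrier (maxSeminorm A B))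
  map_add' x y := map_add (CStarSeminorm.Compl.ofCarrier (maxSeminorm A B)) x y
  map_mul' x y := CStarSeminorm.Compl.of_mul (maxSeminorm A B) x y
  map_star' x := CStarSeminorm.Compl.of_star (maxSeminorm A B) x

theorem norm_ofAlg (x : A ⊗[ℂ] B) : ‖ofAlg A B x‖ = maxFun x :=
  CStarSeminorm.Compl.norm_of (maxSeminorm A B) x

theorem denseRange_ofAlg : DenseRange (ofAlg A B) :=
  CStarSeminorm.Compl.denseRange (maxSeminorm A B)

theorem induction {P : CStarTensor A B → Prop} (hc : IsClosed {x | P x})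
    (h : ∀ x, P (ofAlg A B x)) (x : CStarTensor A B) : P x := denseRange_ofAlg.induction_on x hc h

/-- The elementary tensor `a ⊗ b`. -/
def tmul (a : A) (b : B) : CStarTensor A B := ofAlg A B (a ⊗ₜ[ℂ] b)

theorem norm_tmul_le (a : A) (b : B) : ‖tmul a b‖ ≤ ‖a‖ * ‖b‖ := by
  rw [tmul, norm_ofAlg]
  exact ciSup_le fun N => N.2 a b

theorem tmul_mul_tmul (a a' : A) (b b' : B) :
    tmul a b * tmul a' b' = tmul (a * a') (b * b') := by
  rw [tmul, tmul, ← map_mul, Algebra.TensorProduct.tmul_mul_tmul, tmul]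

theorem star_tmul (a : A) (b : B) : star (tmul a b) = tmul (star a) (star b) := by
  rw [tmul, ← map_star, TensorProduct.star_tmul, tmul]

/-- The map `a ↦ a ⊗ b`. -/
def tmulRight (b : B) : A →L[ℂ] CStarTensor A B :=
  LinearMap.mkContinuous
    { toFun a := tmul a b
      map_add' a a' := by simp only [tmul, TensorProduct.add_tmul, map_add]
      map_smul' c a := by simp only [tmul, ← TensorProduct.smul_tmul', map_smul, RingHom.id_apply] }
    ‖b‖ fun a => (norm_tmul_le a b).trans_eq (mul_comm _ _)

theorem tmulRight_apply (a : A) (b : B) : tmulRight b a = tmul a b := rfl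

theorem tmul_sum {ι : Type*} (s : Finset ι) (a : A) (b : ι → B) :
    tmul a (∑ i ∈ s, b i) = ∑ i ∈ s, tmul a (b i) := by
  simp only [tmul, TensorProduct.tmul_sum, map_sum]

theorem norm_le_maxFun (f : A ⊗[ℂ] B →⋆ₙₐ[ℂ] D) (hf : ∀ a b, ‖f (a ⊗ₜ b)‖ ≤ ‖a‖ * ‖b‖)
    (x : A ⊗[ℂ] B) : ‖f x‖ ≤ maxFun x :=
  le_maxFun ⟨{
    toFun := fun x => ‖f x‖
    map_zero' := by simp
    add_le' := fun x y => by rw [map_add]; exact norm_add_le _ _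
    neg' := fun x => by rw [map_neg, norm_neg]
    smul' := fun c x => by rw [map_smul, norm_smul]
    mul_le' := fun x y => by rw [map_mul]; exact norm_mul_le _ _
    star_mul_self' := fun x => by rw [map_mul, map_star, CStarRing.norm_star_mul_self] }, hf⟩ x

/-- A `*`-homomorphism on the algebraic tensor product, regarded as a bounded linear map. -/
def liftAux (f : A ⊗[ℂ] B →⋆ₙₐ[ℂ] D) (hf : ∀ a b, ‖f (a ⊗ₜ b)‖ ≤ ‖a‖ * ‖b‖) :
    (maxSeminorm A B).Carrier →L[ℂ] D :=
  LinearMap.mkContinuous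
    { toFun x := f x
      map_add' x y := map_add f x y
      map_smul' c x := map_smul f c x } 1 fun x => by
    rw [one_mul]
    exact norm_le_maxFun f hf x

/-- Its extension to the tensor product. -/
def liftL (f : A ⊗[ℂ] B →⋆ₙₐ[ℂ] D) (hf : ∀ a b, ‖f (a ⊗ₜ b)‖ ≤ ‖a‖ * ‖b‖) :
    CStarTensor A B →L[ℂ] D :=
  (liftAux f hf).extend (CStarSeminorm.Compl.ofCarrier (maxSeminorm A B))

theorem liftL_ofAlg (f : A ⊗[ℂ] B →⋆ₙₐ[ℂ] D) (hf : ∀ a b, ‖f (a ⊗ₜ b)‖ ≤ ‖a‖ * ‖b‖)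
    (x : A ⊗[ℂ] B) : liftL f hf (ofAlg A B x) = f x :=
  ContinuousLinearMap.extend_eq (liftAux f hf) (CStarSeminorm.Compl.denseRange (maxSeminorm A B))
    (CStarSeminorm.Compl.isUniformInducing (maxSeminorm A B)) x

/-- The extension of a `*`-homomorphism from the algebraic tensor product to `A ⊗ B`. -/
def lift (f : A ⊗[ℂ] B →⋆ₙₐ[ℂ] D) (hf : ∀ a b, ‖f (a ⊗ₜ b)‖ ≤ ‖a‖ * ‖b‖) :
    CStarTensor A B →⋆ₙₐ[ℂ] D where
  toFun := liftL f hf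
  map_smul' := map_smul (liftL f hf)
  map_zero' := map_zero (liftL f hf)
  map_add' := map_add (liftL f hf)
  map_mul' x y := by
    have c := (liftL f hf).continuous
    induction x using induction with
    | hc => exact isClosed_eq (c.comp (continuous_id.mul continuous_const)) (c.mul continuous_const)
    | h x =>
    induction y using induction with
    | hc => exact isClosed_eq (c.comp (continuous_const.mul continuous_id)) (continuous_const.mul c)
    | h y => rw [← map_mul, liftL_ofAlg, liftL_ofAlg, liftL_ofAlg, map_mul]
  map_star' x := by
    have c := (liftL f hf).continuous
    induction x using induction with
    | hc => exact isClosed_eq (c.comp continuous_star) (continuous_star.comp c)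
    | h x => rw [← map_star, liftL_ofAlg, liftL_ofAlg, map_star]

/-- The algebraic tensor product `φ ⊙ ψ` of two `*`-homomorphisms, with values in `C ⊗ D`. -/
def mapAlg (φ : A →⋆ₙₐ[ℂ] C) (ψ : B →⋆ₙₐ[ℂ] D) : A ⊗[ℂ] B →⋆ₙₐ[ℂ] CStarTensor C D where
  toFun x := ofAlg C D (TensorProduct.map (φ : A →ₗ[ℂ] C) (ψ : B →ₗ[ℂ] D) x)
  map_smul' c x := by simp
  map_zero' := by simp
  map_add' x y := by simp
  map_mul' x y := by
    rw [← map_mul]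
    congr 1
    induction x with
    | zero => simp
    | add x x' hx hx' => rw [add_mul, map_add, map_add, add_mul, hx, hx']
    | tmul a b =>
      induction y with
      | zero => simp
      | add y y' hy hy' => rw [mul_add, map_add, map_add, mul_add, hy, hy']
      | tmul a' b' => simp
  map_star' x := by
    rw [← map_star]
    congr 1
    induction x with
    | zero => simp
    | add x x' hx hx' => rw [star_add, map_add, map_add, star_add, hx, hx']
    | tmul a b => simp [map_star]

/-- The tensor product `φ ⊗ ψ : A ⊗ B → C ⊗ D` of two `*`-homomorphisms. -/
def map (φ : A →⋆ₙₐ[ℂ] C) (ψ : B →⋆ₙₐ[ℂ] D) : CStarTensor A B →⋆ₙₐ[ℂ] CStarTensor C D :=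
  lift (mapAlg φ ψ) fun a b => (norm_tmul_le (φ a) (ψ b)).trans <|
    mul_le_mul (NonUnitalStarAlgHom.norm_apply_le φ a) (NonUnitalStarAlgHom.norm_apply_le ψ b)
      (norm_nonneg _) (norm_nonneg _)

theorem map_tmul (φ : A →⋆ₙₐ[ℂ] C) (ψ : B →⋆ₙₐ[ℂ] D) (a : A) (b : B) :
    map φ ψ (tmul a b) = tmul (φ a) (ψ b) := liftL_ofAlg _ _ _

variable (A) in
/-- The `*`-homomorphism `A → A ⊗ B`, `a ↦ a ⊗ e`, for a projection `e` in `B`. -/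
def tmulProj (e : B) (he : IsStarProjection e) : A →⋆ₙₐ[ℂ] CStarTensor A B where
  toFun a := tmul a e
  map_smul' c a := map_smul (tmulRight e) c a
  map_zero' := map_zero (tmulRight e)
  map_add' a a' := map_add (tmulRight e) a a'
  map_mul' a a' := by rw [tmul_mul_tmul, he.isIdempotentElem]
  map_star' a := by rw [star_tmul, he.isSelfAdjoint]

variable (B) in
/-- The `*`-homomorphism `B → A ⊗ B`, `b ↦ e ⊗ b`, for a projection `e` in `A`. -/
def projTmul (e : A) (he : IsStarProjection e) : B →⋆ₙₐ[ℂ] CStarTensor A B where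
  toFun b := tmul e b
  map_smul' c b := by simp only [tmul, TensorProduct.tmul_smul, map_smul, MonoidHom.id_apply]
  map_zero' := by simp only [tmul, TensorProduct.tmul_zero, map_zero]
  map_add' b b' := by simp only [tmul, TensorProduct.tmul_add, map_add]
  map_mul' b b' := by rw [tmul_mul_tmul, he.isIdempotentElem]
  map_star' b := by rw [star_tmul, he.isSelfAdjoint]

variable (A) in
/-- The `*`-homomorphism `A → M_k(A ⊗ B)`, `a ↦ a ⊗ q = (a ⊗ q i j)_{i j}`, for a projection `q`
in `M_k(B)`. -/
def tmulMat {k : ℕ} (q : Matrix (Fin k) (Fin k) B) (hq : IsStarProjection q) :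
    A →⋆ₙₐ[ℂ] Matrix (Fin k) (Fin k) (CStarTensor A B) where
  toFun a := Matrix.of fun i j => tmul a (q i j)
  map_smul' c a := by ext1 i j; exact map_smul (tmulRight (q i j)) c a
  map_zero' := by ext1 i j; exact map_zero (tmulRight (q i j))
  map_add' a a' := by ext1 i j; exact map_add (tmulRight (q i j)) a a'
  map_mul' a a' := by
    ext1 i j
    have h : (q * q) i j = q i j := by rw [hq.isIdempotentElem]
    simp only [Matrix.of_apply, Matrix.mul_apply, tmul_mul_tmul] at h ⊢
    rw [← tmul_sum, h]
  map_star' a := by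
    ext1 i j
    have h : star q i j = q i j := by rw [hq.isSelfAdjoint]
    simp only [Matrix.star_apply, Matrix.of_apply, star_tmul] at h ⊢
    rw [h]

end CStarTensor

/-! ### Suspensions and the groups `K₁` and `K_*` -/

namespace KTheory

variable {A B : Type*} [NonUnitalCStarAlgebra A] [NonUnitalCStarAlgebra B]

/-- The suspension `SA = C₀(ℝ, A)`. -/
def Susp (A : Type*) [NonUnitalCStarAlgebra A] : Type _ := C₀(ℝ, A)

instance : NonUnitalCStarAlgebra (Susp A) := inferInstanceAs (NonUnitalCStarAlgebra C₀(ℝ, A))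

instance : FunLike (Susp A) ℝ A := inferInstanceAs (FunLike C₀(ℝ, A) ℝ A)

theorem Susp.ext {f g : Susp A} (h : ∀ t, f t = g t) : f = g := DFunLike.ext f g h

theorem Susp.sum_apply {ι : Type*} (s : Finset ι) (f : ι → Susp A) (t : ℝ) :
    (∑ i ∈ s, f i) t = ∑ i ∈ s, f i t :=
  map_sum (⟨⟨fun f : Susp A => f t, rfl⟩, fun _ _ => rfl⟩ : Susp A →+ A) f s

/-- Composition of a function vanishing at infinity with a bounded linear map. -/
def Susp.comp (φ : A →L[ℂ] B) (f : Susp A) : Susp B where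
  toFun t := φ (f t)
  continuous_toFun := φ.continuous.comp (map_continuous (show C₀(ℝ, A) from f))
  zero_at_infty' := by
    have h := (φ.continuous.tendsto 0).comp (zero_at_infty (show C₀(ℝ, A) from f))
    rwa [map_zero] at h

/-- The suspension `SA → SB`, `f ↦ φ ∘ f`, of a `*`-homomorphism `φ : A → B`. -/
def Susp.map (φ : A →⋆ₙₐ[ℂ] B) : Susp A →⋆ₙₐ[ℂ] Susp B where
  toFun := Susp.comp (LinearMap.mkContinuous (φ : A →ₗ[ℂ] B) 1 fun a => by
    rw [one_mul]
    exact NonUnitalStarAlgHom.norm_apply_le φ a)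
  map_smul' c f := Susp.ext fun t => map_smul φ c (f t)
  map_zero' := Susp.ext fun _ => map_zero φ
  map_add' f g := Susp.ext fun t => map_add φ (f t) (g t)
  map_mul' f g := Susp.ext fun t => map_mul φ (f t) (g t)
  map_star' f := Susp.ext fun t => map_star φ (f t)

variable (A) in
/-- The suspension `SA → M_k(S(A ⊗ B))` of `a ↦ a ⊗ q`, for a projection `q` in `M_k(B)`. -/
def Susp.tmulMat {k : ℕ} (q : Matrix (Fin k) (Fin k) B) (hq : IsStarProjection q) :
    Susp A →⋆ₙₐ[ℂ] Matrix (Fin k) (Fin k) (Susp (CStarTensor A B)) where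
  toFun f := Matrix.of fun i j => Susp.comp (CStarTensor.tmulRight (q i j)) f
  map_smul' c f := by
    ext1 i j
    exact Susp.ext fun t => congrFun₂ (map_smul (CStarTensor.tmulMat A q hq) c (f t)) i j
  map_zero' := by
    ext1 i j
    exact Susp.ext fun t => congrFun₂ (map_zero (CStarTensor.tmulMat A q hq)) i j
  map_add' f g := by
    ext1 i j
    exact Susp.ext fun t => congrFun₂ (map_add (CStarTensor.tmulMat A q hq) (f t) (g t)) i j
  map_mul' f g := by
    ext1 i j
    refine Susp.ext fun t => ?_
    refine (congrFun₂ (map_mul (CStarTensor.tmulMat A q hq) (f t) (g t)) i j).trans ?_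
    rw [Matrix.mul_apply, Matrix.mul_apply, Susp.sum_apply]
    rfl
  map_star' f := by
    ext1 i j
    exact Susp.ext fun t => congrFun₂ (map_star (CStarTensor.tmulMat A q hq) (f t)) i j

/-- `K₁(A) = K₀(SA)`. -/
abbrev K1 (A : Type*) [NonUnitalCStarAlgebra A] : Type _ := K0 (Susp A)

/-- `K_*(A) = K₀(A) ⊕ K₁(A)`. -/
abbrev KGrp (A : Type*) [NonUnitalCStarAlgebra A] : Type _ := K0 A × K1 A

/-- The map `K_*(A) → K_*(B)` induced by a `*`-homomorphism `A → B`. -/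
def KGrp.map (φ : A →⋆ₙₐ[ℂ] B) : KGrp A →+ KGrp B :=
  (K0.map φ).prodMap (K0.map (Susp.map φ))

variable (A) in
/-- The map `K_*(A) → K_*(A ⊗ B)` induced by `a ↦ a ⊗ q`, for a projection `q` in `M_k(B)`. -/
def KGrp.tmulProj {k : ℕ} (q : Matrix (Fin k) (Fin k) B) (hq : IsStarProjection q) :
    KGrp A →+ KGrp (CStarTensor A B) :=
  (K0.mapMat (CStarTensor.tmulMat A q hq)).prodMap (K0.mapMat (Susp.tmulMat A q hq))

end KTheory

end

noncomputable section

namespace CStarTensor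

variable {A B : Type*} [NonUnitalCStarAlgebra A] [NonUnitalCStarAlgebra B]
  {H K : Type*} [NormedAddCommGroup H] [InnerProductSpace ℂ H]
  [NormedAddCommGroup K] [InnerProductSpace ℂ K]

variable (H K) in
/-- The algebraic tensor product of two Hilbert spaces, with its inner product. -/
def PreHilb : Type _ := H ⊗[ℂ] K

instance : NormedAddCommGroup (PreHilb H K) := inferInstanceAs (NormedAddCommGroup (H ⊗[ℂ] K))

instance : InnerProductSpace ℂ (PreHilb H K) := inferInstanceAs (InnerProductSpace ℂ (H ⊗[ℂ] K))

/-- The operator `S ⊗ T` on the algebraic tensor product of two Hilbert spaces. -/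
def opTensor (S : H →L[ℂ] H) (T : K →L[ℂ] K) : PreHilb H K →L[ℂ] PreHilb H K :=
  LinearMap.mkContinuous
    { toFun ξ := TensorProduct.map (S : H →ₗ[ℂ] H) (T : K →ₗ[ℂ] K) ξ
      map_add' := map_add (TensorProduct.map (S : H →ₗ[ℂ] H) (T : K →ₗ[ℂ] K))
      map_smul' := map_smul (TensorProduct.map (S : H →ₗ[ℂ] H) (T : K →ₗ[ℂ] K)) }
    (‖S‖ * ‖T‖) fun ξ => by
      have h : ‖TensorProduct.mapL S T (show H ⊗[ℂ] K from ξ)‖ ≤ ‖S‖ * ‖T‖ * ‖ξ‖ :=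
        ((TensorProduct.mapL S T).le_opNorm (show H ⊗[ℂ] K from ξ)).trans
          (mul_le_mul_of_nonneg_right (TensorProduct.norm_mapL_le S T) (norm_nonneg _))
      have e := TensorProduct.mapL_apply S T (show H ⊗[ℂ] K from ξ)
      exact (congrArg norm e).symm.trans_le h

theorem norm_opTensor_le (S : H →L[ℂ] H) (T : K →L[ℂ] K) : ‖opTensor S T‖ ≤ ‖S‖ * ‖T‖ :=
  LinearMap.mkContinuous_norm_le _ (mul_nonneg (norm_nonneg _) (norm_nonneg _)) _

theorem PreHilb.ext {f g : PreHilb H K →L[ℂ] PreHilb H K}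
    (h : ∀ (u : H) (v : K), f (u ⊗ₜ[ℂ] v : H ⊗[ℂ] K) = g (u ⊗ₜ[ℂ] v : H ⊗[ℂ] K)) : f = g :=
  ContinuousLinearMap.coe_injective
    (TensorProduct.ext' (g := (f : PreHilb H K →ₗ[ℂ] PreHilb H K)) h)

variable [CompleteSpace H] [CompleteSpace K]
  (π : A →⋆ₙₐ[ℂ] (H →L[ℂ] H)) (ρ : B →⋆ₙₐ[ℂ] (K →L[ℂ] K))

/-- The tensor product of two representations, acting on the algebraic tensor product of the two
Hilbert spaces. -/
def repTensor : A ⊗[ℂ] B →ₗ[ℂ] (PreHilb H K →L[ℂ] PreHilb H K) :=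
  TensorProduct.lift <| LinearMap.mk₂ ℂ (fun a b => opTensor (π a) (ρ b))
    (fun a a' b => PreHilb.ext fun u v => by
      rw [map_add]; exact TensorProduct.add_tmul (π a u) (π a' u) (ρ b v))
    (fun c a b => PreHilb.ext fun u v => by
      rw [map_smul]; exact (TensorProduct.smul_tmul' c (π a u) (ρ b v)).symm)
    (fun a b b' => PreHilb.ext fun u v => by
      rw [map_add]; exact TensorProduct.tmul_add (π a u) (ρ b v) (ρ b' v))
    (fun c a b => PreHilb.ext fun u v => by
      rw [map_smul]; exact TensorProduct.tmul_smul c (π a u) (ρ b v))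

theorem repTensor_tmul (a : A) (b : B) :
    repTensor π ρ (a ⊗ₜ b) = opTensor (π a) (ρ b) := TensorProduct.lift.tmul _ _

theorem repTensor_mul (x y : A ⊗[ℂ] B) :
    repTensor π ρ (x * y) = repTensor π ρ x * repTensor π ρ y := by
  induction x with
  | zero => simp
  | add x x' hx hx' => rw [add_mul, map_add, map_add, add_mul, hx, hx']
  | tmul a b =>
    induction y with
    | zero => simp
    | add y y' hy hy' => rw [mul_add, map_add, map_add, mul_add, hy, hy']
    | tmul a' b' =>
      rw [Algebra.TensorProduct.tmul_mul_tmul, repTensor_tmul, repTensor_tmul, repTensor_tmul,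
        map_mul, map_mul]
      exact PreHilb.ext fun u v => rfl

theorem inner_opTensor_star (S : H →L[ℂ] H) (T : K →L[ℂ] K) (ξ η : H ⊗[ℂ] K) :
    inner ℂ (TensorProduct.map (star S : H →L[ℂ] H).toLinearMap (star T : K →L[ℂ] K).toLinearMap ξ)
      η = inner ℂ ξ (TensorProduct.map S.toLinearMap T.toLinearMap η) := by
  induction ξ with
  | zero => simp
  | add ξ ξ' h h' => rw [map_add, inner_add_left, inner_add_left, h, h']
  | tmul u v =>
    induction η with
    | zero => simp
    | add η η' h h' => rw [map_add, inner_add_right, inner_add_right, h, h']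
    | tmul u' v' =>
      simp [ContinuousLinearMap.star_eq_adjoint, ContinuousLinearMap.adjoint_inner_left]

theorem inner_repTensor_star (x : A ⊗[ℂ] B) (ξ η : PreHilb H K) :
    inner ℂ (repTensor π ρ (star x) ξ) η = inner ℂ ξ (repTensor π ρ x η) := by
  induction x with
  | zero => simp
  | add x x' hx hx' =>
    rw [star_add, map_add, map_add, add_apply, add_apply, inner_add_left, inner_add_right, hx, hx']
  | tmul a b =>
    rw [TensorProduct.star_tmul, repTensor_tmul, repTensor_tmul, map_star, map_star]
    exact inner_opTensor_star (π a) (ρ b) ξ η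

theorem norm_repTensor_star_le (x : A ⊗[ℂ] B) :
    ‖repTensor π ρ (star x)‖ ≤ ‖repTensor π ρ x‖ := by
  refine ContinuousLinearMap.opNorm_le_bound _ (norm_nonneg _) fun ξ => ?_
  have h : ‖repTensor π ρ (star x) ξ‖ * ‖repTensor π ρ (star x) ξ‖
      ≤ ‖repTensor π ρ x‖ * ‖ξ‖ * ‖repTensor π ρ (star x) ξ‖ := by
    rw [← inner_self_eq_norm_mul_norm (𝕜 := ℂ), inner_repTensor_star]
    refine (RCLike.re_le_norm _).trans ((norm_inner_le_norm _ _).trans ?_)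
    calc ‖ξ‖ * ‖repTensor π ρ x (repTensor π ρ (star x) ξ)‖
        ≤ ‖ξ‖ * (‖repTensor π ρ x‖ * ‖repTensor π ρ (star x) ξ‖) := by
          gcongr
          exact ContinuousLinearMap.le_opNorm _ _
      _ = _ := by ring
  rcases (norm_nonneg (repTensor π ρ (star x) ξ)).eq_or_lt with h0 | h0
  · rw [← h0]
    positivity
  · exact le_of_mul_le_mul_right h h0

/-- The C⋆-seminorm defined by a pair of representations. -/
def repSeminorm : CStarSeminorm (A ⊗[ℂ] B) where
  toFun x := ‖repTensor π ρ x‖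
  map_zero' := by simp
  add_le' x y := by rw [map_add]; exact norm_add_le _ _
  neg' x := by rw [map_neg, norm_neg]
  smul' c x := by rw [map_smul, norm_smul]
  mul_le' x y := by rw [repTensor_mul]; exact norm_mul_le _ _
  star_mul_self' x := by
    apply le_antisymm
    · rw [repTensor_mul]
      exact (norm_mul_le _ _).trans
        (mul_le_mul_of_nonneg_right (norm_repTensor_star_le π ρ x) (norm_nonneg _))
    · have h : ‖repTensor π ρ x‖ ≤ √‖repTensor π ρ (star x * x)‖ := by
        refine ContinuousLinearMap.opNorm_le_bound _ (Real.sqrt_nonneg _) fun ξ => ?_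
        rw [← Real.sqrt_sq (norm_nonneg ξ), ← Real.sqrt_mul (norm_nonneg _)]
        refine Real.le_sqrt_of_sq_le ?_
        rw [sq, sq, ← inner_self_eq_norm_mul_norm (𝕜 := ℂ), ← inner_repTensor_star,
          ← mul_apply_eq_comp, ← repTensor_mul]
        refine (RCLike.re_le_norm _).trans ((norm_inner_le_norm _ _).trans ?_)
        rw [← mul_assoc]
        exact mul_le_mul_of_nonneg_right (ContinuousLinearMap.le_opNorm _ _) (norm_nonneg _)
      calc ‖repTensor π ρ x‖ * ‖repTensor π ρ x‖
          ≤ √‖repTensor π ρ (star x * x)‖ * √‖repTensor π ρ (star x * x)‖ :=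
            mul_self_le_mul_self (norm_nonneg _) h
        _ = ‖repTensor π ρ (star x * x)‖ := Real.mul_self_sqrt (norm_nonneg _)

theorem repSeminorm_isSubcross : IsSubcross (repSeminorm π ρ) := fun a b => by
  change ‖repTensor π ρ (a ⊗ₜ b)‖ ≤ _
  rw [repTensor_tmul]
  exact (norm_opTensor_le _ _).trans (mul_le_mul
    (NonUnitalStarAlgHom.norm_apply_le π a) (NonUnitalStarAlgHom.norm_apply_le ρ b)
    (norm_nonneg _) (norm_nonneg _))


/-- If `A` and `B` are faithfully represented, then `a ⊗ b = 0` only if `a = 0` or `b = 0`. -/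
theorem eq_zero_of_tmul_eq_zero (hπ : Function.Injective π) (hρ : Function.Injective ρ) {a : A}
    {b : B} (h : tmul a b = 0) : a = 0 ∨ b = 0 := by
  have h1 : ‖repTensor π ρ (a ⊗ₜ b)‖ ≤ 0 := by
    rw [← norm_zero (E := CStarTensor A B), ← h, tmul, norm_ofAlg]
    exact le_maxFun ⟨repSeminorm π ρ, repSeminorm_isSubcross π ρ⟩ _
  have h2 : ∀ u v, π a u = 0 ∨ ρ b v = 0 := fun u v => by
    have h3 : repTensor π ρ (a ⊗ₜ b) (u ⊗ₜ[ℂ] v : H ⊗[ℂ] K) = 0 := by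
      rw [norm_le_zero_iff.1 h1]
      rfl
    rw [repTensor_tmul] at h3
    have h4 : (π a u) ⊗ₜ[ℂ] (ρ b v) = 0 := h3
    rwa [← norm_eq_zero, TensorProduct.norm_tmul, mul_eq_zero, norm_eq_zero, norm_eq_zero] at h4
  by_contra! hab
  have ha : π a ≠ 0 := fun h0 => hab.1 (hπ (by rw [h0, map_zero]))
  have hb : ρ b ≠ 0 := fun h0 => hab.2 (hρ (by rw [h0, map_zero]))
  obtain ⟨u, hu⟩ := DFunLike.ne_iff.1 ha
  obtain ⟨v, hv⟩ := DFunLike.ne_iff.1 hb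
  exact (h2 u v).elim hu hv

end CStarTensor

end

/-! ### Supernatural numbers, UHF algebras and dimension drop intervals -/

noncomputable section

/-- A supernatural number `∏ ℓ ^ 𝔭(ℓ)`, the product taken over all primes, with exponents
`𝔭(ℓ) ∈ {0, 1, 2, …, ∞}`. -/
abbrev Supernatural : Type := Nat.Primes → ℕ∞

namespace Supernatural

/-- The natural number `n ≥ 1` divides the supernatural number `𝔭`. -/
def Dvd (n : ℕ) (𝔭 : Supernatural) : Prop :=
  n ≠ 0 ∧ ∀ ℓ : Nat.Primes, (n.factorization ℓ : ℕ∞) ≤ 𝔭 ℓ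

/-- Two supernatural numbers are relatively prime if no prime divides both of them. -/
def Coprime (𝔭 𝔮 : Supernatural) : Prop := ∀ ℓ : Nat.Primes, 𝔭 ℓ = 0 ∨ 𝔮 ℓ = 0

end Supernatural

/-- The Hilbert space `ℓ²(ℕ)`. -/
abbrev HilbertSpaceNat : Type := lp (fun _ : ℕ => ℂ) 2

namespace UHF

/-- The standard orthonormal basis vectors of `ℓ²(ℕ)`. -/
def e (i : ℕ) : HilbertSpaceNat := lp.single 2 i 1

/-- The operator `T` on `ℓ²(ℕ)` is of the form `x ⊗ 1 = diag(x, x, x, …)` for a matrix `x` in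
`M_n(ℂ)`, with respect to the decomposition of the basis into consecutive blocks of length `n`. -/
def IsBlockDiagonal (n : ℕ) (T : HilbertSpaceNat →L[ℂ] HilbertSpaceNat) : Prop :=
  ∀ i j : ℕ, inner ℂ (e i) (T (e j)) =
    if i / n = j / n then inner ℂ (e (i % n)) (T (e (j % n))) else 0

/-- The UHF algebra `M_𝔭` as an algebra of operators on `ℓ²(ℕ)`: the norm closure of the union of
the matrix algebras `M_n(ℂ) ≅ M_n(ℂ) ⊗ 1`, for all natural numbers `n` dividing `𝔭`. Note that
`M_n(ℂ) ⊗ 1 ⊆ M_m(ℂ) ⊗ 1` if `n` divides `m`. -/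
def subalgebra (𝔭 : Supernatural) :
    StarSubalgebra ℂ (HilbertSpaceNat →L[ℂ] HilbertSpaceNat) :=
  (StarAlgebra.adjoin ℂ {T | ∃ n, Supernatural.Dvd n 𝔭 ∧ IsBlockDiagonal n T}).topologicalClosure

end UHF

/-- The UHF algebra `M_𝔭`. -/
def UHF (𝔭 : Supernatural) : Type := UHF.subalgebra 𝔭

instance (𝔭 : Supernatural) : CStarAlgebra (UHF 𝔭) :=
  haveI : IsClosed (UHF.subalgebra 𝔭 : Set (HilbertSpaceNat →L[ℂ] HilbertSpaceNat)) :=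
    StarSubalgebra.isClosed_topologicalClosure _
  inferInstanceAs (CStarAlgebra (UHF.subalgebra 𝔭))

/-- `M_𝔭` acts on `ℓ²(ℕ)`. -/
def UHF.rep (𝔭 : Supernatural) : UHF 𝔭 →⋆ₐ[ℂ] (HilbertSpaceNat →L[ℂ] HilbertSpaceNat) :=
  (UHF.subalgebra 𝔭).subtype

theorem UHF.rep_injective (𝔭 : Supernatural) : Function.Injective (UHF.rep 𝔭) :=
  Subtype.val_injective

end

noncomputable section

namespace UHF

variable (𝔭 𝔮 : Supernatural)

/-- The embedding `M_𝔭 → M_𝔭 ⊗ M_𝔮`, `x ↦ x ⊗ 1`. -/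
def inclLeft : UHF 𝔭 →⋆ₙₐ[ℂ] CStarTensor (UHF 𝔭) (UHF 𝔮) :=
  CStarTensor.tmulProj (UHF 𝔭) (1 : UHF 𝔮) (.one _)

/-- The embedding `M_𝔮 → M_𝔭 ⊗ M_𝔮`, `y ↦ 1 ⊗ y`. -/
def inclRight : UHF 𝔮 →⋆ₙₐ[ℂ] CStarTensor (UHF 𝔭) (UHF 𝔮) :=
  CStarTensor.projTmul (UHF 𝔮) (1 : UHF 𝔭) (.one _)

theorem eq_zero_or_of_tmul {x : UHF 𝔭} {y : UHF 𝔮} (h : CStarTensor.tmul x y = 0) :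
    x = 0 ∨ y = 0 :=
  CStarTensor.eq_zero_of_tmul_eq_zero
    (rep 𝔭 : UHF 𝔭 →⋆ₙₐ[ℂ] (HilbertSpaceNat →L[ℂ] HilbertSpaceNat))
    (rep 𝔮 : UHF 𝔮 →⋆ₙₐ[ℂ] (HilbertSpaceNat →L[ℂ] HilbertSpaceNat))
    (rep_injective 𝔭) (rep_injective 𝔮) h

theorem one_ne_zero' : (1 : UHF 𝔭) ≠ 0 := fun h => by
  have h1 : (1 : HilbertSpaceNat →L[ℂ] HilbertSpaceNat) = 0 := congrArg (rep 𝔭) h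
  have h2 : e 0 = 0 := DFunLike.congr_fun h1 (e 0)
  have h3 : (1 : ℂ) = 0 := by
    have h4 : (e 0 : ℕ → ℂ) 0 = 0 := by rw [h2]; rfl
    rwa [e, lp.single_apply_self] at h4
  exact one_ne_zero h3

theorem inclLeft_injective : Function.Injective (inclLeft 𝔭 𝔮) := by
  rw [injective_iff_map_eq_zero]
  intro x h
  exact (eq_zero_or_of_tmul 𝔭 𝔮 h).resolve_right (one_ne_zero' 𝔮)

theorem inclRight_injective : Function.Injective (inclRight 𝔭 𝔮) := by
  rw [injective_iff_map_eq_zero]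
  intro x h
  exact (eq_zero_or_of_tmul 𝔭 𝔮 h).resolve_left (one_ne_zero' 𝔭)

end UHF

theorem isClosed_range_of_injective {A B : Type*} [NonUnitalCStarAlgebra A]
    [NonUnitalCStarAlgebra B] (φ : A →⋆ₙₐ[ℂ] B) (hφ : Function.Injective φ) :
    IsClosed (Set.range φ) :=
  (NonUnitalStarAlgHom.isometry φ hφ).isClosedEmbedding.isClosed_range

namespace DimDrop

variable (𝔭 𝔮 : Supernatural)

/-- The generalized dimension drop interval `Z_{𝔭,𝔮}`: the continuous functions
`f : [0,1] → M_𝔭 ⊗ M_𝔮` with `f(0) ∈ M_𝔭 ⊗ 1` and `f(1) ∈ 1 ⊗ M_𝔮`. -/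
def subalgebra : NonUnitalStarSubalgebra ℂ C(unitInterval, CStarTensor (UHF 𝔭) (UHF 𝔮)) where
  carrier := {f | f 0 ∈ NonUnitalStarAlgHom.range (UHF.inclLeft 𝔭 𝔮) ∧
    f 1 ∈ NonUnitalStarAlgHom.range (UHF.inclRight 𝔭 𝔮)}
  add_mem' hf hg := ⟨add_mem hf.1 hg.1, add_mem hf.2 hg.2⟩
  zero_mem' := ⟨zero_mem _, zero_mem _⟩
  mul_mem' hf hg := ⟨mul_mem hf.1 hg.1, mul_mem hf.2 hg.2⟩
  smul_mem' c _ hf := ⟨SMulMemClass.smul_mem c hf.1, SMulMemClass.smul_mem c hf.2⟩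
  star_mem' hf := ⟨star_mem hf.1, star_mem hf.2⟩

theorem isClosed_subalgebra :
    IsClosed (subalgebra 𝔭 𝔮 : Set C(unitInterval, CStarTensor (UHF 𝔭) (UHF 𝔮))) := by
  refine IsClosed.inter ?_ ?_
  · exact (isClosed_range_of_injective _ (UHF.inclLeft_injective 𝔭 𝔮)).preimage
      (continuous_eval_const (0 : unitInterval))
  · exact (isClosed_range_of_injective _ (UHF.inclRight_injective 𝔭 𝔮)).preimage
      (continuous_eval_const (1 : unitInterval))

end DimDrop

/-- The generalized dimension drop interval `Z_{𝔭,𝔮}`. -/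
def DimDrop (𝔭 𝔮 : Supernatural) : Type := DimDrop.subalgebra 𝔭 𝔮

instance (𝔭 𝔮 : Supernatural) : NonUnitalCStarAlgebra (DimDrop 𝔭 𝔮) :=
  haveI := DimDrop.isClosed_subalgebra 𝔭 𝔮
  inferInstanceAs (NonUnitalCStarAlgebra (DimDrop.subalgebra 𝔭 𝔮))

namespace DimDrop

variable (𝔭 𝔮 : Supernatural)

/-- The inclusion of `Z_{𝔭,𝔮}` into the algebra of all continuous functions. -/
def incl : DimDrop 𝔭 𝔮 →⋆ₙₐ[ℂ] C(unitInterval, CStarTensor (UHF 𝔭) (UHF 𝔮)) :=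
  NonUnitalStarSubalgebraClass.subtype (DimDrop.subalgebra 𝔭 𝔮)

/-- The unit of `Z_{𝔭,𝔮}`, the constant function `1 ⊗ 1`. -/
def unit : DimDrop 𝔭 𝔮 :=
  ⟨ContinuousMap.const _ (CStarTensor.tmul 1 1), ⟨1, rfl⟩, ⟨1, rfl⟩⟩

theorem incl_injective : Function.Injective (incl 𝔭 𝔮) := Subtype.val_injective

theorem incl_unit (t : unitInterval) :
    incl 𝔭 𝔮 (unit 𝔭 𝔮) t = CStarTensor.tmul (1 : UHF 𝔭) (1 : UHF 𝔮) := rfl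

theorem isStarProjection_unit : IsStarProjection (unit 𝔭 𝔮) where
  isIdempotentElem := incl_injective 𝔭 𝔮 <| ContinuousMap.ext fun t => by
    rw [map_mul, ContinuousMap.mul_apply, incl_unit, CStarTensor.tmul_mul_tmul, mul_one, mul_one]
  isSelfAdjoint := incl_injective 𝔭 𝔮 <| ContinuousMap.ext fun t => by
    rw [map_star, ContinuousMap.star_apply, incl_unit, CStarTensor.star_tmul, star_one, star_one]

variable {𝔭 𝔮} in
/-- The element `x` of `M_𝔭` with `f(0) = x ⊗ 1`. -/
def evalZero (f : DimDrop 𝔭 𝔮) : UHF 𝔭 := f.2.1.choose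

variable {𝔭 𝔮} in
/-- The element `y` of `M_𝔮` with `f(1) = 1 ⊗ y`. -/
def evalOne (f : DimDrop 𝔭 𝔮) : UHF 𝔮 := f.2.2.choose

variable {𝔭 𝔮} in
theorem inclLeft_evalZero (f : DimDrop 𝔭 𝔮) :
    UHF.inclLeft 𝔭 𝔮 (evalZero f) = incl 𝔭 𝔮 f 0 := f.2.1.choose_spec

variable {𝔭 𝔮} in
theorem inclRight_evalOne (f : DimDrop 𝔭 𝔮) :
    UHF.inclRight 𝔭 𝔮 (evalOne f) = incl 𝔭 𝔮 f 1 := f.2.2.choose_spec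

/-- The evaluation `ev₀ : Z_{𝔭,𝔮} → M_𝔭`, where `M_𝔭 ⊗ 1` is identified with `M_𝔭`. -/
def ev₀ : DimDrop 𝔭 𝔮 →⋆ₙₐ[ℂ] UHF 𝔭 where
  toFun := evalZero
  map_smul' c f := UHF.inclLeft_injective 𝔭 𝔮 <| by
    rw [map_smul, inclLeft_evalZero, inclLeft_evalZero, map_smul]; rfl
  map_zero' := UHF.inclLeft_injective 𝔭 𝔮 <| by
    rw [map_zero, inclLeft_evalZero, map_zero (incl 𝔭 𝔮)]; rfl
  map_add' f g := UHF.inclLeft_injective 𝔭 𝔮 <| by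
    rw [map_add, inclLeft_evalZero, inclLeft_evalZero, inclLeft_evalZero, map_add]; rfl
  map_mul' f g := UHF.inclLeft_injective 𝔭 𝔮 <| by
    rw [map_mul, inclLeft_evalZero, inclLeft_evalZero, inclLeft_evalZero, map_mul]; rfl
  map_star' f := UHF.inclLeft_injective 𝔭 𝔮 <| by
    rw [map_star, inclLeft_evalZero, inclLeft_evalZero, map_star]; rfl

/-- The evaluation `ev₁ : Z_{𝔭,𝔮} → M_𝔮`, where `1 ⊗ M_𝔮` is identified with `M_𝔮`. -/
def ev₁ : DimDrop 𝔭 𝔮 →⋆ₙₐ[ℂ] UHF 𝔮 where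
  toFun := evalOne
  map_smul' c f := UHF.inclRight_injective 𝔭 𝔮 <| by
    rw [map_smul, inclRight_evalOne, inclRight_evalOne, map_smul]; rfl
  map_zero' := UHF.inclRight_injective 𝔭 𝔮 <| by
    rw [map_zero, inclRight_evalOne, map_zero (incl 𝔭 𝔮)]; rfl
  map_add' f g := UHF.inclRight_injective 𝔭 𝔮 <| by
    rw [map_add, inclRight_evalOne, inclRight_evalOne, inclRight_evalOne, map_add]; rfl
  map_mul' f g := UHF.inclRight_injective 𝔭 𝔮 <| by
    rw [map_mul, inclRight_evalOne, inclRight_evalOne, inclRight_evalOne, map_mul]; rfl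
  map_star' f := UHF.inclRight_injective 𝔭 𝔮 <| by
    rw [map_star, inclRight_evalOne, inclRight_evalOne, map_star]; rfl

variable (A : Type*) [NonUnitalCStarAlgebra A]

/-- The map `id ⊗ 1 : A → A ⊗ Z_{𝔭,𝔮}`, `a ↦ a ⊗ 1`. -/
def idTensorOne : A →⋆ₙₐ[ℂ] CStarTensor A (DimDrop 𝔭 𝔮) :=
  CStarTensor.tmulProj A (unit 𝔭 𝔮) (isStarProjection_unit 𝔭 𝔮)

/-- The endpoint evaluation `ev₀ ⊕ ev₁ : A ⊗ Z_{𝔭,𝔮} → A ⊗ M_𝔭 ⊕ A ⊗ M_𝔮`. -/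
def evEnds :
    CStarTensor A (DimDrop 𝔭 𝔮) →⋆ₙₐ[ℂ] CStarTensor A (UHF 𝔭) × CStarTensor A (UHF 𝔮) :=
  (CStarTensor.map (NonUnitalStarAlgHom.id ℂ A) (ev₀ 𝔭 𝔮)).prod
    (CStarTensor.map (NonUnitalStarAlgHom.id ℂ A) (ev₁ 𝔭 𝔮))

end DimDrop

/-! ### The maps of the theorem -/

namespace KTheory

/-- The homomorphism `G → G ⊗ K₀(M_𝔭) ⊕ G ⊗ K₀(M_𝔮)`, `g ↦ (g ⊗ [1], g ⊗ [1])`. -/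
def beta (𝔭 𝔮 : Supernatural) (G : Type*) [AddCommGroup G] :
    G →+ (G ⊗[ℤ] K0 (UHF 𝔭)) × (G ⊗[ℤ] K0 (UHF 𝔮)) where
  toFun g := (g ⊗ₜ K0.unitClass (UHF 𝔭), g ⊗ₜ K0.unitClass (UHF 𝔮))
  map_zero' := by simp
  map_add' g h := by simp [TensorProduct.add_tmul]

/-- The property which characterizes the Künneth map
`α : K_*(A) ⊗ (K_*(M_𝔭) ⊕ K_*(M_𝔮)) → K_*(A ⊗ M_𝔭 ⊕ A ⊗ M_𝔮)`: the exterior product of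
`x ∈ K_*(A)` with the class in `K₀(M_𝔭)` or `K₀(M_𝔮)` of a projection `e` in a matrix algebra over
`M_𝔭` or `M_𝔮` is the image of `x` under the map induced by `a ↦ a ⊗ e`. In particular,
`[p] ⊗ [e]` is mapped to `[p ⊗ e]`. There is no condition on the odd parts `K₁(M_𝔭)` and
`K₁(M_𝔮)`, since these groups are zero. -/
structure IsKunnethMap (𝔭 𝔮 : Supernatural) (A : Type*) [NonUnitalCStarAlgebra A]
    (α : KGrp A ⊗[ℤ] (KGrp (UHF 𝔭) × KGrp (UHF 𝔮)) →+
      KGrp (CStarTensor A (UHF 𝔭) × CStarTensor A (UHF 𝔮))) : Prop where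
  left : ∀ (x : KGrp A) (k : ℕ) (e : Matrix (Fin k) (Fin k) (UHF 𝔭)) (he : IsStarProjection e),
    α (x ⊗ₜ ((K0.ofProj e he, 0), 0)) =
      KGrp.map (NonUnitalStarAlgHom.inl ℂ _ _) (KGrp.tmulProj A e he x)
  right : ∀ (x : KGrp A) (k : ℕ) (e : Matrix (Fin k) (Fin k) (UHF 𝔮)) (he : IsStarProjection e),
    α (x ⊗ₜ (0, (K0.ofProj e he, 0))) =
      KGrp.map (NonUnitalStarAlgHom.inr ℂ _ _) (KGrp.tmulProj A e he x)

end KTheory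

end

universe u v

/-! The argument uses neither six-term exact sequences nor Bott periodicity. Everything is phrased
for a functor `F` as in `MatFunctor`: homotopy invariant, acting on homomorphisms into matrix
algebras, and compatible with limits of increasing sequences. For such `F` each group K₀(F B) is
compared with K₀(F ℂ). The functors that matter are B ↦ A ⊗ B and B ↦ S(A ⊗ B), which together give
K_*(A ⊗ B), and the identity and its suspension, which give K₀ and K₁.

UHF algebras. By stability (`K_unit_K_toM`) a minimal projection of M_n identifies K₀(F ℂ) with K₀(F
M_n). Continuity of K₀ (`exists_K0_map_eq`, `exists_K0_map_eq_zero`) then makes K₀(F M_𝔭) the limit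
of copies of K₀(F ℂ) whose connecting maps are multiplications by ranks (`J_eq`, `exists_J_eq`,
`exists_smul_eq_zero`). For the identity functor this exhibits K₀(M_𝔭) as an increasing union of
infinite cyclic groups, hence torsion-free. For its suspension it gives K₁(M_𝔭) = 0, since K₁(ℂ) = 0
(`mvN_scalar`). For the two tensor functors it is the same limit as K_*(A) ⊗ K₀(M_𝔭), so the
exterior product is bijective (`bijective_tensorLift_extProd`). Uniqueness of the Künneth map holds
because classes of projections suffice to write every tensor.

Injectivity of β. If g ⊗ [1] = 0 in G ⊗ K₀(M_𝔭), flatness shows that [1] is divisible by the order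
of g. Since [1] is n times a generator of one of the cyclic groups, with n dividing 𝔭, the order of
g divides such an n. The same holds for 𝔮, and coprimality leaves g = 0.

Injectivity on K_*(A). The homomorphism (ev₀ ⊕ ev₁) ∘ (id ⊗ 1) is the orthogonal sum of a ↦ (a ⊗ 1,
0) and a ↦ (0, a ⊗ 1). Under the Künneth map it becomes x ↦ x ⊗ ([1], [1]), which is injective by
the previous paragraph with G = K_*(A). This gives (c) and half of (a).

Surjectivity onto K_*(A ⊗ Z_{𝔭,𝔮}). The algebra Z_{𝔭,𝔮} is the limit of algebras Z_{n,m} of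
functions with values in M_n ⊗ M_m, with n and m coprime. The homomorphism f ↦ diag(f, …, f) with n
entries is conjugated along a path of unitaries from 1 to the flip of M_n ⊗ M_n, and the conjugates
stay in M_n(Z_{n,m}). After the flip the condition at 1 holds automatically, so the interval can be
contracted to 0, where the entries have become scalars. Hence n times any class comes from K₀(F ℂ)
through the unit (`MatFunctor.exists_card_smul_eq`). The same holds for m, and Bézout's identity
finishes the proof.

The analytic work lies in the continuity of K₀ and in `IsIndLim.tensor`, the compatibility of the
largest tensor norm with limits, which is proved by mapping the tensor product into an ultraproduct.
-/

set_option linter.unusedSectionVars false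

open scoped TensorProduct ZeroAtInfty Matrix

noncomputable section

namespace KTheory

/-! ### Classes of projections over arbitrary finite index sets -/

section Classes

variable {R S T : Type*} [NonUnitalRing R] [StarRing R] [NonUnitalRing S] [StarRing S]
  [NonUnitalRing T] [StarRing T]
variable {ι ι' κ μ : Type*} [Fintype ι] [Fintype ι'] [Fintype κ] [Fintype μ]

/-- The class in `K00` of a projection over an arbitrary finite index set. -/
def K00.cls (p : Matrix ι ι R) (hp : IsStarProjection p) : K00 R :=
  K00.of (Proj.ofEquiv (Fintype.equivFin ι).symm p hp)

theorem K00.of_eq_of_mvN {p q : Proj R} (h : MvN p.mat q.mat) : K00.of p = K00.of q :=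
  congrArg Algebra.GrothendieckAddGroup.of (V.sound h)

theorem K00.cls_eq_of {p : Matrix ι ι R} (hp : IsStarProjection p) (P : Proj R)
    (h : MvN p P.mat) : K00.cls p hp = K00.of P :=
  K00.of_eq_of_mvN (((Proj.mvN_ofEquiv _ p hp).symm).trans (Proj.isProj _) P.isProj h)

theorem K00.of_eq_cls (P : Proj R) : K00.of P = K00.cls P.mat P.isProj :=
  (K00.cls_eq_of P.isProj P P.mvN_refl).symm

theorem mvN_refl {p : Matrix ι ι R} (hp : IsStarProjection p) : MvN p p := by
  simpa using MvN.submatrix hp (Equiv.refl _)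

theorem K00.cls_congr {p : Matrix ι ι R} {q : Matrix κ κ R} {hp : IsStarProjection p}
    {hq : IsStarProjection q} (h : MvN p q) : K00.cls p hp = K00.cls q hq :=
  K00.cls_eq_of hp _ (h.trans hp (Proj.isProj _) (Proj.mvN_ofEquiv _ q hq))

theorem K00.cls_submatrix {p : Matrix ι ι R} {q : Matrix κ κ R} {hp : IsStarProjection p}
    {hq : IsStarProjection q} (e : κ ≃ ι) (h : ∀ i j, q i j = p (e i) (e j)) :
    K00.cls p hp = K00.cls q hq := by
  obtain rfl : q = p.submatrix e e := Matrix.ext h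
  exact K00.cls_congr (MvN.submatrix hp e)

theorem K00.of_dsum (p q : Proj R) : K00.of (p.dsum q) = K00.of p + K00.of q :=
  map_add Algebra.GrothendieckAddGroup.of (V.mk p) (V.mk q)

theorem K00.cls_fromBlocks {p : Matrix ι ι R} {q : Matrix κ κ R} (hp : IsStarProjection p)
    (hq : IsStarProjection q) : K00.cls (Matrix.fromBlocks p 0 0 q)
      (isStarProjection_fromBlocks hp hq) = K00.cls p hp + K00.cls q hq := by
  rw [K00.cls, K00.cls, K00.cls, ← K00.of_dsum, ← K00.cls]
  refine K00.cls_eq_of _ _ (MvN.trans (isStarProjection_fromBlocks hp hq) (Proj.isProj _) ?_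
    (Proj.mvN_dsum _ _))
  exact (Proj.mvN_ofEquiv _ _ _).fromBlocks (Proj.mvN_ofEquiv _ _ _)

theorem K00.cls_zero : K00.cls (0 : Matrix ι ι R) (.zero _) = 0 := by
  rw [← map_zero Algebra.GrothendieckAddGroup.of]
  refine K00.cls_eq_of _ ⟨0, 0, .zero _⟩ ⟨0, ?_, ?_⟩ <;> simp

theorem K00.cls_of_isEmpty [IsEmpty ι] {p : Matrix ι ι R} (hp : IsStarProjection p) :
    K00.cls p hp = 0 := by
  obtain rfl : p = 0 := Subsingleton.elim _ _
  exact K00.cls_zero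

theorem K00.exists_sub (x : K00 R) : ∃ p q : Proj R, x = K00.of p - K00.of q := by
  induction x using AddLocalization.ind with | _ y
  obtain ⟨a, b, hb⟩ := y
  induction a using V.ind with | _ p
  induction b using V.ind with | _ q
  refine ⟨p, q, ?_⟩
  have h (r : Proj R) : K00.of r = AddLocalization.mk (V.mk r) 0 :=
    (AddLocalization.mk_zero_eq_addMonoidOf_mk _).symm
  rw [h, h, Algebra.GrothendieckAddGroup.mk_sub_mk]
  congr 1
  · simp
  · ext; simp

/-- Cancellation fails in general, so equality of classes yields equivalence only after a common
summand has been added. -/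
theorem K00.exists_of_eq {p q : Proj R} (h : K00.of p = K00.of q) :
    ∃ r : Proj R, MvN (p.dsum r).mat (q.dsum r).mat := by
  have h' (r : Proj R) : K00.of r = AddLocalization.mk (V.mk r) 0 :=
    (AddLocalization.mk_zero_eq_addMonoidOf_mk _).symm
  rw [h', h', AddLocalization.mk_eq_mk_iff, AddLocalization.r_iff_exists] at h
  obtain ⟨⟨c, _⟩, hc⟩ := h
  induction c using V.ind with | _ r
  refine ⟨r, ?_⟩
  have h1 : V.mk r + V.mk p = V.mk r + V.mk q := by simpa using hc
  rw [add_comm, add_comm (V.mk r), V.mk_add_mk, V.mk_add_mk] at h1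
  exact Quotient.exact h1

variable [Module ℂ R] [Module ℂ S] [Module ℂ T]

/-- The block matrix with blocks `φ (p i j)`, for a homomorphism `φ` into matrices over an
arbitrary finite index set. -/
def bMap (φ : R →⋆ₙₐ[ℂ] Matrix κ κ S) (p : Matrix ι ι' R) : Matrix (ι × κ) (ι' × κ) S :=
  Matrix.of fun i j => φ (p i.1 j.1) i.2 j.2

theorem bMap_apply (φ : R →⋆ₙₐ[ℂ] Matrix κ κ S) (p : Matrix ι ι' R) (i : ι × κ) (j : ι' × κ) :
    bMap φ p i j = φ (p i.1 j.1) i.2 j.2 := rfl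

theorem bMap_mul (φ : R →⋆ₙₐ[ℂ] Matrix κ κ S) (p : Matrix ι ι' R) (q : Matrix ι' μ R) :
    bMap φ (p * q) = bMap φ p * bMap φ q := by
  ext ⟨i, s⟩ ⟨j, t⟩
  simp [bMap, Matrix.mul_apply, Fintype.sum_prod_type, Matrix.sum_apply]

theorem bMap_conjTranspose (φ : R →⋆ₙₐ[ℂ] Matrix κ κ S) (p : Matrix ι ι' R) :
    bMap φ pᴴ = (bMap φ p)ᴴ := by
  ext ⟨i, s⟩ ⟨j, t⟩
  simp [bMap, map_star, Matrix.star_apply]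

theorem isStarProjection_bMap {p : Matrix ι ι R} (hp : IsStarProjection p)
    (φ : R →⋆ₙₐ[ℂ] Matrix κ κ S) : IsStarProjection (bMap φ p) := by
  have h1 : p * p = p := hp.isIdempotentElem
  have h2 : pᴴ = p := hp.isSelfAdjoint
  constructor
  · rw [IsIdempotentElem, ← bMap_mul, h1]
  · rw [isSelfAdjoint_iff, Matrix.star_eq_conjTranspose, ← bMap_conjTranspose, h2]

/-- Change of the index set of a homomorphism into matrices. -/
def reindexHom (e : κ ≃ μ) (φ : R →⋆ₙₐ[ℂ] Matrix κ κ S) : R →⋆ₙₐ[ℂ] Matrix μ μ S where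
  toFun a := (φ a).submatrix e.symm e.symm
  map_smul' c a := by ext; simp
  map_zero' := by ext; simp
  map_add' a b := by ext; simp
  map_mul' a b := by rw [map_mul, Matrix.submatrix_mul_equiv]
  map_star' a := by ext; simp [map_star]

@[simp]
theorem reindexHom_apply (e : κ ≃ μ) (φ : R →⋆ₙₐ[ℂ] Matrix κ κ S) (a : R) (i j : μ) :
    reindexHom e φ a i j = φ a (e.symm i) (e.symm j) := rfl

/-- The composition of homomorphisms into matrices. -/
def compHom (φ : R →⋆ₙₐ[ℂ] Matrix κ κ S) (ψ : S →⋆ₙₐ[ℂ] Matrix μ μ T) :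
    R →⋆ₙₐ[ℂ] Matrix (κ × μ) (κ × μ) T where
  toFun a := bMap ψ (φ a)
  map_smul' c a := by ext; simp [bMap]
  map_zero' := by ext; simp [bMap]
  map_add' a b := by ext; simp [bMap]
  map_mul' a b := by rw [map_mul, bMap_mul]
  map_star' a := by rw [map_star, Matrix.star_eq_conjTranspose, bMap_conjTranspose]; rfl

@[simp]
theorem compHom_apply (φ : R →⋆ₙₐ[ℂ] Matrix κ κ S) (ψ : S →⋆ₙₐ[ℂ] Matrix μ μ T) (a : R)
    (i j : κ × μ) : compHom φ ψ a i j = ψ (φ a i.1 j.1) i.2 j.2 := rfl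

/-- The direct sum of homomorphisms into matrices. -/
def sumHom (φ : R →⋆ₙₐ[ℂ] Matrix κ κ S) (ψ : R →⋆ₙₐ[ℂ] Matrix μ μ S) :
    R →⋆ₙₐ[ℂ] Matrix (κ ⊕ μ) (κ ⊕ μ) S where
  toFun a := Matrix.fromBlocks (φ a) 0 0 (ψ a)
  map_smul' c a := by ext (i | i) (j | j) <;> simp
  map_zero' := by ext (i | i) (j | j) <;> simp
  map_add' a b := by ext (i | i) (j | j) <;> simp
  map_mul' a b := by simp [Matrix.fromBlocks_multiply]
  map_star' a := by simp [Matrix.star_eq_conjTranspose, Matrix.fromBlocks_conjTranspose, map_star]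

theorem sumHom_apply (φ : R →⋆ₙₐ[ℂ] Matrix κ κ S) (ψ : R →⋆ₙₐ[ℂ] Matrix μ μ S) (a : R) :
    sumHom φ ψ a = Matrix.fromBlocks (φ a) 0 0 (ψ a) := rfl

/-- A homomorphism, regarded as a homomorphism into one by one matrices. -/
def toMat (φ : R →⋆ₙₐ[ℂ] S) : R →⋆ₙₐ[ℂ] Matrix Unit Unit S where
  toFun a := Matrix.of fun _ _ => φ a
  map_smul' c a := by ext; simp
  map_zero' := by ext; simp
  map_add' a b := by ext; simp
  map_mul' a b := by ext; simp [Matrix.mul_apply]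
  map_star' a := by ext; simp [Matrix.star_apply, map_star]

@[simp]
theorem toMat_apply (φ : R →⋆ₙₐ[ℂ] S) (a : R) (i j : Unit) : toMat φ a i j = φ a := rfl

/-- A homomorphism into one by one matrices, regarded as a plain homomorphism. -/
def ofMat (φ : R →⋆ₙₐ[ℂ] Matrix Unit Unit S) : R →⋆ₙₐ[ℂ] S where
  toFun a := φ a () ()
  map_smul' c a := by simp
  map_zero' := by simp
  map_add' a b := by simp
  map_mul' a b := by simp [Matrix.mul_apply]
  map_star' a := by simp [Matrix.star_apply, map_star]

@[simp]
theorem ofMat_apply (φ : R →⋆ₙₐ[ℂ] Matrix Unit Unit S) (a : R) : ofMat φ a = φ a () () := rfl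

theorem toMat_ofMat (φ : R →⋆ₙₐ[ℂ] Matrix Unit Unit S) : toMat (ofMat φ) = φ := by
  ext a i j
  rfl

theorem matHom_ext {φ ψ : R →⋆ₙₐ[ℂ] Matrix κ κ S} (h : ∀ a i j, φ a i j = ψ a i j) : φ = ψ :=
  DFunLike.ext _ _ fun a => Matrix.ext (h a)

/-- The map on `K00` induced by a homomorphism into matrices over an arbitrary index set. -/
def K00.mapI (φ : R →⋆ₙₐ[ℂ] Matrix κ κ S) : K00 R →+ K00 S :=
  K00.mapMat (reindexHom (Fintype.equivFin κ) φ)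

theorem K00.mapI_cls (φ : R →⋆ₙₐ[ℂ] Matrix κ κ S) (p : Matrix ι ι R) (hp : IsStarProjection p) :
    K00.mapI φ (K00.cls p hp) = K00.cls (bMap φ p) (isStarProjection_bMap hp φ) := by
  rw [K00.mapI, K00.cls, K00.mapMat_of, K00.of_eq_cls]
  symm
  exact K00.cls_submatrix (finProdFinEquiv.symm.trans
    ((Fintype.equivFin ι).symm.prodCongr (Fintype.equivFin κ).symm)) fun i j => rfl

theorem K00.hom_ext_cls {G : Type*} [AddCommGroup G] {f g : K00 R →+ G}
    (h : ∀ (n : ℕ) (p : Matrix (Fin n) (Fin n) R) (hp : IsStarProjection p),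
      f (K00.cls p hp) = g (K00.cls p hp)) : f = g :=
  K00.hom_ext fun p => by rw [K00.of_eq_cls]; exact h _ _ _

theorem K00.map_cls (φ : R →⋆ₙₐ[ℂ] S) (p : Matrix ι ι R) (hp : IsStarProjection p) :
    K00.map φ (K00.cls p hp) = K00.cls (p.map φ) (isStarProjection_map hp φ) := by
  rw [K00.cls, K00.map_of, K00.of_eq_cls]
  symm
  exact K00.cls_submatrix (Fintype.equivFin ι).symm fun i j => rfl

theorem K00.mapMat_eq_mapI {k : ℕ} (φ : R →⋆ₙₐ[ℂ] Matrix (Fin k) (Fin k) S) :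
    K00.mapMat φ = K00.mapI φ := by
  refine K00.hom_ext_cls fun n p hp => ?_
  rw [K00.mapI_cls, K00.cls, K00.mapMat_of, K00.of_eq_cls]
  symm
  exact K00.cls_submatrix (finProdFinEquiv.symm.trans
    ((Fintype.equivFin (Fin n)).symm.prodCongr (Equiv.refl (Fin k)))) fun i j => rfl

theorem K00.map_eq_mapI (φ : R →⋆ₙₐ[ℂ] S) : K00.map φ = K00.mapI (toMat φ) := by
  refine K00.hom_ext_cls fun n p hp => ?_
  rw [K00.mapI_cls, K00.map_cls]
  exact K00.cls_submatrix (Equiv.prodPUnit _) fun i j => rfl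

theorem K00.mapI_mapI (φ : R →⋆ₙₐ[ℂ] Matrix κ κ S) (ψ : S →⋆ₙₐ[ℂ] Matrix μ μ T) (x : K00 R) :
    K00.mapI ψ (K00.mapI φ x) = K00.mapI (compHom φ ψ) x := by
  refine DFunLike.congr_fun (f := (K00.mapI ψ).comp (K00.mapI φ))
    (K00.hom_ext_cls fun n p hp => ?_) x
  rw [AddMonoidHom.comp_apply, K00.mapI_cls, K00.mapI_cls, K00.mapI_cls]
  exact K00.cls_submatrix (Equiv.prodAssoc _ _ _).symm fun i j => rfl

theorem K00.mapI_sumHom (φ : R →⋆ₙₐ[ℂ] Matrix κ κ S) (ψ : R →⋆ₙₐ[ℂ] Matrix μ μ S) :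
    K00.mapI (sumHom φ ψ) = K00.mapI φ + K00.mapI ψ := by
  refine K00.hom_ext_cls fun n p hp => ?_
  rw [AddMonoidHom.add_apply, K00.mapI_cls, K00.mapI_cls, K00.mapI_cls, ← K00.cls_fromBlocks]
  refine K00.cls_submatrix (Equiv.prodSumDistrib _ _ _).symm ?_
  rintro (i | i) (j | j) <;> rfl

theorem K00.mapI_reindexHom (e : κ ≃ μ) (φ : R →⋆ₙₐ[ℂ] Matrix κ κ S) :
    K00.mapI (reindexHom e φ) = K00.mapI φ := by
  refine K00.hom_ext_cls fun n p hp => ?_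
  rw [K00.mapI_cls, K00.mapI_cls]
  symm
  exact K00.cls_submatrix ((Equiv.refl (Fin n)).prodCongr e.symm) fun i j => rfl

end Classes

/-! ### Maps on `K₀` induced by homomorphisms into matrices -/

section NonUnital

variable {A B C : Type*} [NonUnitalCStarAlgebra A] [NonUnitalCStarAlgebra B]
  [NonUnitalCStarAlgebra C] {κ μ : Type*} [Fintype κ] [Fintype μ]

open Classical in
/-- The unital extension of a homomorphism into matrices to the unitizations. -/
def unitize (φ : A →⋆ₙₐ[ℂ] Matrix κ κ B) :
    Unitization ℂ A →⋆ₙₐ[ℂ] Matrix κ κ (Unitization ℂ B) :=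
  reindexHom (Fintype.equivFin κ).symm (unitizeMat (reindexHom (Fintype.equivFin κ) φ))

open Classical in
theorem unitize_apply (φ : A →⋆ₙₐ[ℂ] Matrix κ κ B) (x : Unitization ℂ A) (i j : κ) :
    unitize φ x i j =
      (if i = j then algebraMap ℂ (Unitization ℂ B) x.fst else 0) + (φ x.snd i j : B) := by
  rw [unitize, reindexHom_apply, unitizeMat_apply]
  simp

theorem unitize_fst [DecidableEq κ] (φ : A →⋆ₙₐ[ℂ] Matrix κ κ B) (x : Unitization ℂ A) (i j : κ) :
    (unitize φ x i j).fst = if i = j then x.fst else 0 := by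
  rw [unitize_apply]
  by_cases h : i = j
  · simp [h, Unitization.algebraMap_eq_inl]
  · simp [h]

theorem unitize_snd (φ : A →⋆ₙₐ[ℂ] Matrix κ κ B) (x : Unitization ℂ A) (i j : κ) :
    (unitize φ x i j).snd = φ x.snd i j := by
  rw [unitize_apply]
  by_cases h : i = j
  · simp [h, Unitization.algebraMap_eq_inl]
  · simp [h]

/-- The map on `K₀` induced by a homomorphism into matrices over an arbitrary index set. -/
def K0.mapI (φ : A →⋆ₙₐ[ℂ] Matrix κ κ B) : K0 A →+ K0 B :=
  K0.mapMat (reindexHom (Fintype.equivFin κ) φ)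

theorem K0.coe_mapMat {k : ℕ} (φ : A →⋆ₙₐ[ℂ] Matrix (Fin k) (Fin k) B) (x : K0 A) :
    (K0.mapMat φ x).1 = K00.mapMat (unitizeMat φ) x.1 := rfl

theorem K0.coe_mapI (φ : A →⋆ₙₐ[ℂ] Matrix κ κ B) (x : K0 A) :
    (K0.mapI φ x).1 = K00.mapI (unitize φ) x.1 := by
  rw [K0.mapI, K0.coe_mapMat, K00.mapMat_eq_mapI, unitize, K00.mapI_reindexHom]

theorem K0.coe_map (φ : A →⋆ₙₐ[ℂ] B) (x : K0 A) :
    (K0.map φ x).1 = K00.map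
      (Unitization.starMap φ : Unitization ℂ A →⋆ₙₐ[ℂ] Unitization ℂ B) x.1 := rfl

theorem K0.mapMat_eq_mapI {k : ℕ} (φ : A →⋆ₙₐ[ℂ] Matrix (Fin k) (Fin k) B) :
    K0.mapMat φ = K0.mapI φ := by
  ext x
  rw [K0.coe_mapI, K0.coe_mapMat, K00.mapMat_eq_mapI]
  congr 2
  refine matHom_ext fun a i j => ?_
  rw [unitize_apply, unitizeMat_apply]
  congr

theorem K0.map_eq_mapI (φ : A →⋆ₙₐ[ℂ] B) : K0.map φ = K0.mapI (toMat φ) := by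
  ext x
  rw [K0.coe_mapI, K0.coe_map, K00.map_eq_mapI]
  congr 2
  refine matHom_ext fun a i j => ?_
  rw [unitize_apply, toMat_apply]
  simp [Unitization.algebraMap_eq_inl]

theorem K0.mapI_mapI (φ : A →⋆ₙₐ[ℂ] Matrix κ κ B) (ψ : B →⋆ₙₐ[ℂ] Matrix μ μ C) (x : K0 A) :
    K0.mapI ψ (K0.mapI φ x) = K0.mapI (compHom φ ψ) x := by
  classical
  ext
  rw [K0.coe_mapI, K0.coe_mapI, K0.coe_mapI, K00.mapI_mapI]
  congr 2
  refine matHom_ext fun a i j => Unitization.ext ?_ ?_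
  · rw [compHom_apply, unitize_fst, unitize_fst, unitize_fst]
    simp only [Prod.ext_iff]
    split_ifs <;> simp_all
  · rw [compHom_apply, unitize_snd, unitize_snd, unitize_snd, compHom_apply]

theorem K0.mapI_sumHom (φ : A →⋆ₙₐ[ℂ] Matrix κ κ B) (ψ : A →⋆ₙₐ[ℂ] Matrix μ μ B) :
    K0.mapI (sumHom φ ψ) = K0.mapI φ + K0.mapI ψ := by
  classical
  ext x
  rw [AddMonoidHom.add_apply, AddSubgroup.coe_add, K0.coe_mapI, K0.coe_mapI, K0.coe_mapI,
    ← AddMonoidHom.add_apply, ← K00.mapI_sumHom]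
  congr 2
  refine matHom_ext fun a i j => Unitization.ext ?_ ?_
  · rw [unitize_fst, sumHom_apply]
    rcases i with i | i <;> rcases j with j | j <;> simp [unitize_fst]
  · rw [unitize_snd, sumHom_apply, sumHom_apply]
    rcases i with i | i <;> rcases j with j | j <;> simp [unitize_snd]

theorem K0.mapI_reindexHom (e : κ ≃ μ) (φ : A →⋆ₙₐ[ℂ] Matrix κ κ B) :
    K0.mapI (reindexHom e φ) = K0.mapI φ := by
  classical
  ext x
  rw [K0.coe_mapI, K0.coe_mapI, ← K00.mapI_reindexHom e]
  congr 2
  refine matHom_ext fun a i j => Unitization.ext ?_ ?_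
  · rw [reindexHom_apply, unitize_fst, unitize_fst]
    simp
  · rw [reindexHom_apply, unitize_snd, unitize_snd, reindexHom_apply]

/-- The homomorphism `ℂ → A⁺`. -/
def scalarHom (A : Type*) [NonUnitalCStarAlgebra A] : ℂ →⋆ₙₐ[ℂ] Unitization ℂ A where
  toFun c := algebraMap ℂ _ c
  map_smul' c a := by simp [Algebra.smul_def]
  map_zero' := map_zero _
  map_add' := map_add _
  map_mul' := map_mul _
  map_star' a := algebraMap_star_comm a

/-- The unital extension of the zero map factors through the character A⁺ → ℂ, and K₀(A) is by
definition the kernel of what this character induces. -/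
theorem K0.mapI_zero : K0.mapI (0 : A →⋆ₙₐ[ℂ] Matrix κ κ B) = 0 := by
  classical
  ext x
  have h : (unitize (0 : A →⋆ₙₐ[ℂ] Matrix κ κ B)) = reindexHom (Equiv.punitProd κ)
      (compHom (toMat (scalarPart A)) (unitize (0 : A →⋆ₙₐ[ℂ] Matrix κ κ B) |>.comp
        (scalarHom A))) := by
    refine matHom_ext fun a i j => Unitization.ext ?_ ?_
    · simp [unitize_fst, scalarHom, scalarPart_apply, Unitization.algebraMap_eq_inl]
    · simp [unitize_snd]
  rw [K0.coe_mapI, h, K00.mapI_reindexHom, ← K00.mapI_mapI, ← K00.map_eq_mapI,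
    show K00.map (scalarPart A) x.1 = 0 from x.2, map_zero]
  rfl

theorem K0.mapI_id (x : K0 A) : K0.mapI (toMat (NonUnitalStarAlgHom.id ℂ A)) x = x := by
  ext
  rw [← K0.map_eq_mapI, K0.coe_map]
  refine DFunLike.congr_fun (g := AddMonoidHom.id _) (K00.hom_ext fun p => ?_) x.1
  rw [K00.map_of, AddMonoidHom.id_apply]
  congr 2
  refine Matrix.ext fun i j => Unitization.ext ?_ ?_ <;> simp

theorem K0.map_map (φ : A →⋆ₙₐ[ℂ] B) (ψ : B →⋆ₙₐ[ℂ] C) (x : K0 A) :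
    K0.map ψ (K0.map φ x) = K0.map (ψ.comp φ) x := by
  rw [K0.map_eq_mapI, K0.map_eq_mapI, K0.map_eq_mapI, K0.mapI_mapI,
    ← K0.mapI_reindexHom (Equiv.prodPUnit _)]
  congr 1

theorem K0.map_id (x : K0 A) : K0.map (NonUnitalStarAlgHom.id ℂ A) x = x := by
  rw [K0.map_eq_mapI, K0.mapI_id]

end NonUnital

end KTheory

end

open scoped TensorProduct ZeroAtInfty Matrix

noncomputable section

namespace KTheory

/-! ### Equivalence of projections in C⋆-algebras -/

/-- Murray-von Neumann equivalence of elements of a `*`-algebra. -/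
def PEquiv {E : Type*} [Mul E] [Star E] (p q : E) : Prop :=
  ∃ v : E, star v * v = p ∧ v * star v = q

theorem PEquiv.symm {E : Type*} [Mul E] [InvolutiveStar E] {p q : E} (h : PEquiv p q) :
    PEquiv q p := by
  obtain ⟨v, h1, h2⟩ := h
  exact ⟨star v, by rwa [star_star], by rwa [star_star]⟩

theorem PEquiv.trans {E : Type*} [NonUnitalRing E] [StarRing E] {p q r : E}
    (hp : IsStarProjection p) (hr : IsStarProjection r) (h : PEquiv p q) (h' : PEquiv q r) :
    PEquiv p r := by
  obtain ⟨v, h1, h2⟩ := h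
  obtain ⟨w, h3, h4⟩ := h'
  refine ⟨w * v, ?_, ?_⟩
  · calc star (w * v) * (w * v) = star v * (star w * w) * v := by
          simp only [star_mul, mul_assoc]
      _ = (star v * v) * (star v * v) := by rw [h3, ← h2]; simp only [mul_assoc]
      _ = p := by rw [h1]; exact hp.isIdempotentElem
  · calc (w * v) * star (w * v) = w * (v * star v) * star w := by
          simp only [star_mul, mul_assoc]
      _ = (w * star w) * (w * star w) := by rw [h2, ← h3]; simp only [mul_assoc]
      _ = r := by rw [h4]; exact hr.isIdempotentElem

section Unital

variable {E : Type*} [CStarAlgebra E]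

theorem abs_sub_one_lt_of_mem_spectrum {x : E} (h : ‖x - 1‖ < 1) {t : ℝ}
    (ht : t ∈ spectrum ℝ x) : |t - 1| < 1 := by
  rcases subsingleton_or_nontrivial E with hE | hE
  · simp [spectrum.of_subsingleton] at ht
  · have h1 : t - 1 ∈ spectrum ℝ (x - 1) := by
      have := spectrum.sub_singleton_eq (R := ℝ) x 1
      rw [map_one] at this
      rw [← this]
      exact Set.sub_mem_sub ht rfl
    exact (spectrum.norm_le_norm_of_mem h1).trans_lt h

/-- The inverse square root of a self-adjoint element near `1`. -/
theorem exists_inv_sqrt {x : E} (hx : IsSelfAdjoint x) (h : ‖x - 1‖ < 1) :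
    ∃ s : E, IsSelfAdjoint s ∧ s * s * x = 1 ∧ ∀ b, Commute b x → Commute b s := by
  have hpos : ∀ t ∈ spectrum ℝ x, 0 < t := fun t ht => by
    have := (abs_lt.1 (abs_sub_one_lt_of_mem_spectrum h ht)).1
    linarith
  have hc : ContinuousOn (fun t : ℝ => (√t)⁻¹) (spectrum ℝ x) :=
    (Real.continuous_sqrt.continuousOn).inv₀ fun t ht => (Real.sqrt_pos.2 (hpos t ht)).ne'
  refine ⟨cfc (fun t : ℝ => (√t)⁻¹) x, cfc_predicate _ _, ?_, fun b hb => (hb.symm.cfc_real _).symm⟩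
  conv_lhs => rw [← cfc_mul (fun t : ℝ => (√t)⁻¹) (fun t : ℝ => (√t)⁻¹) x hc hc]
  conv_lhs => enter [2]; rw [← cfc_id' ℝ x]
  rw [← cfc_mul (fun t : ℝ => (√t)⁻¹ * (√t)⁻¹) (fun t : ℝ => t) x (hc.mul hc) continuousOn_id,
    ← cfc_one ℝ x]
  refine cfc_congr fun t ht => ?_
  have h0 := hpos t ht
  have h1 : √t * √t = t := Real.mul_self_sqrt h0.le
  have h2 : √t ≠ 0 := (Real.sqrt_pos.2 h0).ne'
  simp only [Pi.one_apply]
  field_simp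
  rw [sq, h1]

/-- If `z = q z p` is almost a partial isometry from `p` to `q`, then `p` and `q` are
equivalent. -/
theorem pEquiv_of_norm_lt {p q z : E} (hp : IsStarProjection p) (hq : IsStarProjection q)
    (hzp : z * p = z) (hqz : q * z = z) (h1 : ‖star z * z - p‖ < 1) (h2 : ‖z * star z - q‖ < 1) :
    PEquiv p q := by
  have hp1 : p * p = p := hp.isIdempotentElem
  have hp2 : star p = p := hp.isSelfAdjoint
  have hq1 : q * q = q := hq.isIdempotentElem
  have hq2 : star q = q := hq.isSelfAdjoint
  have hpz : p * star z = star z := by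
    have := congrArg star hzp
    rwa [star_mul, hp2] at this
  have hzq : star z * q = star z := by
    have := congrArg star hqz
    rwa [star_mul, hq2] at this
  -- Adding `1 - p` and `1 - q` turns the nearly invertible elements of the two corners into
  -- elements within distance less than 1 of the unit of `E`, so the functional calculus can be done
  -- in `E`.
  set x := star z * z + (1 - p) with hx
  set y := z * star z + (1 - q) with hy
  have hxs : IsSelfAdjoint x := by
    rw [isSelfAdjoint_iff, hx]
    simp [hp2]
  have hys : IsSelfAdjoint y := by
    rw [isSelfAdjoint_iff, hy]
    simp [hq2]
  have hx1 : ‖x - 1‖ < 1 := by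
    rwa [show x - 1 = star z * z - p by rw [hx]; abel]
  have hy1 : ‖y - 1‖ < 1 := by
    rwa [show y - 1 = z * star z - q by rw [hy]; abel]
  obtain ⟨s, hs, hsx, hsc⟩ := exists_inv_sqrt hxs hx1
  obtain ⟨r, hr, hry, hrc⟩ := exists_inv_sqrt hys hy1
  have hxp : x * p = star z * z := by
    rw [hx, add_mul, mul_assoc, hzp, sub_mul, one_mul, hp1, sub_self, add_zero]
  have hpx : p * x = star z * z := by
    rw [hx, mul_add, ← mul_assoc, hpz, mul_sub, mul_one, hp1, sub_self, add_zero]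
  have hps : Commute p s := hsc p (hpx.trans hxp.symm)
  have hxs' : Commute x s := hsc x (Commute.refl x)
  have hyz : y * z = z * x := by
    rw [hx, hy, add_mul, mul_add, sub_mul, mul_sub, hqz, hzp, one_mul, mul_one, mul_assoc]
  have hyq : y * q = z * star z := by
    rw [hy, add_mul, mul_assoc, hzq, sub_mul, one_mul, hq1, sub_self, add_zero]
  -- The partial isometry of the polar decomposition, with `s` the inverse square root of `x`.
  refine ⟨z * s, ?_, ?_⟩
  · rw [star_mul, hs.star_eq, show s * star z * (z * s) = s * (star z * z) * s by noncomm_ring,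
      ← hxp]
    calc s * (x * p) * s = s * x * (p * s) := by noncomm_ring
      _ = s * x * s * p := by rw [hps.eq]; noncomm_ring
      _ = s * s * x * p := by rw [mul_assoc s x s, hxs'.eq]; noncomm_ring
      _ = p := by rw [hsx, one_mul]
  · rw [star_mul, hs.star_eq]
    -- It is easier to compare after multiplication by `y`; this is cancelled at the end, since `r *
    -- r` is a left inverse of `y`.
    have h3 : y * (z * s * (s * star z)) = y * q := by
      rw [hyq]
      calc y * (z * s * (s * star z)) = (y * z) * s * s * star z := by noncomm_ring
        _ = z * (x * s) * s * star z := by rw [hyz]; noncomm_ring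
        _ = z * (s * x) * s * star z := by rw [hxs'.eq]
        _ = z * (s * (x * s)) * star z := by noncomm_ring
        _ = z * (s * s * x) * star z := by rw [hxs'.eq, mul_assoc s s x]
        _ = z * star z := by rw [hsx, mul_one]
    have h4 := congrArg (fun w => r * r * w) h3
    simpa only [← mul_assoc, hry, one_mul] using h4

/-- The element z = qp is almost a partial isometry, because z*z - p = p(q - p)p, and symmetrically
for zz*. -/
theorem pEquiv_of_norm_sub_lt {p q : E} (hp : IsStarProjection p) (hq : IsStarProjection q)
    (h : ‖p - q‖ < 1) : PEquiv p q := by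
  have hp1 : p * p = p := hp.isIdempotentElem
  have hp2 : star p = p := hp.isSelfAdjoint
  have hq1 : q * q = q := hq.isIdempotentElem
  have hq2 : star q = q := hq.isSelfAdjoint
  have key (p q : E) (hp1 : p * p = p) (hq1 : q * q = q) (hp : IsStarProjection p)
      (h : ‖p - q‖ < 1) : ‖p * q * p - p‖ < 1 := by
    rw [show p * q * p - p = p * (q - p) * p by
      simp only [mul_sub, sub_mul, hp1]]
    calc ‖p * (q - p) * p‖ ≤ ‖p‖ * ‖q - p‖ * ‖p‖ :=
          (norm_mul_le _ _).trans (mul_le_mul_of_nonneg_right (norm_mul_le _ _) (norm_nonneg _))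
      _ ≤ 1 * ‖q - p‖ * 1 := by
          have := hp.norm_le
          gcongr
      _ < 1 := by rwa [one_mul, mul_one, norm_sub_rev]
  refine pEquiv_of_norm_lt (z := q * p) hp hq (by rw [mul_assoc, hp1]) (by rw [← mul_assoc, hq1])
    ?_ ?_
  · rw [star_mul, hp2, hq2, show p * q * (q * p) = p * (q * q) * p by noncomm_ring, hq1]
    exact key p q hp1 hq1 hp h
  · rw [star_mul, hp2, hq2, show q * p * (p * q) = q * (p * p) * q by noncomm_ring, hp1]
    exact key q p hq1 hp1 hq (by rwa [norm_sub_rev])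

/-- Almost projections are near projections. -/
theorem exists_isStarProjection_norm_sub_le {x : E} (hx : IsSelfAdjoint x)
    (h : ‖x * x - x‖ < 1 / 4) : ∃ p : E, IsStarProjection p ∧ ‖p - x‖ ≤ 2 * ‖x * x - x‖ := by
  have h1 : cfc (fun t : ℝ => t * t - t) x = x * x - x := by
    rw [cfc_sub (fun t : ℝ => t * t) (fun t : ℝ => t) x (continuousOn_id.mul continuousOn_id)
      continuousOn_id, cfc_mul (fun t : ℝ => t) (fun t : ℝ => t) x continuousOn_id continuousOn_id,
      cfc_id' ℝ x]
  have h2 : ∀ t ∈ spectrum ℝ x, |t * t - t| ≤ ‖x * x - x‖ := fun t ht => by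
    rw [← h1]
    exact norm_apply_le_norm_cfc (fun t : ℝ => t * t - t) x ht
      ((continuousOn_id.mul continuousOn_id).sub continuousOn_id) hx
  -- The function |t² - t| has the value 1/4 at t = 1/2. The hypothesis therefore keeps the spectrum
  -- away from the jump of `f`, which is continuous there.
  set f : ℝ → ℝ := fun t => if 1 / 2 < t then 1 else 0 with hf
  have hc : ContinuousOn f (spectrum ℝ x) := by
    intro t ht
    have h3 : t ≠ 1 / 2 := by
      rintro rfl
      have := (h2 _ ht).trans_lt h
      norm_num at this
    refine ContinuousAt.continuousWithinAt ?_
    rcases lt_or_gt_of_ne h3 with h4 | h4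
    · refine (continuousAt_const (y := (0 : ℝ))).congr ?_
      filter_upwards [eventually_lt_nhds h4] with s hs
      simp only [hf]
      rw [if_neg hs.not_gt]
    · refine (continuousAt_const (y := (1 : ℝ))).congr ?_
      filter_upwards [eventually_gt_nhds h4] with s hs
      rw [hf]
      simp only
      rw [if_pos hs]
  refine ⟨cfc f x, ⟨?_, cfc_predicate _ _⟩, ?_⟩
  · rw [IsIdempotentElem, ← cfc_mul f f x hc hc]
    refine cfc_congr fun t _ => ?_
    simp only [hf]
    split_ifs <;> simp
  · conv_lhs => enter [1, 2]; rw [← cfc_id' ℝ x]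
    rw [← cfc_sub f (fun t : ℝ => t) x hc continuousOn_id]
    refine norm_cfc_le (by positivity) fun t ht => ?_
    have h3 := h2 t ht
    have h4 : |t * t - t| = |t| * |t - 1| := by rw [← abs_mul]; congr 1; ring
    rw [h4] at h3
    simp only [hf, Real.norm_eq_abs]
    split_ifs with h5
    · have h6 : 1 / 2 ≤ |t| := h5.le.trans (le_abs_self t)
      rw [abs_sub_comm]
      nlinarith [abs_nonneg (t - 1)]
    · have h6 : 1 / 2 ≤ |t - 1| := by
        rw [abs_sub_comm]
        exact le_trans (by linarith) (le_abs_self _)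
      rw [zero_sub, abs_neg]
      nlinarith [abs_nonneg t]

/-- Projections in a connected family are equivalent. -/
theorem pEquiv_of_continuous {X : Type*} [TopologicalSpace X] [PreconnectedSpace X] {P : X → E}
    (hP : Continuous P) (h : ∀ x, IsStarProjection (P x)) (x y : X) : PEquiv (P x) (P y) := by
  refine PreconnectedSpace.induction₂' (fun x y => PEquiv (P x) (P y)) (fun x => ?_)
    ⟨fun x y z h1 h2 => PEquiv.trans (h x) (h z) h1 h2⟩ x y
  -- Projections at distance less than 1 are equivalent, so the equivalence classes are open in the
  -- parameter space, and connectedness leaves only one.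
  suffices h' : ∀ᶠ z in nhds x, PEquiv (P x) (P z) from h'.mono fun z hz => ⟨hz, hz.symm⟩
  filter_upwards [hP.continuousAt.eventually (Metric.ball_mem_nhds (P x) one_pos)] with z hz
  refine pEquiv_of_norm_sub_lt (h x) (h z) ?_
  rwa [← dist_eq_norm, dist_comm]

end Unital

/-! ### Matrices over C⋆-algebras as C⋆-algebras -/

/-- The C⋆-algebra of square matrices over a C⋆-algebra. -/
def CMat (κ : Type*) (A : Type*) : Type _ := Matrix κ κ A

namespace CMat

variable {κ : Type*} [Fintype κ]

section

variable {A : Type*} [NonUnitalCStarAlgebra A]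

/-- The norm of `CStarMatrix` presupposes an order on the coefficients. The spectral order is
supplied locally, so that no order appears in later statements. -/
instance : NonUnitalCStarAlgebra (CMat κ A) :=
  letI := CStarAlgebra.spectralOrder A
  letI : StarOrderedRing A := CStarAlgebra.spectralOrderedRing A
  inferInstanceAs (NonUnitalCStarAlgebra (CStarMatrix κ κ A))

/-- The identity, from matrices with the C⋆-norm to matrices. -/
def toM (κ A : Type*) [Fintype κ] [NonUnitalCStarAlgebra A] : CMat κ A →⋆ₙₐ[ℂ] Matrix κ κ A where
  toFun x := x
  map_smul' _ _ := rfl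
  map_zero' := rfl
  map_add' _ _ := rfl
  map_mul' _ _ := rfl
  map_star' _ := rfl

/-- The identity, from matrices to matrices with the C⋆-norm. -/
def ofM (κ A : Type*) [Fintype κ] [NonUnitalCStarAlgebra A] : Matrix κ κ A →⋆ₙₐ[ℂ] CMat κ A where
  toFun x := x
  map_smul' _ _ := rfl
  map_zero' := rfl
  map_add' _ _ := rfl
  map_mul' _ _ := rfl
  map_star' _ := rfl

@[simp] theorem toM_ofM (x : Matrix κ κ A) : toM κ A (ofM κ A x) = x := rfl

@[simp] theorem ofM_toM (x : CMat κ A) : ofM κ A (toM κ A x) = x := rfl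

theorem ext {x y : CMat κ A} (h : ∀ i j, toM κ A x i j = toM κ A y i j) : x = y := Matrix.ext h

theorem norm_entry_le (x : CMat κ A) (i j : κ) : ‖toM κ A x i j‖ ≤ ‖x‖ :=
  letI := CStarAlgebra.spectralOrder A
  letI : StarOrderedRing A := CStarAlgebra.spectralOrderedRing A
  CStarMatrix.norm_entry_le_norm (M := (x : CStarMatrix κ κ A))

/-- The topology of the C⋆-norm agrees by definition with the entrywise one, so the identity map
suffices. -/
theorem continuous_ofM : Continuous (ofM κ A) := continuous_id (X := Matrix κ κ A)

theorem continuous_toM : Continuous (toM κ A) := continuous_id (X := Matrix κ κ A)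

theorem continuous_iff {X : Type*} [TopologicalSpace X] {f : X → CMat κ A} :
    Continuous f ↔ ∀ i j, Continuous fun x => toM κ A (f x) i j := by
  refine ⟨fun h i j => ((continuous_toM.comp h).matrix_elem i j), fun h => ?_⟩
  have : Continuous fun x => toM κ A (f x) := continuous_matrix h
  exact continuous_ofM.comp this

-- By the C⋆-identity the norm can be computed from e_jj(a*a), and b ↦ e_jj(b) is a *-homomorphism,
-- hence contractive.
open Classical in
theorem norm_single_le (i j : κ) (a : A) : ‖ofM κ A (Matrix.single i j a)‖ ≤ ‖a‖ := by
  let φ : A →⋆ₙₐ[ℂ] CMat κ A :=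
    { toFun := fun b => ofM κ A (Matrix.single j j b)
      map_smul' := fun c b => by rw [← map_smul, Matrix.smul_single]; rfl
      map_zero' := by simp
      map_add' := fun b c => by rw [← map_add, Matrix.single_add]
      map_mul' := fun b c => by rw [← map_mul, Matrix.single_mul_single_same]
      map_star' := fun b => by
        rw [← map_star, Matrix.star_eq_conjTranspose, Matrix.conjTranspose_single] }
  have h : star (ofM κ A (Matrix.single i j a)) * ofM κ A (Matrix.single i j a)
      = φ (star a * a) := by
    rw [← map_star, ← map_mul, Matrix.star_eq_conjTranspose, Matrix.conjTranspose_single,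
      Matrix.single_mul_single_same]
    rfl
  refine le_of_not_gt fun h' => (mul_self_lt_mul_self (norm_nonneg a) h').not_ge ?_
  rw [← CStarRing.norm_star_mul_self, h, ← CStarRing.norm_star_mul_self]
  exact NonUnitalStarAlgHom.norm_apply_le φ _

/-- A crude bound. Together with `norm_entry_le` it is enough to pass between estimates of entries
and estimates of matrices. -/
theorem norm_le_of_entry (x : CMat κ A) (c : ℝ) (h : ∀ i j, ‖toM κ A x i j‖ ≤ c) :
    ‖x‖ ≤ Fintype.card κ * (Fintype.card κ * c) := by
  classical
  have e : x = ∑ i, ∑ j, ofM κ A (Matrix.single i j (toM κ A x i j)) := by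
    conv_lhs => rw [← ofM_toM x, Matrix.matrix_eq_sum_single (toM κ A x)]
    simp only [map_sum]
  rw [e]
  have h1 (i : κ) : ‖∑ j, ofM κ A (Matrix.single i j (toM κ A x i j))‖ ≤ Fintype.card κ * c := by
    refine (norm_sum_le_of_le _ fun j _ => (norm_single_le i j _).trans (h i j)).trans_eq ?_
    simp
  refine (norm_sum_le_of_le _ fun i _ => h1 i).trans_eq ?_
  simp

/-- The homomorphism of matrix algebras induced by a homomorphism. -/
def mapHom (κ : Type*) [Fintype κ] {A B : Type*} [NonUnitalCStarAlgebra A]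
    [NonUnitalCStarAlgebra B] (φ : A →⋆ₙₐ[ℂ] B) : CMat κ A →⋆ₙₐ[ℂ] CMat κ B where
  toFun x := ofM κ B ((toM κ A x).map φ)
  map_smul' c x := CMat.ext fun i j => map_smul φ c (toM κ A x i j)
  map_zero' := CMat.ext fun i j => map_zero φ
  map_add' x y := CMat.ext fun i j => map_add φ (toM κ A x i j) (toM κ A y i j)
  map_mul' x y := by rw [map_mul, Matrix.map_mul, map_mul]
  map_star' x := CMat.ext fun i j => map_star φ (toM κ A x j i)

theorem toM_mapHom {B : Type*} [NonUnitalCStarAlgebra B] (φ : A →⋆ₙₐ[ℂ] B) (x : CMat κ A)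
    (i j : κ) : toM κ B (mapHom κ φ x) i j = φ (toM κ A x i j) := rfl

end

section

variable {A : Type*} [CStarAlgebra A]

instance [DecidableEq κ] : CStarAlgebra (CMat κ A) :=
  letI := CStarAlgebra.spectralOrder A
  letI : StarOrderedRing A := CStarAlgebra.spectralOrderedRing A
  inferInstanceAs (CStarAlgebra (CStarMatrix κ κ A))

end

theorem mvN_of_pEquiv {A : Type*} [NonUnitalCStarAlgebra A] {p q : Matrix κ κ A}
    (h : PEquiv (ofM κ A p) (ofM κ A q)) : MvN p q := h

theorem isStarProjection_ofM {A : Type*} [NonUnitalCStarAlgebra A] {p : Matrix κ κ A}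
    (h : IsStarProjection p) : IsStarProjection (ofM κ A p) := h.map (ofM κ A)

theorem isStarProjection_toM {A : Type*} [NonUnitalCStarAlgebra A] {p : CMat κ A}
    (h : IsStarProjection p) : IsStarProjection (toM κ A p) := h.map (toM κ A)

end CMat

/-! ### Homotopy invariance -/

section Homotopy

variable {A B : Type*} [NonUnitalCStarAlgebra A] [NonUnitalCStarAlgebra B] {κ : Type*} [Fintype κ]

theorem continuous_unitization {X : Type*} [TopologicalSpace X] {f : X → Unitization ℂ B}
    (h1 : Continuous fun x => (f x).fst) (h2 : Continuous fun x => (f x).snd) : Continuous f := by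
  have h : f = fun x => algebraMap ℂ (Unitization ℂ B) (f x).fst + ((f x).snd : B) := by
    funext x
    rw [Unitization.algebraMap_eq_inl, Unitization.inl_fst_add_inr_snd_eq]
  rw [h]
  exact ((continuous_algebraMap ℂ (Unitization ℂ B)).comp h1).add
    ((Unitization.isometry_inr (𝕜 := ℂ) (A := B)).continuous.comp h2)

/-- `K₀` is homotopy invariant. -/
theorem K0.mapI_eq_of_homotopy {X : Type*} [TopologicalSpace X] [PreconnectedSpace X]
    (φ : X → A →⋆ₙₐ[ℂ] Matrix κ κ B) (h : ∀ a i j, Continuous fun x => φ x a i j) (x y : X) :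
    K0.mapI (φ x) = K0.mapI (φ y) := by
  classical
  ext z
  rw [K0.coe_mapI, K0.coe_mapI]
  congr 1
  refine K00.hom_ext_cls fun n p hp => ?_
  rw [K00.mapI_cls, K00.mapI_cls]
  refine K00.cls_congr (CMat.mvN_of_pEquiv ?_)
  refine pEquiv_of_continuous (P := fun x => CMat.ofM _ _ (bMap (unitize (φ x)) p))
    (CMat.continuous_iff.2 fun i j => ?_)
    (fun x => CMat.isStarProjection_ofM (isStarProjection_bMap hp _)) x y
  refine continuous_unitization ?_ ?_
  · simp only [CMat.toM_ofM, bMap_apply, unitize_fst]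
    exact continuous_const
  · simp only [CMat.toM_ofM, bMap_apply, unitize_snd]
    exact h _ _ _

end Homotopy

end KTheory

end

open scoped TensorProduct ZeroAtInfty Matrix

noncomputable section

namespace KTheory

/-! ### Sequential inductive limits -/

/-- The C⋆-algebra `D` is the inductive limit of the sequence of C⋆-algebras `C j`. -/
structure IsIndLim {C : ℕ → Type*} [∀ j, NonUnitalCStarAlgebra (C j)] {D : Type*}
    [NonUnitalCStarAlgebra D] (κ : ∀ j k, j ≤ k → C j →⋆ₙₐ[ℂ] C k)
    (ι : ∀ j, C j →⋆ₙₐ[ℂ] D) : Prop where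
  ι_κ : ∀ j k h x, ι k (κ j k h x) = ι j x
  κ_κ : ∀ i j k h h' x, κ j k h' (κ i j h x) = κ i k (h.trans h') x
  dense : ∀ d ε, 0 < ε → ∃ j c, ‖ι j c - d‖ < ε
  ker : ∀ j x, ι j x = 0 → ∀ ε, 0 < ε → ∃ k h, ‖κ j k h x‖ < ε

theorem continuous_hom {A B : Type*} [NonUnitalCStarAlgebra A] [NonUnitalCStarAlgebra B]
    (φ : A →⋆ₙₐ[ℂ] B) : Continuous φ :=
  AddMonoidHomClass.continuous_of_bound φ 1 fun a => by
    rw [one_mul]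
    exact NonUnitalStarAlgHom.norm_apply_le φ a

theorem map_cfcₙ_real {A B : Type*} [NonUnitalCStarAlgebra A] [NonUnitalCStarAlgebra B]
    (φ : A →⋆ₙₐ[ℂ] B) {a : A} (ha : IsSelfAdjoint a) {f : ℝ → ℝ} (hf : Continuous f)
    (hf0 : f 0 = 0) : φ (cfcₙ f a) = cfcₙ f (φ a) :=
  φ.map_cfcₙ f a hf.continuousOn hf0 (continuous_hom φ) ha (ha.map φ)

namespace IsIndLim

variable {C : ℕ → Type*} [∀ j, NonUnitalCStarAlgebra (C j)] {D : Type*} [NonUnitalCStarAlgebra D]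
  {κ : ∀ j k, j ≤ k → C j →⋆ₙₐ[ℂ] C k} {ι : ∀ j, C j →⋆ₙₐ[ℂ] D}

/-- The field `ker` speaks only of elements that vanish in the limit; this upgrades it to all
elements. The part of x*x above the level ‖ι x‖², cut out by functional calculus, is killed by ι and
hence becomes small at a later stage. -/
theorem exists_norm_lt_add (H : IsIndLim κ ι) (j : ℕ) (x : C j) {ε : ℝ} (hε : 0 < ε) :
    ∃ k h, ‖κ j k h x‖ < ‖ι j x‖ + ε := by
  set c := ‖ι j x‖ * ‖ι j x‖ with hc
  set f : ℝ → ℝ := fun t => max (|t| - c) 0 with hf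
  have hfc : Continuous f := (continuous_abs.sub continuous_const).max continuous_const
  have hf0 : f 0 = 0 := by
    simp only [hf, abs_zero, zero_sub]
    exact max_eq_right (neg_nonpos.2 (mul_self_nonneg _))
  set a := star x * x with ha
  have has : IsSelfAdjoint a := IsSelfAdjoint.star_mul_self x
  have hker : ι j (cfcₙ f a) = 0 := by
    rw [map_cfcₙ_real _ has hfc hf0, ← norm_le_zero_iff]
    refine norm_cfcₙ_le fun t ht => ?_
    have h1 : |t| ≤ c := by
      have h2 := norm_apply_le_norm_cfcₙ (fun t : ℝ => t) (ι j a) ht continuousOn_id rfl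
        (has.map (ι j))
      rw [cfcₙ_id' ℝ (ι j a) (has.map (ι j)), ha, map_mul, map_star,
        CStarRing.norm_star_mul_self] at h2
      exact h2
    simp [hf, h1]
  -- The estimate concerns x*x, and ‖ι x‖² + ε² ≤ (‖ι x‖ + ε)², so the precision needed is ε².
  obtain ⟨k, h, hk⟩ := H.ker j _ hker (ε * ε) (by positivity)
  refine ⟨k, h, ?_⟩
  have h3 : ‖κ j k h a‖ ≤ c + ‖κ j k h (cfcₙ f a)‖ := by
    rw [map_cfcₙ_real _ has hfc hf0]
    conv_lhs => rw [← cfcₙ_id' ℝ (κ j k h a) (has.map (κ j k h))]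
    refine norm_cfcₙ_le fun t ht => ?_
    have h2 := norm_apply_le_norm_cfcₙ f (κ j k h a) ht hfc.continuousOn hf0 (has.map (κ j k h))
    have h4 : |t| - c ≤ f t := le_max_left _ _
    have h5 := le_abs_self (f t)
    rw [Real.norm_eq_abs] at h2 ⊢
    linarith
  rw [ha, map_mul, map_star, CStarRing.norm_star_mul_self] at h3
  have h6 := norm_nonneg (ι j x)
  by_contra! h7
  have h8 := mul_self_le_mul_self (by positivity) h7
  nlinarith

theorem norm_κ_le (κ : ∀ j k, j ≤ k → C j →⋆ₙₐ[ℂ] C k) (j k : ℕ) (h : j ≤ k) (x : C j) :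
    ‖κ j k h x‖ ≤ ‖x‖ := NonUnitalStarAlgHom.norm_apply_le _ _

end IsIndLim

/-- The unital extension of a homomorphism to the unitizations. -/
def uMap {A B : Type*} [NonUnitalCStarAlgebra A] [NonUnitalCStarAlgebra B] (φ : A →⋆ₙₐ[ℂ] B) :
    Unitization ℂ A →⋆ₙₐ[ℂ] Unitization ℂ B :=
  (Unitization.starMap φ : Unitization ℂ A →⋆ₐ[ℂ] Unitization ℂ B)

theorem uMap_fst {A B : Type*} [NonUnitalCStarAlgebra A] [NonUnitalCStarAlgebra B]
    (φ : A →⋆ₙₐ[ℂ] B) (x : Unitization ℂ A) : (uMap φ x).fst = x.fst := by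
  simp [uMap, Unitization.algebraMap_eq_inl]

theorem uMap_snd {A B : Type*} [NonUnitalCStarAlgebra A] [NonUnitalCStarAlgebra B]
    (φ : A →⋆ₙₐ[ℂ] B) (x : Unitization ℂ A) : (uMap φ x).snd = φ x.snd := by
  simp [uMap, Unitization.algebraMap_eq_inl]

theorem norm_unitization_le {A : Type*} [NonUnitalCStarAlgebra A] (x : Unitization ℂ A) :
    ‖x‖ ≤ ‖x.fst‖ + ‖x.snd‖ := by
  conv_lhs => rw [← Unitization.inl_fst_add_inr_snd_eq x]
  refine (norm_add_le _ _).trans (add_le_add (le_of_eq ?_) (Unitization.norm_inr _).le)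
  have h := norm_algebraMap' (Unitization ℂ A) x.fst
  rwa [Unitization.algebraMap_eq_inl] at h

/-! ### Unitizations and matrix algebras of inductive limits -/

namespace IsIndLim

section

variable {C : ℕ → Type*} [∀ j, NonUnitalCStarAlgebra (C j)] {D : Type*} [NonUnitalCStarAlgebra D]
  {κ : ∀ j k, j ≤ k → C j →⋆ₙₐ[ℂ] C k} {ι : ∀ j, C j →⋆ₙₐ[ℂ] D}

theorem unitization (H : IsIndLim κ ι) :
    IsIndLim (fun j k h => uMap (κ j k h)) (fun j => uMap (ι j)) where
  ι_κ j k h x := Unitization.ext (by simp only [uMap_fst]) (by simp only [uMap_snd, H.ι_κ])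
  κ_κ i j k h h' x := Unitization.ext (by simp only [uMap_fst]) (by simp only [uMap_snd, H.κ_κ])
  dense d ε hε := by
    obtain ⟨j, c, hc⟩ := H.dense d.snd ε hε
    refine ⟨j, Unitization.inl d.fst + (c : Unitization ℂ (C j)), ?_⟩
    refine (norm_unitization_le _).trans_lt ?_
    rw [sub_eq_add_neg, Unitization.fst_add, Unitization.snd_add, Unitization.fst_neg,
      Unitization.snd_neg, uMap_fst, uMap_snd, ← sub_eq_add_neg, ← sub_eq_add_neg]
    simpa using hc
  ker j x hx ε hε := by
    have h1 : x.fst = 0 := by rw [← uMap_fst (ι j), hx]; rfl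
    have h2 : ι j x.snd = 0 := by rw [← uMap_snd, hx]; rfl
    obtain ⟨k, h, hk⟩ := H.ker j _ h2 ε hε
    refine ⟨k, h, (norm_unitization_le _).trans_lt ?_⟩
    rw [uMap_fst, uMap_snd, h1, norm_zero, zero_add]
    exact hk

theorem exists_forall (H : IsIndLim κ ι) {S : Type*} [Finite S] (d : S → D) {ε : ℝ} (hε : 0 < ε) :
    ∃ j, ∀ k, j ≤ k → ∀ s, ∃ c : C k, ‖ι k c - d s‖ < ε := by
  choose j c hc using fun s => H.dense (d s) ε hε
  obtain ⟨M, hM⟩ := (Set.finite_range j).bddAbove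
  refine ⟨M, fun k hk s => ?_⟩
  have h : j s ≤ k := (hM ⟨s, rfl⟩).trans hk
  exact ⟨κ _ _ h (c s), by rw [H.ι_κ]; exact hc s⟩

theorem exists_forall_ker (H : IsIndLim κ ι) {S : Type*} [Finite S] (j : ℕ) (x : S → C j)
    {c ε : ℝ} (hx : ∀ s, ‖ι j (x s)‖ ≤ c) (hε : 0 < ε) :
    ∃ k h, ∀ s, ‖κ j k h (x s)‖ < c + ε := by
  choose k h hk using fun s => H.exists_norm_lt_add j (x s) hε
  obtain ⟨M, hM⟩ := (Set.finite_range k).bddAbove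
  refine ⟨max j M, le_max_left _ _, fun s => ?_⟩
  have h' : k s ≤ max j M := (hM ⟨s, rfl⟩).trans (le_max_right _ _)
  rw [← H.κ_κ j (k s) _ (h s) h']
  exact (norm_κ_le κ _ _ h' _).trans_lt ((hk s).trans_le (by linarith [hx s]))

theorem mat (H : IsIndLim κ ι) (S : Type*) [Fintype S] :
    IsIndLim (fun j k h => CMat.mapHom S (κ j k h)) (fun j => CMat.mapHom S (ι j)) where
  ι_κ j k h x := CMat.ext fun s t => H.ι_κ j k h _
  κ_κ i j k h h' x := CMat.ext fun s t => H.κ_κ i j k h h' _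
  dense d ε hε := by
    -- The factor by which entrywise errors grow in `CMat.norm_le_of_entry`, increased by 1 so that
    -- it is positive even for an empty index set.
    set K : ℝ := Fintype.card S * Fintype.card S + 1 with hK
    have hK0 : 0 < K := by positivity
    obtain ⟨j, hj⟩ := H.exists_forall (fun s : S × S => CMat.toM S D d s.1 s.2)
      (ε := ε / K) (by positivity)
    choose c hc using hj j le_rfl
    refine ⟨j, CMat.ofM S _ (Matrix.of fun s t => c (s, t)), ?_⟩
    refine (CMat.norm_le_of_entry _ (ε / K) fun s t => (hc (s, t)).le).trans_lt ?_
    rw [← mul_assoc, ← mul_div_assoc, div_lt_iff₀ hK0, hK]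
    nlinarith
  ker j x hx ε hε := by
    set K : ℝ := Fintype.card S * Fintype.card S + 1 with hK
    have hK0 : 0 < K := by positivity
    have h0 : ∀ s : S × S, ‖ι j (CMat.toM S _ x s.1 s.2)‖ ≤ 0 := fun s => by
      rw [← CMat.toM_mapHom, hx]
      simp
    obtain ⟨k, h, hk⟩ := H.exists_forall_ker j (fun s : S × S => CMat.toM S _ x s.1 s.2) h0
      (ε := ε / K) (by positivity)
    refine ⟨k, h, (CMat.norm_le_of_entry _ (ε / K) fun s t => ?_).trans_lt ?_⟩
    · exact (hk (s, t)).le.trans_eq (zero_add _)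
    · rw [← mul_assoc, ← mul_div_assoc, div_lt_iff₀ hK0, hK]
      nlinarith

end

/-! ### Continuity of `K₀` -/

section Unital

variable {G : ℕ → Type*} [∀ j, CStarAlgebra (G j)] {E : Type*} [CStarAlgebra E]
  {κ : ∀ j k, j ≤ k → G j →⋆ₙₐ[ℂ] G k} {ι : ∀ j, G j →⋆ₙₐ[ℂ] E}

/-- An approximant of `P` is made self-adjoint. It is almost idempotent in the limit, hence almost
idempotent at a later stage, where the functional calculus provides a projection near it. -/
theorem exists_isStarProjection (H : IsIndLim κ ι) {P : E} (hP : IsStarProjection P) :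
    ∃ j p, IsStarProjection p ∧ ‖ι j p - P‖ < 1 := by
  have hP1 : P * P = P := hP.isIdempotentElem
  have hP2 : star P = P := hP.isSelfAdjoint
  have hPn : ‖P‖ ≤ 1 := hP.norm_le
  -- With error 1/100 the defect x² - x has norm at most 4/100 in the limit and less than 8/100 at a
  -- later stage. This is below 1/4, and the resulting projection moves by less than 16/100.
  obtain ⟨j, c, hc⟩ := H.dense P (1 / 100) (by norm_num)
  set x : G j := (2⁻¹ : ℂ) • (c + star c) with hx
  have hxs : IsSelfAdjoint x := by
    rw [isSelfAdjoint_iff, hx, star_smul, star_add, star_star, add_comm]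
    simp
  have h1 : ‖ι j x - P‖ ≤ 1 / 100 := by
    have e : ι j x - P = (2⁻¹ : ℂ) • ((ι j c - P) + star (ι j c - P)) := by
      rw [hx, map_smul, map_add, map_star, star_sub, hP2]
      module
    rw [e, norm_smul, show ‖(2⁻¹ : ℂ)‖ = 1 / 2 by norm_num]
    have := norm_add_le (ι j c - P) (star (ι j c - P))
    rw [norm_star] at this
    linarith
  set d := ι j x - P with hd
  have h2 : ‖ι j (x * x - x)‖ ≤ 4 / 100 := by
    have e : ι j (x * x - x) = P * d + d * P + d * d - d := by
      rw [map_sub, map_mul, show ι j x = P + d by rw [hd]; abel]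
      rw [add_mul, mul_add, mul_add, hP1]
      abel
    rw [e]
    have a1 := norm_mul_le P d
    have a2 := norm_mul_le d P
    have a3 := norm_mul_le d d
    have a4 := norm_sub_le (P * d + d * P + d * d) d
    have a5 := norm_add_le (P * d + d * P) (d * d)
    have a6 := norm_add_le (P * d) (d * P)
    have a7 := norm_nonneg d
    nlinarith [norm_nonneg P]
  obtain ⟨k, h, hk⟩ := H.exists_norm_lt_add j (x * x - x) (ε := 4 / 100) (by norm_num)
  rw [map_sub, map_mul] at hk
  obtain ⟨p, hp, hpx⟩ := exists_isStarProjection_norm_sub_le (hxs.map (κ j k h)) (by linarith)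
  refine ⟨k, p, hp, ?_⟩
  have h3 : ‖ι k p - P‖ ≤ ‖ι k (p - κ j k h x)‖ + ‖d‖ := by
    rw [show ι k p - P = ι k (p - κ j k h x) + d by rw [map_sub, H.ι_κ, hd]; abel]
    exact norm_add_le _ _
  have h4 := NonUnitalStarAlgHom.norm_apply_le (ι k) (p - κ j k h x)
  linarith

/-- The partial isometry `v` is replaced by a nearby element of a finite stage, compressed between
`p` and `q`. The two inequalities required by `pEquiv_of_norm_lt` hold with margin in the limit and
therefore at some later stage. -/
theorem exists_pEquiv (H : IsIndLim κ ι) {j : ℕ} {p q : G j} (hp : IsStarProjection p)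
    (hq : IsStarProjection q) (h : PEquiv (ι j p) (ι j q)) :
    ∃ k h, PEquiv (κ j k h p) (κ j k h q) := by
  obtain ⟨v, hv1, hv2⟩ := h
  have hvn : ‖v‖ ≤ 1 := by
    have h1 : ‖v‖ * ‖v‖ ≤ 1 := by
      rw [← CStarRing.norm_star_mul_self, hv1]
      exact (hp.map (ι j)).norm_le
    nlinarith [norm_nonneg v]
  have hvp : v * ι j p = v := by
    rw [← sub_eq_zero, ← CStarRing.star_mul_self_eq_zero_iff, star_sub, star_mul,
      (hp.map (ι j)).isSelfAdjoint.star_eq]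
    have e : ι j p * ι j p = ι j p := (hp.map (ι j)).isIdempotentElem
    rw [show (ι j p * star v - star v) * (v * ι j p - v) = ι j p * (star v * v) * ι j p -
      ι j p * (star v * v) - (star v * v) * ι j p + star v * v by noncomm_ring, hv1, e, e]
    abel
  have hqv : ι j q * v = v := by rw [← hv2, mul_assoc, hv1, hvp]
  -- An error of 1/8 changes `star v * v` by at most 2/8 + 1/64, which is below 1/2. The remaining
  -- 1/2 is spent in passing from the limit to a finite stage.
  obtain ⟨i, c, hc⟩ := H.dense v (1 / 8) (by norm_num)
  set m := max i j with hm
  have hjm : j ≤ m := le_max_right _ _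
  set p' := κ j m hjm p with hp'
  set q' := κ j m hjm q with hq'
  have hpp : IsStarProjection p' := hp.map _
  have hqq : IsStarProjection q' := hq.map _
  set z := q' * κ i m (le_max_left _ _) c * p' with hz
  have hzp : z * p' = z := by rw [hz, mul_assoc, show p' * p' = p' from hpp.isIdempotentElem]
  have hqz : q' * z = z := by
    rw [hz, ← mul_assoc, ← mul_assoc, show q' * q' = q' from hqq.isIdempotentElem]
  set d := ι m z - v with hd
  have hdn : ‖d‖ ≤ 1 / 8 := by
    have e : d = ι j q * (ι i c - v) * ι j p := by
      rw [hd, hz, map_mul, map_mul, hp', hq', H.ι_κ, H.ι_κ, H.ι_κ, mul_sub, sub_mul, hqv, hvp]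
    rw [e]
    have a1 := norm_mul_le (ι j q * (ι i c - v)) (ι j p)
    have a2 := norm_mul_le (ι j q) (ι i c - v)
    have a3 := (hp.map (ι j)).norm_le
    have a4 := (hq.map (ι j)).norm_le
    have a5 := norm_nonneg (ι j q)
    have a6 := norm_nonneg (ι j p)
    have a7 := norm_nonneg (ι i c - v)
    have a8 : ‖ι j q * (ι i c - v)‖ ≤ 1 / 8 := by nlinarith
    nlinarith [norm_nonneg (ι j q * (ι i c - v))]
  have hιz : ι m z = v + d := by rw [hd]; abel
  have est (a b : E) (ha : ‖a‖ ≤ 1) (hb : ‖b‖ ≤ 1 / 8) :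
      ‖star (a + b) * (a + b) - star a * a‖ ≤ 1 / 2 := by
    rw [show star (a + b) * (a + b) - star a * a = star a * b + star b * a + star b * b by
      rw [star_add]; noncomm_ring]
    have a1 := norm_mul_le (star a) b
    have a2 := norm_mul_le (star b) a
    have a3 := norm_mul_le (star b) b
    have a5 := norm_add_le (star a * b + star b * a) (star b * b)
    have a6 := norm_add_le (star a * b) (star b * a)
    rw [norm_star] at a1 a2 a3
    nlinarith [norm_nonneg a, norm_nonneg b]
  have h1 : ‖ι m (star z * z - p')‖ ≤ 1 / 2 := by
    rw [map_sub, map_mul, map_star, hιz, hp', H.ι_κ, ← hv1]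
    exact est v d hvn hdn
  have h2 : ‖ι m (z * star z - q')‖ ≤ 1 / 2 := by
    rw [map_sub, map_mul, map_star, hιz, hq', H.ι_κ, ← hv2]
    have := est (star v) (star d) (by rwa [norm_star]) (by rwa [norm_star])
    rwa [star_star, ← star_add, star_star] at this
  -- Indexing the two defects by `Bool` makes both small at the same stage.
  obtain ⟨k, hk, hk'⟩ := H.exists_forall_ker (S := Bool) m
    (fun b => if b then star z * z - p' else z * star z - q') (c := 1 / 2) (ε := 1 / 2)
    (by rintro (_ | _); exacts [h2, h1]) (by norm_num)
  have h3 := hk' true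
  have h4 := hk' false
  simp only [if_true, Bool.false_eq_true, if_false, map_sub, map_mul, map_star, add_halves]
    at h3 h4
  refine ⟨k, hjm.trans hk, ?_⟩
  have h5 := pEquiv_of_norm_lt (hpp.map (κ m k hk)) (hqq.map (κ m k hk)) (z := κ m k hk z)
    (by rw [← map_mul, hzp]) (by rw [← map_mul, hqz]) h3 h4
  rwa [hp', hq', H.κ_κ, H.κ_κ] at h5

end Unital

variable {C : ℕ → Type*} [∀ j, NonUnitalCStarAlgebra (C j)] {D : Type*} [NonUnitalCStarAlgebra D]
  {κ : ∀ j k, j ≤ k → C j →⋆ₙₐ[ℂ] C k} {ι : ∀ j, C j →⋆ₙₐ[ℂ] D}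

/-- The conclusion is for all later stages, so that two projections can be lifted to a common one.
-/
theorem exists_proj_mvN (H : IsIndLim κ ι) (P : Proj (Unitization ℂ D)) :
    ∃ j, ∀ k, j ≤ k → ∃ p : Proj (Unitization ℂ (C k)),
      MvN (p.mat.map (uMap (ι k))) P.mat := by
  obtain ⟨j, p, hp, h⟩ := (H.unitization.mat (Fin P.size)).exists_isStarProjection
    (P := CMat.ofM _ _ P.mat) (CMat.isStarProjection_ofM P.isProj)
  refine ⟨j, fun k hk => ⟨⟨P.size, CMat.toM _ _ (CMat.mapHom _ (uMap (κ j k hk)) p),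
    CMat.isStarProjection_toM (hp.map _)⟩, ?_⟩⟩
  refine CMat.mvN_of_pEquiv (pEquiv_of_norm_sub_lt
    (CMat.isStarProjection_ofM (isStarProjection_map
      (CMat.isStarProjection_toM (hp.map _)) _)) (CMat.isStarProjection_ofM P.isProj) ?_)
  rw [← (H.unitization.mat (Fin P.size)).ι_κ j k hk] at h
  exact h

theorem K0_map_coe {A B : Type*} [NonUnitalCStarAlgebra A] [NonUnitalCStarAlgebra B]
    (φ : A →⋆ₙₐ[ℂ] B) (x : K0 A) : (K0.map φ x).1 = K00.map (uMap φ) x.1 := rfl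

theorem scalarPart_map_uMap {A B : Type*} [NonUnitalCStarAlgebra A] [NonUnitalCStarAlgebra B]
    (φ : A →⋆ₙₐ[ℂ] B) (x : K00 (Unitization ℂ A)) :
    K00.map (scalarPart B) (K00.map (uMap φ) x) = K00.map (scalarPart A) x :=
  K00.map_map _ _ _ (fun x => uMap_fst φ x) x

/-- Every element of `K₀` of an inductive limit comes from a member of the sequence. -/
theorem exists_K0_map_eq (H : IsIndLim κ ι) (x : K0 D) : ∃ j, ∃ y : K0 (C j), K0.map (ι j) y = x := by
  obtain ⟨P, Q, hPQ⟩ := K00.exists_sub x.1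
  obtain ⟨j, hj⟩ := H.exists_proj_mvN P
  obtain ⟨k, hk⟩ := H.exists_proj_mvN Q
  obtain ⟨p, hp⟩ := hj (max j k) (le_max_left _ _)
  obtain ⟨q, hq⟩ := hk (max j k) (le_max_right _ _)
  have h1 : K00.map (uMap (ι (max j k))) (K00.of p - K00.of q) = x.1 := by
    rw [map_sub, hPQ, K00.map_of, K00.map_of]
    exact congrArg₂ _ (K00.of_eq_of_mvN hp) (K00.of_eq_of_mvN hq)
  refine ⟨max j k, ⟨K00.of p - K00.of q, ?_⟩, Subtype.ext h1⟩
  rw [AddMonoidHom.mem_ker, ← scalarPart_map_uMap (ι (max j k)), h1]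
  exact x.2

/-- The two projections may have different sizes. Padding both with zeros to size `S ⊕ T` puts the
equivalence inside a single C⋆-algebra, where `exists_pEquiv` applies, and does not change the
classes. -/
theorem exists_mvN (H : IsIndLim κ ι) {j : ℕ} {S T : Type} [Fintype S] [Fintype T]
    {p : Matrix S S (Unitization ℂ (C j))} {q : Matrix T T (Unitization ℂ (C j))}
    (hp : IsStarProjection p) (hq : IsStarProjection q)
    (h : MvN (p.map (uMap (ι j))) (q.map (uMap (ι j)))) : ∃ k h,
      K00.map (uMap (κ j k h)) (K00.cls p hp) = K00.map (uMap (κ j k h)) (K00.cls q hq) := by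
  classical
  have hp' := isStarProjection_fromBlocks hp (q := (0 : Matrix T T _)) (.zero _)
  have hq' := isStarProjection_fromBlocks (p := (0 : Matrix S S _)) (.zero _) hq
  have e1 : K00.cls _ hp' = K00.cls p hp := by
    rw [K00.cls_fromBlocks hp (.zero _), K00.cls_zero, add_zero]
  have e2 : K00.cls _ hq' = K00.cls q hq := by
    rw [K00.cls_fromBlocks (.zero _) hq, K00.cls_zero, zero_add]
  obtain ⟨v, hv1, hv2⟩ := h
  obtain ⟨k, hk, hk'⟩ := (H.unitization.mat (S ⊕ T)).exists_pEquiv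
    (CMat.isStarProjection_ofM hp') (CMat.isStarProjection_ofM hq') <| by
      refine ⟨CMat.ofM _ _ (Matrix.fromBlocks 0 0 v 0), ?_, ?_⟩
      · have e : Matrix.map (Matrix.fromBlocks p 0 0 (0 : Matrix T T _)) (uMap (ι j)) =
            Matrix.fromBlocks (vᴴ * v) 0 0 0 := by
          rw [hv1, Matrix.fromBlocks_map]
          simp
        refine Eq.trans ?_ (congrArg (CMat.ofM _ _) e.symm)
        rw [← map_star, ← map_mul, Matrix.star_eq_conjTranspose, Matrix.fromBlocks_conjTranspose,
          Matrix.fromBlocks_multiply]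
        simp
      · have e : Matrix.map (Matrix.fromBlocks (0 : Matrix S S _) 0 0 q) (uMap (ι j)) =
            Matrix.fromBlocks 0 0 0 (v * vᴴ) := by
          rw [hv2, Matrix.fromBlocks_map]
          simp
        refine Eq.trans ?_ (congrArg (CMat.ofM _ _) e.symm)
        rw [← map_star, ← map_mul, Matrix.star_eq_conjTranspose, Matrix.fromBlocks_conjTranspose,
          Matrix.fromBlocks_multiply]
        simp
  refine ⟨k, hk, ?_⟩
  rw [← e1, ← e2, K00.map_cls, K00.map_cls]
  exact K00.cls_congr (CMat.mvN_of_pEquiv hk')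

/-- An element of `K₀` of a member of the sequence that vanishes in the limit vanishes at a later
stage. -/
theorem exists_K0_map_eq_zero (H : IsIndLim κ ι) {j : ℕ} (y : K0 (C j)) (hy : K0.map (ι j) y = 0) :
    ∃ k h, K0.map (κ j k h) y = 0 := by
  obtain ⟨P, Q, hPQ⟩ := K00.exists_sub y.1
  have h1 : K00.map (uMap (ι j)) (K00.of P) = K00.map (uMap (ι j)) (K00.of Q) := by
    rw [← sub_eq_zero, ← map_sub, ← hPQ]
    exact congrArg Subtype.val hy
  rw [K00.map_of, K00.map_of] at h1
  obtain ⟨R, hR⟩ := K00.exists_of_eq h1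
  -- The common summand `R` lives over the limit. It is replaced by an equivalent projection that
  -- comes from a finite stage.
  obtain ⟨i, hi⟩ := H.exists_proj_mvN R
  set m := max i j with hm
  have hjm : j ≤ m := le_max_right _ _
  obtain ⟨r, hr⟩ := hi m (le_max_left _ _)
  have key (S : Proj (Unitization ℂ (C j))) :
      MvN ((Matrix.fromBlocks (S.mat.map (uMap (κ j m hjm))) 0 0 r.mat).map (uMap (ι m)))
        (Proj.dsum ⟨S.size, _, isStarProjection_map S.isProj (uMap (ι j))⟩ R).mat := by
    refine MvN.trans ?_ (Proj.isProj _) ?_ (Proj.mvN_dsum _ _)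
    · exact isStarProjection_map (isStarProjection_fromBlocks
        (isStarProjection_map S.isProj _) r.isProj) _
    · rw [Matrix.fromBlocks_map, Matrix.map_zero _ (map_zero _), Matrix.map_zero _ (map_zero _)]
      refine MvN.fromBlocks ?_ hr
      have e : (S.mat.map (uMap (κ j m hjm))).map (uMap (ι m)) = S.mat.map (uMap (ι j)) := by
        ext1 a b
        exact H.unitization.ι_κ j m hjm _
      rw [e]
      exact (⟨S.size, _, isStarProjection_map S.isProj (uMap (ι j))⟩ : Proj _).mvN_refl
  have hS (S : Proj (Unitization ℂ (C j))) :=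
    isStarProjection_fromBlocks (isStarProjection_map S.isProj (uMap (κ j m hjm))) r.isProj
  obtain ⟨k, hk, hk'⟩ := H.exists_mvN (hS P) (hS Q) <|
    ((key P).trans (isStarProjection_map (hS P) _) (Proj.isProj _) hR).trans
      (isStarProjection_map (hS P) _) (isStarProjection_map (hS Q) _) (key Q).symm
  refine ⟨k, hjm.trans hk, Subtype.ext ?_⟩
  rw [K00.cls_fromBlocks (isStarProjection_map P.isProj _) r.isProj,
    K00.cls_fromBlocks (isStarProjection_map Q.isProj _) r.isProj, map_add, map_add,
    add_left_inj] at hk'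
  have e (S : Proj (Unitization ℂ (C j))) :
      K00.map (uMap (κ j k (hjm.trans hk))) (K00.of S) =
        K00.map (uMap (κ m k hk)) (K00.cls _ (isStarProjection_map S.isProj (uMap (κ j m hjm)))) := by
    rw [← K00.map_cls _ _ S.isProj, ← K00.of_eq_cls]
    exact (K00.map_map _ _ _ (fun x => H.unitization.κ_κ j m k hjm hk x) _).symm
  rw [K0_map_coe, hPQ, map_sub, e, e, hk', sub_self]
  rfl

end IsIndLim

end KTheory

end

open scoped TensorProduct ZeroAtInfty Matrix

noncomputable section

namespace KTheory

/-! ### Functors that act on homomorphisms into matrix algebras -/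

/-- A homotopy invariant and continuous functor on C⋆-algebras which acts on homomorphisms into
matrix algebras `B → M_κ(B')`, compatibly with composition and direct sums. -/
structure MatFunctor where
  obj : (B : Type v) → [NonUnitalCStarAlgebra B] → Type u
  inst : (B : Type v) → [NonUnitalCStarAlgebra B] → NonUnitalCStarAlgebra (obj B)
  map : ∀ {B B' : Type v} [NonUnitalCStarAlgebra B] [NonUnitalCStarAlgebra B'] {κ : Type}
    [Fintype κ], (B →⋆ₙₐ[ℂ] Matrix κ κ B') → (obj B →⋆ₙₐ[ℂ] Matrix κ κ (obj B'))
  map_id : ∀ {B : Type v} [NonUnitalCStarAlgebra B],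
    map (toMat (NonUnitalStarAlgHom.id ℂ B)) = toMat (NonUnitalStarAlgHom.id ℂ (obj B))
  map_comp : ∀ {B B' B'' : Type v} [NonUnitalCStarAlgebra B] [NonUnitalCStarAlgebra B']
    [NonUnitalCStarAlgebra B''] {κ μ : Type} [Fintype κ] [Fintype μ]
    (φ : B →⋆ₙₐ[ℂ] Matrix κ κ B') (ψ : B' →⋆ₙₐ[ℂ] Matrix μ μ B''),
    map (compHom φ ψ) = compHom (map φ) (map ψ)
  map_sum : ∀ {B B' : Type v} [NonUnitalCStarAlgebra B] [NonUnitalCStarAlgebra B'] {κ μ : Type}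
    [Fintype κ] [Fintype μ] (φ : B →⋆ₙₐ[ℂ] Matrix κ κ B') (ψ : B →⋆ₙₐ[ℂ] Matrix μ μ B'),
    map (sumHom φ ψ) = sumHom (map φ) (map ψ)
  map_reindex : ∀ {B B' : Type v} [NonUnitalCStarAlgebra B] [NonUnitalCStarAlgebra B']
    {κ μ : Type} [Fintype κ] [Fintype μ] (e : κ ≃ μ) (φ : B →⋆ₙₐ[ℂ] Matrix κ κ B'),
    map (reindexHom e φ) = reindexHom e (map φ)
  map_zero : ∀ {B B' : Type v} [NonUnitalCStarAlgebra B] [NonUnitalCStarAlgebra B'] {κ : Type}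
    [Fintype κ], map (0 : B →⋆ₙₐ[ℂ] Matrix κ κ B') = 0
  continuous_map : ∀ {B B' : Type v} [NonUnitalCStarAlgebra B] [NonUnitalCStarAlgebra B']
    {κ : Type} [Fintype κ] {X : Type} [TopologicalSpace X] (φ : X → B →⋆ₙₐ[ℂ] Matrix κ κ B'),
    (∀ b i j, Continuous fun x => φ x b i j) → ∀ c i j, Continuous fun x => map (φ x) c i j
  isIndLim : ∀ {C : ℕ → Type v} [∀ j, NonUnitalCStarAlgebra (C j)] {D : Type v}
    [NonUnitalCStarAlgebra D] {κ : ∀ j k, j ≤ k → C j →⋆ₙₐ[ℂ] C k} {ι : ∀ j, C j →⋆ₙₐ[ℂ] D},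
    IsIndLim κ ι → (∀ j, Function.Injective (ι j)) →
      IsIndLim (fun j k h => ofMat (map (toMat (κ j k h)))) (fun j => ofMat (map (toMat (ι j))))

attribute [instance] MatFunctor.inst

/-- The identity functor. -/
def MatFunctor.id : MatFunctor.{v, v} where
  obj B _ := B
  inst _ _ := inferInstance
  map φ := φ
  map_id := rfl
  map_comp _ _ := rfl
  map_sum _ _ := rfl
  map_reindex _ _ := rfl
  map_zero := rfl
  continuous_map _ h := h
  isIndLim H _ := H

/-! ### Suspensions -/

namespace Susp

variable {A B : Type*} [NonUnitalCStarAlgebra A] [NonUnitalCStarAlgebra B]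

theorem norm_le (f : Susp A) {c : ℝ} (hc : 0 ≤ c) : ‖f‖ ≤ c ↔ ∀ t, ‖f t‖ ≤ c := by
  have h : ‖(show C₀(ℝ, A) from f).toBCF‖ = ‖f‖ := ZeroAtInftyContinuousMap.norm_toBCF_eq_norm
  rw [← h, BoundedContinuousFunction.norm_le hc]
  rfl

theorem continuous_apply (f : Susp A) : Continuous f := map_continuous (show C₀(ℝ, A) from f)

/-- The entry `b ↦ φ b i j` of a homomorphism into a matrix algebra as a bounded linear map. -/
def entry {κ : Type*} [Fintype κ] (φ : A →⋆ₙₐ[ℂ] Matrix κ κ B) (i j : κ) : A →L[ℂ] B :=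
  LinearMap.mkContinuous
    { toFun a := φ a i j
      map_add' a b := by rw [map_add]; rfl
      map_smul' c a := by rw [map_smul]; rfl } 1 fun a => by
    rw [one_mul]
    let ψ : A →⋆ₙₐ[ℂ] CMat κ B :=
      { toFun a := CMat.ofM κ B (φ a)
        map_smul' c a := by rw [map_smul]; rfl
        map_zero' := by rw [map_zero]; rfl
        map_add' a b := by rw [map_add]; rfl
        map_mul' a b := by rw [map_mul]; rfl
        map_star' a := by rw [map_star]; rfl }
    exact (CMat.norm_entry_le (ψ a) i j).trans (NonUnitalStarAlgHom.norm_apply_le ψ a)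

/-- The suspension of a homomorphism into a matrix algebra. -/
def mapHom {κ : Type*} [Fintype κ] (φ : A →⋆ₙₐ[ℂ] Matrix κ κ B) :
    Susp A →⋆ₙₐ[ℂ] Matrix κ κ (Susp B) where
  toFun f := Matrix.of fun i j => Susp.comp (entry φ i j) f
  map_smul' c f := Matrix.ext fun i j => Susp.ext fun t => map_smul (entry φ i j) c (f t)
  map_zero' := Matrix.ext fun i j => Susp.ext fun _ => map_zero (entry φ i j)
  map_add' f g := Matrix.ext fun i j => Susp.ext fun t => map_add (entry φ i j) (f t) (g t)
  map_mul' f g := Matrix.ext fun i j => Susp.ext fun t => by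
    refine (congrFun₂ (map_mul φ (f t) (g t)) i j).trans ?_
    rw [Matrix.mul_apply, Matrix.mul_apply, Susp.sum_apply]
    rfl
  map_star' f := Matrix.ext fun i j => Susp.ext fun t => congrFun₂ (map_star φ (f t)) i j

theorem mapHom_apply {κ : Type*} [Fintype κ] (φ : A →⋆ₙₐ[ℂ] Matrix κ κ B) (f : Susp A) (i j : κ)
    (t : ℝ) : mapHom φ f i j t = φ (f t) i j := rfl

theorem exists_norm_lt (f : Susp A) {ε : ℝ} (hε : 0 < ε) : ∃ R : ℝ, ∀ t, R < |t| → ‖f t‖ < ε := by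
  have h := zero_at_infty (show C₀(ℝ, A) from f)
  have h1 := (tendsto_zero_iff_norm_tendsto_zero.1 h).eventually (gt_mem_nhds hε)
  rw [← Metric.cobounded_eq_cocompact, (Metric.hasBasis_cobounded_compl_closedBall 0).eventually_iff]
    at h1
  obtain ⟨R, -, hR⟩ := h1
  exact ⟨R, fun t ht => hR (by simpa using ht)⟩

/-- The cut-off of a continuous function on the line. -/
def cutoff (g : C(ℝ, A)) (R : ℝ) : Susp A where
  toFun t := (max 0 (min 1 (R + 1 - |t|)) : ℝ) • g t
  continuous_toFun := by fun_prop
  zero_at_infty' := by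
    refine tendsto_const_nhds.congr' ?_
    rw [← Metric.cobounded_eq_cocompact, Filter.EventuallyEq,
      (Metric.hasBasis_cobounded_compl_closedBall 0).eventually_iff]
    refine ⟨R + 1, trivial, fun t ht => ?_⟩
    have h : R + 1 < |t| := by simpa using ht
    rw [min_eq_right (by linarith), max_eq_left (by linarith), zero_smul]

end Susp

/-! ### Suspensions of inductive limits -/

section Compact

variable {C : ℕ → Type*} [∀ j, NonUnitalCStarAlgebra (C j)] {D : Type*} [NonUnitalCStarAlgebra D]
  {κ : ∀ j k, j ≤ k → C j →⋆ₙₐ[ℂ] C k} {ι : ∀ j, C j →⋆ₙₐ[ℂ] D}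

theorem IsIndLim.exists_forall_compact (H : IsIndLim κ ι) {K : Set D} (hK : IsCompact K) {ε : ℝ}
    (hε : 0 < ε) : ∃ j, ∀ k, j ≤ k → ∀ d ∈ K, ∃ c : C k, ‖ι k c - d‖ < ε := by
  obtain ⟨s, -, hs, hsK⟩ := hK.finite_cover_balls (half_pos hε)
  have := hs.to_subtype
  obtain ⟨j, hj⟩ := H.exists_forall (fun d : s => (d : D)) (half_pos hε)
  refine ⟨j, fun k hk d hd => ?_⟩
  obtain ⟨x, hx, hdx⟩ := Set.mem_iUnion₂.1 (hsK hd)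
  obtain ⟨c, hc⟩ := hj k hk ⟨x, hx⟩
  rw [Metric.mem_ball, dist_comm, dist_eq_norm] at hdx
  refine ⟨c, ?_⟩
  calc ‖ι k c - d‖ = ‖(ι k c - x) + (x - d)‖ := by rw [sub_add_sub_cancel]
    _ ≤ ‖ι k c - x‖ + ‖x - d‖ := norm_add_le _ _
    _ < ε / 2 + ε / 2 := add_lt_add hc hdx
    _ = ε := add_halves ε

theorem IsIndLim.exists_ker_compact (H : IsIndLim κ ι) {j : ℕ} {K : Set (C j)} (hK : IsCompact K)
    (h0 : ∀ x ∈ K, ι j x = 0) {ε : ℝ} (hε : 0 < ε) : ∃ k h, ∀ x ∈ K, ‖κ j k h x‖ < ε := by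
  obtain ⟨s, hs', hs, hsK⟩ := hK.finite_cover_balls (half_pos hε)
  have := hs.to_subtype
  obtain ⟨k, h, hk⟩ := H.exists_forall_ker j (fun d : s => (d : C j)) (c := 0)
    (fun x => by rw [h0 x (hs' x.2), norm_zero]) (half_pos hε)
  refine ⟨k, h, fun d hd => ?_⟩
  obtain ⟨x, hx, hdx⟩ := Set.mem_iUnion₂.1 (hsK hd)
  rw [Metric.mem_ball, dist_eq_norm] at hdx
  calc ‖κ j k h d‖ = ‖κ j k h (d - x) + κ j k h x‖ := by rw [← map_add, sub_add_cancel]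
    _ ≤ ‖κ j k h (d - x)‖ + ‖κ j k h x‖ := norm_add_le _ _
    _ < ε / 2 + (0 + ε / 2) :=
      add_lt_add ((IsIndLim.norm_κ_le κ j k h _).trans_lt hdx) (hk ⟨x, hx⟩)
    _ = ε := by ring

theorem convex_setOf_norm_lt {A B : Type*} [NonUnitalCStarAlgebra A] [NonUnitalCStarAlgebra B]
    (φ : A →⋆ₙₐ[ℂ] B) (b : B) (ε : ℝ) : Convex ℝ {a | ‖φ a - b‖ < ε} := by
  have h : {a | ‖φ a - b‖ < ε} =
      ((φ : A →ₗ[ℂ] B).restrictScalars ℝ) ⁻¹' Metric.ball b ε := by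
    ext a
    simp [dist_eq_norm]
  rw [h]
  exact (convex_ball b ε).linear_preimage _

/-- Continuous selection of approximants. -/
theorem exists_continuous_approx {X A B : Type*} [TopologicalSpace X] [NormalSpace X]
    [ParacompactSpace X] [NonUnitalCStarAlgebra A] [NonUnitalCStarAlgebra B] (φ : A →⋆ₙₐ[ℂ] B)
    (f : C(X, B)) (t : X → Set A) (ht : ∀ x, Convex ℝ (t x)) {ε : ℝ}
    (h : ∀ x, ∃ a, ‖φ a - f x‖ < ε ∧ ∀ᶠ y in nhds x, a ∈ t y) :
    ∃ g : C(X, A), ∀ x, ‖φ (g x) - f x‖ < ε ∧ g x ∈ t x := by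
  -- The admissible values form a convex set at each point and a constant works locally, so local
  -- choices are glued by a partition of unity.
  refine exists_continuous_forall_mem_convex_of_local_const
    (t := fun x => {a | ‖φ a - f x‖ < ε} ∩ t x)
    (fun x => (convex_setOf_norm_lt φ (f x) ε).inter (ht x)) fun x => ?_
  obtain ⟨a, ha, ha'⟩ := h x
  refine ⟨a, Filter.Eventually.and ?_ ha'⟩
  exact (continuous_const.sub f.continuous).norm.continuousAt.eventually (gt_mem_nhds ha)

/-- Functions vanishing at infinity are small off an interval [-R, R], and the image of this
interval is compact, so one stage serves all points. Approximants are selected continuously on the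
whole line and then cut off. -/
theorem IsIndLim.susp (H : IsIndLim κ ι) :
    IsIndLim (fun j k h => ofMat (Susp.mapHom (toMat (κ j k h))))
      (fun j => ofMat (Susp.mapHom (toMat (ι j)))) where
  ι_κ j k h f := Susp.ext fun t => H.ι_κ j k h (f t)
  κ_κ i j k h h' f := Susp.ext fun t => H.κ_κ i j k h h' (f t)
  dense f ε hε := by
    obtain ⟨R, hR⟩ := f.exists_norm_lt (ε := ε / 3) (by positivity)
    obtain ⟨j, hj⟩ := H.exists_forall_compact
      ((isCompact_closedBall (0 : ℝ) R).image f.continuous_apply) (ε := ε / 3) (by positivity)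
    obtain ⟨g, hg⟩ := exists_continuous_approx (ι j) ⟨f, f.continuous_apply⟩
      (fun _ => Set.univ) (fun _ => convex_univ) (ε := ε / 3) fun t => by
        by_cases ht : |t| ≤ R
        · obtain ⟨c, hc⟩ := hj j le_rfl (f t) ⟨t, by simpa using ht, rfl⟩
          exact ⟨c, hc, by simp⟩
        · exact ⟨0, by simpa using hR t (not_le.1 ht), by simp⟩
    refine ⟨j, Susp.cutoff g R, lt_of_le_of_lt ((Susp.norm_le _ (c := 2 * ε / 3)
      (by positivity)).2 fun t => ?_) (by linarith)⟩
    set χ : ℝ := max 0 (min 1 (R + 1 - |t|)) with hχ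
    have h1 : χ ≤ 1 := max_le zero_le_one (min_le_left _ _)
    have h0 : 0 ≤ χ := le_max_left _ _
    -- The first term is the error of the selection. The second lives only where |t| > R, where `f`
    -- itself is small.
    have e : ι j (χ • g t) - f t = χ • (ι j (g t) - f t) - (1 - χ) • f t := by
      have : ι j (χ • g t) = χ • ι j (g t) := by
        rw [← Complex.coe_smul, map_smul, Complex.coe_smul]
      rw [this]
      module
    change ‖ι j (χ • g t) - f t‖ ≤ _
    rw [e]
    refine (norm_sub_le _ _).trans ?_
    rw [norm_smul, norm_smul, Real.norm_of_nonneg h0, Real.norm_of_nonneg (by linarith)]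
    have h2 : χ * ‖ι j (g t) - f t‖ ≤ ε / 3 := by
      have := (hg t).1.le
      exact (mul_le_of_le_one_left (norm_nonneg _) h1).trans this
    have h3 : (1 - χ) * ‖f t‖ ≤ ε / 3 := by
      by_cases ht : |t| ≤ R
      · have : χ = 1 := by
          rw [hχ, min_eq_left (by linarith), max_eq_right zero_le_one]
        rw [this, sub_self, zero_mul]
        positivity
      · exact (mul_le_of_le_one_left (norm_nonneg _) (by linarith)).trans (hR t (not_le.1 ht)).le
    linarith
  ker j f hf ε hε := by
    obtain ⟨R, hR⟩ := f.exists_norm_lt (ε := ε / 2) (by positivity)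
    obtain ⟨k, h, hk⟩ := H.exists_ker_compact
      ((isCompact_closedBall (0 : ℝ) R).image f.continuous_apply) (by
        rintro _ ⟨t, -, rfl⟩
        exact DFunLike.congr_fun hf t) (half_pos hε)
    refine ⟨k, h, lt_of_le_of_lt ((Susp.norm_le _ (c := ε / 2) (by positivity)).2 fun t => ?_)
      (half_lt_self hε)⟩
    by_cases ht : |t| ≤ R
    · exact (hk (f t) ⟨t, by simpa using ht, rfl⟩).le
    · exact (IsIndLim.norm_κ_le κ j k h _).trans (hR t (not_le.1 ht)).le

end Compact

/-- Pointwise continuity in the parameter becomes uniform in t, because the values of `f` lie up to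
a small error in a compact set and the entries of the homomorphisms are contractive. -/
theorem Susp.continuous_mapHom {A B : Type*} [NonUnitalCStarAlgebra A] [NonUnitalCStarAlgebra B]
    {κ : Type*} [Fintype κ] {X : Type*} [TopologicalSpace X] (φ : X → A →⋆ₙₐ[ℂ] Matrix κ κ B)
    (hφ : ∀ b i j, Continuous fun x => φ x b i j) (f : Susp A) (i j : κ) :
    Continuous fun x => Susp.mapHom (φ x) f i j := by
  refine continuous_iff_continuousAt.2 fun x => Metric.tendsto_nhds.2 fun ε hε => ?_
  have hle (y : X) (a : A) : ‖φ y a i j‖ ≤ ‖a‖ :=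
    (ContinuousLinearMap.le_of_opNorm_le _ (LinearMap.mkContinuous_norm_le _ zero_le_one _)
      a : ‖Susp.entry (φ y) i j a‖ ≤ 1 * ‖a‖).trans_eq (one_mul _)
  obtain ⟨R, hR⟩ := f.exists_norm_lt (ε := ε / 4) (by positivity)
  obtain ⟨s, -, hs, hsK⟩ := ((isCompact_closedBall (0 : ℝ) R).image
    f.continuous_apply).finite_cover_balls (e := ε / 6) (by positivity)
  have h1 : ∀ᶠ y in nhds x, ∀ a ∈ s, ‖φ y a i j - φ x a i j‖ < ε / 6 := by
    rw [Filter.eventually_all_finite hs]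
    intro a _
    have := (hφ a i j).tendsto x
    rw [tendsto_iff_norm_sub_tendsto_zero] at this
    exact this.eventually (gt_mem_nhds (by positivity))
  filter_upwards [h1] with y hy
  rw [dist_eq_norm]
  refine lt_of_le_of_lt ((Susp.norm_le _ (c := ε / 2) (by positivity)).2 fun t => ?_)
    (half_lt_self hε)
  change ‖φ y (f t) i j - φ x (f t) i j‖ ≤ ε / 2
  by_cases ht : |t| ≤ R
  · obtain ⟨a, ha, hat⟩ := Set.mem_iUnion₂.1 (hsK ⟨t, by simpa using ht, rfl⟩)
    rw [Metric.mem_ball, dist_eq_norm] at hat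
    have e (z : X) : φ z (f t) i j = φ z (f t - a) i j + φ z a i j := by
      rw [map_sub, Matrix.sub_apply, sub_add_cancel]
    rw [e x, e y]
    have h2 := norm_sub_le (φ y (f t - a) i j) (φ x (f t - a) i j)
    have h3 := norm_add_le (φ y (f t - a) i j - φ x (f t - a) i j) (φ y a i j - φ x a i j)
    have h4 := hle y (f t - a)
    have h5 := hle x (f t - a)
    have h6 := hy a ha
    rw [show φ y (f t - a) i j + φ y a i j - (φ x (f t - a) i j + φ x a i j) =
      φ y (f t - a) i j - φ x (f t - a) i j + (φ y a i j - φ x a i j) by abel]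
    linarith
  · have h2 := norm_sub_le (φ y (f t) i j) (φ x (f t) i j)
    have h3 := hR t (not_le.1 ht)
    have h4 := hle y (f t)
    have h5 := hle x (f t)
    linarith

/-- The suspension of a functor. -/
def MatFunctor.susp (F : MatFunctor.{u, v}) : MatFunctor.{u, v} where
  obj B _ := Susp (F.obj B)
  inst _ _ := inferInstance
  map φ := Susp.mapHom (F.map φ)
  map_id := by
    intros
    refine matHom_ext fun f i j => Susp.ext fun t => ?_
    rw [Susp.mapHom_apply, F.map_id]
    rfl
  map_comp φ ψ := by
    refine matHom_ext fun f i j => Susp.ext fun t => ?_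
    rw [Susp.mapHom_apply, F.map_comp]
    rfl
  map_sum φ ψ := by
    refine matHom_ext fun f i j => Susp.ext fun t => ?_
    rw [Susp.mapHom_apply, F.map_sum]
    rcases i with i | i <;> rcases j with j | j <;> rfl
  map_reindex e φ := by
    refine matHom_ext fun f i j => Susp.ext fun t => ?_
    rw [Susp.mapHom_apply, F.map_reindex]
    rfl
  map_zero := by
    intros
    refine matHom_ext fun f i j => Susp.ext fun t => ?_
    rw [Susp.mapHom_apply, F.map_zero]
    rfl
  continuous_map φ h := Susp.continuous_mapHom _ (F.continuous_map φ h)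
  isIndLim H hι := by
    have h := (F.isIndLim H hι).susp
    simp only [toMat_ofMat] at h
    exact h

end KTheory

end

open scoped TensorProduct ZeroAtInfty Matrix

noncomputable section

namespace CStarTensor

open KTheory
open scoped ENNReal

variable {A B D : Type*} [NonUnitalCStarAlgebra A] [NonUnitalCStarAlgebra B]
  [NonUnitalCStarAlgebra D]

/-! ### Homomorphisms defined on tensor products -/

/-- A bilinear map `A × B → D` that is multiplicative and self-adjoint defines a homomorphism on
the algebraic tensor product. -/
def algLift (β : A →ₗ[ℂ] B →ₗ[ℂ] D) (hmul : ∀ a a' b b', β (a * a') (b * b') = β a b * β a' b')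
    (hstar : ∀ a b, β (star a) (star b) = star (β a b)) : A ⊗[ℂ] B →⋆ₙₐ[ℂ] D where
  toFun := TensorProduct.lift β
  map_smul' c x := map_smul (TensorProduct.lift β) c x
  map_zero' := map_zero (TensorProduct.lift β)
  map_add' := map_add (TensorProduct.lift β)
  map_mul' x y := by
    induction x with
    | zero => simp
    | add x x' hx hx' => rw [add_mul, map_add, map_add, add_mul, hx, hx']
    | tmul a b =>
      induction y with
      | zero => simp
      | add y y' hy hy' => rw [mul_add, map_add, map_add, mul_add, hy, hy']
      | tmul a' b' => simp [hmul]
  map_star' x := by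
    induction x with
    | zero => simp
    | add x x' hx hx' => rw [star_add, map_add, map_add, star_add, hx, hx']
    | tmul a b => simp [hstar]

theorem algLift_tmul (β : A →ₗ[ℂ] B →ₗ[ℂ] D) (hmul) (hstar) (a : A) (b : B) :
    algLift β hmul hstar (a ⊗ₜ b) = β a b := TensorProduct.lift.tmul a b

/-- A homomorphism on the algebraic tensor product is contractive on elementary tensors as soon
as it is bounded on elementary tensors. -/
theorem norm_apply_tmul_le (f : A ⊗[ℂ] B →⋆ₙₐ[ℂ] D) {C : ℝ}
    (hC : ∀ a b, ‖f (a ⊗ₜ b)‖ ≤ C * (‖a‖ * ‖b‖)) (a : A) (b : B) :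
    ‖f (a ⊗ₜ b)‖ ≤ ‖a‖ * ‖b‖ := by
  -- Replacing a and b by a*a and b*b squares both norms by the C⋆-identity, while the constant `C`
  -- stays the same.
  have key : ∀ (n : ℕ) (a : A) (b : B), ‖f (a ⊗ₜ b)‖ ^ 2 ^ n ≤ C * (‖a‖ * ‖b‖) ^ 2 ^ n := by
    intro n
    induction n with
    | zero => simpa using hC
    | succ n ih =>
      intro a b
      have h := ih (star a * a) (star b * b)
      rw [← Algebra.TensorProduct.tmul_mul_tmul, ← TensorProduct.star_tmul, map_mul, map_star,
        CStarRing.norm_star_mul_self, CStarRing.norm_star_mul_self, CStarRing.norm_star_mul_self]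
        at h
      rw [pow_succ' 2, pow_mul, pow_mul, sq, sq]
      refine h.trans_eq ?_
      ring
  by_contra! hlt
  have h0 : 0 < ‖f (a ⊗ₜ b)‖ := (by positivity : (0 : ℝ) ≤ ‖a‖ * ‖b‖).trans_lt hlt
  rcases (by positivity : (0 : ℝ) ≤ ‖a‖ * ‖b‖).eq_or_lt with h1 | h1
  · have := hC a b
    rw [← h1, mul_zero] at this
    exact this.not_gt h0
  · obtain ⟨n, hn⟩ := pow_unbounded_of_one_lt C ((one_lt_div h1).2 hlt)
    have h2 := key n a b
    rw [← div_le_iff₀ (by positivity), ← div_pow] at h2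
    exact (hn.trans_le (pow_le_pow_right₀ ((one_lt_div h1).2 hlt).le Nat.lt_two_pow_self.le)).not_ge
      h2

theorem lift_tmul (f : A ⊗[ℂ] B →⋆ₙₐ[ℂ] D) (hf : ∀ a b, ‖f (a ⊗ₜ b)‖ ≤ ‖a‖ * ‖b‖) (a : A) (b : B) :
    lift f hf (tmul a b) = f (a ⊗ₜ b) := liftL_ofAlg f hf _

theorem induction_tmul {P : CStarTensor A B → Prop} (hc : IsClosed {x | P x})
    (hadd : ∀ x y, P x → P y → P (x + y)) (h : ∀ a b, P (tmul a b)) (x : CStarTensor A B) : P x := by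
  refine induction hc (fun x => ?_) x
  induction x with
  | zero => simpa [tmul] using h 0 0
  | add x y hx hy => rw [map_add]; exact hadd _ _ hx hy
  | tmul a b => exact h a b

theorem hom_ext {f g : CStarTensor A B →⋆ₙₐ[ℂ] D} (h : ∀ a b, f (tmul a b) = g (tmul a b)) :
    f = g := by
  refine DFunLike.ext _ _ fun x => ?_
  refine induction_tmul (isClosed_eq (continuous_hom f) (continuous_hom g))
    (fun x y hx hy => ?_) h x
  rw [map_add, map_add, hx, hy]

/-- The map `b ↦ a ⊗ b`. -/
def tmulLeft (a : A) : B →L[ℂ] CStarTensor A B :=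
  LinearMap.mkContinuous
    { toFun b := tmul a b
      map_add' b b' := by simp only [tmul, TensorProduct.tmul_add, map_add]
      map_smul' c b := by simp only [tmul, TensorProduct.tmul_smul, map_smul, RingHom.id_apply] }
    ‖a‖ fun b => norm_tmul_le a b

theorem tmulLeft_apply (a : A) (b : B) : tmulLeft a b = tmul a b := rfl

/-! ### The functor `A ⊗ ·` -/

section Functor

variable {κ : Type*} [Fintype κ]

/-- The matrix `(a ⊗ φ(b)_{ij})_{ij}`, as a bilinear map. -/
def matBilin (A : Type*) [NonUnitalCStarAlgebra A] (φ : B →⋆ₙₐ[ℂ] Matrix κ κ D) :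
    A →ₗ[ℂ] B →ₗ[ℂ] CMat κ (CStarTensor A D) :=
  LinearMap.mk₂ ℂ (fun a b => CMat.ofM κ _ (Matrix.of fun i j => tmul a (φ b i j)))
    (fun a a' b => CMat.ext fun i j => map_add (tmulRight (φ b i j)) a a')
    (fun c a b => CMat.ext fun i j => map_smul (tmulRight (φ b i j)) c a)
    (fun a b b' => CMat.ext fun i j => by
      have h := map_add (tmulLeft a) (φ b i j) (φ b' i j)
      rw [← Matrix.add_apply, ← map_add] at h
      exact h)
    (fun c a b => CMat.ext fun i j => by
      have h := map_smul (tmulLeft a) c (φ b i j)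
      rw [← Matrix.smul_apply, ← map_smul] at h
      exact h)

/-- The homomorphism `a ⊗ b ↦ (a ⊗ φ(b)_{ij})_{ij}` on the algebraic tensor product. -/
def matAlg (A : Type*) [NonUnitalCStarAlgebra A] (φ : B →⋆ₙₐ[ℂ] Matrix κ κ D) :
    A ⊗[ℂ] B →⋆ₙₐ[ℂ] CMat κ (CStarTensor A D) :=
  algLift (matBilin A φ)
    (fun a a' b b' => CMat.ext fun i j => by
      change tmul (a * a') (φ (b * b') i j) = ((Matrix.of fun i j => tmul a (φ b i j)) *
        (Matrix.of fun i j => tmul a' (φ b' i j)) : Matrix κ κ (CStarTensor A D)) i j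
      rw [map_mul, Matrix.mul_apply, Matrix.mul_apply, tmul_sum]
      simp only [Matrix.of_apply, tmul_mul_tmul])
    (fun a b => CMat.ext fun i j => by
      change tmul (star a) (φ (star b) i j) = star (tmul a (φ b j i))
      rw [map_star, star_tmul]
      rfl)

theorem toM_matAlg_tmul (φ : B →⋆ₙₐ[ℂ] Matrix κ κ D) (a : A) (b : B) (i j : κ) :
    CMat.toM κ _ (matAlg A φ (a ⊗ₜ b)) i j = tmul a (φ b i j) := by
  rw [matAlg, algLift_tmul]
  rfl

/-- Looking at entries gives only a bound with the square of the matrix size; `norm_apply_tmul_le`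
improves the constant to 1, as `lift` requires. -/
theorem norm_matAlg_tmul_le (φ : B →⋆ₙₐ[ℂ] Matrix κ κ D) (a : A) (b : B) :
    ‖matAlg A φ (a ⊗ₜ b)‖ ≤ ‖a‖ * ‖b‖ := by
  refine norm_apply_tmul_le _ (C := Fintype.card κ * Fintype.card κ) (fun a b => ?_) a b
  rw [mul_assoc]
  refine CMat.norm_le_of_entry _ _ fun i j => ?_
  rw [toM_matAlg_tmul]
  refine (norm_tmul_le _ _).trans (mul_le_mul_of_nonneg_left ?_ (norm_nonneg _))
  exact (ContinuousLinearMap.le_of_opNorm_le _ (LinearMap.mkContinuous_norm_le _ zero_le_one _)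
      b : ‖Susp.entry φ i j b‖ ≤ 1 * ‖b‖).trans_eq (one_mul _)

/-- The homomorphism `a ⊗ b ↦ (a ⊗ φ(b)_{ij})_{ij}`. -/
def matMapC (A : Type*) [NonUnitalCStarAlgebra A] (φ : B →⋆ₙₐ[ℂ] Matrix κ κ D) :
    CStarTensor A B →⋆ₙₐ[ℂ] CMat κ (CStarTensor A D) :=
  lift (matAlg A φ) (norm_matAlg_tmul_le φ)

/-- The homomorphism `a ⊗ b ↦ (a ⊗ φ(b)_{ij})_{ij}`. -/
def matMap (A : Type*) [NonUnitalCStarAlgebra A] (φ : B →⋆ₙₐ[ℂ] Matrix κ κ D) :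
    CStarTensor A B →⋆ₙₐ[ℂ] Matrix κ κ (CStarTensor A D) where
  toFun x := CMat.toM κ _ (matMapC A φ x)
  map_smul' c x := by rw [map_smul]; rfl
  map_zero' := by rw [map_zero, map_zero]
  map_add' x y := by rw [map_add, map_add]
  map_mul' x y := by rw [map_mul, map_mul]
  map_star' x := by rw [map_star, map_star]

theorem matMap_tmul (φ : B →⋆ₙₐ[ℂ] Matrix κ κ D) (a : A) (b : B) (i j : κ) :
    matMap A φ (tmul a b) i j = tmul a (φ b i j) := by
  change CMat.toM κ _ (matMapC A φ (tmul a b)) i j = _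
  rw [matMapC, lift_tmul, toM_matAlg_tmul]

theorem continuous_matHom {E : Type*} [NonUnitalCStarAlgebra E] (f : E →⋆ₙₐ[ℂ] Matrix κ κ D)
    (i j : κ) : Continuous fun x => f x i j := (Susp.entry f i j).continuous

theorem matHom_ext_tmul {f g : CStarTensor A B →⋆ₙₐ[ℂ] Matrix κ κ D}
    (h : ∀ a b i j, f (tmul a b) i j = g (tmul a b) i j) : f = g := by
  refine matHom_ext fun x i j => ?_
  refine induction_tmul (isClosed_eq (continuous_matHom f i j) (continuous_matHom g i j))
    (fun x y hx hy => ?_) (fun a b => h a b i j) x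
  rw [map_add, map_add, Matrix.add_apply, Matrix.add_apply, hx, hy]

/-- Clear on the algebraic tensor product, and the homomorphisms are uniformly contractive, so
density suffices. -/
theorem continuous_matMap {X : Type*} [TopologicalSpace X] (φ : X → B →⋆ₙₐ[ℂ] Matrix κ κ D)
    (hφ : ∀ b i j, Continuous fun x => φ x b i j) (c : CStarTensor A B) (i j : κ) :
    Continuous fun x => matMap A (φ x) c i j := by
  have hle (y : X) (a : CStarTensor A B) : ‖matMap A (φ y) a i j‖ ≤ ‖a‖ :=
    (CMat.norm_entry_le (matMapC A (φ y) a) i j).trans (NonUnitalStarAlgHom.norm_apply_le _ a)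
  -- Phrased as approximability by elements with a continuous orbit, so that the condition is
  -- visibly closed.
  have key (x : CStarTensor A B) :
      ∀ ε > 0, ∃ x', ‖x' - x‖ < ε ∧ Continuous fun y => matMap A (φ y) x' i j := by
    refine induction (P := fun x => ∀ ε > 0, ∃ x', ‖x' - x‖ < ε ∧
      Continuous fun y => matMap A (φ y) x' i j) ?_ (fun x ε hε => ?_) x
    · refine isClosed_of_closure_subset fun x hx ε hε => ?_
      obtain ⟨y, hy, hxy⟩ := Metric.mem_closure_iff.1 hx (ε / 2) (half_pos hε)
      obtain ⟨x', hx', h⟩ := hy (ε / 2) (half_pos hε)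
      refine ⟨x', ?_, h⟩
      rw [dist_comm, dist_eq_norm] at hxy
      calc ‖x' - x‖ = ‖(x' - y) + (y - x)‖ := by rw [sub_add_sub_cancel]
        _ ≤ ‖x' - y‖ + ‖y - x‖ := norm_add_le _ _
        _ < ε / 2 + ε / 2 := add_lt_add hx' hxy
        _ = ε := add_halves ε
    · refine ⟨ofAlg A B x, by simpa using hε, ?_⟩
      clear hε
      induction x with
      | zero => simpa using continuous_const
      | add x x' hx hx' =>
        simp only [map_add, Matrix.add_apply]
        exact hx.add hx'
      | tmul a b =>
        change Continuous fun y => matMap A (φ y) (tmul a b) i j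
        simp only [matMap_tmul]
        exact (tmulLeft a).continuous.comp (hφ b i j)
  refine continuous_iff_continuousAt.2 fun x => Metric.tendsto_nhds.2 fun ε hε => ?_
  obtain ⟨c', hc', h⟩ := key c (ε / 3) (by positivity)
  have h1 := h.tendsto x
  rw [tendsto_iff_norm_sub_tendsto_zero] at h1
  filter_upwards [h1.eventually (gt_mem_nhds (by positivity : 0 < ε / 3))] with y hy
  have e (z : X) : matMap A (φ z) c i j = matMap A (φ z) c' i j - matMap A (φ z) (c' - c) i j := by
    rw [map_sub, Matrix.sub_apply, sub_sub_cancel]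
  rw [dist_eq_norm, e x, e y]
  have h2 := norm_sub_le (matMap A (φ y) c' i j - matMap A (φ x) c' i j)
    (matMap A (φ y) (c' - c) i j - matMap A (φ x) (c' - c) i j)
  have h3 := norm_sub_le (matMap A (φ y) (c' - c) i j) (matMap A (φ x) (c' - c) i j)
  have h4 := hle x (c' - c)
  have h5 := hle y (c' - c)
  rw [sub_sub_sub_comm]
  linarith

end Functor

end CStarTensor

end

open scoped TensorProduct ZeroAtInfty Matrix

noncomputable section

/-! ### Ultraproducts of sequences of C⋆-algebras -/

namespace SeqAlg

open Filter Topology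
open scoped ENNReal

variable (E : ℕ → Type u) [∀ j, NonUnitalCStarAlgebra (E j)]

/-- The limit of the norms of the entries of a bounded sequence along a free ultrafilter. -/
def limNorm (f : lp E ∞) : ℝ := limUnder (hyperfilter ℕ : Filter ℕ) fun j => ‖f j‖

variable {E}

/-- Bounded sequences of reals converge along an ultrafilter. Working with true limits makes the
axioms of a C⋆-seminorm immediate from those of the entries. -/
theorem tendsto_limNorm (f : lp E ∞) :
    Tendsto (fun j => ‖f j‖) (hyperfilter ℕ : Filter ℕ) (𝓝 (limNorm E f)) := by
  refine tendsto_nhds_limUnder ?_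
  obtain ⟨x, -, hx⟩ := (isCompact_Icc (a := (0 : ℝ)) (b := ‖f‖)).ultrafilter_le_nhds
    ((hyperfilter ℕ).map fun j => ‖f j‖)
    (le_principal_iff.2 (Filter.mem_map.2 (univ_mem' fun j =>
      ⟨norm_nonneg _, lp.norm_apply_le_norm (by simp) f j⟩)))
  exact ⟨x, hx⟩

theorem limNorm_eq {f : lp E ∞} {x : ℝ}
    (h : Tendsto (fun j => ‖f j‖) (hyperfilter ℕ : Filter ℕ) (𝓝 x)) : limNorm E f = x :=
  tendsto_nhds_unique (tendsto_limNorm f) h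

variable (E)

/-- The C⋆-seminorm on bounded sequences given by the limit along a free ultrafilter. -/
def limSeminorm : CStarSeminorm (lp E ∞) where
  toFun := limNorm E
  map_zero' := limNorm_eq (by simp)
  add_le' f g := le_of_tendsto_of_tendsto' (tendsto_limNorm _)
    ((tendsto_limNorm f).add (tendsto_limNorm g)) fun j => norm_add_le _ _
  neg' f := limNorm_eq (by simpa using tendsto_limNorm f)
  smul' c f := limNorm_eq (by simpa [norm_smul] using (tendsto_limNorm f).const_mul ‖c‖)
  mul_le' f g := le_of_tendsto_of_tendsto' (tendsto_limNorm _)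
    ((tendsto_limNorm f).mul (tendsto_limNorm g)) fun j => norm_mul_le _ _
  star_mul_self' f := limNorm_eq <| by
    simpa [CStarRing.norm_star_mul_self] using (tendsto_limNorm f).mul (tendsto_limNorm f)

/-- The ultraproduct of a sequence of C⋆-algebras. -/
abbrev UltraProd : Type u := (limSeminorm E).Compl

variable {E}

/-- The class of a bounded sequence in the ultraproduct. -/
def mk (f : lp E ∞) : UltraProd E := CStarSeminorm.Compl.ofCarrier (limSeminorm E) f

theorem tendsto_norm_mk (f : lp E ∞) :
    Tendsto (fun j => ‖f j‖) (hyperfilter ℕ : Filter ℕ) (𝓝 ‖mk f‖) := by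
  have h : ‖mk f‖ = limNorm E f := CStarSeminorm.Compl.norm_of (limSeminorm E) f
  rw [h]
  exact tendsto_limNorm f

theorem mk_zero : mk (0 : lp E ∞) = 0 :=
  map_zero (CStarSeminorm.Compl.ofCarrier (limSeminorm E))

theorem mk_add (f g : lp E ∞) : mk (f + g) = mk f + mk g :=
  map_add (CStarSeminorm.Compl.ofCarrier (limSeminorm E)) f g

theorem mk_sub (f g : lp E ∞) : mk (f - g) = mk f - mk g :=
  map_sub (CStarSeminorm.Compl.ofCarrier (limSeminorm E)) f g

theorem mk_smul (c : ℂ) (f : lp E ∞) : mk (c • f) = c • mk f :=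
  map_smul (CStarSeminorm.Compl.ofCarrier (limSeminorm E)) c f

theorem mk_mul (f g : lp E ∞) : mk (f * g) = mk f * mk g :=
  CStarSeminorm.Compl.of_mul (limSeminorm E) f g

theorem mk_star (f : lp E ∞) : mk (star f) = star (mk f) :=
  CStarSeminorm.Compl.of_star (limSeminorm E) f

/-- The ultrafilter is free, so ordinary convergence to zero of the difference is enough. -/
theorem mk_eq {f g : lp E ∞} (h : Tendsto (fun j => ‖f j - g j‖) atTop (𝓝 0)) : mk f = mk g := by
  rw [← sub_eq_zero, ← mk_sub, ← norm_eq_zero]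
  refine tendsto_nhds_unique (tendsto_norm_mk (f - g)) (h.mono_left ?_)
  rw [← Nat.cofinite_eq_atTop]
  exact hyperfilter_le_cofinite

end SeqAlg

/-! ### Tensor products of inductive limits -/

namespace KTheory.IsIndLim

open Filter Topology CStarTensor
open scoped ENNReal

variable {C : ℕ → Type v} [∀ j, NonUnitalCStarAlgebra (C j)] {D : Type v} [NonUnitalCStarAlgebra D]
  {κ : ∀ j k, j ≤ k → C j →⋆ₙₐ[ℂ] C k} {ι : ∀ j, C j →⋆ₙₐ[ℂ] D}

/-- The ranges of the maps `ι k` increase and have dense union, so the distance of `d` to them tends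
to 0. Each term is chosen within 1/(k + 1) of this distance. -/
theorem exists_tendsto (H : IsIndLim κ ι) (d : D) :
    ∃ r : ∀ k, C k, Tendsto (fun k => ι k (r k)) atTop (𝓝 d) := by
  have h (k : ℕ) : ∃ c : C k, dist d (ι k c) <
      Metric.infDist d (Set.range (ι k)) + 1 / ((k : ℝ) + 1) := by
    have h1 : Metric.infDist d (Set.range (ι k)) <
        Metric.infDist d (Set.range (ι k)) + 1 / ((k : ℝ) + 1) :=
      lt_add_of_pos_right _ Nat.one_div_pos_of_nat
    obtain ⟨_, ⟨c, rfl⟩, hc⟩ := (Metric.infDist_lt_iff (Set.range_nonempty _)).1 h1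
    exact ⟨c, hc⟩
  choose r hr using h
  refine ⟨r, tendsto_iff_dist_tendsto_zero.2 ?_⟩
  have h2 : Tendsto (fun k => Metric.infDist d (Set.range (ι k))) atTop (𝓝 0) := by
    refine Metric.tendsto_atTop.2 fun ε hε => ?_
    obtain ⟨j, c, hc⟩ := H.dense d ε hε
    refine ⟨j, fun k hk => ?_⟩
    rw [Real.dist_0_eq_abs, abs_of_nonneg Metric.infDist_nonneg]
    refine (Metric.infDist_le_dist_of_mem (Set.mem_range_self (κ j k hk c))).trans_lt ?_
    rwa [H.ι_κ, dist_comm, dist_eq_norm]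
  have h3 := h2.add (tendsto_one_div_add_atTop_nhds_zero_nat (𝕜 := ℝ))
  rw [add_zero] at h3
  refine squeeze_zero (fun _ => dist_nonneg) (fun k => ?_) h3
  rw [dist_comm]
  exact (hr k).le

section Approx

variable (A : Type u) [NonUnitalCStarAlgebra A] (ι)

/-- A sequence of approximants of an element of the limit. -/
def IsApprox (d : D) (r : ∀ k, C k) : Prop := Tendsto (fun k => ι k (r k)) atTop (𝓝 d)

variable {ι}

/-- Injective homomorphisms are isometric, so a convergent sequence of images comes from a bounded
sequence. This is one of the places where injectivity of the maps into the limit matters. -/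
theorem IsApprox.bddAbove (hι : ∀ j, Function.Injective (ι j)) {d : D} {r : ∀ k, C k}
    (h : IsApprox ι d r) : ∃ c, ∀ k, ‖r k‖ ≤ c := by
  obtain ⟨c, hc⟩ := h.norm.bddAbove_range
  refine ⟨c, fun k => ?_⟩
  rw [← (NonUnitalStarAlgHom.isometry (ι k) (hι k)).norm_map_of_map_zero (map_zero _)]
  exact hc ⟨k, rfl⟩

/-- The sequence `a ⊗ r_k`. -/
def tmulSeq (hι : ∀ j, Function.Injective (ι j)) {d : D} {r : ∀ k, C k} (h : IsApprox ι d r)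
    (a : A) : lp (fun k => CStarTensor A (C k)) ∞ :=
  ⟨fun k => tmul a (r k), by
    obtain ⟨c, hc⟩ := h.bddAbove hι
    refine memℓp_infty_iff.2 ⟨‖a‖ * c, ?_⟩
    rintro _ ⟨k, rfl⟩
    exact (norm_tmul_le _ _).trans (mul_le_mul_of_nonneg_left (hc k) (norm_nonneg _))⟩

variable {A}

theorem tmulSeq_apply (hι : ∀ j, Function.Injective (ι j)) {d : D} {r : ∀ k, C k}
    (h : IsApprox ι d r) (a : A) (k : ℕ) : tmulSeq A hι h a k = tmul a (r k) := rfl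

/-- The class in the ultraproduct does not depend on the approximants. This makes `toUltra`
bilinear, multiplicative and self-adjoint although its definition involves choices. -/
theorem mk_eq_mk (hι : ∀ j, Function.Injective (ι j)) {d : D} {r : ∀ k, C k}
    (h : IsApprox ι d r) (a : A) {f : lp (fun k => CStarTensor A (C k)) ∞}
    {s : ∀ k, C k} (hf : ∀ k, f k = tmul a (s k)) (hs : IsApprox ι d s) :
    SeqAlg.mk f = SeqAlg.mk (tmulSeq A hι h a) := by
  refine SeqAlg.mk_eq ?_
  have h1 := (Tendsto.sub hs h).norm.const_mul ‖a‖
  rw [sub_self, norm_zero, mul_zero] at h1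
  refine squeeze_zero (fun _ => norm_nonneg _) (fun k => ?_) h1
  rw [hf, tmulSeq_apply, ← tmulLeft_apply, ← tmulLeft_apply, ← map_sub, tmulLeft_apply,
    ← map_sub, (NonUnitalStarAlgHom.isometry (ι k) (hι k)).norm_map_of_map_zero (map_zero _)]
  exact norm_tmul_le _ _

theorem isApprox_choose (H : IsIndLim κ ι) (d : D) : IsApprox ι d (H.exists_tendsto d).choose :=
  (H.exists_tendsto d).choose_spec

variable (H : IsIndLim κ ι) (hι : ∀ j, Function.Injective (ι j)) (A)

/-- The homomorphism from `A ⊙ D` to the ultraproduct of the `A ⊗ C k`. -/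
def toUltra : A ⊗[ℂ] D →⋆ₙₐ[ℂ] SeqAlg.UltraProd fun k => CStarTensor A (C k) :=
  algLift
    (LinearMap.mk₂ ℂ (fun a d => SeqAlg.mk (tmulSeq A hι (isApprox_choose H d) a))
      (fun a a' d => by
        rw [← SeqAlg.mk_add]
        exact congrArg SeqAlg.mk (lp.ext (funext fun k => map_add (tmulRight _) a a')))
      (fun c a d => by
        rw [← SeqAlg.mk_smul]
        exact congrArg SeqAlg.mk (lp.ext (funext fun k => map_smul (tmulRight _) c a)))
      (fun a d d' => by
        rw [← SeqAlg.mk_add]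
        refine (mk_eq_mk hι _ a (fun k => (map_add (tmulLeft a) _ _).symm) ?_).symm
        have h := (isApprox_choose H d).add (isApprox_choose H d')
        simp only [← map_add] at h
        exact h)
      (fun c a d => by
        rw [← SeqAlg.mk_smul]
        refine (mk_eq_mk hι _ a (fun k => (map_smul (tmulLeft a) c _).symm) ?_).symm
        have h := (isApprox_choose H d).const_smul c
        simp only [← map_smul] at h
        exact h))
    (fun a a' d d' => by
      change SeqAlg.mk _ = SeqAlg.mk _ * SeqAlg.mk _
      rw [← SeqAlg.mk_mul]
      refine (mk_eq_mk hι _ _ (fun k => tmul_mul_tmul a a' _ _) ?_).symm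
      have h := (isApprox_choose H d).mul (isApprox_choose H d')
      simp only [← map_mul] at h
      exact h)
    (fun a d => by
      change SeqAlg.mk _ = star (SeqAlg.mk _)
      rw [← SeqAlg.mk_star]
      refine (mk_eq_mk hι _ _ (fun k => star_tmul a _) ?_).symm
      have h := (isApprox_choose H d).star
      simp only [← map_star] at h
      exact h)

theorem toUltra_tmul (a : A) (d : D) :
    toUltra A H hι (a ⊗ₜ d) = SeqAlg.mk (tmulSeq A hι (isApprox_choose H d) a) := by
  rw [toUltra, algLift_tmul]
  rfl

theorem norm_toUltra_tmul_le (a : A) (d : D) : ‖toUltra A H hι (a ⊗ₜ d)‖ ≤ ‖a‖ * ‖d‖ := by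
  rw [toUltra_tmul]
  have h1 : Tendsto (fun k => ‖a‖ * ‖ι k ((H.exists_tendsto d).choose k)‖)
      (hyperfilter ℕ : Filter ℕ) (𝓝 (‖a‖ * ‖d‖)) := by
    refine ((isApprox_choose H d).norm.const_mul ‖a‖).mono_left ?_
    rw [← Nat.cofinite_eq_atTop]
    exact hyperfilter_le_cofinite
  refine le_of_tendsto_of_tendsto' (SeqAlg.tendsto_norm_mk _) h1 fun k => ?_
  rw [(NonUnitalStarAlgHom.isometry (ι k) (hι k)).norm_map_of_map_zero (map_zero _)]
  exact norm_tmul_le _ _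

/-- For elements coming from stage j the connecting maps provide the approximants, so the norm in
the ultraproduct is the limit of the norms at the later stages. -/
theorem exists_mk_eq {j : ℕ} (x : A ⊗[ℂ] C j) : ∃ f : lp (fun k => CStarTensor A (C k)) ∞,
    (∀ k h, f k = ofMat (matMap A (toMat (κ j k h))) (ofAlg A (C j) x)) ∧
    lift (toUltra A H hι) (norm_toUltra_tmul_le A H hι)
      (ofMat (matMap A (toMat (ι j))) (ofAlg A (C j) x)) = SeqAlg.mk f := by
  induction x with
  | zero => exact ⟨0, by simp, by simpa using SeqAlg.mk_zero.symm⟩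
  | add x y hx hy =>
    obtain ⟨f, hf, hf'⟩ := hx
    obtain ⟨g, hg, hg'⟩ := hy
    refine ⟨f + g, fun k h => ?_, ?_⟩
    · rw [map_add, map_add, ← hf, ← hg]
      rfl
    · rw [map_add, map_add, map_add, hf', hg', SeqAlg.mk_add]
  | tmul a c =>
    -- Below stage j there is no connecting map; the value 0 there is arbitrary and does not affect
    -- the class.
    obtain ⟨r, hr⟩ : ∃ r : ∀ k, C k, ∀ k h, r k = κ j k h c :=
      ⟨fun k => if h : j ≤ k then κ j k h c else 0, fun k h => dif_pos h⟩
    have hr' : IsApprox ι (ι j c) r := by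
      refine tendsto_const_nhds.congr' ?_
      filter_upwards [eventually_ge_atTop j] with k hk
      rw [hr k hk, H.ι_κ]
    refine ⟨tmulSeq A hι hr' a, fun k h => ?_, ?_⟩
    · rw [tmulSeq_apply, ofMat_apply, hr k h]
      exact (matMap_tmul (toMat (κ j k h)) a c () ()).symm
    · have e : ofMat (matMap A (toMat (ι j))) (ofAlg A (C j) (a ⊗ₜ c)) = tmul a (ι j c) :=
        matMap_tmul (toMat (ι j)) a c () ()
      rw [e, lift_tmul, toUltra_tmul]
      exact (mk_eq_mk hι (isApprox_choose H (ι j c)) a (tmulSeq_apply hι hr' a) hr').symm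

end Approx

/-- The functor `A ⊗ ·` preserves inductive limits of sequences of subalgebras. -/
theorem tensor (A : Type u) [NonUnitalCStarAlgebra A] (H : IsIndLim κ ι)
    (hι : ∀ j, Function.Injective (ι j)) :
    IsIndLim (fun j k h => ofMat (matMap A (toMat (κ j k h))))
      (fun j => ofMat (matMap A (toMat (ι j)))) where
  ι_κ j k h x := by
    refine DFunLike.congr_fun (f := (ofMat (matMap A (toMat (ι k)))).comp
      (ofMat (matMap A (toMat (κ j k h))))) (hom_ext fun a b => ?_) x
    simp [ofMat_apply, matMap_tmul, toMat_apply, H.ι_κ]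
  κ_κ i j k h h' x := by
    refine DFunLike.congr_fun (f := (ofMat (matMap A (toMat (κ j k h')))).comp
      (ofMat (matMap A (toMat (κ i j h))))) (hom_ext fun a b => ?_) x
    simp [ofMat_apply, matMap_tmul, toMat_apply, H.κ_κ]
  dense d := by
    refine CStarTensor.induction (P := fun d => ∀ ε, 0 < ε → ∃ j c,
      ‖ofMat (matMap A (toMat (ι j))) c - d‖ < ε) ?_ (fun x => ?_) d
    · refine isClosed_of_closure_subset fun x hx ε hε => ?_
      obtain ⟨y, hy, hxy⟩ := Metric.mem_closure_iff.1 hx (ε / 2) (half_pos hε)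
      obtain ⟨j, c, h⟩ := hy (ε / 2) (half_pos hε)
      refine ⟨j, c, ?_⟩
      rw [dist_comm, dist_eq_norm] at hxy
      calc _ = ‖(ofMat (matMap A (toMat (ι j))) c - y) + (y - x)‖ := by rw [sub_add_sub_cancel]
        _ ≤ ‖ofMat (matMap A (toMat (ι j))) c - y‖ + ‖y - x‖ := norm_add_le _ _
        _ < ε / 2 + ε / 2 := add_lt_add h hxy
        _ = ε := add_halves ε
    · have κι (j k h x) : ofMat (matMap A (toMat (ι k))) (ofMat (matMap A (toMat (κ j k h))) x) =
          ofMat (matMap A (toMat (ι j))) x := by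
        refine DFunLike.congr_fun (f := (ofMat (matMap A (toMat (ι k)))).comp
          (ofMat (matMap A (toMat (κ j k h))))) (hom_ext fun a b => ?_) x
        simp [ofMat_apply, matMap_tmul, toMat_apply, H.ι_κ]
      induction x with
      | zero => exact fun ε hε => ⟨0, 0, by simpa using hε⟩
      | add x y hx hy =>
        intro ε hε
        obtain ⟨i, c, hc⟩ := hx (ε / 2) (half_pos hε)
        obtain ⟨j, c', hc'⟩ := hy (ε / 2) (half_pos hε)
        refine ⟨max i j, ofMat (matMap A (toMat (κ i _ (le_max_left i j)))) c +
          ofMat (matMap A (toMat (κ j _ (le_max_right i j)))) c', ?_⟩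
        rw [map_add, κι, κι, map_add, add_sub_add_comm]
        calc _ ≤ _ := norm_add_le _ _
          _ < ε / 2 + ε / 2 := add_lt_add hc hc'
          _ = ε := add_halves ε
      | tmul a b =>
        intro ε hε
        obtain ⟨j, c, hc⟩ := H.dense b (ε / (‖a‖ + 1)) (by positivity)
        refine ⟨j, tmul a c, ?_⟩
        have e : ofMat (matMap A (toMat (ι j))) (tmul a c) = tmul a (ι j c) :=
          matMap_tmul _ _ _ _ _
        change ‖_ - tmul a b‖ < ε
        rw [e, ← tmulLeft_apply, ← tmulLeft_apply, ← map_sub]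
        refine (norm_tmul_le _ _).trans_lt ?_
        rw [lt_div_iff₀ (by positivity)] at hc
        nlinarith [norm_nonneg a, norm_nonneg (ι j c - b)]
  ker j x hx ε hε := by
    -- The map to the ultraproduct extends to A ⊗ D because the tensor norm is the largest one. It
    -- sends the image of `x`, which is 0, to 0. Hence the sequence of images of the nearby
    -- algebraic element `x'` has small norm along the ultrafilter, and so at some stage after j.
    obtain ⟨x', hx'⟩ := denseRange_ofAlg.exists_dist_lt x (half_pos hε)
    rw [dist_eq_norm] at hx'
    obtain ⟨f, hf, hf'⟩ := exists_mk_eq A H hι x'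
    have h1 : ‖SeqAlg.mk f‖ < ε / 2 := by
      rw [← hf']
      refine (NonUnitalStarAlgHom.norm_apply_le _ _).trans_lt ?_
      have e : ofMat (matMap A (toMat (ι j))) (ofAlg A (C j) x') =
          - ofMat (matMap A (toMat (ι j))) (x - ofAlg A (C j) x') := by
        rw [map_sub, hx, zero_sub, neg_neg]
      rw [e, norm_neg]
      exact (NonUnitalStarAlgHom.norm_apply_le _ _).trans_lt hx'
    have h2 := (SeqAlg.tendsto_norm_mk f).eventually (gt_mem_nhds h1)
    have h3 : ∀ᶠ k in (hyperfilter ℕ : Filter ℕ), j ≤ k := by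
      have := eventually_ge_atTop j
      rw [← Nat.cofinite_eq_atTop] at this
      exact this.filter_mono hyperfilter_le_cofinite
    obtain ⟨k, hk, hjk⟩ := (h2.and h3).exists
    refine ⟨k, hjk, ?_⟩
    rw [hf k hjk] at hk
    calc _ = ‖ofMat (matMap A (toMat (κ j k hjk))) (x - ofAlg A (C j) x') +
          ofMat (matMap A (toMat (κ j k hjk))) (ofAlg A (C j) x')‖ := by
          rw [← map_add, sub_add_cancel]
      _ ≤ _ := norm_add_le _ _
      _ < ε / 2 + ε / 2 :=
        add_lt_add ((NonUnitalStarAlgHom.norm_apply_le _ _).trans_lt hx') hk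
      _ = ε := add_halves ε

end KTheory.IsIndLim

namespace KTheory

open CStarTensor

/-- The functor `A ⊗ ·`. -/
def MatFunctor.tensor (A : Type u) [NonUnitalCStarAlgebra A] : MatFunctor.{max u v, v} where
  obj B _ := CStarTensor A B
  inst _ _ := inferInstance
  map φ := matMap A φ
  map_id := by
    intros
    exact matHom_ext_tmul fun a b i j => by rw [matMap_tmul]; rfl
  map_comp φ ψ := matHom_ext_tmul fun a b i j => by
    rw [matMap_tmul, compHom_apply, compHom_apply, matMap_tmul, matMap_tmul]
  map_sum φ ψ := matHom_ext_tmul fun a b i j => by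
    rw [matMap_tmul, sumHom_apply, sumHom_apply]
    rcases i with i | i <;> rcases j with j | j
    · exact (matMap_tmul φ a b i j).symm
    · exact _root_.map_zero (tmulLeft a)
    · exact _root_.map_zero (tmulLeft a)
    · exact (matMap_tmul ψ a b i j).symm
  map_reindex e φ := matHom_ext_tmul fun a b i j => by
    rw [matMap_tmul, reindexHom_apply, reindexHom_apply, matMap_tmul]
  map_zero := by
    intros
    exact matHom_ext_tmul fun a b i j => by rw [matMap_tmul]; exact _root_.map_zero (tmulLeft a)
  continuous_map φ h := continuous_matMap φ h
  isIndLim H hι := H.tensor A hι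

end KTheory

end

open scoped TensorProduct ZeroAtInfty Matrix

noncomputable section

namespace KTheory

/-! ### Conjugation of homomorphisms into matrix algebras -/

section Conj

variable {A B : Type*} [NonUnitalCStarAlgebra A] [CStarAlgebra B] {κ : Type*} [Fintype κ]
  [DecidableEq κ]

/-- Conjugation of a homomorphism by an isometry. -/
def conjHom (W : Matrix κ κ B) (hW : Wᴴ * W = 1) (φ : A →⋆ₙₐ[ℂ] Matrix κ κ B) :
    A →⋆ₙₐ[ℂ] Matrix κ κ B where
  toFun a := W * φ a * Wᴴ
  map_smul' c a := by simp
  map_zero' := by simp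
  map_add' a b := by simp [mul_add, add_mul]
  map_mul' a b := by
    rw [map_mul, show W * φ a * Wᴴ * (W * φ b * Wᴴ) = W * φ a * (Wᴴ * W) * φ b * Wᴴ by
      simp only [mul_assoc], hW, mul_one]
    simp only [mul_assoc]
  map_star' a := by
    simp [map_star, Matrix.star_eq_conjTranspose, Matrix.conjTranspose_mul, mul_assoc]

theorem conjHom_apply (W : Matrix κ κ B) (hW : Wᴴ * W = 1) (φ : A →⋆ₙₐ[ℂ] Matrix κ κ B) (a : A) :
    conjHom W hW φ a = W * φ a * Wᴴ := rfl

/-- The path of unitaries `(1 + u) / 2 + e^{is} (1 - u) / 2` from `1` to a self-adjoint unitary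
`u`. -/
def unitaryPath (u : Matrix κ κ B) (s : ℝ) : Matrix κ κ B :=
  (2⁻¹ : ℂ) • (1 + u) + (2⁻¹ * Complex.exp (s * Complex.I)) • (1 - u)

theorem unitaryPath_zero (u : Matrix κ κ B) : unitaryPath u 0 = 1 := by
  rw [unitaryPath]
  simp
  module

theorem unitaryPath_pi (u : Matrix κ κ B) : unitaryPath u Real.pi = u := by
  rw [unitaryPath]
  simp
  module

/-- The elements (1 + u)/2 and (1 - u)/2 are complementary projections, and the coefficients 1 and
e^{is} have modulus 1. -/
theorem unitaryPath_isometry {u : Matrix κ κ B} (hu : uᴴ = u) (huu : u * u = 1) (s : ℝ) :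
    (unitaryPath u s)ᴴ * unitaryPath u s = 1 := by
  have h1 : star (Complex.exp (s * Complex.I)) * Complex.exp (s * Complex.I) = 1 := by
    rw [Complex.star_def, ← Complex.normSq_eq_conj_mul_self, Complex.normSq_eq_norm_sq,
      Complex.norm_exp_ofReal_mul_I]
    simp
  have a1 : (1 + u) * (1 + u) = (2 : ℂ) • (1 + u) := by
    rw [mul_add, add_mul, add_mul, huu, one_mul, mul_one, one_mul]; module
  have a2 : (1 - u) * (1 - u) = (2 : ℂ) • (1 - u) := by
    rw [mul_sub, sub_mul, sub_mul, huu, one_mul, mul_one, one_mul]; module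
  have a3 : (1 + u) * (1 - u) = 0 := by
    rw [mul_sub, add_mul, add_mul, huu, one_mul, mul_one, one_mul]; abel
  have a4 : (1 - u) * (1 + u) = 0 := by
    rw [mul_add, sub_mul, sub_mul, huu, one_mul, mul_one, one_mul]; abel
  have h2 : (unitaryPath u s)ᴴ = (2⁻¹ : ℂ) • (1 + u) +
      (2⁻¹ * star (Complex.exp (s * Complex.I))) • (1 - u) := by
    rw [unitaryPath, Matrix.conjTranspose_add, Matrix.conjTranspose_smul,
      Matrix.conjTranspose_smul, Matrix.conjTranspose_add, Matrix.conjTranspose_sub,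
      Matrix.conjTranspose_one, hu, star_mul']
    simp
  rw [h2, unitaryPath, add_mul, mul_add, mul_add]
  simp only [smul_mul_assoc, mul_smul_comm, a1, a2, a3, a4, smul_zero, add_zero, zero_add, smul_smul]
  rw [show 2⁻¹ * Complex.exp (s * Complex.I) * (2⁻¹ * star (Complex.exp (s * Complex.I)) * 2) =
    2⁻¹ * (star (Complex.exp (s * Complex.I)) * Complex.exp (s * Complex.I)) by ring, h1]
  module

theorem continuous_unitaryPath (u : Matrix κ κ B) : Continuous (unitaryPath u) := by
  unfold unitaryPath
  fun_prop

end Conj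

/-- The homomorphism `λ ↦ λ e` defined by a projection. -/
def scal {B : Type*} [NonUnitalCStarAlgebra B] {κ : Type*} [Fintype κ] (e : Matrix κ κ B)
    (he : IsStarProjection e) : ℂ →⋆ₙₐ[ℂ] Matrix κ κ B where
  toFun c := c • e
  map_smul' c a := by simp [smul_smul]
  map_zero' := by simp
  map_add' a b := add_smul a b e
  map_mul' a b := by
    have h : e * e = e := he.isIdempotentElem
    ext1 i j
    rw [smul_mul_smul_comm, h]
  map_star' a := by rw [star_smul, he.isSelfAdjoint.star_eq]

theorem scal_apply {B : Type*} [NonUnitalCStarAlgebra B] {κ : Type*} [Fintype κ]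
    (e : Matrix κ κ B) (he : IsStarProjection e) (c : ℂ) (i j : κ) :
    scal e he c i j = c • e i j := rfl

/-- The homomorphism `b ↦ diag(b, …, b)`. -/
def diagHom (κ : Type*) [Fintype κ] [DecidableEq κ] (B : Type*) [NonUnitalCStarAlgebra B] :
    B →⋆ₙₐ[ℂ] Matrix κ κ B where
  toFun b := Matrix.diagonal fun _ => b
  map_smul' c a := by ext i j; simp [Matrix.diagonal_apply]
  map_zero' := by simp
  map_add' a b := by simp
  map_mul' a b := by simp
  map_star' a := by simp [Matrix.star_eq_conjTranspose, Matrix.diagonal_conjTranspose, Pi.star_def]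

theorem diagHom_apply {κ : Type*} [Fintype κ] [DecidableEq κ] {B : Type*}
    [NonUnitalCStarAlgebra B] (b : B) (i j : κ) :
    diagHom κ B b i j = if i = j then b else 0 := Matrix.diagonal_apply _ _ _

/-! ### The maps on K₀(F ·), conjugation, and the action of classes of projections -/

namespace MatFunctor

variable (F : MatFunctor.{u, 0}) {B B' B'' : Type} [NonUnitalCStarAlgebra B]
  [NonUnitalCStarAlgebra B'] [NonUnitalCStarAlgebra B''] {κ μ : Type} [Fintype κ] [Fintype μ]

/-- The map on `K₀` induced by a homomorphism into a matrix algebra. -/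
def K (φ : B →⋆ₙₐ[ℂ] Matrix κ κ B') : K0 (F.obj B) →+ K0 (F.obj B') := K0.mapI (F.map φ)

theorem K_id (x : K0 (F.obj B)) : F.K (toMat (NonUnitalStarAlgHom.id ℂ B)) x = x := by
  rw [K, F.map_id, K0.mapI_id]

theorem K_K (φ : B →⋆ₙₐ[ℂ] Matrix κ κ B') (ψ : B' →⋆ₙₐ[ℂ] Matrix μ μ B'') (x : K0 (F.obj B)) :
    F.K ψ (F.K φ x) = F.K (compHom φ ψ) x := by
  rw [K, K, K, F.map_comp, K0.mapI_mapI]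

theorem K_sumHom (φ : B →⋆ₙₐ[ℂ] Matrix κ κ B') (ψ : B →⋆ₙₐ[ℂ] Matrix μ μ B') :
    F.K (sumHom φ ψ) = F.K φ + F.K ψ := by
  rw [K, K, K, F.map_sum, K0.mapI_sumHom]

theorem K_reindexHom (e : κ ≃ μ) (φ : B →⋆ₙₐ[ℂ] Matrix κ κ B') : F.K (reindexHom e φ) = F.K φ := by
  rw [K, K, F.map_reindex, K0.mapI_reindexHom]

theorem K_of_reindex (e : κ ≃ μ) {φ : B →⋆ₙₐ[ℂ] Matrix κ κ B'} {ψ : B →⋆ₙₐ[ℂ] Matrix μ μ B'}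
    (h : ∀ b i j, φ b i j = ψ b (e i) (e j)) : F.K φ = F.K ψ := by
  rw [← F.K_reindexHom e]
  congr 1
  refine matHom_ext fun b i j => ?_
  rw [reindexHom_apply, h, e.apply_symm_apply, e.apply_symm_apply]

theorem K_zero : F.K (0 : B →⋆ₙₐ[ℂ] Matrix κ κ B') = 0 := by
  rw [K, F.map_zero, K0.mapI_zero]

theorem K_eq_of_homotopy {X : Type} [TopologicalSpace X] [PreconnectedSpace X]
    (φ : X → B →⋆ₙₐ[ℂ] Matrix κ κ B') (h : ∀ b i j, Continuous fun x => φ x b i j) (x y : X) :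
    F.K (φ x) = F.K (φ y) :=
  K0.mapI_eq_of_homotopy _ (F.continuous_map φ h) x y

theorem K_toMat (φ : B →⋆ₙₐ[ℂ] B') : F.K (toMat φ) = K0.map (ofMat (F.map (toMat φ))) := by
  rw [K, K0.map_eq_mapI, toMat_ofMat]

/-- Conjugation by a self-adjoint unitary is trivial on `K₀`. -/
theorem K_conjHom [DecidableEq κ] {C : Type} [CStarAlgebra C] {u : Matrix κ κ C} (hu : uᴴ = u)
    (huu : u * u = 1) (φ ψ : B →⋆ₙₐ[ℂ] Matrix κ κ C) (h : ∀ b, ψ b = u * φ b * u) :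
    F.K φ = F.K ψ := by
  have key := F.K_eq_of_homotopy
    (fun s : ℝ => conjHom (unitaryPath u s) (unitaryPath_isometry hu huu s) φ) (fun b i j => by
      have hc := continuous_unitaryPath u
      have h2 : Continuous fun s => unitaryPath u s * φ b * (unitaryPath u s)ᴴ :=
        (hc.matrix_mul continuous_const).matrix_mul hc.matrix_conjTranspose
      exact h2.matrix_elem i j) 0 Real.pi
  have e0 : conjHom (unitaryPath u 0) (unitaryPath_isometry hu huu 0) φ = φ :=
    DFunLike.ext _ _ fun b => by
      rw [conjHom_apply, unitaryPath_zero, Matrix.conjTranspose_one, one_mul, mul_one]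
  have e1 : conjHom (unitaryPath u Real.pi) (unitaryPath_isometry hu huu Real.pi) φ = ψ :=
    DFunLike.ext _ _ fun b => by rw [conjHom_apply, unitaryPath_pi, hu, h]
  rwa [e0, e1] at key

/-- Equivalent projections become conjugate after enlarging the matrices: e ⊕ 0 is carried to 0 ⊕ f
by a self-adjoint unitary, and `K_conjHom` applies. -/
theorem K_scal_eq {C : Type} [CStarAlgebra C] {e : Matrix κ κ C} {f : Matrix μ μ C}
    (he : IsStarProjection e) (hf : IsStarProjection f) (h : MvN e f) :
    F.K (scal e he) = F.K (scal f hf) := by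
  classical
  have he1 : e * e = e := he.isIdempotentElem
  have he2 : eᴴ = e := he.isSelfAdjoint
  have hf1 : f * f = f := hf.isIdempotentElem
  have hf2 : fᴴ = f := hf.isSelfAdjoint
  -- The given `v` is replaced by `v * e`, so that the relations with `e` and `f` hold without
  -- appeal to a norm.
  obtain ⟨w, h1, h2, h3, h4⟩ : ∃ w : Matrix μ κ C, wᴴ * w = e ∧ w * wᴴ = f ∧ w * e = w ∧
      f * w = w := by
    obtain ⟨v, h1, h2⟩ := h
    have h3 : (v * e)ᴴ * (v * e) = e := by
      rw [Matrix.conjTranspose_mul, he2, Matrix.mul_assoc, ← Matrix.mul_assoc vᴴ, h1, he1, he1]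
    refine ⟨v * e, h3, ?_, by rw [Matrix.mul_assoc, he1], ?_⟩
    · rw [Matrix.conjTranspose_mul, he2, Matrix.mul_assoc, ← Matrix.mul_assoc e, he1, ← h1,
        Matrix.mul_assoc vᴴ, h2, ← Matrix.mul_assoc, h2, hf1]
    · rw [← h2, ← Matrix.mul_assoc, Matrix.mul_assoc v, h1, Matrix.mul_assoc, he1]
  have h5 : e * wᴴ = wᴴ := by
    rw [← he2, ← Matrix.conjTranspose_mul, h3]
  have h6 : wᴴ * f = wᴴ := by
    rw [← hf2, ← Matrix.conjTranspose_mul, h4]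
  -- This unitary exchanges the ranges of `e` and `f` by means of `w` and is the identity on their
  -- complements.
  set u : Matrix (κ ⊕ μ) (κ ⊕ μ) C := Matrix.fromBlocks (1 - e) wᴴ w (1 - f) with hu
  have hu1 : uᴴ = u := by
    rw [hu, Matrix.fromBlocks_conjTranspose]
    simp [he2, hf2]
  have hu2 : u * u = 1 := by
    rw [hu, Matrix.fromBlocks_multiply, ← Matrix.fromBlocks_one]
    congr 1
    · simp [Matrix.mul_sub, Matrix.sub_mul, he1, h1]
    · simp [Matrix.mul_sub, Matrix.sub_mul, h5, h6]
    · simp [Matrix.mul_sub, Matrix.sub_mul, h3, h4]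
    · simp [Matrix.mul_sub, Matrix.sub_mul, hf1, h2]
  have key := F.K_conjHom hu1 hu2 (sumHom (scal e he) (0 : ℂ →⋆ₙₐ[ℂ] Matrix μ μ C))
    (sumHom (0 : ℂ →⋆ₙₐ[ℂ] Matrix κ κ C) (scal f hf)) fun c => by
      have e1 : sumHom (scal e he) (0 : ℂ →⋆ₙₐ[ℂ] Matrix μ μ C) c =
        c • Matrix.fromBlocks e 0 0 0 := by
        rw [sumHom_apply, Matrix.fromBlocks_smul]
        simp [scal]
      have e2 : sumHom (0 : ℂ →⋆ₙₐ[ℂ] Matrix κ κ C) (scal f hf) c =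
        c • Matrix.fromBlocks 0 0 0 f := by
        rw [sumHom_apply, Matrix.fromBlocks_smul]
        simp [scal]
      rw [e1, e2, Matrix.mul_smul, Matrix.smul_mul, hu, Matrix.fromBlocks_multiply,
        Matrix.fromBlocks_multiply]
      simp [Matrix.mul_sub, Matrix.sub_mul, he1, h3, h2]
  rwa [K_sumHom, K_sumHom, K_zero, K_zero, add_zero, zero_add] at key

/-- The homomorphism `K₀(B) → Hom(K₀(F ℂ), K₀(F B))` given by `[e] ↦ F(λ ↦ λ e)`, for unital
`B`. -/
def theta (C : Type) [CStarAlgebra C] : K00 C →+ K0 (F.obj ℂ) →+ K0 (F.obj C) :=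
  Algebra.GrothendieckAddGroup.lift
    { toFun := Quotient.lift (fun p : Proj C => F.K (scal p.mat p.isProj))
        fun p q h => F.K_scal_eq p.isProj q.isProj h
      map_zero' := by
        change F.K (scal (0 : Matrix (Fin 0) (Fin 0) C) _) = 0
        rw [← F.K_zero (B := ℂ) (B' := C) (κ := Fin 0)]
        congr 1
        exact matHom_ext fun c i j => i.elim0
      map_add' x y := by
        induction x using V.ind with | _ p
        induction y using V.ind with | _ q
        change F.K (scal (p.dsum q).mat (p.dsum q).isProj) =
          F.K (scal p.mat p.isProj) + F.K (scal q.mat q.isProj)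
        rw [← F.K_sumHom]
        refine (F.K_of_reindex finSumFinEquiv fun c i j => ?_).symm
        have h : (p.dsum q).mat (finSumFinEquiv i) (finSumFinEquiv j) =
            Matrix.fromBlocks p.mat 0 0 q.mat i j := by
          change Matrix.fromBlocks p.mat 0 0 q.mat (finSumFinEquiv.symm (finSumFinEquiv i))
            (finSumFinEquiv.symm (finSumFinEquiv j)) = _
          rw [Equiv.symm_apply_apply, Equiv.symm_apply_apply]
        refine Eq.trans ?_ (congrArg (c • ·) h.symm)
        rw [sumHom_apply]
        rcases i with i | i <;> rcases j with j | j <;> simp [scal] }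

theorem theta_of {C : Type} [CStarAlgebra C] (p : Proj C) :
    F.theta C (K00.of p) = F.K (scal p.mat p.isProj) :=
  DFunLike.congr_fun (Algebra.GrothendieckAddGroup.lift.symm_apply_apply _) (V.mk p)

theorem theta_cls {C : Type} [CStarAlgebra C] (e : Matrix κ κ C) (he : IsStarProjection e) :
    F.theta C (K00.cls e he) = F.K (scal e he) := by
  rw [K00.cls, theta_of]
  exact F.K_scal_eq _ _ (Proj.mvN_ofEquiv _ _ _).symm

theorem K_diagHom (κ : Type) [Fintype κ] [DecidableEq κ] (x : K0 (F.obj B)) :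
    F.K (diagHom κ B) x = Fintype.card κ • x := by
  have key : ∀ (n : ℕ) (x : K0 (F.obj B)), F.K (diagHom (Fin n) B) x = n • x := by
    intro n
    induction n with
    | zero =>
      intro x
      rw [show diagHom (Fin 0) B = 0 from matHom_ext fun b i => i.elim0, K_zero, zero_smul]
      rfl
    | succ n ih =>
      intro x
      have h : F.K (diagHom (Fin (n + 1)) B) =
          F.K (sumHom (diagHom (Fin n) B) (diagHom (Fin 1) B)) := by
        refine (F.K_of_reindex finSumFinEquiv fun c i j => ?_).symm
        rw [sumHom_apply, diagHom_apply]
        simp only [EmbeddingLike.apply_eq_iff_eq]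
        rcases i with i | i <;> rcases j with j | j <;> simp [diagHom_apply]
      have h1 : F.K (diagHom (Fin 1) B) x = x := by
        conv_rhs => rw [← F.K_id x]
        refine DFunLike.congr_fun (F.K_of_reindex (Equiv.ofUnique _ _) fun c i j => ?_) x
        rw [diagHom_apply, if_pos (Subsingleton.elim _ _)]
        rfl
      rw [h, K_sumHom, AddMonoidHom.add_apply, ih, h1, succ_nsmul]
  rw [← key]
  refine DFunLike.congr_fun (F.K_of_reindex (Fintype.equivFin κ) fun c i j => ?_) x
  simp [diagHom_apply]

end MatFunctor

end KTheory

end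

open scoped TensorProduct ZeroAtInfty Matrix

noncomputable section

namespace KTheory

/-! ### Classes of projections in `K₀` and the group `K₀(ℂ)` -/

section Cls

variable {A B : Type*} [NonUnitalCStarAlgebra A] [NonUnitalCStarAlgebra B] {ι κ : Type*}
  [Fintype ι] [Fintype κ]

/-- The class in `K₀(A)` of a projection in a matrix algebra over `A`. -/
def K0.cls (q : Matrix ι ι A) (hq : IsStarProjection q) : K0 A :=
  K0.ofProj (q.submatrix (Fintype.equivFin ι).symm (Fintype.equivFin ι).symm)
    (isStarProjection_submatrix hq _)

theorem K0.coe_ofProj {k : ℕ} (q : Matrix (Fin k) (Fin k) A) (hq : IsStarProjection q) :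
    (K0.ofProj q hq).1 = K00.cls (q.map (Unitization.inrNonUnitalStarAlgHom ℂ A))
      (isStarProjection_map hq _) := K00.of_eq_cls _

theorem K0.coe_cls (q : Matrix ι ι A) (hq : IsStarProjection q) :
    (K0.cls q hq).1 = K00.cls (q.map (Unitization.inrNonUnitalStarAlgHom ℂ A))
      (isStarProjection_map hq _) := by
  rw [K0.cls, K0.coe_ofProj]
  symm
  exact K00.cls_submatrix (Fintype.equivFin ι).symm fun i j => rfl

theorem K0.ofProj_eq_cls {k : ℕ} (q : Matrix (Fin k) (Fin k) A) (hq : IsStarProjection q) :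
    K0.ofProj q hq = K0.cls q hq := Subtype.ext <| by rw [K0.coe_ofProj, K0.coe_cls]

theorem K0.cls_submatrix {p : Matrix ι ι A} {q : Matrix κ κ A} {hp : IsStarProjection p}
    {hq : IsStarProjection q} (e : κ ≃ ι) (h : ∀ i j, q i j = p (e i) (e j)) :
    K0.cls p hp = K0.cls q hq := Subtype.ext <| by
  rw [K0.coe_cls, K0.coe_cls]
  exact K00.cls_submatrix e fun i j => by rw [Matrix.map_apply, h, Matrix.map_apply]

theorem K0.mapI_cls (φ : A →⋆ₙₐ[ℂ] Matrix κ κ B) (q : Matrix ι ι A) (hq : IsStarProjection q) :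
    K0.mapI φ (K0.cls q hq) = K0.cls (bMap φ q) (isStarProjection_bMap hq φ) := by
  classical
  refine Subtype.ext ?_
  rw [K0.coe_mapI, K0.coe_cls, K0.coe_cls, K00.mapI_cls]
  refine K00.cls_submatrix (Equiv.refl _) fun i j => ?_
  refine Unitization.ext ?_ ?_
  · refine Eq.trans ?_ (unitize_fst φ _ _ _).symm
    simp
  · exact (unitize_snd φ (q.map (Unitization.inrNonUnitalStarAlgHom ℂ A) i.1 j.1) i.2 j.2).symm

end Cls

/-- The map `A⁺ → A`, `λ + a ↦ λ 1 + a`, for a unital C⋆-algebra `A`. -/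
def unitPart (A : Type*) [CStarAlgebra A] : Unitization ℂ A →⋆ₙₐ[ℂ] A :=
  (Unitization.starLift (NonUnitalStarAlgHom.id ℂ A) : Unitization ℂ A →⋆ₐ[ℂ] A)

theorem unitPart_apply {A : Type*} [CStarAlgebra A] (x : Unitization ℂ A) :
    unitPart A x = algebraMap ℂ A x.fst + x.snd := by
  rfl

/-- The canonical map from `K₀(A)` to the Grothendieck group of projections over `A`, for a unital
C⋆-algebra `A`. -/
def K0.toK00 (A : Type*) [CStarAlgebra A] : K0 A →+ K00 A :=
  (K00.map (unitPart A)).comp (K00.map (scalarPart A)).ker.subtype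

theorem K0.toK00_cls {A : Type*} [CStarAlgebra A] {ι : Type*} [Fintype ι] (q : Matrix ι ι A)
    (hq : IsStarProjection q) : K0.toK00 A (K0.cls q hq) = K00.cls q hq := by
  change K00.map (unitPart A) (K0.cls q hq).1 = _
  rw [K0.coe_cls, K00.map_cls]
  refine K00.cls_submatrix (Equiv.refl _) fun i j => ?_
  simp [unitPart_apply]

/-- Every projection over `ℂ` is equivalent to an identity matrix. -/
theorem exists_mvN_one {κ : Type*} [Fintype κ] {p : Matrix κ κ ℂ} (hp : IsStarProjection p) :
    ∃ r : ℕ, MvN p (1 : Matrix (Fin r) (Fin r) ℂ) := by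
  classical
  have hp1 : p * p = p := hp.isIdempotentElem
  have hp2 : pᴴ = p := hp.isSelfAdjoint
  set S := LinearMap.range (Matrix.toLpLin 2 2 p : EuclideanSpace ℂ κ →ₗ[ℂ] EuclideanSpace ℂ κ)
  set b := stdOrthonormalBasis ℂ S
  -- The columns of `w` are an orthonormal basis of the range of `p`.
  set w : Matrix κ (Fin (Module.finrank ℂ S)) ℂ := Matrix.of fun i k => (b k : EuclideanSpace ℂ κ) i
    with hw
  have h1 : wᴴ * w = 1 := by
    ext k l
    have h := b.inner_eq_ite k l
    rw [Submodule.coe_inner, EuclideanSpace.inner_eq_star_dotProduct] at h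
    rw [Matrix.one_apply, ← h, Matrix.mul_apply, dotProduct]
    exact Finset.sum_congr rfl fun i _ => mul_comm _ _
  have h2 : p * w = w := by
    ext i k
    obtain ⟨y, hy⟩ := (b k).2
    have h3 : (b k : EuclideanSpace ℂ κ).ofLp = p *ᵥ y.ofLp := by
      rw [← hy, Matrix.toLpLin_apply]
    change (p *ᵥ (b k : EuclideanSpace ℂ κ).ofLp) i = (b k : EuclideanSpace ℂ κ).ofLp i
    rw [h3, Matrix.mulVec_mulVec, hp1]
  have h4 : w * (wᴴ * p) = p := by
    ext i j
    set x : S := ⟨WithLp.toLp 2 fun i => p i j, WithLp.toLp 2 (Pi.single j 1), by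
      rw [Matrix.toLpLin_apply]; simp; rfl⟩ with hx
    have h := congrArg (fun y : S => (y : EuclideanSpace ℂ κ).ofLp i) (b.sum_repr' x)
    simp only [Submodule.coe_sum, Submodule.coe_smul, WithLp.ofLp_sum, WithLp.ofLp_smul,
      Finset.sum_apply, Pi.smul_apply, smul_eq_mul] at h
    refine Eq.trans ?_ h
    rw [Matrix.mul_apply]
    refine Finset.sum_congr rfl fun k _ => ?_
    rw [mul_comm, Submodule.coe_inner, EuclideanSpace.inner_eq_star_dotProduct]
    congr 1
    rw [Matrix.mul_apply, dotProduct]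
    exact Finset.sum_congr rfl fun i _ => mul_comm _ _
  refine ⟨_, wᴴ, ?_, by rwa [Matrix.conjTranspose_conjTranspose]⟩
  rw [Matrix.conjTranspose_conjTranspose]
  conv_rhs => rw [← h4, ← hp2, ← Matrix.conjTranspose_mul, h2]

theorem trace_eq_of_mvN {ι κ : Type*} [Fintype ι] [Fintype κ] {p : Matrix ι ι ℂ}
    {q : Matrix κ κ ℂ} (h : MvN p q) : p.trace = q.trace := by
  obtain ⟨v, rfl, rfl⟩ := h
  exact Matrix.trace_mul_comm _ _

/-- The trace on `K₀(ℂ)`. -/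
def K00.trace : K00 ℂ →+ ℂ :=
  Algebra.GrothendieckAddGroup.lift
    { toFun := Quotient.lift (fun p : Proj ℂ => p.mat.trace) fun _ _ h => trace_eq_of_mvN h
      map_zero' := by
        change (0 : Matrix (Fin 0) (Fin 0) ℂ).trace = 0
        simp
      map_add' x y := by
        induction x using V.ind with | _ p
        induction y using V.ind with | _ q
        change (p.dsum q).mat.trace = p.mat.trace + q.mat.trace
        rw [← trace_eq_of_mvN (p.mvN_dsum q), Matrix.trace, Matrix.trace, Matrix.trace,
          Fintype.sum_sum_type]
        rfl }

theorem K00.trace_cls {κ : Type*} [Fintype κ] (p : Matrix κ κ ℂ) (hp : IsStarProjection p) :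
    K00.trace (K00.cls p hp) = p.trace :=
  (DFunLike.congr_fun (Algebra.GrothendieckAddGroup.lift.symm_apply_apply _) (V.mk _)).trans
    (trace_eq_of_mvN (Proj.mvN_ofEquiv _ p hp)).symm

theorem K00.cls_one {R : Type*} [CStarAlgebra R] (n : ℕ) :
    K00.cls (1 : Matrix (Fin n) (Fin n) R) (.one _) =
      n • K00.cls (1 : Matrix Unit Unit R) (.one _) := by
  induction n with
  | zero => rw [K00.cls_of_isEmpty, zero_smul]
  | succ n ih =>
    rw [succ_nsmul, ← ih, ← K00.cls_fromBlocks]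
    refine K00.cls_submatrix ((Equiv.sumCongr (Equiv.refl _) (Equiv.ofUnique _ _)).trans
      finSumFinEquiv) fun i j => ?_
    rw [Matrix.fromBlocks_one, Matrix.one_apply, Matrix.one_apply]
    simp only [EmbeddingLike.apply_eq_iff_eq]

theorem K00.exists_zsmul_one (x : K00 ℂ) :
    ∃ k : ℤ, x = k • K00.cls (1 : Matrix Unit Unit ℂ) (.one _) := by
  obtain ⟨p, q, rfl⟩ := K00.exists_sub x
  obtain ⟨r, hr⟩ := exists_mvN_one p.isProj
  obtain ⟨s, hs⟩ := exists_mvN_one q.isProj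
  refine ⟨r - s, ?_⟩
  rw [K00.of_eq_cls, K00.of_eq_cls, K00.cls_congr (hq := .one _) hr, K00.cls_congr (hq := .one _) hs,
    K00.cls_one, K00.cls_one, sub_smul, natCast_zsmul, natCast_zsmul]

/-- Projections over `ℂ` with the same class are equivalent. -/
theorem mvN_of_cls_eq {ι κ : Type*} [Fintype ι] [Fintype κ] {p : Matrix ι ι ℂ}
    {q : Matrix κ κ ℂ} (hp : IsStarProjection p) (hq : IsStarProjection q)
    (h : K00.cls p hp = K00.cls q hq) : MvN p q := by
  obtain ⟨r, hr⟩ := exists_mvN_one hp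
  obtain ⟨s, hs⟩ := exists_mvN_one hq
  have h1 := congrArg K00.trace h
  rw [K00.trace_cls, K00.trace_cls, trace_eq_of_mvN hr, trace_eq_of_mvN hs, Matrix.trace_one,
    Matrix.trace_one, Fintype.card_fin, Fintype.card_fin, Nat.cast_inj] at h1
  subst h1
  exact hr.trans hp hq hs.symm

/-- The two characters of ℂ⁺ identify it with ℂ × ℂ. If a difference of classes vanishes under both,
cancellation over ℂ gives a partial isometry for each factor, and the two are glued. -/
theorem K0.toK00_injective : Function.Injective (K0.toK00 ℂ) := by
  rw [injective_iff_map_eq_zero]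
  intro x hx
  obtain ⟨P, Q, hPQ⟩ := K00.exists_sub x.1
  have h1 : K00.map (scalarPart ℂ) x.1 = 0 := x.2
  have h2 : K00.map (unitPart ℂ) x.1 = 0 := hx
  rw [hPQ, map_sub, sub_eq_zero, K00.of_eq_cls, K00.of_eq_cls, K00.map_cls, K00.map_cls] at h1 h2
  obtain ⟨v, hv1, hv2⟩ := mvN_of_cls_eq _ _ h1
  obtain ⟨w, hw1, hw2⟩ := mvN_of_cls_eq _ _ h2
  refine Subtype.ext ?_
  rw [hPQ]
  refine sub_eq_zero.2 (K00.of_eq_of_mvN ?_)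
  have ext {a b : Unitization ℂ ℂ} (h : a.fst = b.fst) (h' : unitPart ℂ a = unitPart ℂ b) :
      a = b := by
    rw [unitPart_apply, unitPart_apply, h] at h'
    exact Unitization.ext h (add_left_cancel h')
  have extM {m n : ℕ} {a b : Matrix (Fin m) (Fin n) (Unitization ℂ ℂ)}
      (h : a.map (scalarPart ℂ) = b.map (scalarPart ℂ))
      (h' : a.map (unitPart ℂ) = b.map (unitPart ℂ)) : a = b := by
    ext1 i j
    exact ext (congrFun₂ h i j) (congrFun₂ h' i j)
  -- The matrix over ℂ⁺ whose images under `scalarPart` and `unitPart` are `v` and `w`.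
  set z : Matrix (Fin Q.size) (Fin P.size) (Unitization ℂ ℂ) :=
    Matrix.of fun i j => Unitization.inl (v i j) + Unitization.inr (w i j - v i j) with hz
  have z1 : z.map (scalarPart ℂ) = v := by
    ext i j
    simp [hz, scalarPart_apply, -Unitization.inr_sub]
  have z2 : z.map (unitPart ℂ) = w := by
    ext i j
    simp [hz, unitPart_apply, -Unitization.inr_sub]
  have hs {m n : ℕ} (a : Matrix (Fin m) (Fin n) (Unitization ℂ ℂ))
      (f : Unitization ℂ ℂ →⋆ₙₐ[ℂ] ℂ) : aᴴ.map f = (a.map f)ᴴ :=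
    Matrix.conjTranspose_map _ (fun x => map_star f x)
  refine ⟨z, extM ?_ ?_, extM ?_ ?_⟩
  · rw [Matrix.map_mul, hs, z1, hv1]
  · rw [Matrix.map_mul, hs, z2, hw1]
  · rw [Matrix.map_mul, hs, z1, hv2]
  · rw [Matrix.map_mul, hs, z2, hw2]

/-- The group `K₀(ℂ)` is generated by the class of the unit. -/
theorem K0.exists_zsmul_unitClass (x : K0 ℂ) : ∃ k : ℤ, x = k • K0.unitClass ℂ := by
  obtain ⟨k, hk⟩ := K00.exists_zsmul_one (K0.toK00 ℂ x)
  refine ⟨k, K0.toK00_injective ?_⟩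
  rw [hk, map_zsmul, K0.unitClass, K0.ofProj_eq_cls, K0.toK00_cls]
  congr 1
  simpa using K00.cls_one (R := ℂ) 1 |>.symm

theorem K0.zsmul_unitClass_eq_zero {k : ℤ} (h : k • K0.unitClass ℂ = 0) : k = 0 := by
  have h1 := congrArg (K00.trace.comp (K0.toK00 ℂ)) h
  rw [map_zsmul, map_zero, AddMonoidHom.comp_apply, K0.unitClass, K0.ofProj_eq_cls, K0.toK00_cls,
    K00.trace_cls] at h1
  simpa using h1

end KTheory

end

open scoped TensorProduct ZeroAtInfty Matrix

noncomputable section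

namespace KTheory

/-! ### Matrix stability -/

/-- The homomorphism `λ ↦ λ e` defined by a projection `e`. -/
def scalOne {B : Type*} [NonUnitalCStarAlgebra B] (e : B) (he : IsStarProjection e) :
    ℂ →⋆ₙₐ[ℂ] B where
  toFun c := c • e
  map_smul' c a := by simp [smul_smul]
  map_zero' := by simp
  map_add' a b := add_smul a b e
  map_mul' a b := by
    have h : e * e = e := he.isIdempotentElem
    rw [smul_mul_smul_comm, h]
  map_star' a := by rw [star_smul, he.isSelfAdjoint.star_eq]

theorem scalOne_apply {B : Type*} [NonUnitalCStarAlgebra B] (e : B) (he : IsStarProjection e)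
    (c : ℂ) : scalOne e he c = c • e := rfl

/-- The homomorphism of `B` onto a corner of a matrix algebra. -/
def cornerHom {κ : Type*} [Fintype κ] [DecidableEq κ] (B : Type*) [NonUnitalCStarAlgebra B]
    (k : κ) : B →⋆ₙₐ[ℂ] Matrix κ κ B where
  toFun b := Matrix.single k k b
  map_smul' c a := by simp
  map_zero' := by simp
  map_add' a b := Matrix.single_add _ _ _ _
  map_mul' a b := by simp
  map_star' a := by simp [Matrix.star_eq_conjTranspose]

/-- The unit matrices. -/
def CMat.unit {κ : Type*} [Fintype κ] [DecidableEq κ] (i j : κ) : CMat κ ℂ :=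
  CMat.ofM κ ℂ (Matrix.single i j 1)

section Unit

variable {κ : Type*} [Fintype κ] [DecidableEq κ]

theorem CMat.star_unit (i j : κ) : star (CMat.unit i j) = CMat.unit j i := by
  rw [CMat.unit, ← map_star, Matrix.star_eq_conjTranspose, Matrix.conjTranspose_single, star_one]
  rfl

theorem CMat.unit_mul_unit (i j k l : κ) :
    CMat.unit i j * CMat.unit k l = if j = k then CMat.unit i l else 0 := by
  rw [CMat.unit, CMat.unit, ← map_mul]
  split_ifs with h
  · subst h
    rw [Matrix.single_mul_single_same, mul_one]
    rfl
  · rw [Matrix.single_mul_single_of_ne _ _ _ _ h, map_zero]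

theorem CMat.isStarProjection_unit (i : κ) : IsStarProjection (CMat.unit i i) where
  isIdempotentElem := by rw [IsIdempotentElem, CMat.unit_mul_unit, if_pos rfl]
  isSelfAdjoint := CMat.star_unit i i

theorem CMat.sum_unit : ∑ i : κ, CMat.unit i i = 1 := by
  refine CMat.ext fun i j => ?_
  rw [map_sum, Matrix.sum_apply]
  change ∑ k, (Matrix.single k k (1 : ℂ)) i j = (1 : Matrix κ κ ℂ) i j
  rw [← Matrix.sum_apply, Matrix.sum_single_one]

theorem CMat.eq_sum_unit (x : CMat κ ℂ) :
    x = ∑ i, ∑ j, (CMat.toM κ ℂ x i j) • CMat.unit i j := by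
  conv_lhs => rw [← CMat.ofM_toM x, Matrix.matrix_eq_sum_single (CMat.toM κ ℂ x)]
  simp only [map_sum, CMat.unit, ← map_smul, Matrix.smul_single, smul_eq_mul, mul_one]

end Unit

namespace MatFunctor

variable (F : MatFunctor.{u, 0}) {B : Type} [NonUnitalCStarAlgebra B] {κ : Type} [Fintype κ]
  [DecidableEq κ]

theorem K_cornerHom (k : κ) (x : K0 (F.obj B)) : F.K (cornerHom B k) x = x := by
  have h : F.K (cornerHom B k) = F.K (sumHom (toMat (NonUnitalStarAlgHom.id ℂ B))
      (0 : B →⋆ₙₐ[ℂ] Matrix {i // i ≠ k} {i // i ≠ k} B)) := by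
    symm
    refine F.K_of_reindex (((Equiv.ofUnique Unit {i // i = k}).sumCongr (Equiv.refl _)).trans
      (Equiv.sumCompl (· = k))) fun b i j => ?_
    rw [sumHom_apply]
    change _ = Matrix.single k k b _ _
    have hd : ((default : {i // i = k}) : κ) = k := (default : {i // i = k}).2
    rcases i with i | i <;> rcases j with j | j
    · simp [toMat, hd]
    · have := Ne.symm j.2
      simp [this]
    · have := Ne.symm i.2
      simp [this]
    · have := Ne.symm j.2
      simp [this]
  rw [h, K_sumHom, K_zero, add_zero, K_id]

/-- Stability: the unit matrix `e_kk` induces an isomorphism, inverse to the identity of `M_κ`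
regarded as a homomorphism into matrices. -/
theorem K_unit_K_toM (k : κ) (y : K0 (F.obj (CMat κ ℂ))) :
    F.K (toMat (scalOne (CMat.unit k k) (CMat.isStarProjection_unit k)))
      (F.K (CMat.toM κ ℂ) y) = y := by
  set φ : CMat κ ℂ →⋆ₙₐ[ℂ] Matrix κ κ (CMat κ ℂ) := reindexHom (Equiv.prodPUnit κ)
    (compHom (CMat.toM κ ℂ) (toMat (scalOne (CMat.unit k k) (CMat.isStarProjection_unit k))))
    with hφ
  have h1 : ∀ b i j, φ b i j = CMat.toM κ ℂ b i j • CMat.unit k k := fun b i j => rfl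
  rw [K_K, ← F.K_reindexHom (Equiv.prodPUnit κ), ← hφ]
  conv_rhs => rw [← F.K_cornerHom k y]
  -- In M_κ ⊗ M_κ the composition is b ↦ b ⊗ e_kk and the corner embedding is b ↦ e_kk ⊗ b. The flip
  -- ∑ e_ij ⊗ e_ji is a self-adjoint unitary that exchanges them.
  refine DFunLike.congr_fun (F.K_conjHom
    (u := (Matrix.of fun i j => CMat.unit j i : Matrix κ κ (CMat κ ℂ))) ?_ ?_ _ _ fun b => ?_) y
  · ext1 i j
    exact CMat.star_unit _ _
  · ext1 i j
    rw [Matrix.mul_apply, Matrix.one_apply]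
    simp only [Matrix.of_apply, CMat.unit_mul_unit]
    split_ifs with h
    · exact CMat.sum_unit
    · simp
  · ext1 i j
    change Matrix.single k k b i j = _
    rw [Matrix.mul_apply]
    simp only [Matrix.mul_apply, Matrix.of_apply, h1, mul_smul_comm, smul_mul_assoc,
      CMat.unit_mul_unit, Finset.sum_mul]
    simp only [ite_mul, zero_mul, CMat.unit_mul_unit, smul_ite, smul_zero]
    rw [Matrix.single_apply]
    by_cases hi : i = k
    · by_cases hj : k = j
      · rw [if_pos ⟨hi.symm, hj⟩]
        simp only [hi, hj, if_true]
        rw [Finset.sum_comm]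
        exact CMat.eq_sum_unit b
      · rw [if_neg fun h => hj h.2]
        simp [hj]
    · rw [if_neg fun h => hi h.1.symm]
      simp [hi]

theorem K_scal_complex {κ : Type} [Fintype κ] {p : Matrix κ κ ℂ} (hp : IsStarProjection p) {r : ℕ}
    (h : MvN p (1 : Matrix (Fin r) (Fin r) ℂ)) (x : K0 (F.obj ℂ)) :
    F.K (scal p hp) x = r • x := by
  rw [F.K_scal_eq hp (.one _) h, ← theta_cls, K00.cls_one, map_nsmul, theta_cls]
  have h1 : scal (1 : Matrix Unit Unit ℂ) (.one _) = toMat (NonUnitalStarAlgHom.id ℂ ℂ) :=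
    matHom_ext fun c i j => by rw [scal_apply]; simp [toMat]
  rw [AddMonoidHom.smul_apply, h1, K_id]

theorem K_toM_K_scalOne {e : CMat κ ℂ} (he : IsStarProjection e) {r : ℕ}
    (h : MvN (CMat.toM κ ℂ e) (1 : Matrix (Fin r) (Fin r) ℂ)) (x : K0 (F.obj ℂ)) :
    F.K (CMat.toM κ ℂ) (F.K (toMat (scalOne e he)) x) = r • x := by
  rw [K_K, ← F.K_scal_complex (CMat.isStarProjection_toM he) h]
  refine DFunLike.congr_fun (F.K_of_reindex (Equiv.punitProd κ) fun c i j => ?_) x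
  rw [compHom_apply, toMat_apply, scalOne_apply, map_smul]
  rfl

/-- A projection of rank r acts as r copies of a minimal one. This can be checked after applying
`CMat.toM`, which is injective on K₀ by stability. -/
theorem K_scalOne {e : CMat κ ℂ} (he : IsStarProjection e) {r : ℕ}
    (h : MvN (CMat.toM κ ℂ e) (1 : Matrix (Fin r) (Fin r) ℂ)) (k : κ) (x : K0 (F.obj ℂ)) :
    F.K (toMat (scalOne e he)) x =
      r • F.K (toMat (scalOne (CMat.unit k k) (CMat.isStarProjection_unit k))) x := by
  rw [← map_nsmul, ← F.K_toM_K_scalOne he h, K_unit_K_toM]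

theorem K_toMat_K_scalOne {C : Type} [NonUnitalCStarAlgebra C] (φ : B →⋆ₙₐ[ℂ] C) {e : B}
    (he : IsStarProjection e) (x : K0 (F.obj ℂ)) :
    F.K (toMat φ) (F.K (toMat (scalOne e he)) x) = F.K (toMat (scalOne (φ e) (he.map φ))) x := by
  rw [K_K]
  refine DFunLike.congr_fun (F.K_of_reindex (Equiv.prodPUnit Unit) fun c i j => ?_) x
  rw [compHom_apply, toMat_apply, toMat_apply, toMat_apply, scalOne_apply, map_smul, scalOne_apply]

end MatFunctor

/-! ### Limits of matrix algebras -/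

/-- A description of `D` as the limit of a sequence of matrix algebras. -/
structure UHFSystem (D : Type) [CStarAlgebra D] where
  n : ℕ → ℕ
  pos : ∀ j, NeZero (n j)
  κ : ∀ j k, j ≤ k → CMat (Fin (n j)) ℂ →⋆ₙₐ[ℂ] CMat (Fin (n k)) ℂ
  ι : ∀ j, CMat (Fin (n j)) ℂ →⋆ₙₐ[ℂ] D
  isIndLim : IsIndLim κ ι
  inj : ∀ j, Function.Injective (ι j)
  map_one : ∀ j, ι j 1 = 1

attribute [instance] UHFSystem.pos

namespace UHFSystem

variable {D : Type} [CStarAlgebra D] (S : UHFSystem D) (F : MatFunctor.{u, 0})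

/-- The image in `D` of a minimal projection of the `j`-th matrix algebra. -/
def e (j : ℕ) : D := S.ι j (CMat.unit 0 0)

theorem isStarProjection_e (j : ℕ) : IsStarProjection (S.e j) :=
  (CMat.isStarProjection_unit 0).map (S.ι j)

/-- The rank in the `k`-th matrix algebra of a minimal projection of the `j`-th one. -/
def r (j k : ℕ) (h : j ≤ k) : ℕ :=
  (exists_mvN_one (CMat.isStarProjection_toM
    ((CMat.isStarProjection_unit (0 : Fin (S.n j))).map (S.κ j k h)))).choose

theorem mvN_r (j k : ℕ) (h : j ≤ k) : MvN (CMat.toM _ _ (S.κ j k h (CMat.unit 0 0)))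
    (1 : Matrix (Fin (S.r j k h)) (Fin (S.r j k h)) ℂ) :=
  (exists_mvN_one (CMat.isStarProjection_toM
    ((CMat.isStarProjection_unit (0 : Fin (S.n j))).map (S.κ j k h)))).choose_spec

/-- Rank 0 would make the minimal projection vanish in `D`, against injectivity. -/
theorem r_ne_zero (j k : ℕ) (h : j ≤ k) : S.r j k h ≠ 0 := by
  intro h0
  obtain ⟨v, hv, -⟩ := S.mvN_r j k h
  have h1 : CMat.toM _ _ (S.κ j k h (CMat.unit 0 0)) = 0 := by
    rw [← hv]
    ext a b
    rw [Matrix.mul_apply]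
    refine Finset.sum_eq_zero fun i _ => ?_
    exact absurd i.2 (by omega)
  have h2 : S.κ j k h (CMat.unit 0 0) = 0 := CMat.ext fun a b => by rw [h1, map_zero]
  have h3 : S.ι j (CMat.unit 0 0) = 0 := by rw [← S.isIndLim.ι_κ j k h, h2, map_zero]
  have h4 : CMat.unit (0 : Fin (S.n j)) 0 = 0 := S.inj j (by rw [h3, map_zero])
  have h5 := congrFun₂ (congrArg (CMat.toM _ _) h4) 0 0
  have h6 : (Matrix.single (0 : Fin (S.n j)) (0 : Fin (S.n j)) (1 : ℂ)) 0 0 = 0 := h5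
  simp at h6

/-- The map `F(λ ↦ λ e_j)`. -/
def J (j : ℕ) : K0 (F.obj ℂ) →+ K0 (F.obj D) :=
  F.K (toMat (scalOne (S.e j) (S.isStarProjection_e j)))

/-- A minimal projection of the j-th algebra has rank `S.r j k h` in the k-th one. Together with the
next two statements this describes K₀(F D) as the limit of copies of K₀(F ℂ) under multiplication by
these ranks. -/
theorem J_eq (j k : ℕ) (h : j ≤ k) (x : K0 (F.obj ℂ)) : S.J F j x = S.r j k h • S.J F k x := by
  have h1 : S.J F j x = F.K (toMat (scalOne (S.ι k (S.κ j k h (CMat.unit 0 0)))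
      (((CMat.isStarProjection_unit 0).map _).map _))) x := by
    rw [J]
    congr 4
    exact (S.isIndLim.ι_κ j k h _).symm
  rw [h1, ← F.K_toMat_K_scalOne (S.ι k) ((CMat.isStarProjection_unit 0).map (S.κ j k h)),
    F.K_scalOne _ (S.mvN_r j k h) 0, map_nsmul,
    F.K_toMat_K_scalOne]
  rfl

/-- Continuity of K₀ lifts `y` to a matrix algebra, and stability moves it to ℂ. -/
theorem exists_J_eq (y : K0 (F.obj D)) : ∃ j x, S.J F j x = y := by
  obtain ⟨j, z, hz⟩ := (F.isIndLim S.isIndLim S.inj).exists_K0_map_eq y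
  refine ⟨j, F.K (CMat.toM _ _) z, ?_⟩
  rw [← F.K_toMat] at hz
  rw [J, ← hz]
  conv_rhs => rw [← F.K_unit_K_toM 0 z, F.K_toMat_K_scalOne]
  rfl

/-- By continuity of K₀ the class already vanishes in some later matrix algebra, where stability
turns it into a multiple of `x`. -/
theorem exists_smul_eq_zero {j : ℕ} {x : K0 (F.obj ℂ)} (hx : S.J F j x = 0) :
    ∃ k h, S.r j k h • x = 0 := by
  have h1 : K0.map (ofMat (F.map (toMat (S.ι j))))
      (F.K (toMat (scalOne (CMat.unit (0 : Fin (S.n j)) 0) (CMat.isStarProjection_unit 0))) x) =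
      0 := by
    rw [← F.K_toMat, F.K_toMat_K_scalOne]
    exact hx
  obtain ⟨k, h, hk⟩ := (F.isIndLim S.isIndLim S.inj).exists_K0_map_eq_zero _ h1
  refine ⟨k, h, ?_⟩
  rw [← F.K_toMat, F.K_toMat_K_scalOne] at hk
  rw [← F.K_toM_K_scalOne ((CMat.isStarProjection_unit 0).map _) (S.mvN_r j k h), hk, map_zero]

theorem K_one (j : ℕ) (x : K0 (F.obj ℂ)) :
    F.K (toMat (scalOne (1 : D) (.one _))) x = S.n j • S.J F j x := by
  have h1 : F.K (toMat (scalOne (1 : D) (.one _))) x =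
      F.K (toMat (scalOne (S.ι j 1) (IsStarProjection.map (.one _) _))) x := by
    congr 4
    exact (S.map_one j).symm
  rw [h1, ← F.K_toMat_K_scalOne (S.ι j) (.one _), F.K_scalOne (r := S.n j) _ ?_ 0, map_nsmul,
    F.K_toMat_K_scalOne]
  · rfl
  · exact mvN_refl (.one _)

end UHFSystem

end KTheory

end

open scoped TensorProduct ZeroAtInfty Matrix

noncomputable section

namespace KTheory

/-! ### Inductive limits of nested subalgebras -/

section Nested

variable {C C' D : Type*} [NonUnitalCStarAlgebra C] [NonUnitalCStarAlgebra C']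
  [NonUnitalCStarAlgebra D]

/-- The homomorphism `φ'⁻¹ ∘ φ`, where `φ'` is injective and the range of `φ` is contained in the
range of `φ'`. -/
def factorHom (φ : C →⋆ₙₐ[ℂ] D) (φ' : C' →⋆ₙₐ[ℂ] D) (hφ' : Function.Injective φ')
    (h : ∀ x, ∃ y, φ' y = φ x) : C →⋆ₙₐ[ℂ] C' where
  toFun x := (h x).choose
  map_smul' c x := hφ' <| by
    rw [(h (c • x)).choose_spec, map_smul, map_smul, (h x).choose_spec]
    rfl
  map_zero' := hφ' <| by rw [(h 0).choose_spec, map_zero, map_zero]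
  map_add' x y := hφ' <| by
    rw [(h (x + y)).choose_spec, map_add, map_add, (h x).choose_spec, (h y).choose_spec]
  map_mul' x y := hφ' <| by
    rw [(h (x * y)).choose_spec, map_mul, map_mul, (h x).choose_spec, (h y).choose_spec]
  map_star' x := hφ' <| by
    rw [(h (star x)).choose_spec, map_star, map_star, (h x).choose_spec]

theorem apply_factorHom (φ : C →⋆ₙₐ[ℂ] D) (φ' : C' →⋆ₙₐ[ℂ] D) (hφ' : Function.Injective φ')
    (h : ∀ x, ∃ y, φ' y = φ x) (x : C) : φ' (factorHom φ φ' hφ' h x) = φ x := (h x).choose_spec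

/-- For injective embeddings the condition on kernels is empty, so nesting and density suffice; the
connecting maps are reconstructed from the embeddings. -/
theorem isIndLim_of_nested {C : ℕ → Type*} [∀ j, NonUnitalCStarAlgebra (C j)]
    (ι : ∀ j, C j →⋆ₙₐ[ℂ] D) (hι : ∀ j, Function.Injective (ι j))
    (h : ∀ j k, j ≤ k → ∀ x, ∃ y, ι k y = ι j x)
    (hd : ∀ d ε, 0 < ε → ∃ j c, ‖ι j c - d‖ < ε) :
    IsIndLim (fun j k hjk => factorHom (ι j) (ι k) (hι k) (h j k hjk)) ι where
  ι_κ j k hjk x := apply_factorHom _ _ _ _ _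
  κ_κ i j k h h' x := hι k <| by
    rw [apply_factorHom, apply_factorHom, apply_factorHom]
  dense := hd
  ker j x hx ε hε := ⟨j, le_rfl, by
    rw [hι j (hx.trans (map_zero _).symm), map_zero, norm_zero]
    exact hε⟩

end Nested

end KTheory

/-! ### UHF algebras as limits of matrix algebras -/

namespace UHF

open KTheory ContinuousLinearMap

theorem inner_e (i : ℕ) (x : HilbertSpaceNat) : inner ℂ (e i) x = x i := by
  rw [e, lp.inner_single_left]
  simp

theorem e_apply (i j : ℕ) : (e i : ℕ → ℂ) j = if j = i then 1 else 0 := by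
  rw [e, lp.single_apply]
  simp [Pi.single_apply]

theorem orthonormal_e : Orthonormal ℂ e := by
  rw [orthonormal_iff_ite]
  intro i j
  rw [inner_e, e_apply]

theorem dense_span_e : Dense (Submodule.span ℂ (Set.range e) : Set HilbertSpaceNat) := by
  set b := HilbertBasis.ofRepr (LinearIsometryEquiv.refl ℂ HilbertSpaceNat) with hb
  have h := b.dense_span
  rw [← Submodule.dense_iff_topologicalClosure_eq_top,
    show ⇑b = e from funext fun i => (b.repr_symm_single i).symm] at h
  exact h

theorem op_ext {S T : HilbertSpaceNat →L[ℂ] HilbertSpaceNat} (h : ∀ j, S (e j) = T (e j)) :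
    S = T := by
  refine ContinuousLinearMap.ext_on dense_span_e ?_
  rintro _ ⟨j, rfl⟩
  exact h j

theorem op_ext_inner {S T : HilbertSpaceNat →L[ℂ] HilbertSpaceNat}
    (h : ∀ i j, inner ℂ (e i) (S (e j)) = inner ℂ (e i) (T (e j))) : S = T :=
  op_ext fun j => lp.ext (funext fun i => by rw [← inner_e, h, inner_e])

theorem orthonormal_block (n : ℕ) [NeZero n] (a : ℕ) : Orthonormal ℂ fun q => e (q * n + a) :=
  orthonormal_e.comp _ fun p q h => by
    have h' : p * n + a = q * n + a := h
    exact Nat.eq_of_mul_eq_mul_right (Nat.pos_of_neZero n) (by omega)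

/-- The isometry `e q ↦ e (q n + a)`. -/
def V (n : ℕ) [NeZero n] (a : ℕ) : HilbertSpaceNat →L[ℂ] HilbertSpaceNat :=
  (orthonormal_block n a).orthogonalFamily.linearIsometry.toContinuousLinearMap

theorem V_e (n : ℕ) [NeZero n] (a q : ℕ) : V n a (e q) = e (q * n + a) := by
  refine ((orthonormal_block n a).orthogonalFamily.linearIsometry_apply_single _).trans ?_
  simp

theorem star_V_e (n : ℕ) [NeZero n] (a : Fin n) (i : ℕ) :
    star (V n a) (e i) = if i % n = a then e (i / n) else 0 := by
  refine lp.ext (funext fun q => ?_)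
  rw [← inner_e, ContinuousLinearMap.star_eq_adjoint, ContinuousLinearMap.adjoint_inner_right, V_e,
    inner_e, e_apply]
  have hn := Nat.pos_of_neZero n
  by_cases h : i % n = a
  · rw [if_pos h, e_apply]
    refine if_congr ⟨fun h' => ?_, fun h' => ?_⟩ rfl rfl
    · rw [← h', Nat.add_comm, Nat.add_mul_div_right _ _ hn, Nat.div_eq_of_lt a.2, Nat.zero_add]
    · rw [h', ← h, Nat.mul_comm]
      exact Nat.div_add_mod i n
  · rw [if_neg h, if_neg]
    · rfl
    · rintro rfl
      exact h (Nat.mul_add_mod_of_lt a.2)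

/-- The block diagonal operator `x ⊗ 1 = diag(x, x, …)`. -/
def blockOp (n : ℕ) [NeZero n] (x : Matrix (Fin n) (Fin n) ℂ) :
    HilbertSpaceNat →L[ℂ] HilbertSpaceNat :=
  ∑ a, ∑ b, x a b • (V n a * star (V n b))

/-- The class of a natural number modulo `n`. -/
def modFin (n : ℕ) [NeZero n] (i : ℕ) : Fin n := ⟨i % n, Nat.mod_lt _ (Nat.pos_of_neZero n)⟩

theorem blockOp_e (n : ℕ) [NeZero n] (x : Matrix (Fin n) (Fin n) ℂ) (j : ℕ) :
    blockOp n x (e j) = ∑ a : Fin n, x a (modFin n j) • e (j / n * n + a) := by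
  rw [blockOp, _root_.sum_apply]
  refine Finset.sum_congr rfl fun a _ => ?_
  rw [_root_.sum_apply, Finset.sum_eq_single (modFin n j)]
  · rw [_root_.smul_apply, mul_apply_eq_comp, star_V_e,
      if_pos (show j % n = (modFin n j : ℕ) from rfl), V_e]
  · intro b _ hb
    rw [_root_.smul_apply, mul_apply_eq_comp, star_V_e, if_neg, map_zero, smul_zero]
    exact fun h => hb (Fin.ext h.symm)
  · simp

theorem inner_blockOp (n : ℕ) [NeZero n] (x : Matrix (Fin n) (Fin n) ℂ) (i j : ℕ) :
    inner ℂ (e i) (blockOp n x (e j)) =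
      if i / n = j / n then x (modFin n i) (modFin n j) else 0 := by
  have hn := Nat.pos_of_neZero n
  rw [blockOp_e, inner_sum]
  simp only [inner_smul_right, inner_e, e_apply]
  split_ifs with h
  · rw [Finset.sum_eq_single (modFin n i)]
    · rw [if_pos, mul_one]
      rw [← h, Nat.mul_comm]
      exact (Nat.div_add_mod i n).symm
    · intro a _ ha
      rw [if_neg, mul_zero]
      rintro rfl
      exact ha (Fin.ext (Nat.mul_add_mod_of_lt a.2).symm)
    · simp
  · refine Finset.sum_eq_zero fun a _ => ?_
    rw [if_neg, mul_zero]
    rintro rfl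
    apply h
    rw [Nat.add_comm, Nat.add_mul_div_right _ _ hn, Nat.div_eq_of_lt a.2, Nat.zero_add]

theorem blockOp_mul (n : ℕ) [NeZero n] (x y : Matrix (Fin n) (Fin n) ℂ) :
    blockOp n (x * y) = blockOp n x * blockOp n y := by
  have hn := Nat.pos_of_neZero n
  refine op_ext fun j => ?_
  rw [mul_apply_eq_comp, blockOp_e, blockOp_e, map_sum]
  have h (a : Fin n) : blockOp n x (y a (modFin n j) • e (j / n * n + a)) =
      ∑ c : Fin n, (x c a * y a (modFin n j)) • e (j / n * n + c) := by
    rw [map_smul, blockOp_e, Finset.smul_sum]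
    refine Finset.sum_congr rfl fun c _ => ?_
    have h1 : modFin n (j / n * n + a) = a := Fin.ext (Nat.mul_add_mod_of_lt a.2)
    have h2 : (j / n * n + a) / n = j / n := by
      rw [Nat.add_comm, Nat.add_mul_div_right _ _ hn, Nat.div_eq_of_lt a.2, Nat.zero_add]
    rw [h1, h2, smul_smul, mul_comm]
  simp only [h]
  rw [Finset.sum_comm]
  refine Finset.sum_congr rfl fun c _ => ?_
  rw [Matrix.mul_apply, Finset.sum_smul]

/-- The representation of `M_n(ℂ)` by block diagonal operators. -/
def blockHom (n : ℕ) [NeZero n] :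
    CMat (Fin n) ℂ →⋆ₙₐ[ℂ] (HilbertSpaceNat →L[ℂ] HilbertSpaceNat) where
  toFun x := blockOp n (CMat.toM _ _ x)
  map_smul' c x := by
    simp only [blockOp, map_smul, Matrix.smul_apply, smul_eq_mul, mul_smul, Finset.smul_sum]
    rfl
  map_zero' := by simp [blockOp]
  map_add' x y := by
    simp only [blockOp, map_add, Matrix.add_apply, add_smul, Finset.sum_add_distrib]
  map_mul' x y := by rw [map_mul, blockOp_mul]
  map_star' x := by
    simp only [blockOp, map_star, Matrix.star_apply, star_sum, star_smul, star_mul, star_star]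
    rw [Finset.sum_comm]

theorem inner_blockHom (n : ℕ) [NeZero n] (x : CMat (Fin n) ℂ) (i j : ℕ) :
    inner ℂ (e i) (blockHom n x (e j)) =
      if i / n = j / n then CMat.toM _ _ x (modFin n i) (modFin n j) else 0 :=
  inner_blockOp n _ i j

theorem blockHom_one (n : ℕ) [NeZero n] : blockHom n 1 = 1 := by
  refine op_ext_inner fun i j => ?_
  rw [inner_blockHom, one_apply_eq_self, inner_e, e_apply]
  change (if i / n = j / n then (1 : Matrix (Fin n) (Fin n) ℂ) (modFin n i) (modFin n j) else 0) = _
  rw [Matrix.one_apply]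
  by_cases h : i = j
  · simp [h]
  · rw [if_neg h]
    split_ifs with h1 h2
    · have h3 : i % n = j % n := congrArg Fin.val h2
      exact absurd (by rw [← Nat.div_add_mod i n, ← Nat.div_add_mod j n, h1, h3]) h
    · rfl
    · rfl

theorem blockHom_injective (n : ℕ) [NeZero n] : Function.Injective (blockHom n) := by
  intro x y h
  refine CMat.ext fun i j => ?_
  have h1 := inner_blockHom n x i j
  rw [h, inner_blockHom] at h1
  have h2 (a : Fin n) : modFin n a = a := Fin.ext (Nat.mod_eq_of_lt a.2)
  simpa [h2, Nat.div_eq_of_lt i.2, Nat.div_eq_of_lt j.2] using h1.symm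

theorem isBlockDiagonal_blockHom (n : ℕ) [NeZero n] (x : CMat (Fin n) ℂ) :
    IsBlockDiagonal n (blockHom n x) := by
  intro i j
  rw [inner_blockHom, inner_blockHom]
  have hn := Nat.pos_of_neZero n
  have h (a : ℕ) : modFin n (a % n) = modFin n a := Fin.ext (Nat.mod_mod a n)
  rw [h, h, Nat.div_eq_of_lt (Nat.mod_lt i hn), Nat.div_eq_of_lt (Nat.mod_lt j hn), if_pos rfl]

theorem IsBlockDiagonal.exists_eq {n : ℕ} [NeZero n] {T : HilbertSpaceNat →L[ℂ] HilbertSpaceNat}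
    (hT : IsBlockDiagonal n T) : ∃ x, blockHom n x = T := by
  refine ⟨CMat.ofM _ _ (Matrix.of fun a b => inner ℂ (e a) (T (e b))), op_ext_inner fun i j => ?_⟩
  rw [inner_blockHom, hT i j]
  rfl

/-- A block of length nd consists of d consecutive blocks of length n; both indices are reduced
modulo nd and their n-blocks compared. -/
theorem IsBlockDiagonal.of_dvd {n m : ℕ} (h : n ∣ m)
    {T : HilbertSpaceNat →L[ℂ] HilbertSpaceNat} (hT : IsBlockDiagonal n T) :
    IsBlockDiagonal m T := by
  intro i j
  obtain ⟨d, rfl⟩ := h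
  rw [hT i j, hT (i % (n * d)) (j % (n * d)), Nat.mod_mul_right_mod, Nat.mod_mul_right_mod,
    Nat.mod_mul_right_div_self, Nat.mod_mul_right_div_self, ← Nat.div_div_eq_div_mul,
    ← Nat.div_div_eq_div_mul]
  by_cases h : i / n = j / n
  · simp [h]
  · rw [if_neg h]
    split_ifs with h1 h2
    · exact absurd (by rw [← Nat.div_add_mod (i / n) d, ← Nat.div_add_mod (j / n) d, h1, h2]) h
    · rfl
    · rfl

end UHF

/-! ### Divisors of supernatural numbers -/

namespace Supernatural

theorem dvd_one (𝔭 : Supernatural) : Dvd 1 𝔭 := ⟨one_ne_zero, fun ℓ => by simp⟩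

theorem Dvd.lcm {𝔭 : Supernatural} {m n : ℕ} (hm : Dvd m 𝔭) (hn : Dvd n 𝔭) :
    Dvd (Nat.lcm m n) 𝔭 := by
  refine ⟨Nat.lcm_ne_zero hm.1 hn.1, fun ℓ => ?_⟩
  rw [Nat.factorization_lcm hm.1 hn.1, Finsupp.sup_apply]
  rcases le_total (m.factorization ℓ) (n.factorization ℓ) with h | h
  · rw [sup_eq_right.2 h]
    exact hn.2 ℓ
  · rw [sup_eq_left.2 h]
    exact hm.2 ℓ

open Classical in
/-- The least common multiple of the divisors of `𝔭` up to `j`. -/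
def level (𝔭 : Supernatural) (j : ℕ) : ℕ := ((Finset.range (j + 1)).filter (Dvd · 𝔭)).lcm id

theorem dvd_lcm {𝔭 : Supernatural} (s : Finset ℕ) (hs : ∀ n ∈ s, Dvd n 𝔭) :
    Dvd (s.lcm id) 𝔭 := by
  classical
  induction s using Finset.induction_on with
  | empty => rw [Finset.lcm_empty]; exact dvd_one 𝔭
  | insert a s _ ih =>
    rw [Finset.lcm_insert]
    exact Dvd.lcm (hs a (Finset.mem_insert_self a s))
      (ih fun n hn => hs n (Finset.mem_insert_of_mem hn))

theorem dvd_level (𝔭 : Supernatural) (j : ℕ) : Dvd (level 𝔭 j) 𝔭 := by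
  classical
  exact dvd_lcm _ fun _ hn => (Finset.mem_filter.1 hn).2

theorem Dvd.dvd_level {𝔭 : Supernatural} {n : ℕ} (h : Dvd n 𝔭) : n ∣ level 𝔭 n := by
  classical
  rw [level]
  exact Finset.dvd_lcm (f := id) (Finset.mem_filter.2 ⟨Finset.mem_range.2 n.lt_succ_self, h⟩)

theorem level_dvd_level (𝔭 : Supernatural) {j k : ℕ} (h : j ≤ k) : level 𝔭 j ∣ level 𝔭 k := by
  classical
  rw [level, level]
  exact Finset.lcm_mono (Finset.filter_subset_filter _ (Finset.range_subset_range.2 (by omega)))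

instance (𝔭 : Supernatural) (j : ℕ) : NeZero (level 𝔭 j) := ⟨(dvd_level 𝔭 j).1⟩

/-- Divisors of relatively prime supernatural numbers are relatively prime. -/
theorem Coprime.coprime {𝔭 𝔮 : Supernatural} (h : Coprime 𝔭 𝔮) {m n : ℕ} (hm : Dvd m 𝔭)
    (hn : Dvd n 𝔮) : Nat.Coprime m n := by
  by_contra hmn
  obtain ⟨p, hp, hpm, hpn⟩ := Nat.Prime.not_coprime_iff_dvd.1 hmn
  have key {n : ℕ} {𝔯 : Supernatural} (hn : Dvd n 𝔯) (hpn : p ∣ n) : 𝔯 ⟨p, hp⟩ ≠ 0 := by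
    intro h0
    have h1 := hn.2 ⟨p, hp⟩
    rw [h0] at h1
    have h2 : n.factorization p = 0 := by simpa using h1
    exact (hp.factorization_pos_of_dvd hn.1 hpn).ne' h2
  exact (h ⟨p, hp⟩).elim (key hm hpm) (key hn hpn)

end Supernatural

/-! ### The increasing sequence of matrix algebras in M_𝔭 -/

namespace UHF

open KTheory

variable (𝔭 : Supernatural)

/-- The embedding of `M_n(ℂ)` in `M_𝔭`. -/
def ofBlock (n : ℕ) [NeZero n] (hn : Supernatural.Dvd n 𝔭) : CMat (Fin n) ℂ →⋆ₙₐ[ℂ] UHF 𝔭 where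
  toFun x := ⟨blockHom n x, StarSubalgebra.le_topologicalClosure _
    (StarAlgebra.subset_adjoin ℂ _ ⟨n, hn, isBlockDiagonal_blockHom n x⟩)⟩
  map_smul' c x := rep_injective 𝔭 (map_smul (blockHom n) c x)
  map_zero' := rep_injective 𝔭 (map_zero (blockHom n))
  map_add' x y := rep_injective 𝔭 (map_add (blockHom n) x y)
  map_mul' x y := rep_injective 𝔭 (map_mul (blockHom n) x y)
  map_star' x := rep_injective 𝔭 (map_star (blockHom n) x)

theorem rep_ofBlock (n : ℕ) [NeZero n] (hn : Supernatural.Dvd n 𝔭) (x : CMat (Fin n) ℂ) :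
    rep 𝔭 (ofBlock 𝔭 n hn x) = blockHom n x := rfl

theorem ofBlock_injective (n : ℕ) [NeZero n] (hn : Supernatural.Dvd n 𝔭) :
    Function.Injective (ofBlock 𝔭 n hn) := fun _ _ h =>
  blockHom_injective n (congrArg (rep 𝔭) h)

theorem ofBlock_one (n : ℕ) [NeZero n] (hn : Supernatural.Dvd n 𝔭) : ofBlock 𝔭 n hn 1 = 1 :=
  rep_injective 𝔭 <| by rw [rep_ofBlock, blockHom_one, map_one]

theorem exists_ofBlock_eq {n m : ℕ} [NeZero n] [NeZero m] (hn : Supernatural.Dvd n 𝔭)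
    (hm : Supernatural.Dvd m 𝔭) (h : n ∣ m) (x : CMat (Fin n) ℂ) :
    ∃ y, ofBlock 𝔭 m hm y = ofBlock 𝔭 n hn x := by
  obtain ⟨y, hy⟩ := ((isBlockDiagonal_blockHom n x).of_dvd h).exists_eq
  exact ⟨y, rep_injective 𝔭 hy⟩

/-- The embedding of the `j`-th matrix algebra. -/
def ι (j : ℕ) : CMat (Fin (𝔭.level j)) ℂ →⋆ₙₐ[ℂ] UHF 𝔭 := ofBlock 𝔭 _ (𝔭.dvd_level j)

theorem exists_ι_eq (j k : ℕ) (h : j ≤ k) (x) : ∃ y, ι 𝔭 k y = ι 𝔭 j x :=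
  exists_ofBlock_eq 𝔭 _ _ (𝔭.level_dvd_level h) x

/-- Every divisor n of 𝔭 divides `level 𝔭 n`, and the levels divide each other in turn. The union of
the matrix algebras is thus already a *-algebra, so passing to the generated algebra adds nothing
before the closure is taken. -/
theorem exists_norm_ι_sub_lt (d : UHF 𝔭) (ε : ℝ) (hε : 0 < ε) : ∃ j c, ‖ι 𝔭 j c - d‖ < ε := by
  have h1 : (d.1 : HilbertSpaceNat →L[ℂ] HilbertSpaceNat) ∈ closure
      (StarAlgebra.adjoin ℂ {T | ∃ n, Supernatural.Dvd n 𝔭 ∧ IsBlockDiagonal n T} :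
        Set (HilbertSpaceNat →L[ℂ] HilbertSpaceNat)) := d.2
  have h2 (T) (hT : T ∈ StarAlgebra.adjoin ℂ {T | ∃ n, Supernatural.Dvd n 𝔭 ∧ IsBlockDiagonal n T}) :
      ∃ j c, rep 𝔭 (ι 𝔭 j c) = T := by
    induction hT using StarAlgebra.adjoin_induction with
    | mem T hT =>
      obtain ⟨n, hn, hT⟩ := hT
      obtain ⟨y, hy⟩ := (hT.of_dvd hn.dvd_level).exists_eq
      exact ⟨n, y, hy⟩
    | algebraMap c =>
      exact ⟨0, c • 1, by
        rw [map_smul, map_smul, ι, ofBlock_one, map_one, Algebra.algebraMap_eq_smul_one]⟩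
    | add S T _ _ hS hT =>
      obtain ⟨j, x, rfl⟩ := hS
      obtain ⟨k, y, rfl⟩ := hT
      obtain ⟨x', hx'⟩ := exists_ι_eq 𝔭 j (max j k) (le_max_left _ _) x
      obtain ⟨y', hy'⟩ := exists_ι_eq 𝔭 k (max j k) (le_max_right _ _) y
      exact ⟨_, x' + y', by rw [map_add, hx', hy', map_add]⟩
    | mul S T _ _ hS hT =>
      obtain ⟨j, x, rfl⟩ := hS
      obtain ⟨k, y, rfl⟩ := hT
      obtain ⟨x', hx'⟩ := exists_ι_eq 𝔭 j (max j k) (le_max_left _ _) x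
      obtain ⟨y', hy'⟩ := exists_ι_eq 𝔭 k (max j k) (le_max_right _ _) y
      exact ⟨_, x' * y', by rw [map_mul, hx', hy', map_mul]⟩
    | star S _ hS =>
      obtain ⟨j, x, rfl⟩ := hS
      exact ⟨j, star x, by rw [map_star, map_star]⟩
  obtain ⟨T, hT, hd⟩ := Metric.mem_closure_iff.1 h1 ε hε
  obtain ⟨j, c, rfl⟩ := h2 T hT
  refine ⟨j, c, ?_⟩
  rw [dist_comm, dist_eq_norm] at hd
  exact hd

/-- The description of `M_𝔭` as a limit of matrix algebras. -/
def system : UHFSystem (UHF 𝔭) where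
  n := 𝔭.level
  pos _ := inferInstance
  κ j k h := factorHom (ι 𝔭 j) (ι 𝔭 k) (ofBlock_injective 𝔭 _ _) (exists_ι_eq 𝔭 j k h)
  ι := ι 𝔭
  isIndLim := isIndLim_of_nested (ι 𝔭) (fun _ => ofBlock_injective 𝔭 _ _) (exists_ι_eq 𝔭)
    (exists_norm_ι_sub_lt 𝔭)
  inj _ := ofBlock_injective 𝔭 _ _
  map_one _ := ofBlock_one 𝔭 _ _

end UHF

end

open scoped TensorProduct ZeroAtInfty Matrix unitInterval

noncomputable section

namespace KTheory

/-! ### Algebras of functions on the interval with commutation conditions at the endpoints -/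

section Lift

variable {A C Z : Type*} [NonUnitalCStarAlgebra A] [NonUnitalCStarAlgebra C]
  [NonUnitalCStarAlgebra Z] {κ : Type*} [Fintype κ]

/-- The corestriction of a homomorphism into `M_κ(C)` to a subalgebra of `C`. -/
def matLift (inc : Z →⋆ₙₐ[ℂ] C) (hinc : Function.Injective inc) (φ : A →⋆ₙₐ[ℂ] Matrix κ κ C)
    (h : ∀ a i j, ∃ z, inc z = φ a i j) : A →⋆ₙₐ[ℂ] Matrix κ κ Z where
  toFun a := Matrix.of fun i j => (h a i j).choose
  map_smul' c a := Matrix.ext fun i j => hinc <| by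
    rw [Matrix.of_apply, (h (c • a) i j).choose_spec, map_smul, Matrix.smul_apply,
      Matrix.smul_apply, Matrix.of_apply, map_smul, (h a i j).choose_spec]
    rfl
  map_zero' := Matrix.ext fun i j => hinc <| by
    rw [Matrix.of_apply, (h 0 i j).choose_spec, map_zero, Matrix.zero_apply, Matrix.zero_apply,
      map_zero]
  map_add' a b := Matrix.ext fun i j => hinc <| by
    rw [Matrix.of_apply, (h (a + b) i j).choose_spec, map_add, Matrix.add_apply,
      Matrix.add_apply, Matrix.of_apply, Matrix.of_apply, map_add, (h a i j).choose_spec,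
      (h b i j).choose_spec]
  map_mul' a b := Matrix.ext fun i j => hinc <| by
    rw [Matrix.of_apply, (h (a * b) i j).choose_spec, map_mul, Matrix.mul_apply,
      Matrix.mul_apply, map_sum]
    refine Finset.sum_congr rfl fun k _ => ?_
    rw [Matrix.of_apply, Matrix.of_apply, map_mul, (h a i k).choose_spec, (h b k j).choose_spec]
  map_star' a := Matrix.ext fun i j => hinc <| by
    rw [Matrix.of_apply, (h (star a) i j).choose_spec, map_star, Matrix.star_apply,
      Matrix.star_apply, Matrix.of_apply, map_star, (h a j i).choose_spec]

theorem apply_matLift (inc : Z →⋆ₙₐ[ℂ] C) (hinc : Function.Injective inc)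
    (φ : A →⋆ₙₐ[ℂ] Matrix κ κ C) (h : ∀ a i j, ∃ z, inc z = φ a i j) (a : A) (i j : κ) :
    inc (matLift inc hinc φ h a i j) = φ a i j := (h a i j).choose_spec

theorem continuous_of_comp_injective {X : Type*} [TopologicalSpace X] (inc : Z →⋆ₙₐ[ℂ] C)
    (hinc : Function.Injective inc) {f : X → Z} (hf : Continuous fun x => inc (f x)) :
    Continuous f :=
  (NonUnitalStarAlgHom.isometry inc hinc).isUniformInducing.isInducing.continuous_iff.2 hf

/-- A continuous family of homomorphisms, as a homomorphism into continuous functions. -/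
def familyHom {Y : Type*} [TopologicalSpace Y] [CompactSpace Y] (χ : Y → A →⋆ₙₐ[ℂ] Matrix κ κ C)
    (hχ : ∀ a i j, Continuous fun t => χ t a i j) : A →⋆ₙₐ[ℂ] Matrix κ κ C(Y, C) where
  toFun a := Matrix.of fun i j => ⟨fun t => χ t a i j, hχ a i j⟩
  map_smul' c a := Matrix.ext fun i j => ContinuousMap.ext fun t => by
    exact congrFun₂ (map_smul (χ t) c a) i j
  map_zero' := Matrix.ext fun i j => ContinuousMap.ext fun t => by
    exact congrFun₂ (map_zero (χ t)) i j
  map_add' a b := Matrix.ext fun i j => ContinuousMap.ext fun t => by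
    exact congrFun₂ (map_add (χ t) a b) i j
  map_mul' a b := Matrix.ext fun i j => ContinuousMap.ext fun t => by
    refine (congrFun₂ (map_mul (χ t) a b) i j).trans ?_
    rw [Matrix.mul_apply, Matrix.mul_apply, ContinuousMap.sum_apply]
    rfl
  map_star' a := Matrix.ext fun i j => ContinuousMap.ext fun t => by
    exact congrFun₂ (map_star (χ t) a) i j

end Lift

/-! ### Flip and contraction in dimension drop algebras -/

section Drop

variable {κ : Type} [Fintype κ] [DecidableEq κ] {T Z : Type} [CStarAlgebra T]
  [NonUnitalCStarAlgebra Z]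

/-- The self-adjoint unitary that flips `M_κ` with a copy of `M_κ` in `T`. -/
def flip (L : CMat κ ℂ →⋆ₙₐ[ℂ] T) : Matrix κ κ T := Matrix.of fun i j => L (CMat.unit j i)

variable (L : CMat κ ℂ →⋆ₙₐ[ℂ] T)

theorem flip_conjTranspose : (flip L)ᴴ = flip L := by
  ext1 i j
  change star (L (CMat.unit i j)) = L (CMat.unit j i)
  rw [← map_star, CMat.star_unit]

theorem flip_mul_flip (hL : L 1 = 1) : flip L * flip L = 1 := by
  ext1 i j
  rw [Matrix.mul_apply, Matrix.one_apply]
  simp only [flip, Matrix.of_apply, ← map_mul, CMat.unit_mul_unit]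
  split_ifs with h
  · rw [← map_sum, CMat.sum_unit, hL]
  · simp

theorem unitaryPath_conjTranspose {B : Type*} [CStarAlgebra B] {u : Matrix κ κ B} (hu : uᴴ = u)
    (s : ℝ) : (unitaryPath u s)ᴴ = unitaryPath u (-s) := by
  rw [unitaryPath, unitaryPath, Matrix.conjTranspose_add, Matrix.conjTranspose_smul,
    Matrix.conjTranspose_smul, Matrix.conjTranspose_add, Matrix.conjTranspose_sub,
    Matrix.conjTranspose_one, hu, star_mul', Complex.star_def, ← Complex.exp_conj]
  have h2 : (starRingEnd ℂ) 2⁻¹ = 2⁻¹ := by rw [map_inv₀, Complex.conj_ofNat]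
  simp [h2]

theorem unitaryPath_coisometry {B : Type*} [CStarAlgebra B] {u : Matrix κ κ B} (hu : uᴴ = u)
    (huu : u * u = 1) (s : ℝ) : unitaryPath u s * (unitaryPath u s)ᴴ = 1 := by
  have h := unitaryPath_isometry hu huu (-s)
  rwa [unitaryPath_conjTranspose hu, neg_neg, ← unitaryPath_conjTranspose hu s] at h

/-- The path consists of linear combinations of 1 and the flip, whose entries lie in the image of
`L`. Everything that commutes with this image therefore commutes with the entries of the whole path.
-/
theorem exists_unitaryPath_flip (hL : L 1 = 1) (s : ℝ) (i j : κ) :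
    ∃ x, unitaryPath (flip L) s i j = L x := by
  refine ⟨(2⁻¹ : ℂ) • ((if i = j then 1 else 0) + CMat.unit j i) +
    (2⁻¹ * Complex.exp (s * Complex.I)) • ((if i = j then 1 else 0) - CMat.unit j i), ?_⟩
  have h : L (if i = j then 1 else 0) = (1 : Matrix κ κ T) i j := by
    rw [Matrix.one_apply]
    split_ifs
    · exact hL
    · exact map_zero L
  rw [map_add, map_smul, map_smul, map_add, map_sub, h]
  rfl

/-- The conjugates of the diagonal matrices. -/
def conjDiag (W : Matrix κ κ T) (hW : Wᴴ * W = 1) : T →⋆ₙₐ[ℂ] Matrix κ κ T :=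
  conjHom W hW (diagHom κ T)

theorem conjDiag_apply (W : Matrix κ κ T) (hW : Wᴴ * W = 1) (c : T) (i j : κ) :
    conjDiag W hW c i j = ∑ a, W i a * c * star (W j a) := by
  rw [conjDiag, conjHom_apply, Matrix.mul_apply]
  refine Finset.sum_congr rfl fun a _ => ?_
  rw [Matrix.conjTranspose_apply]
  congr 1
  exact Matrix.mul_diagonal _ _ _ _

/-- Conjugation by matrices with entries in the image of `L` preserves the condition at the endpoint
`p`, since this image commutes with `S`. -/
theorem commute_conjDiag {W : Matrix κ κ T} (hW : Wᴴ * W = 1) (hWL : ∀ i j, ∃ x, W i j = L x)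
    {y : T} (hy : ∀ x, Commute (L x) y) {c : T} (hc : Commute c y) (i j : κ) :
    Commute (conjDiag W hW c i j) y := by
  rw [conjDiag_apply]
  refine Commute.sum_left _ _ _ fun a _ => ?_
  obtain ⟨x, hx⟩ := hWL i a
  obtain ⟨x', hx'⟩ := hWL j a
  rw [hx, hx', ← map_star]
  exact ((hy x).mul_left hc).mul_left (hy _)

/-- At the endpoint `p'` the value commutes with the entries of `W`, so conjugation does nothing
there. -/
theorem conjDiag_of_commute {W : Matrix κ κ T} (hW : Wᴴ * W = 1) (hW' : W * Wᴴ = 1)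
    (hWL : ∀ i j, ∃ x, W i j = L x) {c : T} (hc : ∀ x, Commute c (L x)) (i j : κ) :
    conjDiag W hW c i j = if i = j then c else 0 := by
  have h := congrFun₂ hW' i j
  rw [Matrix.mul_apply, Matrix.one_apply] at h
  rw [conjDiag_apply]
  have h1 : ∑ a, W i a * c * star (W j a) = c * ∑ a, W i a * Wᴴ a j := by
    rw [Finset.mul_sum]
    refine Finset.sum_congr rfl fun a _ => ?_
    obtain ⟨x, hx⟩ := hWL i a
    rw [Matrix.conjTranspose_apply, hx, ← (hc x).eq, mul_assoc]
  rw [h1, h]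
  split_ifs <;> simp

/-- The flip exchanges the scalar matrices M_κ with the copy `L` of M_κ, and diag(c) commutes with
scalar matrices. So after the flip the condition at `p'` holds for every `c`, which leaves the
interval free to be contracted. -/
theorem commute_conjDiag_flip (hW : (flip L)ᴴ * flip L = 1) (c : T) (i j : κ) (x : CMat κ ℂ) :
    Commute (conjDiag (flip L) hW c i j) (L x) := by
  rw [conjDiag_apply, CMat.eq_sum_unit x, map_sum]
  refine Commute.sum_right _ _ _ fun p _ => ?_
  rw [map_sum]
  refine Commute.sum_right _ _ _ fun q _ => ?_
  rw [map_smul]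
  refine Commute.smul_right ?_ _
  simp only [flip, Matrix.of_apply, ← map_star, CMat.star_unit]
  rw [commute_iff_eq, Finset.sum_mul, Finset.mul_sum]
  rw [Finset.sum_eq_single p, Finset.sum_eq_single q]
  · rw [mul_assoc, ← map_mul, CMat.unit_mul_unit, if_pos rfl, ← mul_assoc, ← mul_assoc, ← map_mul,
      CMat.unit_mul_unit, if_pos rfl]
  · intro a _ ha
    rw [← mul_assoc, ← mul_assoc, ← map_mul, CMat.unit_mul_unit, if_neg ha.symm, map_zero, zero_mul,
      zero_mul]
  · simp
  · intro a _ ha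
    rw [mul_assoc, ← map_mul, CMat.unit_mul_unit, if_neg ha, map_zero, mul_zero]
  · simp

/-- Evaluation at a point. -/
def evalHom {Y C : Type*} [TopologicalSpace Y] [CompactSpace Y] [NonUnitalCStarAlgebra C] (t : Y) :
    C(Y, C) →⋆ₙₐ[ℂ] C where
  toFun f := f t
  map_smul' _ _ := rfl
  map_zero' := rfl
  map_add' _ _ := rfl
  map_mul' _ _ := rfl
  map_star' _ := rfl

/-- Let `Z` be the algebra of all functions `f : I → T` such that `f p` commutes with `S` and
`f p'` commutes with a copy of `M_κ` in the commutant of `S`. If the interval can be contracted to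
`p`, then multiplication by the size of `κ` on `K₀(F Z)` factors through `K₀(F ℂ)`. -/
theorem MatFunctor.exists_card_smul_eq (F : MatFunctor.{u, 0}) [Nontrivial T] (hL : L 1 = 1)
    {S : Set T} (hS : ∀ y ∈ S, ∀ x, Commute (L x) y)
    (hc : ∀ c, (∀ y ∈ S, Commute c y) → (∀ x, Commute c (L x)) → ∃ z : ℂ, c = z • 1)
    (inc : Z →⋆ₙₐ[ℂ] C(I, T)) (hinc : Function.Injective inc) (p p' : I)
    (hmem : ∀ f, (∃ z, inc z = f) ↔
      (∀ y ∈ S, Commute (f p) y) ∧ ∀ x, Commute (f p') (L x))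
    (h : C(I × I, I)) (h0 : ∀ t, h (0, t) = p) (h1 : ∀ t, h (1, t) = t) (hp : ∀ s, h (s, p) = p)
    {e : Z} (he : IsStarProjection e) (he1 : inc e = 1) (y : K0 (F.obj Z)) :
    ∃ x : K0 (F.obj ℂ), F.K (toMat (scalOne e he)) x = Fintype.card κ • y := by
  have hu := flip_conjTranspose L
  have huu := flip_mul_flip L hL
  have hinc1 (z : Z) : ∀ y ∈ S, Commute (inc z p) y := ((hmem (inc z)).1 ⟨z, rfl⟩).1
  have hinc2 (z : Z) : ∀ x, Commute (inc z p') (L x) := ((hmem (inc z)).1 ⟨z, rfl⟩).2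
  -- conjugation by a path of unitaries
  let φ (s : ℝ) : Z →⋆ₙₐ[ℂ] Matrix κ κ C(I, T) := familyHom
    (fun t => ((conjDiag (unitaryPath (flip L) s) (unitaryPath_isometry hu huu s)).comp
      ((evalHom t).comp inc))) fun z i j => by
        change Continuous fun t => conjDiag (unitaryPath (flip L) s)
          (unitaryPath_isometry hu huu s) (inc z t) i j
        simp only [conjDiag_apply]
        fun_prop
  have hφ (s : ℝ) (z : Z) (i j : κ) (t : I) :
      φ s z i j t = conjDiag _ (unitaryPath_isometry hu huu s) (inc z t) i j := rfl
  -- The unitaries of the path need not belong to matrices over `Z`, but both endpoint conditions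
  -- survive conjugation by them.
  have hφm (s : ℝ) (z : Z) (i j : κ) : ∃ z', inc z' = φ s z i j := by
    refine (hmem _).2 ⟨fun y hy => ?_, fun x => ?_⟩
    · exact commute_conjDiag L (unitaryPath_isometry hu huu s) (exists_unitaryPath_flip L hL s) (hS y hy) (hinc1 z y hy) i j
    · rw [hφ, conjDiag_of_commute L (unitaryPath_isometry hu huu s) (unitaryPath_coisometry hu huu s)
        (exists_unitaryPath_flip L hL s) (hinc2 z)]
      split_ifs
      · exact hinc2 z x
      · exact Commute.zero_left _
  have hφc := F.K_eq_of_homotopy (fun s => matLift inc hinc (φ s) (hφm s)) (fun z i j => by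
    refine continuous_of_comp_injective inc hinc ?_
    simp only [apply_matLift]
    -- Joint continuity gives, by currying, continuity in s for the uniform norm over the interval.
    have hc : Continuous fun q : ℝ × I => ∑ a, unitaryPath (flip L) q.1 i a * inc z q.2 *
        star (unitaryPath (flip L) q.1 j a) := by
      have hw (i j : κ) : Continuous fun q : ℝ × I => unitaryPath (flip L) q.1 i j :=
        ((continuous_unitaryPath (flip L)).comp continuous_fst).matrix_elem i j
      refine continuous_finsetSum _ fun a _ => ((hw i a).mul ?_).mul (hw j a).star
      exact (inc z).continuous.comp continuous_snd
    refine (ContinuousMap.curry ⟨_, hc⟩).continuous.congr fun s => ContinuousMap.ext fun t => ?_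
    exact (conjDiag_apply (unitaryPath (flip L) s) (unitaryPath_isometry hu huu s)
      (inc z t) i j).symm) 0 Real.pi
  -- contraction of the interval
  have hW : (flip L)ᴴ * flip L = 1 := by rw [hu, huu]
  let ψ (s : I) : Z →⋆ₙₐ[ℂ] Matrix κ κ C(I, T) := familyHom
    (fun t => (conjDiag (flip L) hW).comp ((evalHom (h (s, t))).comp inc)) fun z i j => by
        change Continuous fun t => conjDiag (flip L) hW (inc z (h (s, t))) i j
        simp only [conjDiag_apply]
        fun_prop
  have hψ (s : I) (z : Z) (i j : κ) (t : I) :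
      ψ s z i j t = conjDiag (flip L) hW (inc z (h (s, t))) i j := rfl
  -- The contraction fixes `p`, so the condition there is kept; the condition at `p'` is automatic
  -- after the flip.
  have hψm (s : I) (z : Z) (i j : κ) : ∃ z', inc z' = ψ s z i j := by
    refine (hmem _).2 ⟨fun y hy => ?_, fun x => ?_⟩
    · rw [hψ, hp]
      exact commute_conjDiag L hW (fun i j => ⟨_, rfl⟩) (hS y hy) (hinc1 z y hy) i j
    · exact commute_conjDiag_flip L hW _ i j x
  have hψc := F.K_eq_of_homotopy (fun s => matLift inc hinc (ψ s) (hψm s)) (fun z i j => by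
    refine continuous_of_comp_injective inc hinc ?_
    simp only [apply_matLift]
    have hc : Continuous fun q : I × I => ∑ a, flip L i a * inc z (h q) * star (flip L j a) := by
      fun_prop
    refine (ContinuousMap.curry ⟨_, hc⟩).continuous.congr fun s => ContinuousMap.ext fun t => ?_
    exact (conjDiag_apply (flip L) hW (inc z (h (s, t))) i j).symm) 1 0
  -- the end of the homotopy
  let sc := scalOne (1 : T) (.one _)
  have hsc : Function.Injective sc := fun a b hab => by
    have h2 : a • (1 : T) = b • 1 := hab
    exact smul_left_injective ℂ one_ne_zero h2
  -- At `p` the flipped entries commute with both `S` and the image of `L`, hence are scalars by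
  -- `hc`. At the end of the contraction they are constant functions.
  let ε : Z →⋆ₙₐ[ℂ] Matrix κ κ ℂ := matLift sc hsc
    ((conjDiag (flip L) hW).comp ((evalHom p).comp inc)) fun z i j => by
      obtain ⟨w, hw⟩ := hc (conjDiag (flip L) hW (inc z p) i j)
        (fun y hy => commute_conjDiag L hW (fun i j => ⟨_, rfl⟩) (hS y hy) (hinc1 z y hy) i j)
        (commute_conjDiag_flip L hW _ i j)
      exact ⟨w, hw.symm⟩
  have hε (z : Z) (i j : κ) : ε z i j • (1 : T) = conjDiag (flip L) hW (inc z p) i j :=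
    apply_matLift sc hsc _ _ z i j
  refine ⟨F.K ε y, ?_⟩
  rw [F.K_K, ← F.K_diagHom]
  have e1 : F.K (compHom ε (toMat (scalOne e he))) = F.K (matLift inc hinc (ψ 0) (hψm 0)) := by
    refine F.K_of_reindex (Equiv.prodPUnit κ) fun z i j => hinc (ContinuousMap.ext fun t => ?_)
    rw [apply_matLift, hψ, h0]
    refine Eq.trans ?_ (hε z i.1 j.1)
    rw [compHom_apply, toMat_apply, scalOne_apply, map_smul, he1]
    rfl
  have e2 : matLift inc hinc (ψ 1) (hψm 1) = matLift inc hinc (φ Real.pi) (hφm Real.pi) := by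
    refine matHom_ext fun z i j => hinc (ContinuousMap.ext fun t => ?_)
    rw [apply_matLift, apply_matLift, hψ, hφ, h1, conjDiag_apply, conjDiag_apply, unitaryPath_pi]
  have e3 : matLift inc hinc (φ 0) (hφm 0) = diagHom κ Z := by
    refine matHom_ext fun z i j => hinc (ContinuousMap.ext fun t => ?_)
    rw [apply_matLift, hφ, conjDiag_apply, unitaryPath_zero, diagHom_apply]
    simp only [Matrix.one_apply]
    by_cases hij : i = j
    · simp [hij]
    · simp [hij, Ne.symm hij]
  -- The chain runs from the composition through ℂ, along the contraction, then back along the path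
  -- of unitaries to the diagonal embedding, which is multiplication by the size of κ.
  rw [e1, ← hψc, e2, ← hφc, e3]

end Drop

end KTheory

end

open scoped TensorProduct ZeroAtInfty Matrix unitInterval

noncomputable section

namespace KTheory

/-! ### Tensor products of matrix algebras -/

namespace CMat

section Kron

variable {κ μ : Type*} [Fintype κ] [Fintype μ] [DecidableEq κ] [DecidableEq μ]

/-- The Kronecker product of matrices. -/
def kron (x : CMat κ ℂ) (y : CMat μ ℂ) : CMat (κ × μ) ℂ :=
  ofM _ _ (Matrix.kronecker (toM _ _ x) (toM _ _ y))

theorem toM_kron (x : CMat κ ℂ) (y : CMat μ ℂ) (i j : κ × μ) :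
    toM _ _ (kron x y) i j = toM _ _ x i.1 j.1 * toM _ _ y i.2 j.2 := rfl

theorem kron_mul_kron (x x' : CMat κ ℂ) (y y' : CMat μ ℂ) :
    kron x y * kron x' y' = kron (x * x') (y * y') := by
  rw [kron, kron, ← map_mul]
  exact congrArg (ofM _ _) (Matrix.mul_kronecker_mul _ _ _ _).symm

theorem star_kron (x : CMat κ ℂ) (y : CMat μ ℂ) : star (kron x y) = kron (star x) (star y) := by
  rw [kron, ← map_star]
  exact congrArg (ofM _ _) (Matrix.conjTranspose_kronecker _ _)

theorem kron_one_one : kron (1 : CMat κ ℂ) (1 : CMat μ ℂ) = 1 :=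
  congrArg (ofM _ _) Matrix.one_kronecker_one

theorem kron_add_left (x x' : CMat κ ℂ) (y : CMat μ ℂ) :
    kron (x + x') y = kron x y + kron x' y := by
  rw [kron, kron, kron, ← map_add, map_add]
  exact congrArg (ofM _ _) (Matrix.add_kronecker _ _ _)

theorem kron_add_right (x : CMat κ ℂ) (y y' : CMat μ ℂ) :
    kron x (y + y') = kron x y + kron x y' := by
  rw [kron, kron, kron, ← map_add, map_add]
  exact congrArg (ofM _ _) (Matrix.kronecker_add _ _ _)

theorem kron_smul_left (c : ℂ) (x : CMat κ ℂ) (y : CMat μ ℂ) : kron (c • x) y = c • kron x y := by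
  rw [kron, kron, ← map_smul, map_smul]
  exact congrArg (ofM _ _) (Matrix.smul_kronecker _ _ _)

theorem kron_smul_right (c : ℂ) (x : CMat κ ℂ) (y : CMat μ ℂ) : kron x (c • y) = c • kron x y := by
  rw [kron, kron, ← map_smul, map_smul]
  exact congrArg (ofM _ _) (Matrix.kronecker_smul _ _ _)

variable (κ μ) in
/-- The homomorphism `x ↦ x ⊗ 1`. -/
def kronLeft : CMat κ ℂ →⋆ₙₐ[ℂ] CMat (κ × μ) ℂ where
  toFun x := kron x 1
  map_smul' c x := kron_smul_left c x 1
  map_zero' := by simpa using kron_smul_left (0 : ℂ) (0 : CMat κ ℂ) (1 : CMat μ ℂ)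
  map_add' x y := kron_add_left x y 1
  map_mul' x y := by rw [kron_mul_kron, mul_one]
  map_star' x := by rw [star_kron, star_one]

variable (κ μ) in
/-- The homomorphism `y ↦ 1 ⊗ y`. -/
def kronRight : CMat μ ℂ →⋆ₙₐ[ℂ] CMat (κ × μ) ℂ where
  toFun y := kron 1 y
  map_smul' c y := kron_smul_right c 1 y
  map_zero' := by simpa using kron_smul_right (0 : ℂ) (1 : CMat κ ℂ) (0 : CMat μ ℂ)
  map_add' x y := kron_add_right 1 x y
  map_mul' x y := by rw [kron_mul_kron, mul_one]
  map_star' x := by rw [star_kron, star_one]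

theorem kronLeft_apply (x : CMat κ ℂ) : kronLeft κ μ x = kron x 1 := rfl

theorem kronRight_apply (y : CMat μ ℂ) : kronRight κ μ y = kron 1 y := rfl

theorem commute_kronLeft_kronRight (x : CMat κ ℂ) (y : CMat μ ℂ) :
    Commute (kronLeft κ μ x) (kronRight κ μ y) := by
  rw [commute_iff_eq, kronLeft_apply, kronRight_apply, kron_mul_kron, kron_mul_kron]
  simp only [mul_one, one_mul]

theorem toM_mul (x y : CMat κ ℂ) (i j : κ) :
    toM _ _ (x * y) i j = ∑ k, toM _ _ x i k * toM _ _ y k j := by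
  rw [map_mul, Matrix.mul_apply]

theorem toM_one (i j : κ) : toM κ ℂ 1 i j = if i = j then 1 else 0 := Matrix.one_apply

theorem toM_unit (a b i j : κ) :
    toM κ ℂ (unit a b) i j = if a = i ∧ b = j then 1 else 0 := Matrix.single_apply ..

/-- Compare the entries at ((i, d), (j, b)) of the two products of `c` with 1 ⊗ e_da. -/
theorem entry_of_commute_kronRight {c : CMat (κ × μ) ℂ} (hc : ∀ y, Commute c (kronRight κ μ y))
    (i j : κ) (a b d : μ) :
    toM _ _ c (i, a) (j, b) = if a = b then toM _ _ c (i, d) (j, d) else 0 := by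
  have h := congrArg (fun x => toM _ _ x (i, d) (j, b)) (hc (unit d a)).eq
  simp only [kronRight_apply, toM_mul, toM_kron, toM_one, toM_unit, Fintype.sum_prod_type] at h
  simpa [ite_and, eq_comm] using h.symm

theorem entry_of_commute_kronLeft {c : CMat (κ × μ) ℂ} (hc : ∀ x, Commute c (kronLeft κ μ x))
    (i j k : κ) (a b : μ) :
    toM _ _ c (i, a) (j, b) = if i = j then toM _ _ c (k, a) (k, b) else 0 := by
  have h := congrArg (fun x => toM _ _ x (k, a) (j, b)) (hc (unit k i)).eq
  simp only [kronLeft_apply, toM_mul, toM_kron, toM_one, toM_unit, Fintype.sum_prod_type] at h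
  simpa [ite_and, eq_comm] using h.symm

/-- The commutant of 1 ⊗ M_μ is M_κ ⊗ 1: by the entry formula `c` is determined by its block at a
fixed index `d`. -/
theorem exists_kronLeft_eq [Nonempty μ] {c : CMat (κ × μ) ℂ}
    (hc : ∀ y, Commute c (kronRight κ μ y)) : ∃ x, kronLeft κ μ x = c := by
  obtain ⟨d⟩ := ‹Nonempty μ›
  refine ⟨ofM _ _ (Matrix.of fun i j => toM _ _ c (i, d) (j, d)), CMat.ext fun i j => ?_⟩
  rw [entry_of_commute_kronRight hc i.1 j.1 i.2 j.2 d, kronLeft_apply, toM_kron, toM_one]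
  change toM _ _ c (i.1, d) (j.1, d) * _ = _
  split_ifs <;> simp

theorem exists_kronRight_eq [Nonempty κ] {c : CMat (κ × μ) ℂ}
    (hc : ∀ x, Commute c (kronLeft κ μ x)) : ∃ y, kronRight κ μ y = c := by
  obtain ⟨k⟩ := ‹Nonempty κ›
  refine ⟨ofM _ _ (Matrix.of fun a b => toM _ _ c (k, a) (k, b)), CMat.ext fun i j => ?_⟩
  rw [entry_of_commute_kronLeft hc i.1 j.1 k i.2 j.2, kronRight_apply, toM_kron, toM_one]
  change _ * toM _ _ c (k, i.2) (k, j.2) = _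
  split_ifs <;> simp

theorem exists_smul_one_eq [Nonempty κ] [Nonempty μ] {c : CMat (κ × μ) ℂ}
    (h : ∀ x, Commute c (kronLeft κ μ x)) (h' : ∀ y, Commute c (kronRight κ μ y)) :
    ∃ z : ℂ, c = z • 1 := by
  obtain ⟨k⟩ := ‹Nonempty κ›
  obtain ⟨d⟩ := ‹Nonempty μ›
  refine ⟨toM _ _ c (k, d) (k, d), CMat.ext fun i j => ?_⟩
  rw [entry_of_commute_kronLeft h i.1 j.1 k i.2 j.2, entry_of_commute_kronRight h' k k i.2 j.2 d,
    map_smul, Matrix.smul_apply, toM_one, smul_eq_mul]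
  by_cases h1 : i.1 = j.1 <;> by_cases h2 : i.2 = j.2 <;> simp [h1, h2, Prod.ext_iff]

end Kron

/-! ### Systems of matrix units -/

section Units

variable {κ : Type*} [Fintype κ] [DecidableEq κ] {E : Type*} [NonUnitalCStarAlgebra E]

/-- The homomorphism defined by a system of matrix units. -/
def unitsHom (U : κ → κ → E) (hU : ∀ i j k l, U i j * U k l = if j = k then U i l else 0)
    (hU' : ∀ i j, star (U i j) = U j i) : CMat κ ℂ →⋆ₙₐ[ℂ] E where
  toFun x := ∑ i, ∑ j, toM _ _ x i j • U i j
  map_smul' c x := by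
    simp only [map_smul, Matrix.smul_apply, smul_eq_mul, mul_smul, Finset.smul_sum,
      MonoidHom.id_apply]
  map_zero' := by simp
  map_add' x y := by simp only [map_add, Matrix.add_apply, add_smul, Finset.sum_add_distrib]
  map_mul' x y := by
    rw [Finset.sum_mul]
    refine Finset.sum_congr rfl fun i _ => ?_
    simp only [toM_mul, Finset.sum_smul, Finset.sum_mul, Finset.mul_sum, smul_mul_smul_comm, hU,
      smul_ite, smul_zero]
    rw [Finset.sum_comm]
    refine Finset.sum_congr rfl fun k _ => ?_
    rw [Finset.sum_comm]
    simp
  map_star' x := by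
    simp only [star_sum, star_smul, hU', map_star, Matrix.star_apply]
    rw [Finset.sum_comm]

variable {U : κ → κ → E} (hU : ∀ i j k l, U i j * U k l = if j = k then U i l else 0)
    (hU' : ∀ i j, star (U i j) = U j i)

theorem unitsHom_apply (x : CMat κ ℂ) : unitsHom U hU hU' x = ∑ i, ∑ j, toM _ _ x i j • U i j := rfl

/-- Multiplying by matrix units on both sides isolates each coefficient. -/
theorem unitsHom_injective (h : ∀ i, U i i ≠ 0) : Function.Injective (unitsHom U hU hU') := by
  rw [injective_iff_map_eq_zero]
  intro x hx
  refine CMat.ext fun i j => ?_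
  have h1 : U i i * unitsHom U hU hU' x * U j i = toM _ _ x i j • U i i := by
    simp only [unitsHom_apply, Finset.mul_sum, Finset.sum_mul, mul_smul_comm, smul_mul_assoc, hU,
      ite_mul, zero_mul, smul_ite, smul_zero]
    simp
  rw [hx, mul_zero, zero_mul] at h1
  rw [map_zero, Matrix.zero_apply]
  exact (smul_eq_zero.1 h1.symm).resolve_right (h i)

end Units

end CMat

end KTheory

end

open scoped TensorProduct ZeroAtInfty Matrix unitInterval

noncomputable section

open KTheory

/-! ### Matrix algebras in `M_𝔭 ⊗ M_𝔮` -/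

namespace UHF

variable (𝔭 𝔮 : Supernatural)

/-- The matrix units of `M_n ⊗ M_m` in `M_𝔭 ⊗ M_𝔮`. -/
def tensorUnit (j : ℕ) (a b : Fin (𝔭.level j) × Fin (𝔮.level j)) : CStarTensor (UHF 𝔭) (UHF 𝔮) :=
  CStarTensor.tmul (ι 𝔭 j (CMat.unit a.1 b.1)) (ι 𝔮 j (CMat.unit a.2 b.2))

theorem tmul_zero_left {A B : Type*} [NonUnitalCStarAlgebra A] [NonUnitalCStarAlgebra B] (b : B) :
    CStarTensor.tmul (0 : A) b = 0 := map_zero (CStarTensor.tmulRight b)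

theorem tmul_zero_right {A B : Type*} [NonUnitalCStarAlgebra A] [NonUnitalCStarAlgebra B] (a : A) :
    CStarTensor.tmul a (0 : B) = 0 := map_zero (CStarTensor.tmulLeft a)

theorem tensorUnit_mul (j : ℕ) (a b c d : Fin (𝔭.level j) × Fin (𝔮.level j)) :
    tensorUnit 𝔭 𝔮 j a b * tensorUnit 𝔭 𝔮 j c d = if b = c then tensorUnit 𝔭 𝔮 j a d else 0 := by
  rw [tensorUnit, tensorUnit, CStarTensor.tmul_mul_tmul, ← map_mul, ← map_mul, CMat.unit_mul_unit,
    CMat.unit_mul_unit]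
  by_cases h1 : b.1 = c.1
  · by_cases h2 : b.2 = c.2
    · rw [if_pos h1, if_pos h2, if_pos (Prod.ext h1 h2)]
      rfl
    · rw [if_neg h2, if_neg (fun h => h2 (congrArg Prod.snd h)), map_zero, tmul_zero_right]
  · rw [if_neg h1, if_neg (fun h => h1 (congrArg Prod.fst h)), map_zero, tmul_zero_left]

theorem star_tensorUnit (j : ℕ) (a b : Fin (𝔭.level j) × Fin (𝔮.level j)) :
    star (tensorUnit 𝔭 𝔮 j a b) = tensorUnit 𝔭 𝔮 j b a := by
  rw [tensorUnit, CStarTensor.star_tmul, ← map_star, ← map_star, CMat.star_unit, CMat.star_unit]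
  rfl

theorem unit_ne_zero {κ : Type*} [Fintype κ] [DecidableEq κ] (a b : κ) : CMat.unit a b ≠ 0 :=
  fun h => by
    have h1 := CMat.toM_unit a b a b
    rw [h, map_zero] at h1
    simp at h1

theorem tensorUnit_ne_zero (j : ℕ) (a b : Fin (𝔭.level j) × Fin (𝔮.level j)) :
    tensorUnit 𝔭 𝔮 j a b ≠ 0 := fun h => by
  rcases eq_zero_or_of_tmul 𝔭 𝔮 h with h | h
  · exact unit_ne_zero _ _ (ofBlock_injective 𝔭 _ _ (h.trans (map_zero _).symm))
  · exact unit_ne_zero _ _ (ofBlock_injective 𝔮 _ _ (h.trans (map_zero _).symm))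

/-- The embedding of `M_n ⊗ M_m` into `M_𝔭 ⊗ M_𝔮`. -/
def τ (j : ℕ) :
    CMat (Fin (𝔭.level j) × Fin (𝔮.level j)) ℂ →⋆ₙₐ[ℂ] CStarTensor (UHF 𝔭) (UHF 𝔮) :=
  CMat.unitsHom (tensorUnit 𝔭 𝔮 j) (tensorUnit_mul 𝔭 𝔮 j) (star_tensorUnit 𝔭 𝔮 j)

theorem τ_injective (j : ℕ) : Function.Injective (τ 𝔭 𝔮 j) :=
  CMat.unitsHom_injective _ _ fun a => tensorUnit_ne_zero 𝔭 𝔮 j a a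

theorem τ_kron (j : ℕ) (x : CMat (Fin (𝔭.level j)) ℂ) (y : CMat (Fin (𝔮.level j)) ℂ) :
    τ 𝔭 𝔮 j (CMat.kron x y) = CStarTensor.tmul (ι 𝔭 j x) (ι 𝔮 j y) := by
  have h1 : ι 𝔭 j x = ∑ a, ∑ b, CMat.toM _ _ x a b • ι 𝔭 j (CMat.unit a b) := by
    conv_lhs => rw [CMat.eq_sum_unit x]
    simp only [map_sum, map_smul]
  have h2 : ι 𝔮 j y = ∑ a, ∑ b, CMat.toM _ _ y a b • ι 𝔮 j (CMat.unit a b) := by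
    conv_lhs => rw [CMat.eq_sum_unit y]
    simp only [map_sum, map_smul]
  rw [τ, CMat.unitsHom_apply, ← CStarTensor.tmulRight_apply, h1, map_sum, Fintype.sum_prod_type]
  refine Finset.sum_congr rfl fun a _ => ?_
  simp only [Fintype.sum_prod_type]
  rw [Finset.sum_comm, map_sum]
  refine Finset.sum_congr rfl fun b _ => ?_
  rw [map_smul, CStarTensor.tmulRight_apply, ← CStarTensor.tmulLeft_apply, h2, map_sum,
    Finset.smul_sum]
  refine Finset.sum_congr rfl fun c _ => ?_
  rw [map_sum, Finset.smul_sum]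
  refine Finset.sum_congr rfl fun d _ => ?_
  rw [map_smul, smul_smul]
  rfl

theorem τ_kronLeft (j : ℕ) (x : CMat (Fin (𝔭.level j)) ℂ) :
    τ 𝔭 𝔮 j (CMat.kronLeft _ _ x) = inclLeft 𝔭 𝔮 (ι 𝔭 j x) := by
  rw [CMat.kronLeft_apply, τ_kron, ι, ι, ofBlock_one]
  rfl

theorem τ_kronRight (j : ℕ) (y : CMat (Fin (𝔮.level j)) ℂ) :
    τ 𝔭 𝔮 j (CMat.kronRight _ _ y) = inclRight 𝔭 𝔮 (ι 𝔮 j y) := by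
  rw [CMat.kronRight_apply, τ_kron, ι, ι, ofBlock_one]
  rfl

theorem τ_one (j : ℕ) : τ 𝔭 𝔮 j 1 = CStarTensor.tmul 1 1 := by
  rw [← CMat.kron_one_one, τ_kron, ι, ι, ofBlock_one, ofBlock_one]

theorem commute_inclLeft_inclRight (x : UHF 𝔭) (y : UHF 𝔮) :
    Commute (inclLeft 𝔭 𝔮 x) (inclRight 𝔭 𝔮 y) := by
  change CStarTensor.tmul x 1 * CStarTensor.tmul 1 y = CStarTensor.tmul 1 y * CStarTensor.tmul x 1
  rw [CStarTensor.tmul_mul_tmul, CStarTensor.tmul_mul_tmul]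
  simp only [mul_one, one_mul]

theorem exists_τ_eq (j k : ℕ) (h : j ≤ k) (x) : ∃ y, τ 𝔭 𝔮 k y = τ 𝔭 𝔮 j x := by
  have h1 (a b) : tensorUnit 𝔭 𝔮 j a b ∈ NonUnitalStarAlgHom.range (τ 𝔭 𝔮 k) := by
    obtain ⟨x, hx⟩ := exists_ι_eq 𝔭 j k h (CMat.unit a.1 b.1)
    obtain ⟨y, hy⟩ := exists_ι_eq 𝔮 j k h (CMat.unit a.2 b.2)
    exact ⟨CMat.kron x y, by rw [tensorUnit, ← hx, ← hy]; exact τ_kron 𝔭 𝔮 k x y⟩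
  have h2 : τ 𝔭 𝔮 j x ∈ NonUnitalStarAlgHom.range (τ 𝔭 𝔮 k) :=
    sum_mem fun a _ => sum_mem fun b _ => SMulMemClass.smul_mem _ (h1 a b)
  exact h2

theorem exists_norm_τ_sub_lt (d : CStarTensor (UHF 𝔭) (UHF 𝔮)) (ε : ℝ) (hε : 0 < ε) :
    ∃ j c, ‖τ 𝔭 𝔮 j c - d‖ < ε := by
  suffices h : d ∈ closure {z | ∃ j c, τ 𝔭 𝔮 j c = z} by
    obtain ⟨_, ⟨j, c, rfl⟩, h⟩ := Metric.mem_closure_iff.1 h ε hε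
    exact ⟨j, c, by rwa [norm_sub_rev, ← dist_eq_norm]⟩
  induction d using CStarTensor.induction_tmul with
  | hc => exact isClosed_closure
  | hadd x y hx hy =>
    refine map_mem_closure₂ continuous_add hx hy ?_
    rintro _ ⟨j, c, rfl⟩ _ ⟨k, d, rfl⟩
    obtain ⟨c', hc⟩ := exists_τ_eq 𝔭 𝔮 j (max j k) (le_max_left _ _) c
    obtain ⟨d', hd⟩ := exists_τ_eq 𝔭 𝔮 k (max j k) (le_max_right _ _) d
    exact ⟨max j k, c' + d', by rw [map_add, hc, hd]⟩
  | h a b =>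
    have h1 (𝔭 : Supernatural) (a : UHF 𝔭) : a ∈ closure {z | ∃ j c, ι 𝔭 j c = z} := by
      refine Metric.mem_closure_iff.2 fun ε hε => ?_
      obtain ⟨j, c, h⟩ := exists_norm_ι_sub_lt 𝔭 a ε hε
      exact ⟨_, ⟨j, c, rfl⟩, by rwa [dist_eq_norm, norm_sub_rev]⟩
    have h2 (j c b) : CStarTensor.tmul (ι 𝔭 j c) b ∈ closure {z | ∃ j c, τ 𝔭 𝔮 j c = z} := by
      refine map_mem_closure (CStarTensor.tmulLeft (ι 𝔭 j c)).continuous (h1 𝔮 b) ?_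
      rintro _ ⟨k, d, rfl⟩
      obtain ⟨c', hc⟩ := exists_ι_eq 𝔭 j (max j k) (le_max_left _ _) c
      obtain ⟨d', hd⟩ := exists_ι_eq 𝔮 k (max j k) (le_max_right _ _) d
      exact ⟨max j k, CMat.kron c' d', (τ_kron 𝔭 𝔮 _ c' d').trans (by rw [hc, hd])⟩
    have h3 := map_mem_closure (CStarTensor.tmulRight b).continuous (h1 𝔭 a)
      (t := closure {z | ∃ j c, τ 𝔭 𝔮 j c = z}) (by rintro _ ⟨j, c, rfl⟩; exact h2 j c b)
    rwa [closure_closure] at h3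

end UHF

/-! ### Dimension drop intervals as limits -/

namespace KTheory

/-- Composition with a homomorphism. -/
def compLeftHom {Y A B : Type*} [TopologicalSpace Y] [CompactSpace Y] [NonUnitalCStarAlgebra A]
    [NonUnitalCStarAlgebra B] (φ : A →⋆ₙₐ[ℂ] B) : C(Y, A) →⋆ₙₐ[ℂ] C(Y, B) where
  toFun f := ⟨fun t => φ (f t), (continuous_hom φ).comp f.continuous⟩
  map_smul' c f := ContinuousMap.ext fun t => map_smul φ c (f t)
  map_zero' := ContinuousMap.ext fun _ => map_zero φ
  map_add' f g := ContinuousMap.ext fun t => map_add φ (f t) (g t)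
  map_mul' f g := ContinuousMap.ext fun t => map_mul φ (f t) (g t)
  map_star' f := ContinuousMap.ext fun t => map_star φ (f t)

theorem compLeftHom_apply {Y A B : Type*} [TopologicalSpace Y] [CompactSpace Y]
    [NonUnitalCStarAlgebra A] [NonUnitalCStarAlgebra B] (φ : A →⋆ₙₐ[ℂ] B) (f : C(Y, A)) (t : Y) :
    compLeftHom φ f t = φ (f t) := rfl

theorem compLeftHom_injective {Y A B : Type*} [TopologicalSpace Y] [CompactSpace Y]
    [NonUnitalCStarAlgebra A] [NonUnitalCStarAlgebra B] {φ : A →⋆ₙₐ[ℂ] B}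
    (hφ : Function.Injective φ) :
    Function.Injective (compLeftHom φ : C(Y, A) →⋆ₙₐ[ℂ] C(Y, B)) := fun _ _ h =>
  ContinuousMap.ext fun t => hφ (DFunLike.congr_fun h t)

end KTheory

namespace DimDrop

variable (𝔭 𝔮 : Supernatural)

/-- The functions in `Z_{𝔭,𝔮}` with values in `M_n ⊗ M_m`. -/
def finSubalgebra (j : ℕ) :
    NonUnitalStarSubalgebra ℂ C(I, CMat (Fin (𝔭.level j) × Fin (𝔮.level j)) ℂ) :=
  (subalgebra 𝔭 𝔮).comap (compLeftHom (UHF.τ 𝔭 𝔮 j))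

/-- The functions in `Z_{𝔭,𝔮}` with values in `M_n ⊗ M_m`. -/
def Level (j : ℕ) : Type := finSubalgebra 𝔭 𝔮 j

instance (j : ℕ) : NonUnitalCStarAlgebra (Level 𝔭 𝔮 j) :=
  haveI : IsClosed (finSubalgebra 𝔭 𝔮 j : Set C(I, CMat (Fin (𝔭.level j) × Fin (𝔮.level j)) ℂ)) :=
    (isClosed_subalgebra 𝔭 𝔮).preimage (continuous_hom (compLeftHom (Y := I) (UHF.τ 𝔭 𝔮 j)))
  inferInstanceAs (NonUnitalCStarAlgebra (finSubalgebra 𝔭 𝔮 j))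

/-- The inclusion into the algebra of all functions. -/
def finIncl (j : ℕ) :
    Level 𝔭 𝔮 j →⋆ₙₐ[ℂ] C(I, CMat (Fin (𝔭.level j) × Fin (𝔮.level j)) ℂ) :=
  NonUnitalStarSubalgebraClass.subtype (finSubalgebra 𝔭 𝔮 j)

theorem finIncl_injective (j : ℕ) : Function.Injective (finIncl 𝔭 𝔮 j) := Subtype.val_injective

/-- At a finite level the endpoint conditions become commutation relations, by computing commutants
in M_n ⊗ M_m. This is the form required by `MatFunctor.exists_card_smul_eq`. -/
theorem exists_finIncl_eq (j : ℕ) (f) : (∃ z, finIncl 𝔭 𝔮 j z = f) ↔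
    (∀ y, Commute (f 0) (CMat.kronRight _ _ y)) ∧ ∀ x, Commute (f 1) (CMat.kronLeft _ _ x) := by
  have h1 : (∃ z, finIncl 𝔭 𝔮 j z = f) ↔ f ∈ finSubalgebra 𝔭 𝔮 j :=
    ⟨fun ⟨z, hz⟩ => hz ▸ z.2, fun h => ⟨⟨f, h⟩, rfl⟩⟩
  rw [h1]
  refine and_congr ⟨?_, fun h => ?_⟩ ⟨?_, fun h => ?_⟩
  · rintro ⟨x, hx⟩ y
    refine UHF.τ_injective 𝔭 𝔮 j ?_
    rw [map_mul, map_mul, UHF.τ_kronRight]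
    change UHF.inclLeft 𝔭 𝔮 x = UHF.τ 𝔭 𝔮 j (f 0) at hx
    rw [← hx]
    exact UHF.commute_inclLeft_inclRight 𝔭 𝔮 _ _
  · obtain ⟨x, hx⟩ := CMat.exists_kronLeft_eq h
    refine ⟨UHF.ι 𝔭 j x, ?_⟩
    change UHF.inclLeft 𝔭 𝔮 (UHF.ι 𝔭 j x) = UHF.τ 𝔭 𝔮 j (f 0)
    rw [← hx, UHF.τ_kronLeft]
  · rintro ⟨x, hx⟩ y
    refine UHF.τ_injective 𝔭 𝔮 j ?_
    rw [map_mul, map_mul, UHF.τ_kronLeft]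
    change UHF.inclRight 𝔭 𝔮 x = UHF.τ 𝔭 𝔮 j (f 1) at hx
    rw [← hx]
    exact (UHF.commute_inclLeft_inclRight 𝔭 𝔮 _ _).symm
  · obtain ⟨x, hx⟩ := CMat.exists_kronRight_eq h
    refine ⟨UHF.ι 𝔮 j x, ?_⟩
    change UHF.inclRight 𝔭 𝔮 (UHF.ι 𝔮 j x) = UHF.τ 𝔭 𝔮 j (f 1)
    rw [← hx, UHF.τ_kronRight]

/-- The inclusion into `Z_{𝔭,𝔮}`. -/
def ι (j : ℕ) : Level 𝔭 𝔮 j →⋆ₙₐ[ℂ] DimDrop 𝔭 𝔮 :=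
  factorHom ((compLeftHom (UHF.τ 𝔭 𝔮 j)).comp (finIncl 𝔭 𝔮 j)) (incl 𝔭 𝔮) (incl_injective 𝔭 𝔮)
    fun z => ⟨⟨_, z.2⟩, rfl⟩

theorem incl_ι (j : ℕ) (z : Level 𝔭 𝔮 j) :
    incl 𝔭 𝔮 (ι 𝔭 𝔮 j z) = compLeftHom (UHF.τ 𝔭 𝔮 j) (finIncl 𝔭 𝔮 j z) := apply_factorHom _ _ _ _ _

theorem ι_injective (j : ℕ) : Function.Injective (ι 𝔭 𝔮 j) := fun x y h => by
  have h1 := congrArg (incl 𝔭 𝔮) h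
  rw [incl_ι, incl_ι] at h1
  exact finIncl_injective 𝔭 𝔮 j (compLeftHom_injective (UHF.τ_injective 𝔭 𝔮 j) h1)

theorem exists_ι_eq (j k : ℕ) (h : j ≤ k) (z) : ∃ w, ι 𝔭 𝔮 k w = ι 𝔭 𝔮 j z := by
  let φ := factorHom (UHF.τ 𝔭 𝔮 j) (UHF.τ 𝔭 𝔮 k) (UHF.τ_injective 𝔭 𝔮 k) (UHF.exists_τ_eq 𝔭 𝔮 j k h)
  have h1 : compLeftHom (UHF.τ 𝔭 𝔮 k) (compLeftHom φ (finIncl 𝔭 𝔮 j z)) =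
      compLeftHom (UHF.τ 𝔭 𝔮 j) (finIncl 𝔭 𝔮 j z) :=
    ContinuousMap.ext fun t => apply_factorHom (UHF.τ 𝔭 𝔮 j) (UHF.τ 𝔭 𝔮 k)
      (UHF.τ_injective 𝔭 𝔮 k) (UHF.exists_τ_eq 𝔭 𝔮 j k h) (finIncl 𝔭 𝔮 j z t)
  have h2 : compLeftHom φ (finIncl 𝔭 𝔮 j z) ∈ finSubalgebra 𝔭 𝔮 k := by
    change compLeftHom (UHF.τ 𝔭 𝔮 k) (compLeftHom φ (finIncl 𝔭 𝔮 j z)) ∈ subalgebra 𝔭 𝔮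
    rw [h1]
    exact z.2
  let w : Level 𝔭 𝔮 k := ⟨_, h2⟩
  exact ⟨w, incl_injective 𝔭 𝔮 (((incl_ι 𝔭 𝔮 k w).trans h1).trans (incl_ι 𝔭 𝔮 j z).symm)⟩

/-- A function is approximated by continuous selection under an endpoint constraint. The constraint
is linear, so it passes through the partition of unity. -/
theorem exists_norm_ι_sub_lt (f : DimDrop 𝔭 𝔮) (ε : ℝ) (hε : 0 < ε) :
    ∃ j z, ‖ι 𝔭 𝔮 j z - f‖ < ε := by
  have H := isIndLim_of_nested (UHF.τ 𝔭 𝔮) (UHF.τ_injective 𝔭 𝔮) (UHF.exists_τ_eq 𝔭 𝔮)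
    (UHF.exists_norm_τ_sub_lt 𝔭 𝔮)
  obtain ⟨j, hj⟩ := H.exists_forall_compact (isCompact_range (incl 𝔭 𝔮 f).continuous) (half_pos hε)
  -- At the endpoints the approximants must be sought in M_𝔭 and M_𝔮 themselves; approximation in
  -- M_𝔭 ⊗ M_𝔮 would lose the constraint.
  obtain ⟨j₀, hj₀⟩ := (UHF.system 𝔭).isIndLim.exists_forall_compact
    (isCompact_singleton (x := ev₀ 𝔭 𝔮 f)) (half_pos hε)
  obtain ⟨j₁, hj₁⟩ := (UHF.system 𝔮).isIndLim.exists_forall_compact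
    (isCompact_singleton (x := ev₁ 𝔭 𝔮 f)) (half_pos hε)
  obtain ⟨k, hk, hk₀, hk₁⟩ : ∃ k, j ≤ k ∧ j₀ ≤ k ∧ j₁ ≤ k :=
    ⟨max j (max j₀ j₁), by omega, by omega, by omega⟩
  obtain ⟨x, hx⟩ : ∃ x, ‖UHF.ι 𝔭 k x - ev₀ 𝔭 𝔮 f‖ < ε / 2 := hj₀ k hk₀ _ rfl
  obtain ⟨y, hy⟩ : ∃ y, ‖UHF.ι 𝔮 k y - ev₁ 𝔭 𝔮 f‖ < ε / 2 := hj₁ k hk₁ _ rfl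
  obtain ⟨g, hg⟩ := exists_continuous_approx (ε := ε / 2) (UHF.τ 𝔭 𝔮 k) (incl 𝔭 𝔮 f)
    (fun t => {c | (t = 0 → ∀ y, Commute c (CMat.kronRight _ _ y)) ∧
      (t = 1 → ∀ x, Commute c (CMat.kronLeft _ _ x))}) (fun t => by
        intro a ha b hb s r _ _ _
        refine ⟨fun ht y => ?_, fun ht x => ?_⟩
        · exact ((ha.1 ht y).smul_left s).add_left ((hb.1 ht y).smul_left r)
        · exact ((ha.2 ht x).smul_left s).add_left ((hb.2 ht x).smul_left r)) (fun t => by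
    by_cases h0 : t = 0
    · subst h0
      -- Near 0 the constant x ⊗ 1 is admissible: it meets the condition at 0, and 1 is outside the
      -- chosen neighbourhood.
      refine ⟨CMat.kronLeft _ _ x, ?_, ?_⟩
      · rw [UHF.τ_kronLeft, ← inclLeft_evalZero, ← map_sub]
        exact (NonUnitalStarAlgHom.norm_apply_le _ _).trans_lt hx
      · filter_upwards [isOpen_compl_singleton.mem_nhds (show (0 : I) ∈ ({1}ᶜ : Set I) by simp)]
          with t ht
        exact ⟨fun _ y => CMat.commute_kronLeft_kronRight x y, fun h => absurd h ht⟩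
    by_cases h1 : t = 1
    · subst h1
      refine ⟨CMat.kronRight _ _ y, ?_, ?_⟩
      · rw [UHF.τ_kronRight, ← inclRight_evalOne, ← map_sub]
        exact (NonUnitalStarAlgHom.norm_apply_le _ _).trans_lt hy
      · filter_upwards [isOpen_compl_singleton.mem_nhds (show (1 : I) ∈ ({0}ᶜ : Set I) by simp)]
          with t ht
        exact ⟨fun h => absurd h ht, fun _ x => (CMat.commute_kronLeft_kronRight x y).symm⟩
    obtain ⟨c, hc⟩ := hj k hk (incl 𝔭 𝔮 f t) ⟨t, rfl⟩
    refine ⟨c, hc, ?_⟩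
    filter_upwards [isOpen_compl_singleton.mem_nhds h0, isOpen_compl_singleton.mem_nhds h1]
      with s hs hs'
    exact ⟨fun h => absurd h hs, fun h => absurd h hs'⟩)
  obtain ⟨z, hz⟩ := (exists_finIncl_eq 𝔭 𝔮 k g).2 ⟨(hg 0).2.1 rfl, (hg 1).2.2 rfl⟩
  refine ⟨k, z, ?_⟩
  rw [← (NonUnitalStarAlgHom.isometry (incl 𝔭 𝔮) (incl_injective 𝔭 𝔮)).norm_map_of_map_zero
    (map_zero _), map_sub, incl_ι, hz]
  refine lt_of_le_of_lt ((ContinuousMap.norm_le _ (half_pos hε).le).2 fun t => ?_) (half_lt_self hε)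
  exact (hg t).1.le

theorem isIndLim : IsIndLim (fun j k h => factorHom (ι 𝔭 𝔮 j) (ι 𝔭 𝔮 k) (ι_injective 𝔭 𝔮 k)
    (exists_ι_eq 𝔭 𝔮 j k h)) (ι 𝔭 𝔮) :=
  isIndLim_of_nested _ _ _ (exists_norm_ι_sub_lt 𝔭 𝔮)

/-- The unit function. -/
def finUnit (j : ℕ) : Level 𝔭 𝔮 j :=
  ⟨1, ((exists_finIncl_eq 𝔭 𝔮 j 1).2 ⟨fun _ => Commute.one_left _, fun _ => Commute.one_left _⟩).elim
    fun z h => h ▸ z.2⟩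

theorem finIncl_finUnit (j : ℕ) : finIncl 𝔭 𝔮 j (finUnit 𝔭 𝔮 j) = 1 := rfl

theorem isStarProjection_finUnit (j : ℕ) : IsStarProjection (finUnit 𝔭 𝔮 j) where
  isIdempotentElem := finIncl_injective 𝔭 𝔮 j (by rw [map_mul, finIncl_finUnit, mul_one])
  isSelfAdjoint := finIncl_injective 𝔭 𝔮 j (by
    rw [map_star, finIncl_finUnit]
    exact ContinuousMap.ext fun _ => star_one _)

theorem ι_finUnit (j : ℕ) : ι 𝔭 𝔮 j (finUnit 𝔭 𝔮 j) = unit 𝔭 𝔮 :=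
  incl_injective 𝔭 𝔮 <| ContinuousMap.ext fun t => by
    rw [incl_ι, incl_unit, compLeftHom_apply, finIncl_finUnit]
    exact UHF.τ_one 𝔭 𝔮 j

/-- Both n and m times a class come from K₀(F ℂ), by contracting the interval to one endpoint or the
other. Since n and m are coprime, so does the class itself. -/
theorem exists_K_finUnit_eq (h : Supernatural.Coprime 𝔭 𝔮) (F : MatFunctor.{u, 0}) (j : ℕ)
    (z : K0 (F.obj (Level 𝔭 𝔮 j))) : ∃ x, F.K (toMat (scalOne (finUnit 𝔭 𝔮 j)
      (isStarProjection_finUnit 𝔭 𝔮 j))) x = z := by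
  have : Nontrivial (CMat (Fin (𝔭.level j) × Fin (𝔮.level j)) ℂ) :=
    ⟨_, _, UHF.unit_ne_zero (0, 0) (0, 0)⟩
  obtain ⟨x, hx⟩ := F.exists_card_smul_eq (CMat.kronLeft (Fin (𝔭.level j)) (Fin (𝔮.level j)))
    CMat.kron_one_one (S := Set.range (CMat.kronRight _ _))
    (by rintro _ ⟨y, rfl⟩ x; exact CMat.commute_kronLeft_kronRight x y)
    (fun c h h' => CMat.exists_smul_one_eq h' fun y => h _ ⟨y, rfl⟩)
    (finIncl 𝔭 𝔮 j) (finIncl_injective 𝔭 𝔮 j) 0 1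
    (fun f => by rw [exists_finIncl_eq, Set.forall_mem_range])
    -- The contraction (s, t) ↦ ts to the endpoint 0.
    ⟨fun q => q.2 * q.1, by fun_prop⟩ (fun t => mul_zero t) (fun t => mul_one t)
    (fun s => zero_mul s) (isStarProjection_finUnit 𝔭 𝔮 j) (finIncl_finUnit 𝔭 𝔮 j) z
  obtain ⟨x', hx'⟩ := F.exists_card_smul_eq (CMat.kronRight (Fin (𝔭.level j)) (Fin (𝔮.level j)))
    CMat.kron_one_one (S := Set.range (CMat.kronLeft _ _))
    (by rintro _ ⟨x, rfl⟩ y; exact (CMat.commute_kronLeft_kronRight x y).symm)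
    (fun c h h' => CMat.exists_smul_one_eq (fun x => h _ ⟨x, rfl⟩) h')
    (finIncl 𝔭 𝔮 j) (finIncl_injective 𝔭 𝔮 j) 1 0
    (fun f => by rw [exists_finIncl_eq, Set.forall_mem_range, and_comm])
    -- The contraction (s, t) ↦ 1 - (1 - t)s to the endpoint 1.
    ⟨fun q => unitInterval.symm (unitInterval.symm q.2 * q.1), by fun_prop⟩
    (fun t => by simp) (fun t => by simp) (fun s => by simp) (isStarProjection_finUnit 𝔭 𝔮 j)
    (finIncl_finUnit 𝔭 𝔮 j) z
  rw [Fintype.card_fin] at hx hx'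
  have hc := h.coprime (𝔭.dvd_level j) (𝔮.dvd_level j)
  have hb := Nat.gcd_eq_gcd_ab (𝔭.level j) (𝔮.level j)
  rw [hc.gcd_eq_one] at hb
  refine ⟨(𝔭.level j).gcdA (𝔮.level j) • x + (𝔭.level j).gcdB (𝔮.level j) • x', ?_⟩
  rw [map_add, map_zsmul, map_zsmul, hx, hx', ← natCast_zsmul, ← natCast_zsmul, smul_smul,
    smul_smul, ← add_smul, mul_comm, mul_comm (Nat.gcdB _ _), ← hb]
  exact one_zsmul z

theorem surjective_K_unit (h : Supernatural.Coprime 𝔭 𝔮) (F : MatFunctor.{u, 0}) :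
    Function.Surjective (F.K (toMat (scalOne (unit 𝔭 𝔮) (isStarProjection_unit 𝔭 𝔮)))) := by
  intro y
  obtain ⟨j, z, hz⟩ := (F.isIndLim (isIndLim 𝔭 𝔮) (ι_injective 𝔭 𝔮)).exists_K0_map_eq y
  obtain ⟨x, hx⟩ := exists_K_finUnit_eq 𝔭 𝔮 h F j z
  refine ⟨x, ?_⟩
  rw [← F.K_toMat, ← hx, F.K_toMat_K_scalOne] at hz
  rw [← hz]
  congr 4
  exact (ι_finUnit 𝔭 𝔮 j).symm

end DimDrop

end

open scoped TensorProduct ZeroAtInfty Matrix unitInterval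

noncomputable section

namespace KTheory

/-! ### Paths of unitaries -/

/-- On a finite spectrum the argument is continuous whether or not its branch cut is met, so the
functional calculus provides a logarithm that commutes with whatever commutes with `u` and its
adjoint. -/
theorem exists_selfAdjoint_expUnitary_eq {E : Type*} [CStarAlgebra E] (u : unitary E)
    (h : (spectrum ℂ (u : E)).Finite) :
    ∃ a : selfAdjoint E, selfAdjoint.expUnitary a = u ∧
      ∀ p : E, Commute (u : E) p → Commute (star u : E) p → Commute (a : E) p := by
  refine ⟨Unitary.argSelfAdjoint u, ?_, fun p h1 h2 => h1.cfc h2 _⟩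
  ext
  have hc : ContinuousOn (fun z : ℂ => (z.arg : ℂ)) (spectrum ℂ (u : E)) := h.continuousOn _
  rw [selfAdjoint.expUnitary_coe, Unitary.argSelfAdjoint_coe,
    ← CFC.exp_eq_normedSpace_exp (𝕜 := ℂ), ← cfc_comp_smul .., ← cfc_comp' ..]
  conv_rhs => rw [← cfc_id' ℂ (u : E)]
  refine cfc_congr fun y hy => ?_
  have hy₁ : ‖y‖ = 1 := spectrum.norm_eq_one_of_unitary u.2 hy
  have h3 : Complex.I * y.arg = Complex.log y :=
    Complex.ext (by simp [Complex.log_re, hy₁]) (by simp [Complex.log_im])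
  have h4 : y ≠ 0 := by
    rintro rfl
    simp at hy₁
  simpa [← Complex.exp_eq_exp_ℂ, h3] using Complex.exp_log h4

theorem spectrum_finite {κ : Type*} [Fintype κ] [DecidableEq κ] (x : CMat κ ℂ) :
    (spectrum ℂ x).Finite := Matrix.finite_spectrum (CMat.toM κ ℂ x)

theorem mul_eq_of_star_mul_self {E : Type*} [NonUnitalCStarAlgebra E] {p x : E}
    (hp : IsStarProjection p) (h : star x * x = p) : x * p = x := by
  have hp1 : p * p = p := hp.isIdempotentElem
  have hp2 : star p = p := hp.isSelfAdjoint
  rw [← sub_eq_zero, ← CStarRing.star_mul_self_eq_zero_iff, star_sub, star_mul, hp2, sub_mul,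
    mul_sub, mul_sub, ← mul_assoc, mul_assoc p, h, ← mul_assoc, h]
  simp only [hp1, sub_self]

theorem mul_eq_of_mul_star_self {E : Type*} [NonUnitalCStarAlgebra E] {p x : E}
    (hp : IsStarProjection p) (h : x * star x = p) : p * x = x := by
  have hp2 : star p = p := hp.isSelfAdjoint
  have h3 := congrArg star (mul_eq_of_star_mul_self (x := star x) hp (by rw [star_star, h]))
  rwa [star_mul, star_star, hp2] at h3

/-- Unitaries in a corner of a matrix algebra are connected to the unit. -/
theorem exists_path_of_partialIsometry {E : Type*} [CStarAlgebra E]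
    (hE : ∀ x : E, (spectrum ℂ x).Finite) {p w : E} (h1 : star w * w = p) (h2 : w * star w = p)
    (hp : IsStarProjection p) :
    ∃ γ : C(ℝ, E), γ 0 = p ∧ γ 1 = w ∧ ∀ s, star (γ s) * γ s = p ∧ γ s * star (γ s) = p := by
  have hp1 : p * p = p := hp.isIdempotentElem
  have hp2 : star p = p := hp.isSelfAdjoint
  have hwp : w * p = w := mul_eq_of_star_mul_self hp h1
  have hpw : p * w = w := mul_eq_of_mul_star_self hp h2
  have hws : star w * p = star w := by rw [← hp2, ← star_mul, hpw]
  have hsw : p * star w = star w := by rw [← hp2, ← star_mul, hwp]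
  -- The unitary `w` of the corner is completed by the identity on the complement of `p`, so that
  -- logarithms can be taken in the unital algebra `E`.
  have hu : w + (1 - p) ∈ unitary E := by
    rw [Unitary.mem_iff]
    constructor
    · simp only [star_add, star_sub, star_one, hp2, add_mul, mul_add, sub_mul, mul_sub, one_mul,
        mul_one, h1, hws, hpw, hp1]
      abel
    · simp only [star_add, star_sub, star_one, hp2, add_mul, mul_add, sub_mul, mul_sub, one_mul,
        mul_one, h2, hsw, hwp, hp1]
      abel
  obtain ⟨a, ha, hap⟩ := exists_selfAdjoint_expUnitary_eq ⟨_, hu⟩ (hE _)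
  have hap' : Commute (a : E) p := by
    refine hap p ?_ ?_
    · change (w + (1 - p)) * p = p * (w + (1 - p))
      simp only [add_mul, mul_add, sub_mul, mul_sub, one_mul, mul_one, hwp, hpw]
    · change star (w + (1 - p)) * p = p * star (w + (1 - p))
      simp only [star_add, star_sub, star_one, hp2, add_mul, mul_add, sub_mul, mul_sub, one_mul,
        mul_one, hws, hsw]
  have hc (s : ℝ) : Commute (selfAdjoint.expUnitary (s • a) : E) p := by
    rw [selfAdjoint.expUnitary_coe]
    refine Commute.exp_left ?_
    exact (hap'.smul_left s).smul_left Complex.I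
  -- The path is p exp(isa). It stays in the corner because `a` commutes with `p`.
  have hcont : Continuous fun s : ℝ => p * (selfAdjoint.expUnitary (s • a) : E) :=
    continuous_const.mul (continuous_subtype_val.comp
      (selfAdjoint.continuous_expUnitary.comp (continuous_id.smul continuous_const)))
  refine ⟨⟨_, hcont⟩, ?_, ?_, fun s => ⟨?_, ?_⟩⟩
  · simp
  · simp only [ContinuousMap.coe_mk, one_smul, ha]
    rw [mul_add, hpw, mul_sub, hp1, mul_one, sub_self, add_zero]
  · simp only [ContinuousMap.coe_mk]
    rw [star_mul, hp2, mul_assoc, ← mul_assoc p p, hp1, ← (hc s).eq, ← mul_assoc]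
    rw [Unitary.coe_star_mul_self, one_mul]
  · simp only [ContinuousMap.coe_mk]
    rw [star_mul, hp2, mul_assoc, ← mul_assoc _ (star _) p, ← Unitary.coe_star,
      Unitary.coe_mul_star_self, one_mul, hp1]

/-! ### The group `K₁(ℂ)` -/

namespace Susp

/-- The extension by zero to the extended real line. -/
def extend (f : Susp ℂ) (t : EReal) : ℂ := if t = ⊥ ∨ t = ⊤ then 0 else f t.toReal

@[simp] theorem extend_bot (f : Susp ℂ) : extend f ⊥ = 0 := if_pos (Or.inl rfl)

@[simp] theorem extend_top (f : Susp ℂ) : extend f ⊤ = 0 := if_pos (Or.inr rfl)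

@[simp] theorem extend_coe (f : Susp ℂ) (r : ℝ) : extend f r = f r := by simp [extend]

/-- Only ±∞ need an argument: the set where |f| ≥ ε is compact in the line, hence closed in the
extended line, and it misses both points. -/
theorem continuous_extend (f : Susp ℂ) : Continuous (extend f) := by
  have h0 {t : EReal} (ht : ∀ r : ℝ, t ≠ r) (h1 : extend f t = 0) : ContinuousAt (extend f) t := by
    rw [ContinuousAt, h1, Metric.tendsto_nhds]
    intro ε hε
    have h2 : IsCompact {r : ℝ | ε ≤ ‖f r‖} := by
      have h3 : ∀ᶠ r in Filter.cocompact ℝ, ‖f r‖ < ε := by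
        have h4 := (zero_at_infty (show C₀(ℝ, ℂ) from f)).norm
        rw [norm_zero] at h4
        exact h4.eventually_lt_const hε
      obtain ⟨K, hK, hKs⟩ := Filter.mem_cocompact.1 h3
      refine hK.of_isClosed_subset (isClosed_le continuous_const f.continuous_apply.norm) ?_
      intro r hr
      by_contra hrK
      exact absurd (show ‖f r‖ < ε from hKs hrK) (not_lt.2 hr)
    have h5 := (h2.image continuous_coe_real_ereal).isClosed.isOpen_compl
    have h6 : t ∈ (((↑) : ℝ → EReal) '' {r : ℝ | ε ≤ ‖f r‖})ᶜ := by
      rintro ⟨r, -, hr⟩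
      exact ht r hr.symm
    filter_upwards [h5.mem_nhds h6] with s hs
    rw [dist_zero_right]
    induction s with
    | bot => simpa using hε
    | top => simpa using hε
    | coe r =>
      rw [extend_coe]
      by_contra! hr
      exact hs ⟨r, hr, rfl⟩
  rw [continuous_iff_continuousAt]
  intro t
  induction t with
  | bot => exact h0 (fun r => (EReal.coe_ne_bot r).symm) (extend_bot f)
  | top => exact h0 (fun r => (EReal.coe_ne_top r).symm) (extend_top f)
  | coe r =>
    rw [← EReal.isOpenEmbedding_coe.continuousAt_iff]
    refine f.continuous_apply.continuousAt.congr (Filter.Eventually.of_forall fun s => ?_)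
    exact (extend_coe f s).symm

/-- Evaluation of elements of the unitization at points of the extended real line. -/
def evalU (t : EReal) : Unitization ℂ (Susp ℂ) →⋆ₙₐ[ℂ] ℂ where
  toFun x := x.fst + extend x.snd t
  map_smul' c x := by
    induction t with
    | bot => simp
    | top => simp
    | coe r =>
      simp only [extend_coe, Unitization.fst_smul, Unitization.snd_smul, smul_add]
      rfl
  map_zero' := by
    induction t with
    | bot => simp
    | top => simp
    | coe r =>
      simp only [extend_coe, Unitization.fst_zero, Unitization.snd_zero, zero_add]
      rfl
  map_add' x y := by
    induction t with
    | bot => simp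
    | top => simp
    | coe r =>
      simp only [extend_coe, Unitization.fst_add, Unitization.snd_add]
      rw [show (x.snd + y.snd) r = x.snd r + y.snd r from rfl]
      ring
  map_mul' x y := by
    induction t with
    | bot => simp
    | top => simp
    | coe r =>
      simp only [extend_coe, Unitization.fst_mul, Unitization.snd_mul]
      rw [show (x.fst • y.snd + y.fst • x.snd + x.snd * y.snd) r =
        x.fst * y.snd r + y.fst * x.snd r + x.snd r * y.snd r from rfl]
      ring
  map_star' x := by
    induction t with
    | bot => simp
    | top => simp
    | coe r =>
      simp only [extend_coe, Unitization.fst_star, Unitization.snd_star, star_add]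
      rfl

theorem evalU_apply (t : EReal) (x : Unitization ℂ (Susp ℂ)) :
    evalU t x = x.fst + extend x.snd t := rfl

theorem evalU_bot (x : Unitization ℂ (Susp ℂ)) : evalU ⊥ x = x.fst := by simp [evalU_apply]

theorem evalU_top (x : Unitization ℂ (Susp ℂ)) : evalU ⊤ x = x.fst := by simp [evalU_apply]

theorem continuous_evalU (x : Unitization ℂ (Susp ℂ)) : Continuous fun t => evalU t x :=
  continuous_const.add (continuous_extend _)

theorem ext_evalU {x y : Unitization ℂ (Susp ℂ)} (h : ∀ t, evalU t x = evalU t y) : x = y := by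
  have h1 : x.fst = y.fst := by rw [← evalU_bot, h, evalU_bot]
  refine Unitization.ext h1 (Susp.ext fun r => ?_)
  have h2 := h r
  rw [evalU_apply, evalU_apply, h1, extend_coe, extend_coe] at h2
  exact add_left_cancel h2

/-- The unitization of the suspension of ℂ is thereby the algebra of continuous functions on the
extended line with equal values at the two ends. -/
theorem exists_evalU_eq (g : C(EReal, ℂ)) (hg : g ⊥ = g ⊤) :
    ∃ x : Unitization ℂ (Susp ℂ), ∀ t, evalU t x = g t := by
  have h1 : Filter.Tendsto (fun r : ℝ => g r - g ⊥) (Filter.cocompact ℝ) (nhds 0) := by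
    rw [cocompact_eq_atBot_atTop, Filter.tendsto_sup]
    constructor
    · have h2 := ((g.continuous.tendsto ⊥).comp EReal.tendsto_coe_atBot).sub_const (g ⊥)
      rwa [sub_self] at h2
    · have h2 := ((g.continuous.tendsto ⊤).comp EReal.tendsto_coe_atTop).sub_const (g ⊥)
      rwa [hg, sub_self, ← hg] at h2
  let f : C₀(ℝ, ℂ) := ⟨⟨fun r => g r - g ⊥,
    (g.continuous.comp continuous_coe_real_ereal).sub continuous_const⟩, h1⟩
  refine ⟨Unitization.inl (g ⊥) + Unitization.inr (show Susp ℂ from f), fun t => ?_⟩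
  have h3 (r : ℝ) : (show Susp ℂ from f) r = g r - g ⊥ := rfl
  rw [evalU_apply, Unitization.fst_add, Unitization.fst_inl, Unitization.fst_inr, add_zero,
    Unitization.snd_add, Unitization.snd_inl, Unitization.snd_inr, zero_add]
  induction t with
  | bot => rw [extend_bot, add_zero]
  | top => rw [extend_top, add_zero, hg]
  | coe r => rw [extend_coe, h3, add_sub_cancel]

end Susp

theorem CMat.exists_evalU_eq {κ : Type*} [Fintype κ] (g : C(EReal, CMat κ ℂ)) (hg : g ⊥ = g ⊤) :
    ∃ x : Matrix κ κ (Unitization ℂ (Susp ℂ)), ∀ t i j, Susp.evalU t (x i j) = toM _ _ (g t) i j := by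
  have h (i j : κ) : ∃ x : Unitization ℂ (Susp ℂ), ∀ t, Susp.evalU t x = toM _ _ (g t) i j :=
    Susp.exists_evalU_eq ⟨fun t => toM _ _ (g t) i j, CMat.continuous_iff.1 g.continuous i j⟩
      (by simp [hg])
  choose x hx using h
  exact ⟨Matrix.of x, fun t i j => hx i j t⟩

/-- A loop of projections in a matrix algebra is trivial. On the contractible extended line it is
equivalent to a constant, and the mismatch at the two ends is removed because unitaries of a corner
are connected to its unit. -/
theorem mvN_scalar {κ : Type*} [Fintype κ] [DecidableEq κ]
    {P : Matrix κ κ (Unitization ℂ (Susp ℂ))} (hP : IsStarProjection P) :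
    MvN P ((P.map (scalarPart (Susp ℂ))).map (scalarHom (Susp ℂ))) := by
  let f : C(EReal, CMat κ ℂ) := ⟨fun t => CMat.ofM _ _ (P.map (Susp.evalU t)),
    CMat.continuous_iff.2 fun i j => Susp.continuous_evalU (P i j)⟩
  have hf (t : EReal) : IsStarProjection (f t) :=
    CMat.isStarProjection_ofM (isStarProjection_map hP (Susp.evalU t))
  have hbot : f ⊥ = CMat.ofM _ _ (P.map (scalarPart (Susp ℂ))) :=
    CMat.ext fun i j => Susp.evalU_bot _
  have htop : f ⊤ = f ⊥ := CMat.ext fun i j => (Susp.evalU_top _).trans (Susp.evalU_bot _).symm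
  -- The minimum contracts the extended line to ⊥: the parameter ⊤ gives `f` and ⊥ gives the
  -- constant `f ⊥`.
  let H : C(EReal × EReal, CMat κ ℂ) := ⟨fun q => f (min q.1 q.2), by fun_prop⟩
  obtain ⟨V, hV1, hV2⟩ := pEquiv_of_continuous (P := H.curry) H.curry.continuous (fun s =>
    ⟨ContinuousMap.ext fun t => (hf _).isIdempotentElem,
      ContinuousMap.ext fun t => (hf _).isSelfAdjoint⟩) ⊤ ⊥
  have hV1' (t : EReal) : star (V t) * V t = f t := by
    have h := DFunLike.congr_fun hV1 t
    have h' : H.curry ⊤ t = f t := congrArg f (min_eq_right le_top)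
    rw [h'] at h
    exact h
  have hV2' (t : EReal) : V t * star (V t) = f ⊥ := by
    have h := DFunLike.congr_fun hV2 t
    have h' : H.curry ⊥ t = f ⊥ := congrArg f (min_eq_left bot_le)
    rw [h'] at h
    exact h
  obtain ⟨γ, hγ0, hγ1, hγ⟩ := exists_path_of_partialIsometry spectrum_finite (p := f ⊥)
    (w := star (V ⊥)) (by rw [star_star, hV2']) (by rw [star_star, hV1']) (hf ⊥)
  obtain ⟨δ, hδ0, hδ1, hδ⟩ := exists_path_of_partialIsometry spectrum_finite (p := f ⊥)
    (w := star (V ⊤)) (by rw [star_star, hV2']) (by rw [star_star, hV1', htop]) (hf ⊥)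
  obtain ⟨a, ha0, ha1, -⟩ := exists_continuous_zero_one_of_isClosed
    (isClosed_singleton (x := (⊥ : EReal))) (isClosed_singleton (x := (⊤ : EReal))) (by simp)
  have ha0' : a ⊥ = 0 := ha0 rfl
  have ha1' : a ⊤ = 1 := ha1 rfl
  have hpp : f ⊥ * f ⊥ = f ⊥ := (hf ⊥).isIdempotentElem
  have hpV (t : EReal) : f ⊥ * V t = V t := mul_eq_of_mul_star_self (hf ⊥) (hV2' t)
  -- The paths correct `V` on the left by `star (V ⊥)` at ⊥ and by `star (V ⊤)` at ⊤, so that `W`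
  -- takes the value `f ⊥` at both ends and comes from the unitization. The range projection stays
  -- `f ⊥` throughout.
  let W : C(EReal, CMat κ ℂ) := ⟨fun t => γ (1 - a t) * δ (a t) * V t, by fun_prop⟩
  have hW (t : EReal) : W t = γ (1 - a t) * δ (a t) * V t := rfl
  have hWb : W ⊥ = f ⊥ := by
    rw [hW, ha0', sub_zero, hγ1, hδ0, mul_assoc, hpV, hV1']
  have hWt : W ⊤ = f ⊥ := by
    rw [hW, ha1', sub_self, hγ0, hδ1, mul_assoc, hV1', htop, hpp]
  have hW1 (t : EReal) : star (W t) * W t = f t := by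
    rw [hW, star_mul, star_mul, mul_assoc, mul_assoc, mul_assoc (γ _), ← mul_assoc (star (γ _)),
      (hγ _).1, ← mul_assoc (f ⊥), mul_eq_of_mul_star_self (hf ⊥) (hδ _).2, ← mul_assoc (star (δ _)),
      (hδ _).1, hpV, hV1']
  have hW2 (t : EReal) : W t * star (W t) = f ⊥ := by
    rw [hW, star_mul, star_mul, mul_assoc (γ _ * δ _), ← mul_assoc (V t), hV2', ← mul_assoc,
      mul_assoc (γ _), mul_eq_of_star_mul_self (hf ⊥) (hδ _).1, mul_assoc, ← mul_assoc (δ _),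
      (hδ _).2, ← mul_assoc, mul_eq_of_star_mul_self (hf ⊥) (hγ _).1, (hγ _).2]
  obtain ⟨w, hw⟩ := CMat.exists_evalU_eq W (hWb.trans hWt.symm)
  have hwm (t : EReal) : w.map (Susp.evalU t) = CMat.toM _ _ (W t) := Matrix.ext fun i j => hw t i j
  have hwc (t : EReal) : wᴴ.map (Susp.evalU t) = CMat.toM _ _ (star (W t)) := by
    rw [Matrix.conjTranspose_map _ (fun x => map_star (Susp.evalU t) x), hwm, map_star]
    rfl
  refine ⟨w, Matrix.ext fun i j => Susp.ext_evalU fun t => ?_,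
    Matrix.ext fun i j => Susp.ext_evalU fun t => ?_⟩
  · have h := congrFun₂ (Matrix.map_mul (L := wᴴ) (M := w) (f := Susp.evalU t)) i j
    rw [hwm, hwc, ← map_mul, hW1] at h
    exact h
  · have h := congrFun₂ (Matrix.map_mul (L := w) (M := wᴴ) (f := Susp.evalU t)) i j
    rw [hwm, hwc, ← map_mul, hW2, hbot] at h
    refine h.trans ?_
    have h' (c : ℂ) : Susp.evalU t (scalarHom (Susp ℂ) c) = c := by
      rw [Susp.evalU_apply]
      change c + Susp.extend 0 t = c
      induction t with
      | bot => simp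
      | top => simp
      | coe r =>
        rw [Susp.extend_coe]
        exact add_zero c
    exact (h' _).symm

/-- Since every projection is equivalent to its scalar part, the map K₀((Sℂ)⁺) → K₀(ℂ) is injective,
and K₀(Sℂ) is its kernel. -/
theorem subsingleton_K1_complex : Subsingleton (K0 (Susp ℂ)) := by
  refine ⟨fun x y => ?_⟩
  suffices h : ∀ x : K0 (Susp ℂ), x = 0 by rw [h x, h y]
  intro x
  have h1 (z : K00 (Unitization ℂ (Susp ℂ))) :
      K00.map (scalarHom (Susp ℂ)) (K00.map (scalarPart (Susp ℂ)) z) = z := by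
    refine DFunLike.congr_fun (f := (K00.map (scalarHom (Susp ℂ))).comp
      (K00.map (scalarPart (Susp ℂ)))) (g := AddMonoidHom.id _) (K00.hom_ext fun p => ?_) z
    rw [AddMonoidHom.comp_apply, K00.map_of, K00.map_of]
    exact K00.of_eq_of_mvN (mvN_scalar p.isProj).symm
  refine Subtype.ext ?_
  rw [← h1 x.1, show K00.map (scalarPart (Susp ℂ)) x.1 = 0 from x.2, map_zero]
  rfl

/-- For the suspended identity functor the limit description expresses every element of K₁(D)
through K₁(ℂ). -/
theorem UHFSystem.subsingleton_K1 {D : Type} [CStarAlgebra D] (S : UHFSystem D) :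
    Subsingleton (K1 D) := by
  refine ⟨fun x y => ?_⟩
  have := subsingleton_K1_complex
  suffices h : ∀ x : K1 D, x = 0 by rw [h x, h y]
  intro x
  obtain ⟨j, z, hz⟩ := S.exists_J_eq (MatFunctor.susp MatFunctor.id) x
  have h1 : z = 0 := Subsingleton.elim (α := K0 (Susp ℂ)) _ _
  rw [← hz, h1]
  exact map_zero _

end KTheory

end

open scoped TensorProduct ZeroAtInfty Matrix unitInterval

noncomputable section

namespace KTheory

/-! ### Orthogonal homomorphisms and direct sums -/

section Orthogonal

variable {A B : Type*} [NonUnitalCStarAlgebra A] [NonUnitalCStarAlgebra B]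

/-- The homomorphism `a ↦ u u* ⊗ φ(a) + w w* ⊗ ψ(a)` defined by orthogonal homomorphisms and real
unit vectors. -/
def vecHom {κ : Type*} [Fintype κ] (φ ψ : A →⋆ₙₐ[ℂ] B) (h : ∀ a b, φ a * ψ b = 0)
    (h' : ∀ a b, ψ a * φ b = 0) (u w : κ → ℝ) (hu : ∑ k, u k * u k = 1) (hw : ∑ k, w k * w k = 1) :
    A →⋆ₙₐ[ℂ] Matrix κ κ B where
  toFun a := Matrix.of fun i j => (u i * u j) • φ a + (w i * w j) • ψ a
  map_smul' c a := Matrix.ext fun i j => by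
    simp only [map_smul, Matrix.of_apply, Matrix.smul_apply, smul_add, MonoidHom.id_apply]
    rw [smul_comm c, smul_comm c]
  map_zero' := Matrix.ext fun i j => by simp
  map_add' a b := Matrix.ext fun i j => by
    simp only [map_add, Matrix.of_apply, Matrix.add_apply, smul_add]
    abel
  map_mul' a b := Matrix.ext fun i j => by
    rw [Matrix.mul_apply]
    simp only [Matrix.of_apply, mul_add, add_mul, smul_mul_smul_comm, h, h', smul_zero, add_zero,
      zero_add, ← map_mul, Finset.sum_add_distrib, ← Finset.sum_smul]
    congr 2
    · rw [show ∑ k, u i * u k * (u k * u j) = u i * u j * ∑ k, u k * u k by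
        rw [Finset.mul_sum]; exact Finset.sum_congr rfl fun k _ => by ring, hu, mul_one]
    · rw [show ∑ k, w i * w k * (w k * w j) = w i * w j * ∑ k, w k * w k by
        rw [Finset.mul_sum]; exact Finset.sum_congr rfl fun k _ => by ring, hw, mul_one]
  map_star' a := Matrix.ext fun i j => by
    simp only [map_star, Matrix.star_apply, Matrix.of_apply, star_add, star_smul, star_trivial]
    rw [mul_comm (u i), mul_comm (w i)]

theorem vecHom_apply {κ : Type*} [Fintype κ] (φ ψ : A →⋆ₙₐ[ℂ] B) (h : ∀ a b, φ a * ψ b = 0)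
    (h' : ∀ a b, ψ a * φ b = 0) (u w : κ → ℝ) (hu : ∑ k, u k * u k = 1) (hw : ∑ k, w k * w k = 1)
    (a : A) (i j : κ) :
    vecHom φ ψ h h' u w hu hw a i j = (u i * u j) • φ a + (w i * w j) • ψ a := rfl

/-- `K₀` is additive on orthogonal homomorphisms. -/
theorem K0.map_add_of_orthogonal (φ ψ χ : A →⋆ₙₐ[ℂ] B) (hχ : ∀ a, χ a = φ a + ψ a)
    (h : ∀ a b, φ a * ψ b = 0) (x : K0 A) : K0.map χ x = K0.map φ x + K0.map ψ x := by
  have h' (a b : A) : ψ a * φ b = 0 := by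
    rw [← star_star (ψ a * φ b), star_mul, ← map_star, ← map_star, h, star_zero]
  -- The vector carrying ψ is rotated from the first basis vector to the second, while φ stays on
  -- the first. This turns (φ + ψ) ⊕ 0 into φ ⊕ ψ; orthogonality keeps every stage multiplicative.
  let w (s : ℝ) : Unit ⊕ Unit → ℝ := Sum.elim (fun _ => Real.cos s) (fun _ => Real.sin s)
  have hw (s : ℝ) : ∑ k, w s k * w s k = 1 := by
    simp only [w, Fintype.sum_sum_type, Sum.elim_inl, Sum.elim_inr, Finset.univ_unique,
      Finset.sum_singleton]
    rw [← sq, ← sq, Real.cos_sq_add_sin_sq]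
  have key := K0.mapI_eq_of_homotopy (fun s : ℝ => vecHom φ ψ h h' (w 0) (w s) (hw 0) (hw s))
    (fun a i j => by
      simp only [vecHom_apply]
      have hc (i : Unit ⊕ Unit) : Continuous fun s => w s i := by
        rcases i with i | i
        · exact Real.continuous_cos
        · exact Real.continuous_sin
      exact continuous_const.add (((hc i).mul (hc j)).smul continuous_const)) 0 (Real.pi / 2)
  have e0 : vecHom φ ψ h h' (w 0) (w 0) (hw 0) (hw 0) =
      sumHom (toMat χ) (0 : A →⋆ₙₐ[ℂ] Matrix Unit Unit B) := by
    refine matHom_ext fun a i j => ?_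
    rw [vecHom_apply, sumHom_apply]
    rcases i with i | i <;> rcases j with j | j <;> simp [w, hχ, toMat_apply]
  have e1 : vecHom φ ψ h h' (w 0) (w (Real.pi / 2)) (hw 0) (hw (Real.pi / 2)) =
      sumHom (toMat φ) (toMat ψ) := by
    refine matHom_ext fun a i j => ?_
    rw [vecHom_apply, sumHom_apply]
    rcases i with i | i <;> rcases j with j | j <;> simp [w, toMat_apply]
  rw [e0, e1, K0.mapI_sumHom, K0.mapI_sumHom, K0.mapI_zero, add_zero] at key
  rw [K0.map_eq_mapI, K0.map_eq_mapI, K0.map_eq_mapI, key, AddMonoidHom.add_apply]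

theorem K0.map_zero (x : K0 A) : K0.map (0 : A →⋆ₙₐ[ℂ] B) x = 0 := by
  rw [K0.map_eq_mapI, show toMat (0 : A →⋆ₙₐ[ℂ] B) = 0 from matHom_ext fun _ _ _ => rfl,
    K0.mapI_zero]
  rfl

end Orthogonal

section Biproduct

variable {P Q R : Type*} [NonUnitalCStarAlgebra P] [NonUnitalCStarAlgebra Q]
  [NonUnitalCStarAlgebra R]

/-- `K₀` of a direct sum. -/
theorem K0.bijective_of_biproduct (l : P →⋆ₙₐ[ℂ] R) (r : Q →⋆ₙₐ[ℂ] R) (f : R →⋆ₙₐ[ℂ] P)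
    (g : R →⋆ₙₐ[ℂ] Q) (hfl : ∀ a, f (l a) = a) (hgr : ∀ b, g (r b) = b) (hfr : ∀ b, f (r b) = 0)
    (hgl : ∀ a, g (l a) = 0) (h : ∀ c, c = l (f c) + r (g c)) :
    Function.Bijective fun x : K0 P × K0 Q => K0.map l x.1 + K0.map r x.2 := by
  have hlr (a b) : l a * r b = 0 := by
    rw [h (l a * r b), map_mul f, map_mul g, hfr, mul_zero, hgl, zero_mul, _root_.map_zero,
      _root_.map_zero, add_zero]
  have e1 (x : K0 P) : K0.map f (K0.map l x) = x := by
    rw [K0.map_map, show f.comp l = NonUnitalStarAlgHom.id ℂ P from DFunLike.ext _ _ hfl, K0.map_id]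
  have e2 (x : K0 Q) : K0.map g (K0.map r x) = x := by
    rw [K0.map_map, show g.comp r = NonUnitalStarAlgHom.id ℂ Q from DFunLike.ext _ _ hgr, K0.map_id]
  have e3 (x : K0 Q) : K0.map f (K0.map r x) = 0 := by
    rw [K0.map_map, show f.comp r = 0 from DFunLike.ext _ _ hfr, K0.map_zero]
  have e4 (x : K0 P) : K0.map g (K0.map l x) = 0 := by
    rw [K0.map_map, show g.comp l = 0 from DFunLike.ext _ _ hgl, K0.map_zero]
  refine Function.bijective_iff_has_inverse.2 ⟨fun z => (K0.map f z, K0.map g z), fun x => ?_,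
    fun z => ?_⟩
  · refine Prod.ext ?_ ?_
    · simp only [map_add, e1, e3, add_zero]
    · simp only [map_add, e2, e4, zero_add]
  · simp only [K0.map_map]
    rw [← K0.map_add_of_orthogonal (l.comp f) (r.comp g) (NonUnitalStarAlgHom.id ℂ R) h
      (fun a b => hlr _ _), K0.map_id]

theorem KGrp.bijective_inl_inr (P Q : Type*) [NonUnitalCStarAlgebra P] [NonUnitalCStarAlgebra Q] :
    Function.Bijective fun x : KGrp P × KGrp Q =>
      KGrp.map (NonUnitalStarAlgHom.inl ℂ P Q) x.1 + KGrp.map (NonUnitalStarAlgHom.inr ℂ P Q) x.2 := by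
  have h0 := K0.bijective_of_biproduct (NonUnitalStarAlgHom.inl ℂ P Q)
    (NonUnitalStarAlgHom.inr ℂ P Q) (NonUnitalStarAlgHom.fst ℂ P Q) (NonUnitalStarAlgHom.snd ℂ P Q)
    (fun _ => rfl) (fun _ => rfl) (fun _ => rfl) (fun _ => rfl)
    (fun c => Prod.ext (add_zero c.1).symm (zero_add c.2).symm)
  have h1 := K0.bijective_of_biproduct (Susp.map (NonUnitalStarAlgHom.inl ℂ P Q))
    (Susp.map (NonUnitalStarAlgHom.inr ℂ P Q)) (Susp.map (NonUnitalStarAlgHom.fst ℂ P Q))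
    (Susp.map (NonUnitalStarAlgHom.snd ℂ P Q))
    (fun _ => rfl) (fun _ => rfl) (fun _ => rfl) (fun _ => rfl)
    (fun c => Susp.ext fun t => Prod.ext (add_zero (c t).1).symm (zero_add (c t).2).symm)
  constructor
  · rintro ⟨⟨a, b⟩, c, d⟩ ⟨⟨a', b'⟩, c', d'⟩ h
    have e0 := @h0.1 (a, c) (a', c') (congrArg Prod.fst h)
    have e1 := @h1.1 (b, d) (b', d') (congrArg Prod.snd h)
    simp only [Prod.mk.injEq] at e0 e1 ⊢
    exact ⟨⟨e0.1, e1.1⟩, e0.2, e1.2⟩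
  · rintro ⟨y, z⟩
    obtain ⟨⟨a, c⟩, hac⟩ := h0.2 y
    obtain ⟨⟨b, d⟩, hbd⟩ := h1.2 z
    exact ⟨((a, b), c, d), Prod.ext hac hbd⟩

end Biproduct

/-! ### The tensor product with `ℂ` -/

section Complex

variable (A : Type u) [NonUnitalCStarAlgebra A]

/-- The isomorphism `A → A ⊗ ℂ`, `a ↦ a ⊗ 1`. -/
def tmulOne : A →⋆ₙₐ[ℂ] CStarTensor A ℂ := CStarTensor.tmulProj A (1 : ℂ) (.one _)

theorem tmulOne_apply (a : A) : tmulOne A a = CStarTensor.tmul a 1 := rfl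

/-- The bilinear map `(a, z) ↦ z a`. -/
def smulBilin : A →ₗ[ℂ] ℂ →ₗ[ℂ] A :=
  LinearMap.mk₂ ℂ (fun (a : A) (z : ℂ) => z • a) (fun a b z => smul_add z a b)
    (fun c a z => smul_comm z c a) (fun a z w => add_smul z w a) (fun c a z => smul_assoc c z a)

theorem smulBilin_apply (a : A) (z : ℂ) : smulBilin A a z = z • a := rfl

/-- The isomorphism `A ⊗ ℂ → A`, `a ⊗ z ↦ z a`. -/
def ofTmulOne : CStarTensor A ℂ →⋆ₙₐ[ℂ] A :=
  CStarTensor.lift (CStarTensor.algLift (smulBilin A)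
    (fun a a' z z' => by
      rw [smulBilin_apply, smulBilin_apply, smulBilin_apply, smul_mul_smul_comm])
    (fun a z => by rw [smulBilin_apply, smulBilin_apply, star_smul])) fun a z => by
      rw [CStarTensor.algLift_tmul, smulBilin_apply, norm_smul, mul_comm]

theorem ofTmulOne_tmul (a : A) (z : ℂ) : ofTmulOne A (CStarTensor.tmul a z) = z • a := by
  rw [ofTmulOne, CStarTensor.lift_tmul, CStarTensor.algLift_tmul, smulBilin_apply]

theorem ofTmulOne_tmulOne (a : A) : ofTmulOne A (tmulOne A a) = a := by
  rw [tmulOne_apply, ofTmulOne_tmul, one_smul]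

theorem tmulOne_ofTmulOne (x : CStarTensor A ℂ) : tmulOne A (ofTmulOne A x) = x := by
  refine DFunLike.congr_fun (f := (tmulOne A).comp (ofTmulOne A)) (g := NonUnitalStarAlgHom.id ℂ _)
    (CStarTensor.hom_ext fun a z => ?_) x
  change tmulOne A (ofTmulOne A (CStarTensor.tmul a z)) = CStarTensor.tmul a z
  rw [ofTmulOne_tmul, tmulOne_apply, ← CStarTensor.tmulRight_apply, map_smul,
    CStarTensor.tmulRight_apply, ← CStarTensor.tmulLeft_apply, ← map_smul,
    CStarTensor.tmulLeft_apply, smul_eq_mul, mul_one]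

theorem K0.bijective_of_inverse {A B : Type*} [NonUnitalCStarAlgebra A] [NonUnitalCStarAlgebra B]
    (φ : A →⋆ₙₐ[ℂ] B) (ψ : B →⋆ₙₐ[ℂ] A) (h : ∀ a, ψ (φ a) = a) (h' : ∀ b, φ (ψ b) = b) :
    Function.Bijective (K0.map φ) := by
  refine Function.bijective_iff_has_inverse.2 ⟨K0.map ψ, fun x => ?_, fun x => ?_⟩
  · rw [K0.map_map, show ψ.comp φ = NonUnitalStarAlgHom.id ℂ A from DFunLike.ext _ _ h, K0.map_id]
  · rw [K0.map_map, show φ.comp ψ = NonUnitalStarAlgHom.id ℂ B from DFunLike.ext _ _ h', K0.map_id]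

/-- The functor `A ⊗ ·`. -/
abbrev evenF : MatFunctor.{u, 0} := MatFunctor.tensor A

/-- The functor `S(A ⊗ ·)`. -/
abbrev oddF : MatFunctor.{u, 0} := MatFunctor.susp (MatFunctor.tensor A)

/-- The isomorphism `K₀(A) → K₀(A ⊗ ℂ)`. -/
def evenBase : K0 A →+ K0 ((evenF A).obj ℂ) := K0.map (tmulOne A)

/-- The isomorphism `K₁(A) → K₁(A ⊗ ℂ)`. -/
def oddBase : K1 A →+ K0 ((oddF A).obj ℂ) := K0.map (Susp.map (tmulOne A))

theorem bijective_evenBase : Function.Bijective (evenBase A) :=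
  K0.bijective_of_inverse _ (ofTmulOne A) (ofTmulOne_tmulOne A) (tmulOne_ofTmulOne A)

theorem bijective_oddBase : Function.Bijective (oddBase A) :=
  K0.bijective_of_inverse _ (Susp.map (ofTmulOne A))
    (fun f => Susp.ext fun t => ofTmulOne_tmulOne A (f t))
    (fun f : Susp (CStarTensor A ℂ) => Susp.ext fun t => tmulOne_ofTmulOne A (f t))

theorem mapI_map_eq {A B C : Type*} [NonUnitalCStarAlgebra A] [NonUnitalCStarAlgebra B]
    [NonUnitalCStarAlgebra C] {κ : Type*} [Fintype κ] (φ : A →⋆ₙₐ[ℂ] Matrix κ κ C) (i : A →⋆ₙₐ[ℂ] B)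
    (ψ : B →⋆ₙₐ[ℂ] Matrix κ κ C) (h : ∀ a s t, φ a s t = ψ (i a) s t) (x : K0 A) :
    K0.mapI φ x = K0.mapI ψ (K0.map i x) := by
  rw [K0.map_eq_mapI, K0.mapI_mapI, ← K0.mapI_reindexHom (Equiv.punitProd _) (compHom _ _)]
  exact congrArg (fun χ => K0.mapI χ x) (matHom_ext fun a s t => h a s t)

variable {B : Type} [NonUnitalCStarAlgebra B]

/-- The link between the Künneth condition and the functorial description: a ⊗ e is the image of a ⊗
1 in A ⊗ ℂ under the map induced by λ ↦ λe. -/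
theorem mapMat_tmulMat {k : ℕ} (e : Matrix (Fin k) (Fin k) B) (he : IsStarProjection e) (x : K0 A) :
    K0.mapMat (CStarTensor.tmulMat A e he) x = (evenF A).K (scal e he) (evenBase A x) := by
  rw [K0.mapMat_eq_mapI]
  refine mapI_map_eq _ _ _ (fun a s t => ?_) x
  refine Eq.trans ?_ (CStarTensor.matMap_tmul (A := A) (scal e he) a 1 s t).symm
  rw [scal_apply, one_smul]
  rfl

theorem mapMat_susp_tmulMat {k : ℕ} (e : Matrix (Fin k) (Fin k) B) (he : IsStarProjection e)
    (x : K1 A) : K0.mapMat (Susp.tmulMat A e he) x = (oddF A).K (scal e he) (oddBase A x) := by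
  rw [K0.mapMat_eq_mapI]
  refine mapI_map_eq _ _ _ (fun f s t => Susp.ext fun r => ?_) x
  refine Eq.trans ?_ (CStarTensor.matMap_tmul (A := A) (scal e he) (f r) 1 s t).symm
  rw [scal_apply, one_smul]
  rfl

theorem map_tmulProj (e : B) (he : IsStarProjection e) (x : K0 A) :
    K0.map (CStarTensor.tmulProj A e he) x =
      (evenF A).K (toMat (scalOne e he)) (evenBase A x) := by
  rw [K0.map_eq_mapI]
  refine mapI_map_eq _ _ _ (fun a s t => ?_) x
  refine Eq.trans ?_ (CStarTensor.matMap_tmul (A := A) (toMat (scalOne e he)) a 1 s t).symm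
  rw [toMat_apply, toMat_apply, scalOne_apply, one_smul]
  rfl

theorem map_susp_tmulProj (e : B) (he : IsStarProjection e) (x : K1 A) :
    K0.map (Susp.map (CStarTensor.tmulProj A e he)) x =
      (oddF A).K (toMat (scalOne e he)) (oddBase A x) := by
  rw [K0.map_eq_mapI]
  refine mapI_map_eq _ _ _ (fun f s t => Susp.ext fun r => ?_) x
  refine Eq.trans ?_ (CStarTensor.matMap_tmul (A := A) (toMat (scalOne e he)) (f r) 1 s t).symm
  rw [toMat_apply (scalOne e he), scalOne_apply, one_smul]
  rfl

end Complex

end KTheory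

end

open scoped TensorProduct ZeroAtInfty Matrix unitInterval

noncomputable section

namespace KTheory

/-! ### Tensor products with directed unions of cyclic groups -/

section Directed

variable {X M Y : Type*} [AddCommGroup X] [AddCommGroup M] [AddCommGroup Y]

/-- The homomorphism on a tensor product defined by a biadditive map. -/
def tensorLift (B : X →+ M →+ Y) : X ⊗[ℤ] M →+ Y :=
  TensorProduct.liftAddHom B fun r x m => by rw [map_zsmul, map_zsmul]; rfl

/-- The second factor is a directed union of the cyclic groups generated by the `e j`, so finitely
many terms can be rewritten over one generator and collected. -/
theorem exists_tmul_eq {e : ℕ → M} (hM : ∀ m, ∃ (j : ℕ) (n : ℤ), m = n • e j)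
    (hr : ∀ j k, j ≤ k → ∃ r : ℕ, e j = r • e k) (t : X ⊗[ℤ] M) :
    ∃ (j : ℕ) (x : X), t = x ⊗ₜ e j := by
  have hup (x : X) {j k : ℕ} (h : j ≤ k) : ∃ x' : X, x ⊗ₜ[ℤ] e j = x' ⊗ₜ e k := by
    obtain ⟨r, hr⟩ := hr j k h
    exact ⟨r • x, by rw [hr, TensorProduct.smul_tmul]⟩
  induction t with
  | zero => exact ⟨0, 0, (TensorProduct.zero_tmul _ _).symm⟩
  | tmul x m =>
    obtain ⟨j, n, rfl⟩ := hM m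
    exact ⟨j, n • x, by rw [TensorProduct.smul_tmul]⟩
  | add s t hs ht =>
    obtain ⟨j, x, rfl⟩ := hs
    obtain ⟨k, y, rfl⟩ := ht
    obtain ⟨x', hx⟩ := hup x (le_max_left j k)
    obtain ⟨y', hy⟩ := hup y (le_max_right j k)
    exact ⟨max j k, x' + y', by rw [hx, hy, TensorProduct.add_tmul]⟩

/-- Every tensor is elementary over some `e j`, so both halves reduce to elements of this form. -/
theorem bijective_tensorLift {e : ℕ → M} (hM : ∀ m, ∃ (j : ℕ) (n : ℤ), m = n • e j)
    (hr : ∀ j k, j ≤ k → ∃ r : ℕ, e j = r • e k) (B : X →+ M →+ Y)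
    (hs : ∀ y, ∃ j x, B x (e j) = y) (hk : ∀ j x, B x (e j) = 0 → x ⊗ₜ[ℤ] e j = 0) :
    Function.Bijective (tensorLift B) := by
  refine ⟨(injective_iff_map_eq_zero _).2 fun t ht => ?_, fun y => ?_⟩
  · obtain ⟨j, x, rfl⟩ := exists_tmul_eq hM hr t
    exact hk j x ht
  · obtain ⟨j, x, rfl⟩ := hs y
    exact ⟨x ⊗ₜ e j, rfl⟩

end Directed

/-- The vanishing of an elementary tensor with a torsion-free second factor. -/
theorem exists_addOrderOf_zsmul_eq {G : Type*} {M : Type*} [AddCommGroup G] [AddCommGroup M]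
    [Module.IsTorsionFree ℤ M] {g : G} {m : M} (h : g ⊗ₜ[ℤ] m = 0) :
    ∃ y : M, (addOrderOf g : ℤ) • y = m := by
  -- Torsion-free groups are flat, so by the equational criterion `m` is a combination of elements
  -- `y k` whose coefficients annihilate `g`. These coefficients are multiples of the order of `g`.
  obtain ⟨N, a, y, hy, ha⟩ :=
    TensorProduct.vanishesTrivially_of_sum_tmul_eq_zero_of_rTensor_injective (R := ℤ)
      (m := fun _ : Unit => g) (n := fun _ : Unit => m)
      (Module.Flat.rTensor_preserves_injective_linearMap _ Subtype.val_injective)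
      (by simpa using h)
  have hd (k : Fin N) : (addOrderOf g : ℤ) ∣ a () k :=
    addOrderOf_dvd_iff_zsmul_eq_zero.2 (by simpa using ha k)
  choose b hb using hd
  refine ⟨∑ k, b k • y k, ?_⟩
  rw [Finset.smul_sum]
  refine Eq.trans ?_ (hy ()).symm
  exact Finset.sum_congr rfl fun k _ => by rw [hb, mul_smul]

/-! ### The group `K₀` of a limit of matrix algebras -/

namespace UHFSystem

variable {D : Type} [CStarAlgebra D] (S : UHFSystem D)

/-- The class in `K₀(D)` of a minimal projection of the `j`-th matrix algebra. -/
def E (j : ℕ) : K0 D := K0.ofProj (k := 1) (Matrix.of fun _ _ => S.e j)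
  ⟨Matrix.ext fun _ _ => by
    rw [Matrix.mul_apply, Fin.sum_univ_one]
    exact (S.isStarProjection_e j).isIdempotentElem,
  Matrix.ext fun _ _ => (S.isStarProjection_e j).isSelfAdjoint⟩

theorem cls_eq_unitClass : K0.cls (1 : Matrix (Fin 1) (Fin 1) D) (.one _) = K0.unitClass D := by
  rw [← K0.ofProj_eq_cls]
  rfl

theorem K_scalOne_unitClass {e : D} (he : IsStarProjection e)
    (he' : IsStarProjection (Matrix.of fun _ _ => e : Matrix (Fin 1) (Fin 1) D)) :
    MatFunctor.id.K (toMat (scalOne e he)) (K0.unitClass ℂ) = K0.ofProj _ he' := by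
  rw [← cls_eq_unitClass, K0.ofProj_eq_cls]
  refine (K0.mapI_cls (toMat (scalOne e he)) _ _).trans ?_
  refine K0.cls_submatrix (Equiv.prodPUnit _).symm fun i j => ?_
  rw [Subsingleton.elim i j]
  simp [bMap, toMat_apply, scalOne_apply]

theorem J_unitClass (j : ℕ) : S.J MatFunctor.id j (K0.unitClass ℂ) = S.E j :=
  K_scalOne_unitClass _ _

theorem exists_zsmul_E (m : K0 D) : ∃ (j : ℕ) (n : ℤ), m = n • S.E j := by
  obtain ⟨j, x, hx⟩ := S.exists_J_eq MatFunctor.id m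
  obtain ⟨n, hn⟩ := K0.exists_zsmul_unitClass x
  refine ⟨j, n, ?_⟩
  rw [← hx, ← J_unitClass, hn]
  exact map_zsmul _ _ _

theorem E_eq (j k : ℕ) (h : j ≤ k) : S.E j = S.r j k h • S.E k := by
  rw [← J_unitClass, ← J_unitClass]
  exact S.J_eq MatFunctor.id j k h _

theorem unitClass_eq (j : ℕ) : K0.unitClass D = S.n j • S.E j := by
  rw [← J_unitClass]
  refine Eq.trans ?_ (S.K_one MatFunctor.id j (K0.unitClass ℂ))
  have h1 : (1 : Matrix (Fin 1) (Fin 1) D) = Matrix.of fun _ _ => 1 := by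
    ext i j
    rw [Subsingleton.elim i j, Matrix.one_apply_eq, Matrix.of_apply]
  rw [K_scalOne_unitClass (.one _) (h1 ▸ .one _)]
  rw [K0.ofProj_eq_cls, ← cls_eq_unitClass]
  exact K0.cls_submatrix (Equiv.refl _) fun i j => by rw [h1]; rfl

/-- A relation in the limit becomes, after multiplication by a nonzero rank, a relation for the unit
class of ℂ, where the trace excludes it. -/
theorem eq_zero_of_zsmul_E {j : ℕ} {n : ℤ} (h : n • S.E j = 0) : n = 0 := by
  have h1 : S.J MatFunctor.id j (n • K0.unitClass ℂ) = 0 := by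
    refine (map_zsmul (S.J MatFunctor.id j) n (K0.unitClass ℂ)).trans ?_
    exact (congrArg (n • ·) (S.J_unitClass j)).trans h
  obtain ⟨k, hjk, hk⟩ := S.exists_smul_eq_zero MatFunctor.id h1
  have h2 : ((S.r j k hjk : ℤ) * n) • K0.unitClass ℂ = 0 := by
    rw [mul_smul, natCast_zsmul]
    exact hk
  exact (mul_eq_zero.1 (K0.zsmul_unitClass_eq_zero h2)).resolve_left
    (Nat.cast_ne_zero.2 (S.r_ne_zero j k hjk))

theorem isTorsionFree_K0 (S : UHFSystem D) : Module.IsTorsionFree ℤ (K0 D) := by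
  refine ⟨fun r hr => (injective_iff_map_eq_zero (DistribSMul.toAddMonoidHom (K0 D) r)).2
    fun x hx => ?_⟩
  obtain ⟨j, n, rfl⟩ := S.exists_zsmul_E x
  have h1 : (r * n) • S.E j = 0 := (mul_smul _ _ _).trans hx
  rw [(mul_eq_zero.1 (S.eq_zero_of_zsmul_E h1)).resolve_left hr.ne_zero, zero_smul]

/-- The class [1] is the order of `g` times some y. At a stage where y is a multiple of the
generator, comparing coefficients shows that the order of `g` divides `S.n j`. -/
theorem exists_smul_eq_zero_of_tmul {G : Type*} [AddCommGroup G] {g : G}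
    (h : g ⊗ₜ[ℤ] K0.unitClass D = 0) : ∃ j, S.n j • g = 0 := by
  have := S.isTorsionFree_K0
  obtain ⟨y, hy⟩ := exists_addOrderOf_zsmul_eq h
  obtain ⟨j, c, rfl⟩ := S.exists_zsmul_E y
  refine ⟨j, ?_⟩
  have h1 : ((addOrderOf g : ℤ) * c - S.n j) • S.E j = 0 := by
    rw [sub_smul, mul_smul, hy, S.unitClass_eq j, natCast_zsmul, sub_self]
  have h2 := sub_eq_zero.1 (S.eq_zero_of_zsmul_E h1)
  rw [← natCast_zsmul, ← h2, mul_comm, mul_smul, natCast_zsmul, addOrderOf_nsmul_eq_zero, smul_zero]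

/-- The class of a minimal projection acts on the values of a functor by `J`. -/
theorem theta_E (F : MatFunctor.{u, 0}) (j : ℕ) (x : K0 (F.obj ℂ)) :
    F.theta D (K0.toK00 D (S.E j)) x = S.J F j x := by
  rw [E, K0.ofProj_eq_cls, K0.toK00_cls, F.theta_cls]
  refine DFunLike.congr_fun (F.K_of_reindex (Equiv.ofUnique _ _) fun c i j => ?_) x
  rw [scal_apply, toMat_apply, scalOne_apply]
  rfl

end UHFSystem

/-- The order of `g` divides both a divisor of 𝔭 and a divisor of 𝔮, hence is 1. -/
theorem injective_beta {𝔭 𝔮 : Supernatural} (h : Supernatural.Coprime 𝔭 𝔮) (G : Type*)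
    [AddCommGroup G] : Function.Injective (beta 𝔭 𝔮 G) := by
  refine (injective_iff_map_eq_zero _).2 fun g hg => ?_
  obtain ⟨j, hj⟩ := (UHF.system 𝔭).exists_smul_eq_zero_of_tmul (congrArg Prod.fst hg)
  obtain ⟨k, hk⟩ := (UHF.system 𝔮).exists_smul_eq_zero_of_tmul (congrArg Prod.snd hg)
  have hc : Nat.Coprime (𝔭.level j) (𝔮.level k) := h.coprime (𝔭.dvd_level j) (𝔮.dvd_level k)
  have h1 := Nat.dvd_gcd (addOrderOf_dvd_iff_nsmul_eq_zero.2 hj)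
    (addOrderOf_dvd_iff_nsmul_eq_zero.2 hk)
  rw [show Nat.gcd ((UHF.system 𝔭).n j) ((UHF.system 𝔮).n k) = 1 from hc, Nat.dvd_one, AddMonoid.addOrderOf_eq_one_iff] at h1
  exact h1

end KTheory

end

open scoped TensorProduct ZeroAtInfty Matrix unitInterval

noncomputable section

namespace KTheory

/-! ### The Künneth map -/

section Kunneth

variable (A : Type u) [NonUnitalCStarAlgebra A] (D : Type) [CStarAlgebra D]

/-- The exterior product `K₀(A) × K₀(D) → K₀(A ⊗ D)`. -/
def evenProd : K0 A →+ K0 D →+ K0 (CStarTensor A D) :=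
  (((evenF A).theta D).comp (K0.toK00 D)).flip.comp (evenBase A)

/-- The exterior product `K₁(A) × K₀(D) → K₁(A ⊗ D)`. -/
def oddProd : K1 A →+ K0 D →+ K1 (CStarTensor A D) :=
  (((oddF A).theta D).comp (K0.toK00 D)).flip.comp (oddBase A)

theorem evenProd_apply (x : K0 A) (m : K0 D) :
    evenProd A D x m = (evenF A).theta D (K0.toK00 D m) (evenBase A x) := rfl

theorem oddProd_apply (x : K1 A) (m : K0 D) :
    oddProd A D x m = (oddF A).theta D (K0.toK00 D m) (oddBase A x) := rfl

/-- The exterior product of elements of `K_*(A)` with the even parts of elements of `K_*(D)`. -/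
def extProd : KGrp A →+ KGrp D →+ KGrp (CStarTensor A D) where
  toFun x := ((evenProd A D x.1).prod (oddProd A D x.2)).comp (AddMonoidHom.fst _ _)
  map_zero' := AddMonoidHom.ext fun m => Prod.ext
    (DFunLike.congr_fun (map_zero (evenProd A D)) m.1)
    (DFunLike.congr_fun (map_zero (oddProd A D)) m.1)
  map_add' x y := AddMonoidHom.ext fun m => Prod.ext
    (DFunLike.congr_fun (map_add (evenProd A D) x.1 y.1) m.1)
    (DFunLike.congr_fun (map_add (oddProd A D) x.2 y.2) m.1)

theorem extProd_apply (x : KGrp A) (m : KGrp D) :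
    extProd A D x m = (evenProd A D x.1 m.1, oddProd A D x.2 m.1) := rfl

variable {D} in
theorem extProd_ofProj (x : KGrp A) {k : ℕ} (e : Matrix (Fin k) (Fin k) D)
    (he : IsStarProjection e) : extProd A D x (K0.ofProj e he, 0) = KGrp.tmulProj A e he x := by
  rw [extProd_apply]
  refine Prod.ext ?_ ?_
  · change evenProd A D x.1 (K0.ofProj e he) = K0.mapMat (CStarTensor.tmulMat A e he) x.1
    rw [mapMat_tmulMat, evenProd_apply, K0.ofProj_eq_cls, K0.toK00_cls, MatFunctor.theta_cls]
  · change oddProd A D x.2 (K0.ofProj e he) = K0.mapMat (Susp.tmulMat A e he) x.2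
    rw [mapMat_susp_tmulMat, oddProd_apply, K0.ofProj_eq_cls, K0.toK00_cls, MatFunctor.theta_cls]

variable {D}

namespace UHFSystem

variable (S : UHFSystem D)

theorem exists_zsmul_prod_E (m : KGrp D) :
    ∃ (j : ℕ) (n : ℤ), m = n • ((S.E j, 0) : KGrp D) := by
  have := S.subsingleton_K1
  obtain ⟨j, n, hn⟩ := S.exists_zsmul_E m.1
  exact ⟨j, n, Prod.ext hn (Subsingleton.elim _ _)⟩

theorem prod_E_eq (j k : ℕ) (h : j ≤ k) :
    ((S.E j, 0) : KGrp D) = S.r j k h • ((S.E k, 0) : KGrp D) :=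
  Prod.ext (S.E_eq j k h) (smul_zero _).symm

theorem J_nsmul (F : MatFunctor.{u, 0}) (j k : ℕ) (h : j ≤ k) (x : K0 (F.obj ℂ)) :
    S.J F k (S.r j k h • x) = S.J F j x := by
  rw [map_nsmul, ← S.J_eq]

theorem evenProd_E (j : ℕ) (x : K0 A) :
    evenProd A D x (S.E j) = S.J (evenF A) j (evenBase A x) := S.theta_E (evenF A) j _

theorem oddProd_E (j : ℕ) (x : K1 A) :
    oddProd A D x (S.E j) = S.J (oddF A) j (oddBase A x) := S.theta_E (oddF A) j _

/-- Against the generator of stage j the exterior product is the map `J` of that stage, in each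
degree. So K_*(A) ⊗ K₀(D) and K_*(A ⊗ D) are limits of K_*(A) along the same multiplications. -/
theorem bijective_tensorLift_extProd (S : UHFSystem D) : Function.Bijective (tensorLift (extProd A D)) := by
  refine bijective_tensorLift (e := fun j => ((S.E j, 0) : KGrp D)) S.exists_zsmul_prod_E
    (fun j k h => ⟨_, S.prod_E_eq j k h⟩) _ (fun y => ?_) (fun j x hx => ?_)
  · obtain ⟨i, a, ha⟩ := S.exists_J_eq (evenF A) y.1
    obtain ⟨j, b, hb⟩ := S.exists_J_eq (oddF A) y.2
    -- The even and odd parts are brought to a common stage.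
    rw [← S.J_nsmul _ i (max i j) (le_max_left i j)] at ha
    rw [← S.J_nsmul _ j (max i j) (le_max_right i j)] at hb
    obtain ⟨a', ha'⟩ := (bijective_evenBase A).2 (S.r i (max i j) (le_max_left i j) • a)
    obtain ⟨b', hb'⟩ := (bijective_oddBase A).2 (S.r j (max i j) (le_max_right i j) • b)
    refine ⟨max i j, (a', b'), Prod.ext ?_ ?_⟩
    · refine (S.evenProd_E A _ a').trans ?_
      rw [ha']
      exact ha
    · refine (S.oddProd_E A _ b').trans ?_
      rw [hb']
      exact hb
  · obtain ⟨a, b⟩ := x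
    have h0 : S.J (evenF A) j (evenBase A a) = 0 :=
      (S.evenProd_E A j a).symm.trans (congrArg Prod.fst hx)
    have h1 : S.J (oddF A) j (oddBase A b) = 0 :=
      (S.oddProd_E A j b).symm.trans (congrArg Prod.snd hx)
    obtain ⟨k, hk, h2⟩ := S.exists_smul_eq_zero (evenF A) h0
    obtain ⟨l, hl, h3⟩ := S.exists_smul_eq_zero (oddF A) h1
    rw [← map_nsmul] at h2 h3
    have h4 := (injective_iff_map_eq_zero _).1 (bijective_evenBase A).1 _ h2
    have h5 := (injective_iff_map_eq_zero _).1 (bijective_oddBase A).1 _ h3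
    -- The even and odd parts may be annihilated at different stages, so their tensors are treated
    -- separately.
    have h6 : ((a, 0) : KGrp A) ⊗ₜ[ℤ] ((S.E j, 0) : KGrp D) = 0 := by
      rw [S.prod_E_eq j k hk, ← TensorProduct.smul_tmul,
        show S.r j k hk • ((a, 0) : KGrp A) = 0 from Prod.ext h4 (smul_zero _),
        TensorProduct.zero_tmul]
    have h7 : ((0, b) : KGrp A) ⊗ₜ[ℤ] ((S.E j, 0) : KGrp D) = 0 := by
      rw [S.prod_E_eq j l hl, ← TensorProduct.smul_tmul,
        show S.r j l hl • ((0, b) : KGrp A) = 0 from Prod.ext (smul_zero _) h5,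
        TensorProduct.zero_tmul]
    have h8 : ((a, b) : KGrp A) = (a, 0) + (0, b) := by simp
    rw [h8, TensorProduct.add_tmul, h6, h7, add_zero]

theorem theta_unitClass (S : UHFSystem D) (F : MatFunctor.{u, 0}) (x : K0 (F.obj ℂ)) :
    F.theta D (K0.toK00 D (K0.unitClass D)) x = F.K (toMat (scalOne 1 (.one _))) x := by
  rw [S.K_one F 0, S.unitClass_eq 0, map_nsmul, map_nsmul, AddMonoidHom.nsmul_apply, S.theta_E]

theorem extProd_unitClass (S : UHFSystem D) (x : KGrp A) : extProd A D x (K0.unitClass D, 0) =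
    KGrp.map (CStarTensor.tmulProj A (1 : D) (.one _)) x :=
  Prod.ext ((S.theta_unitClass (evenF A) _).trans (map_tmulProj A 1 (.one _) x.1).symm)
    ((S.theta_unitClass (oddF A) _).trans (map_susp_tmulProj A 1 (.one _) x.2).symm)

/-- Because K₁(D) = 0, every tensor can be written over the class of one minimal projection; this
yields uniqueness of the Künneth map. -/
theorem tmul_hom_ext (S : UHFSystem D) {Y : Type*} [AddCommGroup Y] {f g : KGrp A ⊗[ℤ] KGrp D →+ Y}
    (h : ∀ (x : KGrp A) (k : ℕ) (e : Matrix (Fin k) (Fin k) D) (he : IsStarProjection e),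
      f (x ⊗ₜ (K0.ofProj e he, 0)) = g (x ⊗ₜ (K0.ofProj e he, 0))) : f = g := by
  refine AddMonoidHom.ext fun t => ?_
  obtain ⟨j, x, rfl⟩ := exists_tmul_eq (e := fun j => ((S.E j, 0) : KGrp D)) S.exists_zsmul_prod_E
    (fun j k h => ⟨_, S.prod_E_eq j k h⟩) t
  exact h x 1 _ _

end UHFSystem

end Kunneth

/-! ### The Künneth map for both endpoints and the endpoint evaluations -/

section Ends

variable (𝔭 𝔮 : Supernatural) (A : Type u) [NonUnitalCStarAlgebra A]

/-- The Künneth map. -/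
def kunneth : KGrp A ⊗[ℤ] (KGrp (UHF 𝔭) × KGrp (UHF 𝔮)) →+
    KGrp (CStarTensor A (UHF 𝔭) × CStarTensor A (UHF 𝔮)) :=
  (((KGrp.map (NonUnitalStarAlgHom.inl ℂ _ _)).comp (tensorLift (extProd A (UHF 𝔭)))).coprod
    ((KGrp.map (NonUnitalStarAlgHom.inr ℂ _ _)).comp (tensorLift (extProd A (UHF 𝔮))))).comp
    (TensorProduct.prodRight ℤ ℤ (KGrp A) (KGrp (UHF 𝔭)) (KGrp (UHF 𝔮))).toLinearMap.toAddMonoidHom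

theorem kunneth_tmul (x : KGrp A) (m : KGrp (UHF 𝔭) × KGrp (UHF 𝔮)) :
    kunneth 𝔭 𝔮 A (x ⊗ₜ m) = KGrp.map (NonUnitalStarAlgHom.inl ℂ _ _) (extProd A (UHF 𝔭) x m.1) +
      KGrp.map (NonUnitalStarAlgHom.inr ℂ _ _) (extProd A (UHF 𝔮) x m.2) := rfl

theorem kunneth_apply (t : KGrp A ⊗[ℤ] (KGrp (UHF 𝔭) × KGrp (UHF 𝔮))) :
    kunneth 𝔭 𝔮 A t =
      KGrp.map (NonUnitalStarAlgHom.inl ℂ _ _) (tensorLift (extProd A (UHF 𝔭))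
        (TensorProduct.prodRight ℤ ℤ (KGrp A) (KGrp (UHF 𝔭)) (KGrp (UHF 𝔮)) t).1) +
      KGrp.map (NonUnitalStarAlgHom.inr ℂ _ _) (tensorLift (extProd A (UHF 𝔮))
        (TensorProduct.prodRight ℤ ℤ (KGrp A) (KGrp (UHF 𝔭)) (KGrp (UHF 𝔮)) t).2) := rfl

theorem bijective_kunneth : Function.Bijective (kunneth 𝔭 𝔮 A) := by
  have h1 := (((UHF.system 𝔭).bijective_tensorLift_extProd A).prodMap
      ((UHF.system 𝔮).bijective_tensorLift_extProd A)).comp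
    (TensorProduct.prodRight ℤ ℤ (KGrp A) (KGrp (UHF 𝔭)) (KGrp (UHF 𝔮))).bijective
  have h2 := (KGrp.bijective_inl_inr (CStarTensor A (UHF 𝔭)) (CStarTensor A (UHF 𝔮))).comp h1
  refine (funext fun t => ?_ : _ = ⇑(kunneth 𝔭 𝔮 A)) ▸ h2
  rw [kunneth_apply]
  rfl

theorem isKunnethMap_kunneth : IsKunnethMap 𝔭 𝔮 A (kunneth 𝔭 𝔮 A) where
  left x k e he := by
    rw [kunneth_tmul, extProd_ofProj, map_zero, map_zero, add_zero]
  right x k e he := by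
    rw [kunneth_tmul, extProd_ofProj, map_zero, map_zero, zero_add]

variable {𝔭 𝔮 A} in
theorem IsKunnethMap.unique {α β : KGrp A ⊗[ℤ] (KGrp (UHF 𝔭) × KGrp (UHF 𝔮)) →+
    KGrp (CStarTensor A (UHF 𝔭) × CStarTensor A (UHF 𝔮))} (hα : IsKunnethMap 𝔭 𝔮 A α)
    (hβ : IsKunnethMap 𝔭 𝔮 A β) : α = β := by
  have h1 := (UHF.system 𝔭).tmul_hom_ext A
    (f := α.comp (LinearMap.lTensor (KGrp A) (LinearMap.inl ℤ _ _)).toAddMonoidHom)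
    (g := β.comp (LinearMap.lTensor (KGrp A) (LinearMap.inl ℤ _ _)).toAddMonoidHom)
    fun x k e he => (hα.left x k e he).trans (hβ.left x k e he).symm
  have h2 := (UHF.system 𝔮).tmul_hom_ext A
    (f := α.comp (LinearMap.lTensor (KGrp A) (LinearMap.inr ℤ _ _)).toAddMonoidHom)
    (g := β.comp (LinearMap.lTensor (KGrp A) (LinearMap.inr ℤ _ _)).toAddMonoidHom)
    fun x k e he => (hα.right x k e he).trans (hβ.right x k e he).symm
  refine AddMonoidHom.ext fun t => ?_
  induction t with
  | zero => rw [map_zero, map_zero]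
  | add s t hs ht => rw [map_add, map_add, hs, ht]
  | tmul x m =>
    obtain ⟨m, n⟩ := m
    have h3 : ((m, n) : KGrp (UHF 𝔭) × KGrp (UHF 𝔮)) = (m, 0) + (0, n) := by simp
    rw [h3, TensorProduct.tmul_add, map_add, map_add]
    exact congrArg₂ (· + ·) (DFunLike.congr_fun h1 (x ⊗ₜ m)) (DFunLike.congr_fun h2 (x ⊗ₜ n))

theorem ev₀_unit : DimDrop.ev₀ 𝔭 𝔮 (DimDrop.unit 𝔭 𝔮) = 1 :=
  UHF.inclLeft_injective 𝔭 𝔮 (DimDrop.inclLeft_evalZero _)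

theorem ev₁_unit : DimDrop.ev₁ 𝔭 𝔮 (DimDrop.unit 𝔭 𝔮) = 1 :=
  UHF.inclRight_injective 𝔭 𝔮 (DimDrop.inclRight_evalOne _)

theorem evEnds_idTensorOne (a : A) :
    DimDrop.evEnds 𝔭 𝔮 A (DimDrop.idTensorOne 𝔭 𝔮 A a) =
      NonUnitalStarAlgHom.inl ℂ _ _ (CStarTensor.tmulProj A (1 : UHF 𝔭) (.one _) a) +
      NonUnitalStarAlgHom.inr ℂ _ _ (CStarTensor.tmulProj A (1 : UHF 𝔮) (.one _) a) := by
  have h0 : CStarTensor.map (NonUnitalStarAlgHom.id ℂ A) (DimDrop.ev₀ 𝔭 𝔮)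
      (CStarTensor.tmul a (DimDrop.unit 𝔭 𝔮)) = CStarTensor.tmul a 1 := by
    rw [CStarTensor.map_tmul, ev₀_unit]
    rfl
  have h1 : CStarTensor.map (NonUnitalStarAlgHom.id ℂ A) (DimDrop.ev₁ 𝔭 𝔮)
      (CStarTensor.tmul a (DimDrop.unit 𝔭 𝔮)) = CStarTensor.tmul a 1 := by
    rw [CStarTensor.map_tmul, ev₁_unit]
    rfl
  exact Prod.ext (h0.trans (add_zero _).symm) (h1.trans (zero_add _).symm)

/-- The composed homomorphism is a sum of two orthogonal ones, one into each summand, on which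
K-theory is additive; each of them is the exterior product with a unit class. -/
theorem map_evEnds_map_idTensorOne (x : KGrp A) :
    KGrp.map (DimDrop.evEnds 𝔭 𝔮 A) (KGrp.map (DimDrop.idTensorOne 𝔭 𝔮 A) x) =
      kunneth 𝔭 𝔮 A (x ⊗ₜ ((K0.unitClass (UHF 𝔭), 0), (K0.unitClass (UHF 𝔮), 0))) := by
  rw [kunneth_tmul, (UHF.system 𝔭).extProd_unitClass A, (UHF.system 𝔮).extProd_unitClass A]
  refine Prod.ext ?_ ?_
  · change K0.map (DimDrop.evEnds 𝔭 𝔮 A) (K0.map (DimDrop.idTensorOne 𝔭 𝔮 A) x.1) =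
      K0.map _ (K0.map _ x.1) + K0.map _ (K0.map _ x.1)
    rw [K0.map_map, K0.map_map, K0.map_map]
    exact K0.map_add_of_orthogonal _ _ _ (evEnds_idTensorOne 𝔭 𝔮 A)
      (fun a b => Prod.ext (mul_zero _) (zero_mul _)) x.1
  · change K0.map (Susp.map (DimDrop.evEnds 𝔭 𝔮 A))
        (K0.map (Susp.map (DimDrop.idTensorOne 𝔭 𝔮 A)) x.2) =
      K0.map (Susp.map _) (K0.map (Susp.map _) x.2) + K0.map (Susp.map _) (K0.map (Susp.map _) x.2)
    rw [K0.map_map, K0.map_map, K0.map_map]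
    exact K0.map_add_of_orthogonal _ _ _
      (fun f => Susp.ext fun t => evEnds_idTensorOne 𝔭 𝔮 A (f t))
      (fun a b => Susp.ext fun t => Prod.ext (mul_zero _) (zero_mul _)) x.2

variable {𝔭 𝔮}

/-- Projecting to the even parts recovers `beta`, which is injective for every group. -/
theorem injective_tmul_unitClass (h : Supernatural.Coprime 𝔭 𝔮) {G : Type*} [AddCommGroup G] :
    Function.Injective fun x : G => x ⊗ₜ[ℤ]
      (((K0.unitClass (UHF 𝔭), 0), (K0.unitClass (UHF 𝔮), 0)) :
        KGrp (UHF 𝔭) × KGrp (UHF 𝔮)) := by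
  refine Function.Injective.of_comp (f := fun t =>
    ((LinearMap.lTensor G (LinearMap.fst ℤ _ _)).prodMap
      (LinearMap.lTensor G (LinearMap.fst ℤ _ _)))
      (TensorProduct.prodRight ℤ ℤ G (KGrp (UHF 𝔭)) (KGrp (UHF 𝔮)) t)) ?_
  exact injective_beta h G

theorem surjective_map_idTensorOne (h : Supernatural.Coprime 𝔭 𝔮) :
    Function.Surjective (KGrp.map (DimDrop.idTensorOne 𝔭 𝔮 A)) := by
  rintro ⟨y, z⟩
  obtain ⟨a, ha⟩ := ((DimDrop.surjective_K_unit 𝔭 𝔮 h (evenF A)).comp (bijective_evenBase A).2) y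
  obtain ⟨b, hb⟩ := ((DimDrop.surjective_K_unit 𝔭 𝔮 h (oddF A)).comp (bijective_oddBase A).2) z
  exact ⟨(a, b), Prod.ext ((map_tmulProj A _ _ a).trans ha) ((map_susp_tmulProj A _ _ b).trans hb)⟩

end Ends

end KTheory

end

theorem mainTheorem11 (𝔭 𝔮 : Supernatural) (h𝔭𝔮 : Supernatural.Coprime 𝔭 𝔮) :
    (∀ (G : Type v) [AddCommGroup G], Function.Injective (KTheory.beta 𝔭 𝔮 G)) ∧
    Subsingleton (KTheory.K1 (UHF 𝔭)) ∧ Subsingleton (KTheory.K1 (UHF 𝔮)) ∧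
    ∀ (A : Type u) [NonUnitalCStarAlgebra A] [TopologicalSpace.SeparableSpace A],
      Function.Bijective (KTheory.KGrp.map (DimDrop.idTensorOne 𝔭 𝔮 A)) ∧
      ∃ α : KTheory.KGrp A ⊗[ℤ] (KTheory.KGrp (UHF 𝔭) × KTheory.KGrp (UHF 𝔮)) ≃+
          KTheory.KGrp (CStarTensor A (UHF 𝔭) × CStarTensor A (UHF 𝔮)),
        KTheory.IsKunnethMap 𝔭 𝔮 A α.toAddMonoidHom ∧
        (∀ α', KTheory.IsKunnethMap 𝔭 𝔮 A α' → α' = α.toAddMonoidHom) ∧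
        Function.Injective fun x : KTheory.KGrp A =>
          α.symm (KTheory.KGrp.map (DimDrop.evEnds 𝔭 𝔮 A)
            (KTheory.KGrp.map (DimDrop.idTensorOne 𝔭 𝔮 A) x)) := by
  refine ⟨fun G _ => KTheory.injective_beta h𝔭𝔮 G, (UHF.system 𝔭).subsingleton_K1,
    (UHF.system 𝔮).subsingleton_K1, fun A _ _ => ?_⟩
  let α := AddEquiv.ofBijective (KTheory.kunneth 𝔭 𝔮 A) (KTheory.bijective_kunneth 𝔭 𝔮 A)
  have hα : KTheory.IsKunnethMap 𝔭 𝔮 A α.toAddMonoidHom := KTheory.isKunnethMap_kunneth 𝔭 𝔮 A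
  -- This is proved before the isomorphism in (a), because injectivity of (id ⊗ 1)_* is read off
  -- from this composition.
  have hinj : Function.Injective fun x : KTheory.KGrp A =>
      α.symm (KTheory.KGrp.map (DimDrop.evEnds 𝔭 𝔮 A)
        (KTheory.KGrp.map (DimDrop.idTensorOne 𝔭 𝔮 A) x)) := by
    intro x y hxy
    have h1 := α.symm.injective hxy
    rw [KTheory.map_evEnds_map_idTensorOne, KTheory.map_evEnds_map_idTensorOne] at h1
    exact KTheory.injective_tmul_unitClass h𝔭𝔮 (α.injective h1)
  exact ⟨⟨hinj.of_comp (f := fun z => α.symm (KTheory.KGrp.map (DimDrop.evEnds 𝔭 𝔮 A) z)),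
    KTheory.surjective_map_idTensorOne A h𝔭𝔮⟩, α, hα, fun α' h' => h'.unique hα, hinj⟩
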